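/- **Setting.** A system of dimension $d_S\ge 1$ interacts with $N=N_{uno}+\mathcal M N_{mac}$ apparatuses of dimension $d$ ($N_{uno},\mathcal M,N_{mac}\ge 1$) through $H=A\otimes\sum_{k=1}^N B_k$ (with $\hbar=1$), starting from $\rho_{0S}\otimes\bigotimes_{k=1}^N\rho_{0k}$. The observable $A$ is drawn from the Gaussian Unitary Ensemble with scale factor $\eta_S>0$ and the $B_k$ independently from the GUE with scale factor $\eta_E>0$, where the GUE on $n\times n$ matrices with scale factor $\eta$ is the law of $U\,\mathrm{diag}(\lambda)\,U^\dagger$ under $\frac1Z e^{-\frac{\eta}{2}\sum_i\lambda_i^2}\prod_{i<j}(\lambda_i-\lambda_j)^2\,d\lambda\,dU$, with $dU$ the Haar measure. The $\rho_{0k}$ are i.i.d. from either the Hilbert–Schmidt or the Bures probability measure on $d\times d$ density matrices, independently of $A$ and the $B_k$. The density matrix $\rho_{0S}$ is arbitrary and fixed. Let $|a\rangle$ be the eigenvectors of $A$, $p_a=\langle a|\rho_{0S}|a\rangle$, and let $\rho_{S:E_{obs}}(t)$ be the state $e^{-itH}(\rho_{0S}\otimes\bigotimes_k\rho_{0k})e^{itH}$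 with $N_{uno}$ apparatuses traced out. The remaining ones are grouped into $\mathcal M$ macrofractions of $N_{mac}$ apparatuses each. A spectrum broadcast structure (SBS) is a state $\sum_a p_a|a\rangle\langle a|\otimes\bigotimes_{m=1}^{\mathcal M}\rho_a^{(m)}$, where $\rho_a^{(m)}$ is a state of the $m$-th macrofraction and $\rho_a^{(m)}\perp\rho_{a'}^{(m)}$ (orthogonal supports) for all $a\ne a'$ and all $m$; assume $d_S\le d^{N_{mac}}$, so that such states exist. Let $\epsilon_{SBS}(t)$ be the infimum of $\frac12\|\rho_{S:E_{obs}}(t)-\rho_{SBS}\|_{\rm tr}$ over all SBS $\rho_{SBS}$, and let $\langle\langle\cdot\rangle\rangle$ be the average over $A$, all the $B_k$ and all the $\rho_{0k}$. Put $g=1/\sqrt{\eta_S\eta_E}$, let $\langle\mathrm{tr}\rho_0^2\rangle$ be the mean purity of the chosen state ensemble, and let $\tau_{SBS}$ be the larger of $$\tau_{dec}=\big[8g^2N_{uno}d_S(d-\langle\mathrm{tr}\rho_0^2\rangle)\big]^{-1/2},\qquad \tau_{fid}=\big[8g^2N_{mac}d_S(d\langle\mathrm{tr}\rho_0^2\rangle-1)\big]^{-1/2}.$$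 **Result.** (i) There are an absolute constant $C>0$ and an integer $d_0\geq 2$ such that for both state ensembles, all $d\ge d_0$ and all $d_S,N_{uno},\mathcal M,N_{mac}\ge1$ with $d_S\le d^{N_{mac}}$ there is $K>0$ such that, for all $\eta_S,\eta_E>0$, all $\rho_{0S}$ and all $t\ge K\,\tau_{SBS}$, $$\langle\langle\epsilon_{SBS}(t)\rangle\rangle\;\le\; C\,d_S^2\Big(e^{-\frac{N_{uno}}{2}\log d}+\mathcal M\,e^{-\frac{N_{mac}}{2d}}\Big).$$ (ii) For all $d,d_S,N_{uno},\mathcal M,N_{mac}\ge 1$ with $d_S\le d^{N_{mac}}$, all $\eta_S,\eta_E>0$, all $\rho_{0S}$ and all real $t$, the averaging law is a probability measure, $\epsilon_{SBS}(t)$ is an integrable random variable, and $$P\big[\,|\epsilon_{SBS}(t)-\langle\langle\epsilon_{SBS}(t)\rangle\rangle|\ge\delta\,\big]\le 2e^{-2\delta^2}\qquad\text{for all }\delta\ge0 .$$ -/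

import Mathlib

open MeasureTheory Matrix
open scoped ComplexOrder

noncomputable section

namespace VonNeumann

/-! ### The unitary group and its normalised Haar measure -/

instance instMeasurableSpaceUnitaryGroup (d : ℕ) :
    MeasurableSpace (Matrix.unitaryGroup (Fin d) ℂ) := borel _

instance instBorelSpaceUnitaryGroup (d : ℕ) :
    BorelSpace (Matrix.unitaryGroup (Fin d) ℂ) := ⟨rfl⟩

instance instCompactSpaceUnitaryGroup (d : ℕ) :
    CompactSpace (Matrix.unitaryGroup (Fin d) ℂ) := by
  refine isCompact_iff_compactSpace.mp ?_
  have hK : IsCompact (Set.pi Set.univ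
      (fun _ : Fin d => Set.pi Set.univ (fun _ : Fin d => Metric.closedBall (0 : ℂ) 1))) :=
    isCompact_univ_pi fun _ => isCompact_univ_pi fun _ => isCompact_closedBall _ _
  have hc : IsClosed {U : Matrix (Fin d) (Fin d) ℂ | U ∈ Matrix.unitaryGroup (Fin d) ℂ} := by
    have h : {U : Matrix (Fin d) (Fin d) ℂ | U ∈ Matrix.unitaryGroup (Fin d) ℂ}
        = {U | U * star U = 1} := by
      ext U
      exact Matrix.mem_unitaryGroup_iff
    rw [h]
    exact isClosed_eq (by fun_prop) continuous_const
  refine IsCompact.of_isClosed_subset hK hc ?_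
  intro U hU i _ j _
  simpa using entry_norm_bound_of_unitary hU i j

/-- The Haar probability measure on the unitary group `U(d)`. -/
def haarUnitary (d : ℕ) : Measure (Matrix.unitaryGroup (Fin d) ℂ) :=
  Measure.haarMeasure ⊤

/-! ### Random Hermitian matrices and random states given by spectrum and eigenbasis -/

/-- A Hermitian matrix `U diag(x) U†`, given by its eigenvalues `x` and its eigenbasis (the columns
of the unitary matrix `U`). -/
abbrev SpectralData (d : ℕ) : Type := (Fin d → ℝ) × Matrix.unitaryGroup (Fin d) ℂ

/-- The matrix `U diag(x) U†`. -/
def SpectralData.toMatrix {d : ℕ} (s : SpectralData d) : Matrix (Fin d) (Fin d) ℂ :=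
  (s.2 : Matrix (Fin d) (Fin d) ℂ) * Matrix.diagonal (fun i => (s.1 i : ℂ)) *
    (s.2 : Matrix (Fin d) (Fin d) ℂ)ᴴ

/-- The rescaling of a finite non-zero measure to a probability measure (the factor `1 / Z`). -/
def normalise {α : Type*} [MeasurableSpace α] (ν : Measure α) : Measure α :=
  (ν Set.univ)⁻¹ • ν

/-- The unitarily invariant law whose eigenvalues are distributed according to `ν / Z` and whose
eigenbasis is an independent Haar distributed one. -/
def unitarilyInvariant {d : ℕ} (ν : Measure (Fin d → ℝ)) : Measure (SpectralData d) :=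
  (normalise ν).prod (haarUnitary d)

/-- The Gaussian Unitary Ensemble with scale factor `η`:
`(1 / Z) exp (-(η / 2) ∑ xᵢ²) ∏_{i < j} (xᵢ - xⱼ)² dx dU`. -/
def gue (η : ℝ) (d : ℕ) : Measure (SpectralData d) :=
  unitarilyInvariant ((volume : Measure (Fin d → ℝ)).withDensity fun x =>
    ENNReal.ofReal (Real.exp (-(η / 2) * ∑ i, x i ^ 2) *
      ∏ i, ∏ j ∈ Finset.Ioi i, (x i - x j) ^ 2))

/-- Lebesgue measure `δ(1 - ∑ xᵢ) dx` on the probability simplex in `ℝ^d`: all coordinates but the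
first are free, and the first is one minus their sum. -/
def simplexMeasure : (d : ℕ) → Measure (Fin d → ℝ)
  | 0 => 0
  | n + 1 =>
      Measure.map (fun y : Fin n → ℝ => (Fin.cons (1 - ∑ i, y i) y : Fin (n + 1) → ℝ))
        ((volume : Measure (Fin n → ℝ)).restrict {y | (∀ i, 0 ≤ y i) ∧ ∑ i, y i ≤ 1})

/-- The two standard measures on mixed states. -/
inductive StateEnsemble
  | hilbertSchmidt
  | bures

/-- The density, with respect to `δ(1 - ∑ xᵢ) dx` and up to normalisation, of the eigenvalues of a
random mixed state. -/
def StateEnsemble.density {d : ℕ} (e : StateEnsemble) (x : Fin d → ℝ) : ℝ :=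
  match e with
  | .hilbertSchmidt => ∏ i, ∏ j ∈ Finset.Ioi i, (x i - x j) ^ 2
  | .bures => (∏ i, (Real.sqrt (x i))⁻¹) *
      ∏ i, ∏ j ∈ Finset.Ioi i, (x i - x j) ^ 2 / (x i + x j)

/-- The Hilbert-Schmidt or Bures probability measure on `d`-dimensional mixed states. -/
def StateEnsemble.law (e : StateEnsemble) (d : ℕ) : Measure (SpectralData d) :=
  unitarilyInvariant ((simplexMeasure d).withDensity fun x => ENNReal.ofReal (e.density x))

/-- The average purity `⟨tr ρ²⟩`. -/
def StateEnsemble.meanPurity (e : StateEnsemble) (d : ℕ) : ℝ :=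
  ∫ s, (s.toMatrix * s.toMatrix).trace.re ∂(e.law d)

/-! ### States, trace norm, spectrum broadcast structures -/

/-- Density matrices. -/
def IsState {ι : Type*} [Fintype ι] (ρ : Matrix ι ι ℂ) : Prop :=
  ρ.PosSemidef ∧ ρ.trace = 1

/-- The trace norm `‖X‖_tr = tr √(X† X)`, the sum of the singular values. -/
def traceNorm {ι : Type*} [Fintype ι] [DecidableEq ι] (X : Matrix ι ι ℂ) : ℝ :=
  ∑ i, Real.sqrt ((Matrix.isHermitian_conjTranspose_mul_self X).eigenvalues i)

/-- The tensor product `⨂ₖ ρₖ` of matrices of one and the same size, on the index set `κ → ι`. -/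
def tensorPower {κ ι : Type*} [Fintype κ] (ρ : κ → Matrix ι ι ℂ) : Matrix (κ → ι) (κ → ι) ℂ :=
  fun x y => ∏ k, ρ k (x k) (y k)

/-- The operator acting as `B` on the tensor factor `k` and as the identity on the others. -/
def onSite {κ ι : Type*} [Fintype κ] [DecidableEq κ] [DecidableEq ι] (k : κ) (B : Matrix ι ι ℂ) :
    Matrix (κ → ι) (κ → ι) ℂ :=
  tensorPower (Function.update (fun _ => (1 : Matrix ι ι ℂ)) k B)

/-- Labels of the `Nobs = M * Nmac` observed apparatuses: the pair `(m, k)` is the `k`-th member of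
the `m`-th macrofraction. -/
abbrev ObsLabel (M Nmac : ℕ) : Type := Fin M × Fin Nmac

/-- Labels of all the apparatuses: `Nuno` unobserved and `M * Nmac` observed ones. -/
abbrev EnvLabel (Nuno M Nmac : ℕ) : Type := Fin Nuno ⊕ ObsLabel M Nmac

/-- The rank-one projector `|a⟩⟨a|` on the `a`-th eigenvector of `A`. -/
def pointer {dS : ℕ} (A : SpectralData dS) (a : Fin dS) : Matrix (Fin dS) (Fin dS) ℂ :=
  fun i j => A.2.1 i a * star (A.2.1 j a)

/-- `p_a = ⟨a|ρ|a⟩`, for the `a`-th eigenvector of `A`. -/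
def pointerProb {dS : ℕ} (A : SpectralData dS) (ρ : Matrix (Fin dS) (Fin dS) ℂ) (a : Fin dS) : ℝ :=
  (pointer A a * ρ).trace.re

/-- Spectrum broadcast structures with respect to the eigenbasis `|a⟩` of `A`, with probabilities
`p_a`: `∑ₐ p_a |a⟩⟨a| ⊗ ⨂ₘ ρ_a^(m)`, where for each macrofraction `m` the states `ρ_a^(m)` with
different `a` have orthogonal supports. -/
def IsSBS {dS d M Nmac : ℕ} (A : SpectralData dS) (p : Fin dS → ℝ)
    (σ : Matrix (Fin dS × (ObsLabel M Nmac → Fin d)) (Fin dS × (ObsLabel M Nmac → Fin d)) ℂ) :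
    Prop :=
  ∃ ρ : Fin dS → Fin M → Matrix (Fin Nmac → Fin d) (Fin Nmac → Fin d) ℂ,
    (∀ a m, IsState (ρ a m)) ∧
    (∀ a a', a ≠ a' → ∀ m, ρ a m * ρ a' m = 0) ∧
    ∀ i x j y, σ (i, x) (j, y) =
      ∑ a, (p a : ℂ) * pointer A a i j *
        ∏ m, ρ a m (fun k => x (m, k)) (fun k => y (m, k))

/-! ### The measurement dynamics -/

/-- The sample space: the observable `A` of the system, the observables `B_k` of the apparatuses,
and the initial states `ρ_{0k}` of the apparatuses. -/
abbrev Sample (dS d Nuno M Nmac : ℕ) : Type :=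
  SpectralData dS × (EnvLabel Nuno M Nmac → SpectralData d) ×
    (EnvLabel Nuno M Nmac → SpectralData d)

/-- The joint law: `A` is GUE with scale factor `ηS`, the `B_k` are i.i.d. GUE with scale factor
`ηE`, the `ρ_{0k}` are i.i.d. from the ensemble `e`, and all these are independent. -/
def sampleLaw (e : StateEnsemble) (ηS ηE : ℝ) (dS d Nuno M Nmac : ℕ) :
    Measure (Sample dS d Nuno M Nmac) :=
  (gue ηS dS).prod
    ((Measure.pi fun _ : EnvLabel Nuno M Nmac => gue ηE d).prod
      (Measure.pi fun _ : EnvLabel Nuno M Nmac => e.law d))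

section Dynamics

variable {dS d Nuno M Nmac : ℕ}

/-- The Hamiltonian `A ⊗ ∑ₖ B_k`. -/
def hamiltonian (ω : Sample dS d Nuno M Nmac) :
    Matrix (Fin dS × (EnvLabel Nuno M Nmac → Fin d)) (Fin dS × (EnvLabel Nuno M Nmac → Fin d)) ℂ :=
  Matrix.kronecker ω.1.toMatrix (∑ k, onSite k (ω.2.1 k).toMatrix)

/-- The unitary evolution `exp (-i t H)`. -/
def evolution (ω : Sample dS d Nuno M Nmac) (t : ℝ) :
    Matrix (Fin dS × (EnvLabel Nuno M Nmac → Fin d)) (Fin dS × (EnvLabel Nuno M Nmac → Fin d)) ℂ :=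
  NormedSpace.exp ((-(Complex.I * (t : ℂ))) • hamiltonian ω)

/-- The total state at time `t`, started from `ρ_{0S} ⊗ ⨂ₖ ρ_{0k}`. -/
def totalState (ρS : Matrix (Fin dS) (Fin dS) ℂ) (ω : Sample dS d Nuno M Nmac) (t : ℝ) :
    Matrix (Fin dS × (EnvLabel Nuno M Nmac → Fin d)) (Fin dS × (EnvLabel Nuno M Nmac → Fin d)) ℂ :=
  evolution ω t * Matrix.kronecker ρS (tensorPower fun k => (ω.2.2 k).toMatrix) *
    (evolution ω t)ᴴ

/-- The partially reduced state: the unobserved apparatuses are traced out. -/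
def reducedState (ρS : Matrix (Fin dS) (Fin dS) ℂ) (ω : Sample dS d Nuno M Nmac) (t : ℝ) :
    Matrix (Fin dS × (ObsLabel M Nmac → Fin d)) (Fin dS × (ObsLabel M Nmac → Fin d)) ℂ :=
  fun ix jy => ∑ z : Fin Nuno → Fin d,
    totalState ρS ω t (ix.1, Sum.elim z ix.2) (jy.1, Sum.elim z jy.2)

/-- The optimal trace distance of the partially reduced state at time `t` to a spectrum broadcast
structure with respect to the eigenbasis of `A`. -/
def epsSBS (ρS : Matrix (Fin dS) (Fin dS) ℂ) (t : ℝ) (ω : Sample dS d Nuno M Nmac) : ℝ :=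
  sInf {r : ℝ | ∃ σ, IsSBS ω.1 (pointerProb ω.1 ρS) σ ∧
    r = 1 / 2 * traceNorm (reducedState ρS ω t - σ)}

end Dynamics

/-! ### Time scales -/

/-- The interaction strength `g = 1 / √(ηS ηE)`. -/
def coupling (ηS ηE : ℝ) : ℝ := 1 / Real.sqrt (ηS * ηE)

/-- `τ_dec = [8 g² Nuno dS (d - ⟨tr ρ²⟩)]^(-1/2)`. -/
def tauDec (e : StateEnsemble) (ηS ηE : ℝ) (dS d Nuno : ℕ) : ℝ :=
  1 / Real.sqrt (8 * coupling ηS ηE ^ 2 * Nuno * dS * (d - e.meanPurity d))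

/-- `τ_fid = [8 g² Nmac dS (d ⟨tr ρ²⟩ - 1)]^(-1/2)`. -/
def tauFid (e : StateEnsemble) (ηS ηE : ℝ) (dS d Nmac : ℕ) : ℝ :=
  1 / Real.sqrt (8 * coupling ηS ηE ^ 2 * Nmac * dS * (d * e.meanPurity d - 1))

/-- `τ_SBS`, the larger of `τ_dec` and `τ_fid`. -/
def tauSBS (e : StateEnsemble) (ηS ηE : ℝ) (dS d Nuno Nmac : ℕ) : ℝ :=
  max (tauDec e ηS ηE dS d Nuno) (tauFid e ηS ηE dS d Nmac)

end VonNeumann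

end

/-! Part (i) splits into a pointwise estimate and an average.

Pointwise: the Hamiltonian is diagonal in the eigenbasis of A, so the evolution is a controlled
unitary (`evolution_eq`) and the reduced state is a sum of branches |a⟩⟨b|, each weighted by a
decoherence factor (`reducedState_eq`). The branches a ≠ b cost, in trace norm, at most a product
over the unobserved apparatuses of |tr(e^{-iτB}ρ)|. On the diagonal, a macrofraction carries
unitarily rotated copies of one and the same state, and these must be replaced by exactly orthogonal
states. `exists_orthogonal_states` drops the small eigenvalues, so that the remaining weighted
eigenvectors of all the copies fit into the space together, and orthogonalises them at once by a
polar decomposition. A Powers-Størmer inequality bounds the error by classical overlaps of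
measurement statistics. These overlaps, and the bound on the dropped weight, factorise over the
apparatuses; the outcome is `epsSBS_le_sbsBound`.

Average: everything now depends on one-site means raised to the powers N_uno and N_mac, so their
constants matter. The mean decoherence factor must be at most d^{-1/2} with no constant in front,
and the mean overlap and the mean flatness Σ √(x_i/d) must be at most e^{-1/d}; a fixed bound 97/100
is enough for the last two once d is large. Three kinds of moments enter. At late times the
Riemann-Lebesgue lemma makes the phases e^{-iτ b_j} behave, in each fixed moment, like independent
uniform phases (`norm_integral_sub_resonance_le`). The eigenbases contribute Haar moments of
|Z_ij|², obtained from invariance under plane rotations. The spectra of the states contribute second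
and third moments, obtained from loop equations, that is, integration by parts against the joint
eigenvalue density (`StateEnsemble.loop_moment`). The saving over Cauchy-Schwarz comes from
`sqrt_le_cubic`, a cubic majorant of the square root, which needs three moments only and gains a
factor of about 0.95 or 0.96.

Times: the one-site bounds need the relevant gap of A, times t, to be large. For fixed dimensions
the probability of a small gap tends to zero as t grows, so K, which may depend on the dimensions,
is chosen to bring it below the target. A GUE of another scale is a dilation of the standard one,
hence only t/√(η_S η_E) matters, and this quantity is controlled by a lower bound on τ_dec.

Part (ii): almost surely 0 ≤ ε_SBS ≤ 1, so Hoeffding's lemma gives the tail bound. Measurability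
holds because ε_SBS is an infimum, over a family that does not depend on the sample, of continuous
functions. -/

noncomputable section

namespace VonNeumann

set_option linter.unusedSectionVars false

/-! ### Trace norm: singular values, duality with unitaries, Hölder inequality. -/

section TraceNorm

variable {ι κ μ : Type*} [Fintype ι] [Fintype κ] [Fintype μ]

/-- The squared Hilbert-Schmidt norm. -/
def frobSq (Y : Matrix ι κ ℂ) : ℝ := ∑ i, ∑ j, ‖Y i j‖ ^ 2

lemma frobSq_nonneg (Y : Matrix ι κ ℂ) : 0 ≤ frobSq Y := by
  unfold frobSq; positivity

lemma trace_mul_conjTranspose_self (Y : Matrix ι κ ℂ) : (Y * Yᴴ).trace = (frobSq Y : ℂ) := by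
  simp only [Matrix.trace, Matrix.diag, Matrix.mul_apply, Matrix.conjTranspose_apply, frobSq]
  push_cast
  refine Finset.sum_congr rfl fun i _ => Finset.sum_congr rfl fun j _ => ?_
  rw [RCLike.star_def, Complex.mul_conj, Complex.normSq_eq_norm_sq]
  push_cast; rfl

lemma frobSq_conjTranspose (Y : Matrix ι κ ℂ) : frobSq Yᴴ = frobSq Y := by
  unfold frobSq
  rw [Finset.sum_comm]
  simp [Matrix.conjTranspose_apply]

lemma frobSq_unitary_mul [DecidableEq ι] {W : Matrix ι ι ℂ} (hW : W ∈ Matrix.unitaryGroup ι ℂ)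
    (Y : Matrix ι κ ℂ) : frobSq (W * Y) = frobSq Y := by
  have h1 : Wᴴ * W = 1 := Matrix.mem_unitaryGroup_iff'.mp hW
  have h : ((frobSq (W * Y) : ℝ) : ℂ) = frobSq Y := by
    rw [← trace_mul_conjTranspose_self, ← trace_mul_conjTranspose_self, Matrix.conjTranspose_mul,
      ← Matrix.mul_assoc, Matrix.trace_mul_comm, ← Matrix.mul_assoc, ← Matrix.mul_assoc, h1,
      Matrix.one_mul]
  exact_mod_cast h

lemma frobSq_mul_unitary [DecidableEq κ] {W : Matrix κ κ ℂ} (hW : W ∈ Matrix.unitaryGroup κ ℂ)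
    (Y : Matrix ι κ ℂ) : frobSq (Y * W) = frobSq Y := by
  rw [← frobSq_conjTranspose, Matrix.conjTranspose_mul, frobSq_unitary_mul, frobSq_conjTranspose]
  exact Unitary.star_mem hW

lemma norm_trace_mul_conjTranspose_le (Y Z : Matrix ι κ ℂ) :
    ‖(Y * Zᴴ).trace‖ ≤ √(frobSq Y) * √(frobSq Z) := by
  have h : (Y * Zᴴ).trace = ∑ p : ι × κ, Y p.1 p.2 * star (Z p.1 p.2) := by
    rw [Fintype.sum_prod_type]
    simp [Matrix.trace, Matrix.mul_apply]
  have e : ∀ X : Matrix ι κ ℂ, frobSq X = ∑ p : ι × κ, ‖X p.1 p.2‖ ^ 2 := by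
    intro X; rw [Fintype.sum_prod_type]; rfl
  rw [h, e, e]
  refine (norm_sum_le _ _).trans ?_
  simp only [norm_mul, norm_star]
  exact Real.sum_mul_le_sqrt_mul_sqrt _ _ _

lemma frobSq_submatrix {ι' κ' : Type*} [Fintype ι'] [Fintype κ'] (e : ι' ≃ ι) (f : κ' ≃ κ)
    (Y : Matrix ι κ ℂ) : frobSq (Y.submatrix e f) = frobSq Y := by
  unfold frobSq
  rw [← e.sum_comp]
  refine Finset.sum_congr rfl fun i _ => ?_
  rw [← f.sum_comp]
  rfl

lemma frobSq_kronecker {ι' κ' : Type*} [Fintype ι'] [Fintype κ'] (Y : Matrix ι κ ℂ)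
    (Y' : Matrix ι' κ' ℂ) : frobSq (Matrix.kronecker Y Y') = frobSq Y * frobSq Y' := by
  unfold frobSq
  simp only [Fintype.sum_prod_type, Matrix.kronecker, Matrix.kroneckerMap_apply, norm_mul, mul_pow]
  rw [Finset.sum_mul_sum]
  refine Finset.sum_congr rfl fun i _ => Finset.sum_congr rfl fun i' _ => ?_
  rw [Finset.sum_mul_sum]

variable [DecidableEq ι]

/-- The columns of `Y` are orthogonal with squared norms `l`. The non-zero ones, normalised, extend
to an orthonormal basis, which supplies the columns of `F`; a zero column is matched by a zero
diagonal entry. -/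
lemma exists_unitary_mul_diagonal {Y : Matrix ι ι ℂ} {l : ι → ℝ} (hl : ∀ i, 0 ≤ l i)
    (h : Yᴴ * Y = Matrix.diagonal fun i => (l i : ℂ)) :
    ∃ F ∈ Matrix.unitaryGroup ι ℂ, Y = F * Matrix.diagonal fun i => ((√(l i) : ℝ) : ℂ) := by
  set v : ι → EuclideanSpace ℂ ι := fun j => ((√(l j) : ℝ) : ℂ)⁻¹ • WithLp.toLp 2 (fun i => Y i j)
    with hv
  have hin : ∀ i j, inner ℂ (WithLp.toLp 2 (fun k => Y k i)) (WithLp.toLp 2 (fun k => Y k j))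
      = if i = j then (l i : ℂ) else 0 := by
    intro i j
    have := congrFun (congrFun h i) j
    rw [Matrix.diagonal_apply, Matrix.mul_apply] at this
    rw [← this]
    simp [PiLp.inner_apply, Matrix.conjTranspose_apply, mul_comm]
  have hon : Orthonormal ℂ (({i | l i ≠ 0} : Set ι).domRestrict v) := by
    rw [orthonormal_iff_ite]
    rintro ⟨i, hi⟩ ⟨j, hj⟩
    change inner ℂ (v i) (v j) = _
    simp only [hv, inner_smul_left, inner_smul_right, hin, Subtype.mk.injEq]
    split_ifs with hij
    · subst hij
      have h0 : ((√(l i) : ℝ) : ℂ) ≠ 0 := by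
        simpa [Real.sqrt_eq_zero (hl i)] using hi
      have : ((l i : ℝ) : ℂ) = (√(l i) : ℝ) * (√(l i) : ℝ) := by
        rw [← Complex.ofReal_mul, Real.mul_self_sqrt (hl i)]
      rw [this]
      simp only [map_inv₀, Complex.conj_ofReal]
      field_simp
    · simp
  obtain ⟨b, hb⟩ := hon.exists_orthonormalBasis_extension_of_card_eq (by simp)
  refine ⟨Matrix.of fun i j => b j i, ?_, ?_⟩
  · rw [Matrix.mem_unitaryGroup_iff']
    ext i j
    have := orthonormal_iff_ite.mp b.orthonormal i j
    rw [Matrix.one_apply, ← this]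
    simp [Matrix.mul_apply, Matrix.star_apply, PiLp.inner_apply, mul_comm]
  · ext i j
    rw [Matrix.mul_diagonal, Matrix.of_apply]
    by_cases hj : l j = 0
    · have h0 := hin j j
      rw [if_pos rfl, hj] at h0
      have h1 : WithLp.toLp 2 (fun k => Y k j) = 0 := by simpa using h0
      have h2 : Y i j = 0 := by
        have := congrArg (fun w : EuclideanSpace ℂ ι => w i) h1
        simpa using this
      simp [h2, hj]
    · have h0 : ((√(l j) : ℝ) : ℂ) ≠ 0 := by simpa [Real.sqrt_eq_zero (hl j)] using hj
      rw [hb j hj]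
      simp only [hv, PiLp.smul_apply, smul_eq_mul]
      field_simp

/-- The singular values of `X`. -/
def singVal (X : Matrix ι ι ℂ) (i : ι) : ℝ :=
  √((Matrix.isHermitian_conjTranspose_mul_self X).eigenvalues i)

lemma singVal_nonneg (X : Matrix ι ι ℂ) (i : ι) : 0 ≤ singVal X i := Real.sqrt_nonneg _

lemma traceNorm_eq_sum_singVal (X : Matrix ι ι ℂ) : traceNorm X = ∑ i, singVal X i := rfl

lemma traceNorm_nonneg (X : Matrix ι ι ℂ) : 0 ≤ traceNorm X :=
  Finset.sum_nonneg fun i _ => singVal_nonneg X i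

/-- The singular value decomposition. -/
theorem exists_svd (X : Matrix ι ι ℂ) :
    ∃ F ∈ Matrix.unitaryGroup ι ℂ, ∃ E ∈ Matrix.unitaryGroup ι ℂ,
      X = F * (Matrix.diagonal fun i => (singVal X i : ℂ)) * Eᴴ := by
  set hH := Matrix.isHermitian_conjTranspose_mul_self X
  set E : Matrix ι ι ℂ := (hH.eigenvectorUnitary : Matrix ι ι ℂ) with hE
  have hEU : E ∈ Matrix.unitaryGroup ι ℂ := hH.eigenvectorUnitary.2
  have h1 : Eᴴ * E = 1 := Matrix.mem_unitaryGroup_iff'.mp hEU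
  have h2 : E * Eᴴ = 1 := Matrix.mem_unitaryGroup_iff.mp hEU
  have hs : Xᴴ * X = E * (Matrix.diagonal fun i => (hH.eigenvalues i : ℂ)) * Eᴴ := by
    have := hH.spectral_theorem
    rw [Unitary.conjStarAlgAut_apply] at this
    exact this
  have hY : (X * E)ᴴ * (X * E) = Matrix.diagonal fun i => (hH.eigenvalues i : ℂ) := by
    have h3 : (X * E)ᴴ * (X * E) = Eᴴ * (Xᴴ * X) * E := by
      simp only [Matrix.conjTranspose_mul, Matrix.mul_assoc]
    have h4 : ∀ D : Matrix ι ι ℂ, Eᴴ * (E * D * Eᴴ) * E = D := by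
      intro D
      rw [← Matrix.mul_assoc, ← Matrix.mul_assoc, h1, Matrix.one_mul, Matrix.mul_assoc, h1,
        Matrix.mul_one]
    exact h3.trans ((congrArg (fun D => Eᴴ * D * E) hs).trans (h4 _))
  obtain ⟨F, hF, hFE⟩ := exists_unitary_mul_diagonal
    (fun i => (Matrix.posSemidef_conjTranspose_mul_self X).eigenvalues_nonneg i) hY
  refine ⟨F, hF, E, hEU, ?_⟩
  calc X = X * E * Eᴴ := by rw [Matrix.mul_assoc, h2, Matrix.mul_one]
    _ = _ := by rw [hFE]; rfl

/-- One half of the duality ‖X‖_tr = max |tr(W X)| over unitaries `W`; for X = F D E† the maximiser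
is E F†. The other half is `norm_trace_unitary_mul_le`, and the triangle inequality follows from the
two. -/
lemma exists_unitary_trace_mul_eq (X : Matrix ι ι ℂ) :
    ∃ W ∈ Matrix.unitaryGroup ι ℂ, (W * X).trace = (traceNorm X : ℂ) := by
  obtain ⟨F, hF, E, hE, h⟩ := exists_svd X
  refine ⟨E * Fᴴ, mul_mem hE (Unitary.star_mem hF), ?_⟩
  have h1 : Fᴴ * F = 1 := Matrix.mem_unitaryGroup_iff'.mp hF
  have h2 : Eᴴ * E = 1 := Matrix.mem_unitaryGroup_iff'.mp hE
  have : E * Fᴴ * X = E * ((Matrix.diagonal fun i => (singVal X i : ℂ)) * Eᴴ) := by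
    conv_lhs => rw [h]
    rw [Matrix.mul_assoc F, Matrix.mul_assoc, ← Matrix.mul_assoc Fᴴ, h1, Matrix.one_mul]
  rw [this, Matrix.trace_mul_comm, Matrix.mul_assoc, h2, Matrix.mul_one, Matrix.trace_diagonal,
    traceNorm_eq_sum_singVal]
  push_cast; rfl

/-- Every matrix is a product `Y Z†` whose factors have squared Hilbert-Schmidt norm equal to its
trace norm. -/
theorem exists_factorization (X : Matrix ι ι ℂ) :
    ∃ Y Z : Matrix ι ι ℂ, X = Y * Zᴴ ∧ frobSq Y = traceNorm X ∧ frobSq Z = traceNorm X := by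
  obtain ⟨F, hF, E, hE, h⟩ := exists_svd X
  set D : Matrix ι ι ℂ := Matrix.diagonal fun i => ((√(singVal X i) : ℝ) : ℂ) with hD
  have hDf : frobSq D = traceNorm X := by
    rw [traceNorm_eq_sum_singVal]
    unfold frobSq
    refine Finset.sum_congr rfl fun i _ => ?_
    rw [Finset.sum_eq_single i]
    · simp [hD, Real.sq_sqrt (singVal_nonneg X i)]
    · intro j _ hj; simp [hD, Matrix.diagonal_apply_ne _ hj.symm]
    · simp
  have hDH : Dᴴ = D := by
    rw [hD, Matrix.diagonal_conjTranspose]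
    congr 1; ext i; simp
  refine ⟨F * D, E * D, ?_, ?_, ?_⟩
  · rw [Matrix.conjTranspose_mul, hDH, Matrix.mul_assoc F, ← Matrix.mul_assoc D, hD,
      Matrix.diagonal_mul_diagonal, ← Matrix.mul_assoc]
    conv_lhs => rw [h]
    congr 3
    ext i
    rw [← Complex.ofReal_mul, Real.mul_self_sqrt (singVal_nonneg X i)]
  · rw [frobSq_unitary_mul hF, hDf]
  · rw [frobSq_unitary_mul hE, hDf]

/-- Hölder's inequality. Together with `exists_factorization` it reduces bounds on trace norms of
tensor products and reindexings to identities for `frobSq`, which are entrywise computations. -/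
theorem traceNorm_mul_conjTranspose_le (Y Z : Matrix ι κ ℂ) :
    traceNorm (Y * Zᴴ) ≤ √(frobSq Y) * √(frobSq Z) := by
  obtain ⟨W, hW, h⟩ := exists_unitary_trace_mul_eq (Y * Zᴴ)
  have h2 := norm_trace_mul_conjTranspose_le (W * Y) Z
  rw [Matrix.mul_assoc, h, frobSq_unitary_mul hW, Complex.norm_real, Real.norm_eq_abs] at h2
  exact (le_abs_self _).trans h2

lemma norm_trace_unitary_mul_le {W : Matrix ι ι ℂ} (hW : W ∈ Matrix.unitaryGroup ι ℂ)
    (X : Matrix ι ι ℂ) : ‖(W * X).trace‖ ≤ traceNorm X := by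
  obtain ⟨Y, Z, h, hY, hZ⟩ := exists_factorization X
  have h2 := norm_trace_mul_conjTranspose_le (W * Y) Z
  rw [frobSq_unitary_mul hW, hY, hZ, Real.mul_self_sqrt (traceNorm_nonneg X), Matrix.mul_assoc,
    ← h] at h2
  exact h2

lemma traceNorm_add_le (X Y : Matrix ι ι ℂ) : traceNorm (X + Y) ≤ traceNorm X + traceNorm Y := by
  obtain ⟨W, hW, h⟩ := exists_unitary_trace_mul_eq (X + Y)
  have h1 := norm_trace_unitary_mul_le hW X
  have h2 := norm_trace_unitary_mul_le hW Y
  rw [Matrix.mul_add, Matrix.trace_add] at h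
  have h3 := norm_add_le (W * X).trace (W * Y).trace
  rw [h, Complex.norm_real, Real.norm_eq_abs] at h3
  linarith [le_abs_self (traceNorm (X + Y))]

lemma traceNorm_smul_le (c : ℂ) (X : Matrix ι ι ℂ) : traceNorm (c • X) ≤ ‖c‖ * traceNorm X := by
  obtain ⟨W, hW, h⟩ := exists_unitary_trace_mul_eq (c • X)
  have h1 := norm_trace_unitary_mul_le hW X
  rw [Matrix.mul_smul, Matrix.trace_smul] at h
  have h3 : ‖c • (W * X).trace‖ = traceNorm (c • X) := by
    rw [h, Complex.norm_real, Real.norm_eq_abs, abs_of_nonneg (traceNorm_nonneg _)]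
  rw [← h3, norm_smul]
  gcongr

@[simp] lemma traceNorm_zero : traceNorm (0 : Matrix ι ι ℂ) = 0 := by
  refine le_antisymm ?_ (traceNorm_nonneg _)
  simpa using traceNorm_smul_le 0 (0 : Matrix ι ι ℂ)

lemma traceNorm_neg_le (X : Matrix ι ι ℂ) : traceNorm (-X) ≤ traceNorm X := by
  simpa using traceNorm_smul_le (-1) X

lemma traceNorm_sub_le (X Y : Matrix ι ι ℂ) : traceNorm (X - Y) ≤ traceNorm X + traceNorm Y := by
  rw [sub_eq_add_neg]
  exact (traceNorm_add_le _ _).trans (by gcongr; exact traceNorm_neg_le Y)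

lemma traceNorm_sum_le {α : Type*} (s : Finset α) (f : α → Matrix ι ι ℂ) :
    traceNorm (∑ a ∈ s, f a) ≤ ∑ a ∈ s, traceNorm (f a) :=
  Finset.le_sum_of_subadditive _ traceNorm_zero.le traceNorm_add_le s f

lemma mul_diagonal_sqrt_mul_conjTranspose {l : ι → ℝ} (hl : ∀ i, 0 ≤ l i) (E : Matrix κ ι ℂ) :
    E * (Matrix.diagonal fun i => (l i : ℂ)) * Eᴴ =
      (E * Matrix.diagonal fun i => ((√(l i) : ℝ) : ℂ)) *
        (E * Matrix.diagonal fun i => ((√(l i) : ℝ) : ℂ))ᴴ := by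
  rw [Matrix.conjTranspose_mul, Matrix.diagonal_conjTranspose, ← Matrix.mul_assoc (E * _),
    Matrix.mul_assoc E _ (Matrix.diagonal (star _)), Matrix.diagonal_mul_diagonal]
  congr 3
  ext i
  simp only [Pi.star_apply, RCLike.star_def, Complex.conj_ofReal]
  rw [← Complex.ofReal_mul, Real.mul_self_sqrt (hl i)]

lemma _root_.Matrix.PosSemidef.exists_mul_conjTranspose {ρ : Matrix ι ι ℂ} (h : ρ.PosSemidef) :
    ∃ Y : Matrix ι ι ℂ, ρ = Y * Yᴴ := by
  refine ⟨_, Eq.trans ?_ (mul_diagonal_sqrt_mul_conjTranspose h.eigenvalues_nonneg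
    (h.1.eigenvectorUnitary : Matrix ι ι ℂ))⟩
  have := h.1.spectral_theorem
  rw [Unitary.conjStarAlgAut_apply] at this
  exact this

lemma IsState.traceNorm_le_one {ρ : Matrix ι ι ℂ} (h : IsState ρ) : traceNorm ρ ≤ 1 := by
  obtain ⟨Y, hY⟩ := h.1.exists_mul_conjTranspose
  have h1 := traceNorm_mul_conjTranspose_le Y Y
  rw [← hY, Real.mul_self_sqrt (frobSq_nonneg _)] at h1
  have h2 := trace_mul_conjTranspose_self Y
  rw [← hY, h.2] at h2
  have h3 : frobSq Y = 1 := by exact_mod_cast h2.symm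
  linarith

/-- The triangle inequality and Hölder against the identity matrix make the trace norm Lipschitz for
the Hilbert-Schmidt distance. -/
lemma continuous_traceNorm : Continuous (traceNorm : Matrix ι ι ℂ → ℝ) := by
  have hb : ∀ X Y : Matrix ι ι ℂ,
      |traceNorm X - traceNorm Y| ≤ √(frobSq (X - Y)) * √(frobSq (1 : Matrix ι ι ℂ)) := by
    have key : ∀ X Y : Matrix ι ι ℂ,
        traceNorm X - traceNorm Y ≤ √(frobSq (X - Y)) * √(frobSq (1 : Matrix ι ι ℂ)) := by
      intro X Y
      have h1 := traceNorm_mul_conjTranspose_le (X - Y) (1 : Matrix ι ι ℂ)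
      have h2 := traceNorm_add_le (X - Y) Y
      rw [Matrix.conjTranspose_one, Matrix.mul_one] at h1
      rw [sub_add_cancel] at h2
      linarith
    intro X Y
    rw [abs_sub_le_iff]
    refine ⟨key X Y, ?_⟩
    have := key Y X
    have e : frobSq (Y - X) = frobSq (X - Y) := by
      unfold frobSq; simp only [Matrix.sub_apply, norm_sub_rev]
    rwa [e] at this
  rw [continuous_iff_continuousAt]
  intro Y
  rw [ContinuousAt, tendsto_iff_dist_tendsto_zero]
  have hc : Continuous fun X : Matrix ι ι ℂ =>
      √(frobSq (X - Y)) * √(frobSq (1 : Matrix ι ι ℂ)) := by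
    unfold frobSq; fun_prop
  have h0 := hc.tendsto Y
  simp only [sub_self] at h0
  have hz : frobSq (0 : Matrix ι ι ℂ) = 0 := by simp [frobSq]
  rw [hz, Real.sqrt_zero, zero_mul] at h0
  exact squeeze_zero (fun _ => dist_nonneg) (fun X => by rw [Real.dist_eq]; exact hb X Y) h0

lemma traceNorm_submatrix_le {ι' : Type*} [Fintype ι'] [DecidableEq ι'] (e : ι' ≃ ι)
    (X : Matrix ι ι ℂ) : traceNorm (X.submatrix e e) ≤ traceNorm X := by
  obtain ⟨Y, Z, h, hY, hZ⟩ := exists_factorization X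
  have h1 := traceNorm_mul_conjTranspose_le (Y.submatrix e (Equiv.refl ι))
    (Z.submatrix e (Equiv.refl ι))
  rw [frobSq_submatrix, frobSq_submatrix, hY, hZ, Real.mul_self_sqrt (traceNorm_nonneg X)] at h1
  convert h1 using 1
  conv_lhs => rw [h]
  congr 1

lemma traceNorm_kronecker_le {ι' : Type*} [Fintype ι'] [DecidableEq ι'] (X : Matrix ι ι ℂ)
    (X' : Matrix ι' ι' ℂ) : traceNorm (Matrix.kronecker X X') ≤ traceNorm X * traceNorm X' := by
  obtain ⟨Y, Z, h, hY, hZ⟩ := exists_factorization X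
  obtain ⟨Y', Z', h', hY', hZ'⟩ := exists_factorization X'
  have h1 := traceNorm_mul_conjTranspose_le (Matrix.kronecker Y Y') (Matrix.kronecker Z Z')
  rw [frobSq_kronecker, frobSq_kronecker, hY, hZ, hY', hZ',
    Real.mul_self_sqrt (mul_nonneg (traceNorm_nonneg X) (traceNorm_nonneg X'))] at h1
  convert h1 using 2
  conv_lhs => rw [h, h']
  exact (Matrix.mul_kronecker_mul _ _ _ _).trans
    (congrArg (Matrix.kronecker Y Y' * ·) (Matrix.conjTranspose_kronecker _ _).symm)

end TraceNorm

/-! ### Multiplicativity for tensor products over sites. -/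

section TensorPower

variable {α ι : Type*} [Fintype α] [DecidableEq α] [Fintype ι]

lemma tensorPower_mul (ρ σ : α → Matrix ι ι ℂ) :
    tensorPower ρ * tensorPower σ = tensorPower fun k => ρ k * σ k := by
  ext x y
  simp only [Matrix.mul_apply, tensorPower, ← Finset.prod_mul_distrib]
  rw [Finset.prod_univ_sum]
  simp [Fintype.piFinset_univ]

lemma tensorPower_conjTranspose {α ι : Type*} [Fintype α] (ρ : α → Matrix ι ι ℂ) :
    (tensorPower ρ)ᴴ = tensorPower fun k => (ρ k)ᴴ := by
  ext x y
  simp [tensorPower, Matrix.conjTranspose_apply]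

lemma frobSq_tensorPower (ρ : α → Matrix ι ι ℂ) :
    frobSq (tensorPower ρ) = ∏ k, frobSq (ρ k) := by
  have : ∀ X : Matrix ι ι ℂ, frobSq X = ∑ p : ι × ι, ‖X p.1 p.2‖ ^ 2 := by
    intro X; rw [Fintype.sum_prod_type]; rfl
  simp only [this]
  rw [Finset.prod_univ_sum, Fintype.piFinset_univ]
  unfold frobSq
  rw [← Fintype.sum_prod_type', ← (Equiv.arrowProdEquivProdArrow α (fun _ => ι) (fun _ => ι)).sum_comp]
  refine Finset.sum_congr rfl fun p _ => ?_
  simp [tensorPower, Finset.prod_pow, Equiv.arrowProdEquivProdArrow]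

lemma traceNorm_tensorPower_le [DecidableEq ι] (X : α → Matrix ι ι ℂ) :
    traceNorm (tensorPower X) ≤ ∏ k, traceNorm (X k) := by
  choose Y Z h hY hZ using fun k => exists_factorization (X k)
  have h1 := traceNorm_mul_conjTranspose_le (tensorPower Y) (tensorPower Z)
  rw [frobSq_tensorPower, frobSq_tensorPower] at h1
  simp only [hY, hZ] at h1
  rw [Real.mul_self_sqrt (Finset.prod_nonneg fun k _ => traceNorm_nonneg (X k)),
    tensorPower_conjTranspose, tensorPower_mul] at h1
  convert h1 using 3
  exact funext h

end TensorPower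

/-! ### Replacing rotated copies of a state by orthogonal states. -/

section Orthogonalisation

variable {ι κ : Type*} [Fintype ι] [DecidableEq ι] [Fintype κ] [DecidableEq κ]

lemma frobSq_isometry_mul {μ : Type*} [Fintype μ] {W : Matrix ι κ ℂ} (hW : Wᴴ * W = 1)
    (Y : Matrix κ μ ℂ) : frobSq (W * Y) = frobSq Y := by
  have h : ((frobSq (W * Y) : ℝ) : ℂ) = frobSq Y := by
    rw [← trace_mul_conjTranspose_self, ← trace_mul_conjTranspose_self, Matrix.conjTranspose_mul,
      ← Matrix.mul_assoc, Matrix.trace_mul_comm, ← Matrix.mul_assoc, ← Matrix.mul_assoc, hW,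
      Matrix.one_mul]
  exact_mod_cast h

/-- Padding with zero columns along an embedding of `κ` into `ι` reduces this to the square case
`exists_unitary_mul_diagonal`. -/
lemma exists_isometry_mul_diagonal (hc : Fintype.card κ ≤ Fintype.card ι) {Y : Matrix ι κ ℂ}
    {l : κ → ℝ} (hl : ∀ i, 0 ≤ l i) (h : Yᴴ * Y = Matrix.diagonal fun i => (l i : ℂ)) :
    ∃ F : Matrix ι κ ℂ, Fᴴ * F = 1 ∧ Y = F * Matrix.diagonal fun i => ((√(l i) : ℝ) : ℂ) := by
  obtain ⟨g⟩ := Function.Embedding.nonempty_of_card_le hc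
  set Y' : Matrix ι ι ℂ := Matrix.of fun i => Function.extend g (Y i) 0 with hY'
  set l' : ι → ℝ := Function.extend g l 0 with hl'
  have hYg : ∀ i p, Y' i (g p) = Y i p := fun i p => g.injective.extend_apply _ _ _
  have hlg : ∀ p, l' (g p) = l p := fun p => g.injective.extend_apply _ _ _
  have hY0 : ∀ i c, (¬ ∃ p, g p = c) → Y' i c = 0 := fun i c hcn =>
    Function.extend_apply' _ _ _ hcn
  have hl0 : ∀ c, (¬ ∃ p, g p = c) → l' c = 0 := fun c hcn =>
    Function.extend_apply' _ _ _ hcn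
  have hl'n : ∀ c, 0 ≤ l' c := by
    intro c
    by_cases hcn : ∃ p, g p = c
    · obtain ⟨p, rfl⟩ := hcn; rw [hlg]; exact hl p
    · rw [hl0 c hcn]
  have h' : Y'ᴴ * Y' = Matrix.diagonal fun i => (l' i : ℂ) := by
    ext c c'
    rw [Matrix.mul_apply, Matrix.diagonal_apply]
    simp only [Matrix.conjTranspose_apply]
    by_cases hcn : ∃ p, g p = c
    · by_cases hcn' : ∃ p, g p = c'
      · obtain ⟨p, rfl⟩ := hcn
        obtain ⟨p', rfl⟩ := hcn'
        have := congrFun (congrFun h p) p'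
        rw [Matrix.mul_apply, Matrix.diagonal_apply] at this
        simp only [Matrix.conjTranspose_apply] at this
        simp only [hYg, hlg, g.injective.eq_iff, this]
      · simp only [hY0 _ c' hcn', mul_zero, Finset.sum_const_zero]
        rw [if_neg]
        rintro rfl
        exact hcn' hcn
    · simp [hY0 _ c hcn, hl0 c hcn]
  obtain ⟨F, hF, hFY⟩ := exists_unitary_mul_diagonal hl'n h'
  refine ⟨F.submatrix id g, ?_, ?_⟩
  · have h1 : Fᴴ * F = 1 := Matrix.mem_unitaryGroup_iff'.mp hF
    ext p p'
    have := congrFun (congrFun h1 (g p)) (g p')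
    rw [Matrix.mul_apply] at this ⊢
    simpa [Matrix.one_apply, g.injective.eq_iff] using this
  · ext i p
    rw [Matrix.mul_diagonal, Matrix.submatrix_apply, ← hYg i p, hFY, Matrix.mul_diagonal, hlg]
    rfl

/-- The polar decomposition of a tall matrix. -/
lemma exists_polar (hc : Fintype.card κ ≤ Fintype.card ι) (Z : Matrix ι κ ℂ) :
    ∃ (W : Matrix ι κ ℂ) (S : Matrix κ κ ℂ), Wᴴ * W = 1 ∧ S.PosSemidef ∧ Z = W * S := by
  set hH := Matrix.isHermitian_conjTranspose_mul_self Z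
  set E : Matrix κ κ ℂ := (hH.eigenvectorUnitary : Matrix κ κ ℂ) with hE
  have hEU : E ∈ Matrix.unitaryGroup κ ℂ := hH.eigenvectorUnitary.2
  have h1 : Eᴴ * E = 1 := Matrix.mem_unitaryGroup_iff'.mp hEU
  have h2 : E * Eᴴ = 1 := Matrix.mem_unitaryGroup_iff.mp hEU
  have hs : Zᴴ * Z = E * (Matrix.diagonal fun i => (hH.eigenvalues i : ℂ)) * Eᴴ := by
    have := hH.spectral_theorem
    rw [Unitary.conjStarAlgAut_apply] at this
    exact this
  have hl := fun i => (Matrix.posSemidef_conjTranspose_mul_self Z).eigenvalues_nonneg i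
  have hY : (Z * E)ᴴ * (Z * E) = Matrix.diagonal fun i => (hH.eigenvalues i : ℂ) := by
    have h3 : (Z * E)ᴴ * (Z * E) = Eᴴ * (Zᴴ * Z) * E := by
      simp only [Matrix.conjTranspose_mul, Matrix.mul_assoc]
    have h4 : ∀ D : Matrix κ κ ℂ, Eᴴ * (E * D * Eᴴ) * E = D := by
      intro D
      rw [← Matrix.mul_assoc, ← Matrix.mul_assoc, h1, Matrix.one_mul, Matrix.mul_assoc, h1,
        Matrix.mul_one]
    exact h3.trans ((congrArg (fun D => Eᴴ * D * E) hs).trans (h4 _))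
  obtain ⟨F, hF, hFY⟩ := exists_isometry_mul_diagonal hc hl hY
  refine ⟨F * Eᴴ, E * (Matrix.diagonal fun i => ((√(hH.eigenvalues i) : ℝ) : ℂ)) * Eᴴ, ?_, ?_, ?_⟩
  · rw [Matrix.conjTranspose_mul, Matrix.conjTranspose_conjTranspose, Matrix.mul_assoc,
      ← Matrix.mul_assoc Fᴴ, hF, Matrix.one_mul, h2]
  · refine Matrix.PosSemidef.mul_mul_conjTranspose_same ?_ E
    rw [Matrix.posSemidef_diagonal_iff]
    intro i
    exact_mod_cast Real.sqrt_nonneg _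
  · calc Z = Z * E * Eᴴ := by rw [Matrix.mul_assoc, h2, Matrix.mul_one]
      _ = F * Eᴴ * (E * (Matrix.diagonal fun i => ((√(hH.eigenvalues i) : ℝ) : ℂ)) * Eᴴ) := by
        rw [Matrix.mul_assoc F, ← Matrix.mul_assoc Eᴴ, ← Matrix.mul_assoc Eᴴ, h1, Matrix.one_mul,
          hFY, Matrix.mul_assoc]

/-- A diagonal entry of E†XE is a sum over i of a conjugated entry of `E` times an entry of XE.
Cauchy-Schwarz over e at fixed i suffices: the rows of `E` are unit vectors and right multiplication
by `E` preserves the row norms of `X`. The sum of row norms plays the role of the trace norm of `X`,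
with the advantage that it can be read off from the entries. -/
lemma sum_norm_conj_diag_le {E : Matrix κ κ ℂ} (hE : E ∈ Matrix.unitaryGroup κ ℂ)
    (X : Matrix κ κ ℂ) : ∑ e, ‖(Eᴴ * X * E) e e‖ ≤ ∑ i, √(∑ j, ‖X i j‖ ^ 2) := by
  have hrow : ∀ (Y : Matrix κ κ ℂ) i, ∑ e, ‖(Y * E) i e‖ ^ 2 = ∑ j, ‖Y i j‖ ^ 2 := by
    intro Y i
    have := frobSq_mul_unitary hE (Matrix.of fun _ : Unit => Y i)
    simp only [frobSq, Finset.univ_unique, Finset.sum_singleton, Matrix.of_apply] at this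
    rw [← this]
    refine Finset.sum_congr rfl fun e _ => ?_
    simp [Matrix.mul_apply]
  have hcol : ∀ i, ∑ e, ‖E i e‖ ^ 2 = 1 := by
    intro i
    have := hrow 1 i
    rw [Matrix.one_mul] at this
    rw [this, Finset.sum_eq_single i]
    · simp
    · intro j _ hj; simp [Matrix.one_apply_ne hj.symm]
    · simp
  calc ∑ e, ‖(Eᴴ * X * E) e e‖ ≤ ∑ e, ∑ i, ‖E i e‖ * ‖(X * E) i e‖ := by
        refine Finset.sum_le_sum fun e _ => ?_
        rw [Matrix.mul_assoc, Matrix.mul_apply]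
        refine (norm_sum_le _ _).trans (le_of_eq ?_)
        simp [Matrix.conjTranspose_apply]
    _ = ∑ i, ∑ e, ‖E i e‖ * ‖(X * E) i e‖ := Finset.sum_comm
    _ ≤ ∑ i, √(∑ j, ‖X i j‖ ^ 2) := by
        refine Finset.sum_le_sum fun i _ => ?_
        refine (Real.sum_mul_le_sqrt_mul_sqrt _ _ _).trans (le_of_eq ?_)
        rw [hcol, hrow, Real.sqrt_one, one_mul]

/-- A form of the Powers-Størmer inequality. -/
theorem frobSq_sub_le {S B : Matrix κ κ ℂ} (hS : S.PosSemidef) (hB : B.PosSemidef) :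
    frobSq (S - B) ≤ ∑ i, √(∑ j, ‖(S * S - B * B) i j‖ ^ 2) := by
  have hΔ : (S - B).IsHermitian := hS.1.sub hB.1
  set E : Matrix κ κ ℂ := (hΔ.eigenvectorUnitary : Matrix κ κ ℂ) with hE
  have hEU : E ∈ Matrix.unitaryGroup κ ℂ := hΔ.eigenvectorUnitary.2
  have h1 : Eᴴ * E = 1 := Matrix.mem_unitaryGroup_iff'.mp hEU
  set D : Matrix κ κ ℂ := Matrix.diagonal fun i => (hΔ.eigenvalues i : ℂ) with hD
  have hs : S - B = E * D * Eᴴ := by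
    have := hΔ.spectral_theorem
    rw [Unitary.conjStarAlgAut_apply] at this
    exact this
  have hdiag : Eᴴ * (S - B) * E = D := by
    rw [hs, ← Matrix.mul_assoc, ← Matrix.mul_assoc, h1, Matrix.one_mul, Matrix.mul_assoc, h1,
      Matrix.mul_one]
  have hf : frobSq (S - B) = ∑ e, hΔ.eigenvalues e ^ 2 := by
    rw [← frobSq_mul_unitary hEU, ← frobSq_unitary_mul (Unitary.star_mem hEU)]
    have : star E * ((S - B) * E) = D := by
      rw [← Matrix.mul_assoc]; exact hdiag
    rw [this]
    unfold frobSq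
    refine Finset.sum_congr rfl fun i _ => ?_
    rw [Finset.sum_eq_single i]
    · simp [hD]
    · intro j _ hj; simp [hD, Matrix.diagonal_apply_ne _ hj.symm]
    · simp
  rw [hf]
  refine le_trans ?_ (sum_norm_conj_diag_le hEU _)
  refine Finset.sum_le_sum fun e _ => ?_
  have hpos : ∀ {P : Matrix κ κ ℂ}, P.PosSemidef → ∃ r : ℝ, 0 ≤ r ∧ (Eᴴ * P * E) e e = r := by
    intro P hP
    have := (hP.conjTranspose_mul_mul_same E).diag_nonneg (i := e)
    obtain ⟨h3, h4⟩ := Complex.nonneg_iff.mp this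
    exact ⟨_, h3, Complex.ext rfl (by simpa using h4.symm)⟩
  obtain ⟨r, hr, hSr⟩ := hpos hS
  obtain ⟨q, hq, hBq⟩ := hpos hB
  have hde : ((hΔ.eigenvalues e : ℝ) : ℂ) = r - q := by
    rw [← hSr, ← hBq, ← Matrix.sub_apply, ← Matrix.sub_mul, ← Matrix.mul_sub, hdiag, hD,
      Matrix.diagonal_apply_eq]
  have hde' : hΔ.eigenvalues e = r - q := by exact_mod_cast hde
  have hprod : ∀ P Q : Matrix κ κ ℂ, Eᴴ * (P * Q) * E = (Eᴴ * P * E) * (Eᴴ * Q * E) := by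
    intro P Q
    have h2 : E * Eᴴ = 1 := Matrix.mem_unitaryGroup_iff.mp hEU
    simp only [Matrix.mul_assoc]
    rw [← Matrix.mul_assoc E, h2, Matrix.one_mul]
  -- As a symmetrised product of S - B and S + B, the difference of squares has in the eigenbasis of
  -- S - B the diagonal entries (r - q)(r + q), where r and q are the diagonal entries of `S` and
  -- `B`. Positivity gives |r - q| ≤ r + q, hence (r - q)² ≤ |(r - q)(r + q)|.
  have hid : S * S - B * B = (2⁻¹ : ℂ) • ((S - B) * (S + B) + (S + B) * (S - B)) := by
    have : (S - B) * (S + B) + (S + B) * (S - B) = (2 : ℂ) • (S * S - B * B) := by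
      rw [two_smul]; noncomm_ring
    rw [this, smul_smul]; norm_num
  have hval : (Eᴴ * (S * S - B * B) * E) e e = ((r - q) * (r + q) : ℝ) := by
    have hsum : (Eᴴ * (S + B) * E) e e = r + q := by
      rw [Matrix.mul_add, Matrix.add_mul, Matrix.add_apply, hSr, hBq]
    rw [hid, Matrix.mul_smul, Matrix.smul_mul, Matrix.mul_add, Matrix.add_mul, hprod, hprod, hdiag,
      Matrix.smul_apply, Matrix.add_apply, hD, Matrix.diagonal_mul, Matrix.mul_diagonal, hsum, hde,
      smul_eq_mul]
    push_cast
    ring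
  rw [hval, hde', Complex.norm_real, Real.norm_eq_abs, abs_mul, abs_of_nonneg (add_nonneg hr hq),
    ← sq_abs, sq]
  gcongr
  rw [abs_le]; constructor <;> linarith

/-- Keep the indices with x_s ≥ n/D, where D is the dimension: there are at most D/n of them because
the weights sum to one, and each dropped weight satisfies x_s ≤ √(n x_s/D). The square root is what
makes the bound on the dropped weight multiplicative for product spectra. -/
lemma exists_large_finset {n : ℕ} (hn : 0 < n) (hnι : n ≤ Fintype.card ι) {x : ι → ℝ}
    (hx : ∀ s, 0 ≤ x s) (hx1 : ∑ s, x s = 1) :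
    ∃ T : Finset ι, T.Nonempty ∧ n * T.card ≤ Fintype.card ι ∧
      ∑ s ∈ Tᶜ, x s ≤ √n * ∑ s, √(x s / Fintype.card ι) := by
  set D := Fintype.card ι with hD
  have hD0 : 0 < D := hn.trans_le hnι
  have hD0' : (0 : ℝ) < D := by exact_mod_cast hD0
  set T₁ : Finset ι := Finset.univ.filter fun s => (n : ℝ) ≤ D * x s with hT₁
  have htail : ∑ s ∈ T₁ᶜ, x s ≤ √n * ∑ s, √(x s / D) := by
    rw [Finset.mul_sum]
    refine le_trans (Finset.sum_le_sum fun s hs => ?_)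
      (Finset.sum_le_univ_sum_of_nonneg fun s => by positivity)
    have hs' : D * x s ≤ n := by
      simp only [hT₁, Finset.mem_compl, Finset.mem_filter, Finset.mem_univ, true_and, not_le] at hs
      exact hs.le
    calc x s = √(x s * x s) := (Real.sqrt_mul_self (hx s)).symm
      _ ≤ √(n * (x s / D)) := by
          apply Real.sqrt_le_sqrt
          rw [← mul_div_assoc, le_div_iff₀ hD0']
          nlinarith [hx s]
      _ = _ := Real.sqrt_mul (by positivity) _
  by_cases hne : T₁.Nonempty
  · refine ⟨T₁, hne, ?_, htail⟩
    have : (n : ℝ) * T₁.card ≤ D := by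
      calc (n : ℝ) * T₁.card = ∑ s ∈ T₁, (n : ℝ) := by simp [mul_comm]
        _ ≤ ∑ s ∈ T₁, D * x s := Finset.sum_le_sum fun s hs => (Finset.mem_filter.mp hs).2
        _ = D * ∑ s ∈ T₁, x s := by rw [Finset.mul_sum]
        _ ≤ D * ∑ s, x s := by
            exact mul_le_mul_of_nonneg_left (Finset.sum_le_univ_sum_of_nonneg hx) hD0'.le
        _ = D := by rw [hx1, mul_one]
    exact_mod_cast this
  -- If no weight reaches the threshold, any single index will do: the set must be non-empty so that
  -- one of its members can later receive the dropped weight.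
  · obtain ⟨s₀⟩ : Nonempty ι := Fintype.card_pos_iff.mp hD0
    refine ⟨{s₀}, Finset.singleton_nonempty _, by simpa using hnι, le_trans ?_ htail⟩
    rw [Finset.not_nonempty_iff_eq_empty.mp hne, Finset.compl_empty]
    exact Finset.sum_le_univ_sum_of_nonneg hx

lemma sqrt_sum_le_sum_sqrt {α : Type*} (s : Finset α) {f : α → ℝ} (hf : ∀ a, 0 ≤ f a) :
    √(∑ a ∈ s, f a) ≤ ∑ a ∈ s, √(f a) := by
  rw [Real.sqrt_le_left (Finset.sum_nonneg fun a _ => Real.sqrt_nonneg _)]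
  calc ∑ a ∈ s, f a = ∑ a ∈ s, √(f a) ^ 2 := by simp [Real.sq_sqrt (hf _)]
    _ ≤ _ := Finset.sum_sq_le_sq_sum_of_nonneg fun a _ => Real.sqrt_nonneg _

lemma traceNorm_mul_diagonal_mul_le {l : κ → ℝ} (hl : ∀ i, 0 ≤ l i) {E : Matrix ι κ ℂ}
    (hE : Eᴴ * E = 1) :
    traceNorm (E * (Matrix.diagonal fun i => (l i : ℂ)) * Eᴴ) ≤ ∑ i, l i := by
  rw [mul_diagonal_sqrt_mul_conjTranspose hl]
  refine (traceNorm_mul_conjTranspose_le _ _).trans (le_of_eq ?_)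
  rw [Real.mul_self_sqrt (frobSq_nonneg _), frobSq_isometry_mul hE]
  unfold frobSq
  refine Finset.sum_congr rfl fun i _ => ?_
  rw [Finset.sum_eq_single i]
  · simp [Real.sq_sqrt (hl i)]
  · intro j _ hj; simp [Matrix.diagonal_apply_ne _ hj.symm]
  · simp

/-- The sum of the pairwise measured overlaps of the states `Rₐ diag(x) Rₐ†`, each pair being
measured in the eigenbasis of its first member. -/
def overlapSum {n : ℕ} (x : ι → ℝ) (R : Fin n → Matrix ι ι ℂ) : ℝ :=
  ∑ a, ∑ b ∈ {a}ᶜ, ∑ s, √(x s * ∑ s', ‖((R a)ᴴ * R b) s s'‖ ^ 2 * x s')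

/-- Collect the vectors √x_s R_a e_s, over all a and the large s, as the columns of one matrix `Z`.
Its isometric polar factor `W` has orthonormal columns close to the normalised columns of `Z`, with
an error governed by the off-diagonal blocks of the Gram matrix of `Z`. The columns of `W` with
label a span mutually orthogonal supports, on which the eigenvalues are reinstalled. -/
theorem exists_orthogonal_states {n : ℕ} (hn : 0 < n) (hnι : n ≤ Fintype.card ι) {x : ι → ℝ}
    (hx : ∀ s, 0 ≤ x s) (hx1 : ∑ s, x s = 1) {R : Fin n → Matrix ι ι ℂ}
    (hR : ∀ a, R a ∈ Matrix.unitaryGroup ι ℂ) :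
    ∃ σ : Fin n → Matrix ι ι ℂ, (∀ a, IsState (σ a)) ∧ (∀ a a', a ≠ a' → σ a * σ a' = 0) ∧
      ∀ a, traceNorm (R a * (Matrix.diagonal fun s => (x s : ℂ)) * (R a)ᴴ - σ a) ≤
        2 * √(overlapSum x R) + 2 * (√n * ∑ s, √(x s / Fintype.card ι)) := by
  obtain ⟨T, ⟨s₀, hs₀⟩, hTc, htail⟩ := exists_large_finset hn hnι hx hx1
  set tail : ℝ := ∑ s ∈ Tᶜ, x s with htaildef
  have htail0 : 0 ≤ tail := Finset.sum_nonneg fun s _ => hx s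
  have hR1 : ∀ a, (R a)ᴴ * R a = 1 := fun a => Matrix.mem_unitaryGroup_iff'.mp (hR a)
  set Z : Matrix ι (Fin n × T) ℂ := Matrix.of fun i p => R p.1 i p.2 * (√(x p.2) : ℝ) with hZ
  obtain ⟨W, S, hW, hS, hZS⟩ := exists_polar (ι := ι) (κ := Fin n × T) (by simpa using hTc) Z
  set B : Matrix (Fin n × T) (Fin n × T) ℂ := Matrix.diagonal fun p => ((√(x p.2) : ℝ) : ℂ) with hB
  have hBpos : B.PosSemidef := by
    rw [hB, Matrix.posSemidef_diagonal_iff]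
    intro i
    exact_mod_cast Real.sqrt_nonneg _
  have hSS : S * S = Zᴴ * Z := by
    rw [hZS, Matrix.conjTranspose_mul, hS.1.eq, Matrix.mul_assoc, ← Matrix.mul_assoc Wᴴ, hW,
      Matrix.one_mul]
  have hent : ∀ a s b s', (S * S - B * B) (a, s) (b, s') =
      if a = b then 0 else ((√(x s) : ℝ) : ℂ) * ((R a)ᴴ * R b) s s' * (√(x s') : ℝ) := by
    intro a s b s'
    have h1 : (Zᴴ * Z) (a, s) (b, s') =
        ((√(x s) : ℝ) : ℂ) * ((R a)ᴴ * R b) s s' * (√(x s') : ℝ) := by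
      simp only [hZ, Matrix.mul_apply, Matrix.conjTranspose_apply, Matrix.of_apply, Finset.mul_sum,
        Finset.sum_mul, star_mul', RCLike.star_def, Complex.conj_ofReal]
      refine Finset.sum_congr rfl fun i _ => ?_
      ring
    rw [hSS, Matrix.sub_apply, h1, hB, Matrix.diagonal_mul_diagonal, Matrix.diagonal_apply]
    split_ifs with h2 h3 h3
    · obtain ⟨rfl, rfl⟩ := Prod.mk.inj h2
      rw [hR1]; simp
    · exact absurd (congrArg Prod.fst h2) h3
    · subst h3
      have : (s : ι) ≠ s' := fun h => h2 (by rw [Subtype.ext h])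
      rw [hR1, Matrix.one_apply_ne this]; simp
    · simp
  have hq0 : ∀ (a b : Fin n) (s : ι), 0 ≤ ∑ s', ‖((R a)ᴴ * R b) s s'‖ ^ 2 * x s' := fun a b s =>
    Finset.sum_nonneg fun s' _ => mul_nonneg (by positivity) (hx s')
  -- Here Z - WB = W(S - B), and S² - B² is the Gram matrix of `Z` without its diagonal blocks. The
  -- Powers-Størmer bound by row norms, with the square root of a sum over b estimated by the sum of
  -- the square roots, produces the terms of `overlapSum`.
  have hps : frobSq (Z - W * B) ≤ overlapSum x R := by
    have : Z - W * B = W * (S - B) := by rw [Matrix.mul_sub, ← hZS]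
    rw [this, frobSq_isometry_mul hW]
    refine (frobSq_sub_le hS hBpos).trans ?_
    rw [Fintype.sum_prod_type]
    unfold overlapSum
    refine Finset.sum_le_sum fun a _ => ?_
    rw [Finset.sum_comm]
    refine le_trans (Finset.sum_le_sum (g := fun s : T => ∑ b ∈ {a}ᶜ,
      √(x s * ∑ s', ‖((R a)ᴴ * R b) s s'‖ ^ 2 * x s')) fun s _ => ?_) ?_
    · refine le_trans (Real.sqrt_le_sqrt ?_) (sqrt_sum_le_sum_sqrt _
        fun b => mul_nonneg (hx s) (hq0 a b s))
      rw [Fintype.sum_prod_type, ← Finset.sum_add_sum_compl {a}, Finset.sum_singleton]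
      simp only [hent, if_true, norm_zero]
      rw [Finset.sum_eq_zero (by simp), zero_add]
      refine Finset.sum_le_sum fun b hb => ?_
      have hab : a ≠ b := by
        simp only [Finset.mem_compl, Finset.mem_singleton] at hb; exact fun h => hb h.symm
      simp only [if_neg hab, norm_mul, Complex.norm_real, Real.norm_eq_abs, mul_pow, sq_abs,
        Real.sq_sqrt (hx _)]
      rw [Finset.mul_sum, Finset.sum_coe_sort T
        (fun s' => x s * ‖((R a)ᴴ * R b) s s'‖ ^ 2 * x s')]
      refine le_trans (Finset.sum_le_univ_sum_of_nonneg fun s' => ?_) (le_of_eq ?_)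
      · exact mul_nonneg (mul_nonneg (hx s) (by positivity)) (hx s')
      · refine Finset.sum_congr rfl fun s' _ => ?_
        ring
    · rw [Finset.sum_coe_sort T
        (fun s => ∑ b ∈ {a}ᶜ, √(x s * ∑ s', ‖((R a)ᴴ * R b) s s'‖ ^ 2 * x s'))]
      exact Finset.sum_le_univ_sum_of_nonneg fun s =>
        Finset.sum_nonneg fun _ _ => Real.sqrt_nonneg _
  set Wc : Fin n → Matrix ι T ℂ := fun a => W.submatrix id fun s => (a, s) with hWc
  have hWW : ∀ a b, (Wc a)ᴴ * Wc b = if a = b then 1 else 0 := by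
    intro a b
    ext s s'
    have := congrFun (congrFun hW (a, s)) (b, s')
    rw [Matrix.mul_apply] at this ⊢
    have e : ∀ j, (Wc a)ᴴ s j * Wc b j s' = Wᴴ (a, s) j * W j (b, s') := fun j => rfl
    simp only [e, this]
    by_cases hab : a = b <;> simp [hab, Matrix.one_apply]
  -- The dropped weight is put on a single index, so that the trace is one again.
  set y : T → ℝ := fun s => x s + if s = ⟨s₀, hs₀⟩ then tail else 0 with hy
  have hy0 : ∀ s, 0 ≤ y s := fun s => add_nonneg (hx s) (by split_ifs <;> simp [htail0])
  have hxT : ∑ s : T, x s + tail = 1 := by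
    rw [Finset.sum_coe_sort T x, htaildef, Finset.sum_add_sum_compl, hx1]
  have hy1 : ∑ s, y s = 1 := by
    simp only [hy, Finset.sum_add_distrib]
    simpa using hxT
  refine ⟨fun a => Wc a * (Matrix.diagonal fun s => (y s : ℂ)) * (Wc a)ᴴ, fun a => ⟨?_, ?_⟩, ?_, ?_⟩
  · refine Matrix.PosSemidef.mul_mul_conjTranspose_same ?_ _
    rw [Matrix.posSemidef_diagonal_iff]
    intro i
    exact_mod_cast hy0 i
  · rw [Matrix.trace_mul_comm, ← Matrix.mul_assoc, hWW, if_pos rfl, Matrix.one_mul,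
      Matrix.trace_diagonal]
    exact_mod_cast hy1
  · intro a b hab
    simp only [Matrix.mul_assoc]
    rw [← Matrix.mul_assoc (Wc a)ᴴ, hWW, if_neg hab]
    simp
  · intro a
    set Za : Matrix ι T ℂ := Z.submatrix id fun s => (a, s) with hZa
    set Ya : Matrix ι T ℂ := (W * B).submatrix id fun s => (a, s) with hYa
    have hfrob : ∀ X : Matrix ι (Fin n × T) ℂ,
        frobSq (X.submatrix id fun s : T => (a, s)) ≤ frobSq X := by
      intro X
      unfold frobSq
      refine Finset.sum_le_sum fun i _ => ?_
      rw [Fintype.sum_prod_type]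
      exact Finset.single_le_sum (f := fun a' => ∑ s : T, ‖X i (a', s)‖ ^ 2)
        (fun _ _ => by positivity) (Finset.mem_univ a)
    have hdsq : (Matrix.diagonal fun s : T => ((√(x s) : ℝ) : ℂ)) *
        (Matrix.diagonal fun s : T => ((√(x s) : ℝ) : ℂ))ᴴ =
        Matrix.diagonal fun s : T => (x s : ℂ) := by
      rw [Matrix.diagonal_conjTranspose, Matrix.diagonal_mul_diagonal]
      congr 1; ext s
      simp only [Pi.star_apply, RCLike.star_def, Complex.conj_ofReal]
      rw [← Complex.ofReal_mul, Real.mul_self_sqrt (hx s)]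
    have hdf : frobSq (Matrix.diagonal fun s : T => ((√(x s) : ℝ) : ℂ)) ≤ 1 := by
      have h1 := trace_mul_conjTranspose_self (Matrix.diagonal fun s : T => ((√(x s) : ℝ) : ℂ))
      rw [hdsq, Matrix.trace_diagonal, ← Complex.ofReal_sum] at h1
      have h2 := Complex.ofReal_injective h1
      linarith
    set Ra : Matrix ι T ℂ := (R a).submatrix id (fun s : T => (s : ι)) with hRa
    have hRaRa : Raᴴ * Ra = 1 := by
      ext s s'
      have := congrFun (congrFun (hR1 a) s) s'
      rw [Matrix.mul_apply] at this ⊢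
      refine this.trans ?_
      simp only [Matrix.one_apply, Subtype.ext_iff]
    have hZaR : Za = Ra * Matrix.diagonal fun s : T => ((√(x s) : ℝ) : ℂ) := by
      ext i s; simp [hZa, hZ, hRa, Matrix.mul_diagonal]
    have hYaW : Ya = Wc a * Matrix.diagonal fun s : T => ((√(x s) : ℝ) : ℂ) := by
      ext i s; simp [hYa, hWc, hB, Matrix.mul_diagonal]
    have hWaWa : (Wc a)ᴴ * Wc a = 1 := by rw [hWW, if_pos rfl]
    have hZf : √(frobSq Za) ≤ 1 := by
      rw [hZaR, frobSq_isometry_mul hRaRa]; exact Real.sqrt_le_one.mpr hdf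
    have hYf : √(frobSq Ya) ≤ 1 := by
      rw [hYaW, frobSq_isometry_mul hWaWa]; exact Real.sqrt_le_one.mpr hdf
    have hZY : √(frobSq (Za - Ya)) ≤ √(overlapSum x R) :=
      Real.sqrt_le_sqrt ((hfrob (Z - W * B)).trans hps)
    -- ZZ† - YY† = (Z - Y)Z† + Y(Z - Y)†. Both `Za` and `Ya` have Hilbert-Schmidt norm at most one,
    -- so by Hölder each term costs one √`overlapSum`; the dropped and the reinstalled weight cost
    -- one tail each.
    have e1 : R a * (Matrix.diagonal fun s => (x s : ℂ)) * (R a)ᴴ -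
        Wc a * (Matrix.diagonal fun s => (y s : ℂ)) * (Wc a)ᴴ =
        R a * (Matrix.diagonal fun s => ((if s ∈ T then 0 else x s : ℝ) : ℂ)) * (R a)ᴴ +
        ((Za - Ya) * Zaᴴ + Ya * (Za - Ya)ᴴ) -
        Wc a * (Matrix.diagonal fun s : T => ((if s = ⟨s₀, hs₀⟩ then tail else 0 : ℝ) : ℂ)) *
          (Wc a)ᴴ := by
      have h1 : R a * (Matrix.diagonal fun s => (x s : ℂ)) * (R a)ᴴ =
          R a * (Matrix.diagonal fun s => ((if s ∈ T then 0 else x s : ℝ) : ℂ)) * (R a)ᴴ +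
          Za * Zaᴴ := by
        ext i j
        rw [Matrix.add_apply, Matrix.mul_apply, Matrix.mul_apply, Matrix.mul_apply,
          ← Finset.sum_add_sum_compl T, ← Finset.sum_add_sum_compl T (fun k => (R a *
            (Matrix.diagonal fun s => ((if s ∈ T then 0 else x s : ℝ) : ℂ))) i k * (R a)ᴴ k j)]
        have h3 : ∑ k : T, Za i k * Zaᴴ k j = ∑ k ∈ T,
            (R a * (Matrix.diagonal fun s => (x s : ℂ))) i k * (R a)ᴴ k j := by
          rw [← Finset.sum_coe_sort T]
          refine Finset.sum_congr rfl fun k _ => ?_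
          have : ((x k : ℝ) : ℂ) = (√(x k) : ℝ) * (√(x k) : ℝ) := by
            rw [← Complex.ofReal_mul, Real.mul_self_sqrt (hx k)]
          simp only [hZa, hZ, Matrix.submatrix_apply, Matrix.of_apply, Matrix.conjTranspose_apply,
            id, star_mul', RCLike.star_def, Complex.conj_ofReal, Matrix.mul_diagonal, this]
          ring
        rw [h3, Finset.sum_eq_zero (s := T) (f := fun k => (R a *
            (Matrix.diagonal fun s => ((if s ∈ T then 0 else x s : ℝ) : ℂ))) i k * (R a)ᴴ k j),
          zero_add, add_comm]
        · congr 1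
          refine Finset.sum_congr rfl fun k hk => ?_
          rw [Finset.mem_compl] at hk
          simp [Matrix.mul_diagonal, hk]
        · intro k hk
          simp [Matrix.mul_diagonal, hk]
      have h2 : Wc a * (Matrix.diagonal fun s => (y s : ℂ)) * (Wc a)ᴴ = Ya * Yaᴴ +
          Wc a * (Matrix.diagonal fun s : T => ((if s = ⟨s₀, hs₀⟩ then tail else 0 : ℝ) : ℂ)) *
          (Wc a)ᴴ := by
        have : Ya * Yaᴴ = Wc a * (Matrix.diagonal fun s : T => (x s : ℂ)) * (Wc a)ᴴ := by
          rw [hYaW, Matrix.conjTranspose_mul, Matrix.mul_assoc, ← Matrix.mul_assoc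
            (Matrix.diagonal _), hdsq, ← Matrix.mul_assoc]
        rw [this, ← Matrix.add_mul, ← Matrix.mul_add, Matrix.diagonal_add]
        simp only [hy, Complex.ofReal_add]
      rw [h1, h2, Matrix.sub_mul, Matrix.conjTranspose_sub, Matrix.mul_sub]
      abel
    rw [e1]
    refine (traceNorm_sub_le _ _).trans ?_
    have b1 : traceNorm (R a * (Matrix.diagonal fun s => ((if s ∈ T then 0 else x s : ℝ) : ℂ)) *
        (R a)ᴴ) ≤ tail := by
      refine (traceNorm_mul_diagonal_mul_le (fun s => by split_ifs <;> simp [hx s]) (hR1 a)).trans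
        (le_of_eq ?_)
      rw [htaildef, ← Finset.sum_add_sum_compl T, Finset.sum_eq_zero (s := T), zero_add]
      · exact Finset.sum_congr rfl fun s hs => if_neg (Finset.mem_compl.mp hs)
      · intro s hs; exact if_pos hs
    have b2 : traceNorm (Wc a * (Matrix.diagonal fun s : T =>
        ((if s = ⟨s₀, hs₀⟩ then tail else 0 : ℝ) : ℂ)) * (Wc a)ᴴ) ≤ tail := by
      refine (traceNorm_mul_diagonal_mul_le (fun s => by split_ifs <;> simp [htail0])
        hWaWa).trans (le_of_eq ?_)
      simp
    have b3 : traceNorm ((Za - Ya) * Zaᴴ) ≤ √(overlapSum x R) := by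
      refine (traceNorm_mul_conjTranspose_le _ _).trans ?_
      calc _ ≤ √(overlapSum x R) * 1 := by gcongr
        _ = _ := mul_one _
    have b4 : traceNorm (Ya * (Za - Ya)ᴴ) ≤ √(overlapSum x R) := by
      refine (traceNorm_mul_conjTranspose_le _ _).trans ?_
      calc _ ≤ 1 * √(overlapSum x R) := by gcongr
        _ = _ := one_mul _
    have b5 := traceNorm_add_le (R a * (Matrix.diagonal fun s =>
      ((if s ∈ T then 0 else x s : ℝ) : ℂ)) * (R a)ᴴ) ((Za - Ya) * Zaᴴ + Ya * (Za - Ya)ᴴ)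
    have b6 := traceNorm_add_le ((Za - Ya) * Zaᴴ) (Ya * (Za - Ya)ᴴ)
    linarith

end Orthogonalisation

/-! ### Branch decomposition of the evolved and of the reduced state. -/

section Dynamics

variable {d : ℕ}

/-- The conditional evolution `exp (-i τ B)` of one apparatus. -/
def siteU (τ : ℝ) (B : SpectralData d) : Matrix (Fin d) (Fin d) ℂ :=
  (B.2 : Matrix (Fin d) (Fin d) ℂ) *
    Matrix.diagonal (fun j => Complex.exp (-(Complex.I * ((τ * B.1 j : ℝ) : ℂ)))) *
    (B.2 : Matrix (Fin d) (Fin d) ℂ)ᴴ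

lemma unitary_conjTranspose_mul (U : Matrix.unitaryGroup (Fin d) ℂ) :
    (U : Matrix (Fin d) (Fin d) ℂ)ᴴ * U = 1 := Matrix.mem_unitaryGroup_iff'.mp U.2

lemma unitary_mul_conjTranspose (U : Matrix.unitaryGroup (Fin d) ℂ) :
    (U : Matrix (Fin d) (Fin d) ℂ) * (U : Matrix (Fin d) (Fin d) ℂ)ᴴ = 1 :=
  Matrix.mem_unitaryGroup_iff.mp U.2

lemma siteU_zero (B : SpectralData d) : siteU 0 B = 1 := by
  simp [siteU, unitary_mul_conjTranspose]

lemma siteU_conjTranspose (τ : ℝ) (B : SpectralData d) : (siteU τ B)ᴴ = siteU (-τ) B := by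
  unfold siteU
  rw [Matrix.conjTranspose_mul, Matrix.conjTranspose_mul, Matrix.conjTranspose_conjTranspose,
    Matrix.diagonal_conjTranspose, Matrix.mul_assoc]
  congr 3
  ext j
  simp only [Pi.star_apply, RCLike.star_def, ← Complex.exp_conj, map_neg, map_mul, Complex.conj_I,
    Complex.conj_ofReal]
  push_cast
  ring_nf

lemma siteU_mul (τ τ' : ℝ) (B : SpectralData d) : siteU τ B * siteU τ' B = siteU (τ + τ') B := by
  unfold siteU
  rw [Matrix.mul_assoc, ← Matrix.mul_assoc _ _ (B.2 : Matrix (Fin d) (Fin d) ℂ)ᴴ,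
    ← Matrix.mul_assoc _ _ (Matrix.diagonal _), unitary_conjTranspose_mul, Matrix.one_mul,
    Matrix.mul_assoc, ← Matrix.mul_assoc (Matrix.diagonal _) (Matrix.diagonal _),
    Matrix.diagonal_mul_diagonal, ← Matrix.mul_assoc]
  congr 3
  ext j
  rw [← Complex.exp_add]
  congr 1
  push_cast
  ring

lemma siteU_mem (τ : ℝ) (B : SpectralData d) : siteU τ B ∈ Matrix.unitaryGroup (Fin d) ℂ := by
  rw [Matrix.mem_unitaryGroup_iff, Matrix.star_eq_conjTranspose, siteU_conjTranspose, siteU_mul,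
    add_neg_cancel, siteU_zero]

section Tensor

variable {α : Type*} [Fintype α] [DecidableEq α]

lemma tensorPower_one : tensorPower (fun _ : α => (1 : Matrix (Fin d) (Fin d) ℂ)) = 1 := by
  ext x y
  simp only [tensorPower, Matrix.one_apply]
  rw [Finset.prod_ite_zero]
  simp [funext_iff]

lemma tensorPower_diagonal (D : α → Fin d → ℂ) :
    tensorPower (fun k => Matrix.diagonal (D k)) = Matrix.diagonal fun x => ∏ k, D k (x k) := by
  ext x y
  simp only [tensorPower, Matrix.diagonal_apply]
  rw [Finset.prod_ite_zero]
  simp [funext_iff]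

lemma tensorPower_mem_unitary {V : α → Matrix (Fin d) (Fin d) ℂ}
    (hV : ∀ k, V k ∈ Matrix.unitaryGroup (Fin d) ℂ) :
    tensorPower V ∈ Matrix.unitaryGroup (α → Fin d) ℂ := by
  rw [Matrix.mem_unitaryGroup_iff, Matrix.star_eq_conjTranspose, tensorPower_conjTranspose,
    tensorPower_mul]
  have : ∀ k, V k * (V k)ᴴ = 1 := fun k => Matrix.mem_unitaryGroup_iff.mp (hV k)
  simp only [this, tensorPower_one]

/-- The identity on the other sites equals V 1 V†, so that a single product basis diagonalises all
the local terms simultaneously. -/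
lemma onSite_toMatrix (k : α) (B : α → SpectralData d) :
    onSite k (B k).toMatrix =
      tensorPower (fun k => ((B k).2 : Matrix (Fin d) (Fin d) ℂ)) *
        Matrix.diagonal (fun x => ((B k).1 (x k) : ℂ)) *
        (tensorPower (fun k => ((B k).2 : Matrix (Fin d) (Fin d) ℂ)))ᴴ := by
  have h1 : (Matrix.diagonal fun x : α → Fin d => ((B k).1 (x k) : ℂ)) =
      tensorPower (Function.update (fun _ => (1 : Matrix (Fin d) (Fin d) ℂ)) k
        (Matrix.diagonal fun i => ((B k).1 i : ℂ))) := by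
    have : Function.update (fun _ => (1 : Matrix (Fin d) (Fin d) ℂ)) k
        (Matrix.diagonal fun i => ((B k).1 i : ℂ)) =
        fun k' => Matrix.diagonal (Function.update (fun _ _ => (1 : ℂ)) k
          (fun i => ((B k).1 i : ℂ)) k') := by
      ext k' : 1
      by_cases h : k' = k
      · subst h; simp
      · simp [Function.update_of_ne h]
    rw [this, tensorPower_diagonal]
    congr 1
    ext x
    rw [Finset.prod_eq_single k]
    · simp
    · intro k' _ hk'; simp [Function.update_of_ne hk']
    · simp
  rw [h1, tensorPower_conjTranspose, tensorPower_mul, tensorPower_mul, onSite]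
  congr 1
  ext k' : 1
  by_cases h : k' = k
  · subst h; simp [SpectralData.toMatrix]
  · simp [Function.update_of_ne h, unitary_mul_conjTranspose]

end Tensor

variable {dS Nuno M Nmac : ℕ}

/-- The product of the eigenbases of all the observables. -/
def jointBasis (ω : Sample dS d Nuno M Nmac) :
    Matrix (Fin dS × (EnvLabel Nuno M Nmac → Fin d)) (Fin dS × (EnvLabel Nuno M Nmac → Fin d)) ℂ :=
  Matrix.kronecker (ω.1.2 : Matrix (Fin dS) (Fin dS) ℂ)
    (tensorPower fun k => ((ω.2.1 k).2 : Matrix (Fin d) (Fin d) ℂ))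

lemma jointBasis_mul_conjTranspose (ω : Sample dS d Nuno M Nmac) :
    jointBasis ω * (jointBasis ω)ᴴ = 1 := by
  have h := Matrix.mem_unitaryGroup_iff.mp
    (tensorPower_mem_unitary fun k : EnvLabel Nuno M Nmac => (ω.2.1 k).2.2)
  rw [Matrix.star_eq_conjTranspose] at h
  unfold jointBasis
  rw [show (Matrix.kronecker (ω.1.2 : Matrix (Fin dS) (Fin dS) ℂ)
    (tensorPower fun k => ((ω.2.1 k).2 : Matrix (Fin d) (Fin d) ℂ)))ᴴ = _ from
    Matrix.conjTranspose_kronecker _ _]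
  refine (Matrix.mul_kronecker_mul _ _ _ _).symm.trans ?_
  rw [unitary_mul_conjTranspose, h]
  exact Matrix.one_kronecker_one

lemma hamiltonian_eq (ω : Sample dS d Nuno M Nmac) :
    hamiltonian ω = jointBasis ω *
      Matrix.diagonal (fun p => ((ω.1.1 p.1 : ℝ) : ℂ) * ∑ k, (((ω.2.1 k).1 (p.2 k) : ℝ) : ℂ)) *
      (jointBasis ω)ᴴ := by
  have h1 : (∑ k, onSite k (ω.2.1 k).toMatrix) =
      tensorPower (fun k => ((ω.2.1 k).2 : Matrix (Fin d) (Fin d) ℂ)) *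
        Matrix.diagonal (fun x => ∑ k, ((ω.2.1 k).1 (x k) : ℂ)) *
        (tensorPower (fun k => ((ω.2.1 k).2 : Matrix (Fin d) (Fin d) ℂ)))ᴴ := by
    simp only [onSite_toMatrix]
    rw [← Finset.sum_mul, ← Finset.mul_sum]
    congr 2
    ext x y
    rw [Matrix.sum_apply]
    by_cases h : x = y
    · subst h; simp
    · simp [Matrix.diagonal_apply_ne _ h]
  unfold hamiltonian jointBasis
  rw [h1, SpectralData.toMatrix]
  refine (Matrix.mul_kronecker_mul _ _ _ _).trans ?_
  refine congrArg₂ (· * ·) ((Matrix.mul_kronecker_mul _ _ _ _).trans ?_)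
    (Matrix.conjTranspose_kronecker _ _).symm
  refine congrArg₂ (· * ·) rfl ?_
  exact Matrix.diagonal_kronecker_diagonal _ _

/-- In the joint eigenbasis the Hamiltonian is the diagonal λ_a Σ_k b_k. Its exponential is a
product over the sites, and collecting the terms with the same a gives a unitary controlled by the
pointer state, in which apparatus k evolves for the effective time t λ_a. -/
lemma evolution_eq (ω : Sample dS d Nuno M Nmac) (t : ℝ) :
    evolution ω t =
      ∑ a, Matrix.kronecker (pointer ω.1 a)
        (tensorPower fun k => siteU (t * ω.1.1 a) (ω.2.1 k)) := by
  have hU := jointBasis_mul_conjTranspose ω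
  have hU' : (jointBasis ω)⁻¹ = (jointBasis ω)ᴴ := Matrix.inv_eq_right_inv hU
  have hunit : IsUnit (jointBasis ω) := IsUnit.of_mul_eq_one _ hU
  have h1 : evolution ω t = jointBasis ω *
      Matrix.diagonal (fun p => ∏ k, Complex.exp
        (-(Complex.I * ((t * ω.1.1 p.1 * (ω.2.1 k).1 (p.2 k) : ℝ) : ℂ)))) * (jointBasis ω)ᴴ := by
    rw [evolution, hamiltonian_eq, ← Matrix.smul_mul, ← Matrix.mul_smul, ← hU',
      Matrix.exp_conj _ _ hunit, ← Matrix.diagonal_smul, Matrix.exp_diagonal]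
    congr 3
    ext p
    rw [Pi.coe_exp, ← Complex.exp_eq_exp_ℂ, ← Complex.exp_sum]
    congr 1
    simp only [Pi.smul_apply, smul_eq_mul, Finset.mul_sum]
    refine Finset.sum_congr rfl fun k _ => ?_
    push_cast
    ring
  have h2 : Matrix.diagonal (fun p : Fin dS × (EnvLabel Nuno M Nmac → Fin d) =>
      ∏ k, Complex.exp (-(Complex.I * ((t * ω.1.1 p.1 * (ω.2.1 k).1 (p.2 k) : ℝ) : ℂ)))) =
      ∑ a, Matrix.kronecker (Matrix.diagonal (Pi.single a (1 : ℂ)))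
        (tensorPower fun k => Matrix.diagonal fun j => Complex.exp
          (-(Complex.I * ((t * ω.1.1 a * (ω.2.1 k).1 j : ℝ) : ℂ)))) := by
    ext ⟨a, x⟩ ⟨b, y⟩
    rw [Matrix.sum_apply]
    simp only [tensorPower_diagonal, Matrix.kronecker, Matrix.kroneckerMap_apply]
    by_cases hab : a = b
    · subst hab
      by_cases hxy : x = y
      · subst hxy
        rw [Finset.sum_eq_single a]
        · simp
        · intro c _ hc; simp [hc.symm]
        · simp
      · simp [hxy]
    · simp [hab]
  rw [h1, h2, Finset.mul_sum, Finset.sum_mul]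
  refine Finset.sum_congr rfl fun a _ => ?_
  have e1 : ((ω.1.2 : Matrix (Fin dS) (Fin dS) ℂ) * Matrix.diagonal (Pi.single a (1 : ℂ))) *
      (ω.1.2 : Matrix (Fin dS) (Fin dS) ℂ)ᴴ = pointer ω.1 a := by
    ext i j
    rw [Matrix.mul_apply, Finset.sum_eq_single a]
    · simp [pointer, Matrix.mul_diagonal]
    · intro c _ hc; simp [Matrix.mul_diagonal, hc]
    · simp
  have e2 : (tensorPower fun k => siteU (t * ω.1.1 a) (ω.2.1 k)) =
      tensorPower (fun k => ((ω.2.1 k).2 : Matrix (Fin d) (Fin d) ℂ)) *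
        (tensorPower fun k => Matrix.diagonal fun j => Complex.exp
          (-(Complex.I * ((t * ω.1.1 a * (ω.2.1 k).1 j : ℝ) : ℂ)))) *
        (tensorPower fun k => ((ω.2.1 k).2 : Matrix (Fin d) (Fin d) ℂ))ᴴ := by
    rw [tensorPower_conjTranspose, tensorPower_mul, tensorPower_mul]
    rfl
  rw [e2, ← e1]
  refine Eq.symm ((Matrix.mul_kronecker_mul _ _ _ _).trans ?_)
  exact congrArg₂ (· * ·) (Matrix.mul_kronecker_mul _ _ _ _)
    (Matrix.conjTranspose_kronecker _ _).symm

/-- The operator `|a⟩⟨b|`, for the eigenvectors of `A`. -/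
def ketBra (A : SpectralData dS) (a b : Fin dS) : Matrix (Fin dS) (Fin dS) ℂ :=
  fun i j => A.2.1 i a * star (A.2.1 j b)

/-- The matrix elements of `ρ` in the eigenbasis of `A`. -/
def pointerEntry (A : SpectralData dS) (ρ : Matrix (Fin dS) (Fin dS) ℂ) (a b : Fin dS) : ℂ :=
  ((A.2 : Matrix (Fin dS) (Fin dS) ℂ)ᴴ * ρ * A.2) a b

lemma pointer_mul_mul_pointer (A : SpectralData dS) (ρ : Matrix (Fin dS) (Fin dS) ℂ)
    (a b : Fin dS) : pointer A a * ρ * (pointer A b)ᴴ = pointerEntry A ρ a b • ketBra A a b := by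
  ext i j
  simp only [Matrix.mul_apply, pointer, Matrix.conjTranspose_apply, pointerEntry, ketBra,
    Matrix.smul_apply, smul_eq_mul, Finset.sum_mul, star_mul', star_star]
  refine Finset.sum_congr rfl fun k _ => Finset.sum_congr rfl fun l _ => ?_
  ring

/-- The branch `(a, b)` of the state of apparatus `k`. -/
def branch (ω : Sample dS d Nuno M Nmac) (t : ℝ) (a b : Fin dS) (k : EnvLabel Nuno M Nmac) :
    Matrix (Fin d) (Fin d) ℂ :=
  siteU (t * ω.1.1 a) (ω.2.1 k) * (ω.2.2 k).toMatrix * (siteU (t * ω.1.1 b) (ω.2.1 k))ᴴ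

lemma totalState_eq (ρS : Matrix (Fin dS) (Fin dS) ℂ) (ω : Sample dS d Nuno M Nmac) (t : ℝ) :
    totalState ρS ω t = ∑ a, ∑ b, pointerEntry ω.1 ρS a b •
      Matrix.kronecker (ketBra ω.1 a b) (tensorPower (branch ω t a b)) := by
  rw [totalState, evolution_eq, Matrix.conjTranspose_sum, Finset.sum_mul, Finset.sum_mul]
  refine Finset.sum_congr rfl fun a _ => ?_
  rw [Finset.mul_sum]
  refine Finset.sum_congr rfl fun b _ => ?_
  have h3 : (tensorPower (branch ω t a b)) =
      (tensorPower fun k => siteU (t * ω.1.1 a) (ω.2.1 k)) *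
      (tensorPower fun k => (ω.2.2 k).toMatrix) *
      (tensorPower fun k => siteU (t * ω.1.1 b) (ω.2.1 k))ᴴ := by
    rw [tensorPower_conjTranspose, tensorPower_mul, tensorPower_mul]
    rfl
  rw [h3]
  refine Eq.trans ?_ (Matrix.smul_kronecker _ _ _)
  rw [← pointer_mul_mul_pointer]
  refine Eq.symm ((Matrix.mul_kronecker_mul _ _ _ _).trans ?_)
  exact congrArg₂ (· * ·) (Matrix.mul_kronecker_mul _ _ _ _)
    (Matrix.conjTranspose_kronecker _ _).symm

/-- The decoherence factor of the coherence `(a, b)`. -/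
def decoherence (ω : Sample dS d Nuno M Nmac) (t : ℝ) (a b : Fin dS) : ℂ :=
  ∏ k : Fin Nuno, (branch ω t a b (Sum.inl k)).trace

/-- Each branch is a product over the sites, so tracing out the unobserved ones leaves the product
of their traces as a scalar. -/
lemma reducedState_eq (ρS : Matrix (Fin dS) (Fin dS) ℂ) (ω : Sample dS d Nuno M Nmac) (t : ℝ) :
    reducedState ρS ω t = ∑ a, ∑ b, (pointerEntry ω.1 ρS a b * decoherence ω t a b) •
      Matrix.kronecker (ketBra ω.1 a b)
        (tensorPower fun k : ObsLabel M Nmac => branch ω t a b (Sum.inr k)) := by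
  ext ⟨i, x⟩ ⟨j, y⟩
  simp only [reducedState, totalState_eq, Matrix.sum_apply, Matrix.smul_apply, Matrix.kronecker,
    Matrix.kroneckerMap_apply, smul_eq_mul]
  rw [Finset.sum_comm]
  refine Finset.sum_congr rfl fun a _ => ?_
  rw [Finset.sum_comm]
  refine Finset.sum_congr rfl fun b _ => ?_
  have h : ∑ z : Fin Nuno → Fin d, ∏ k, branch ω t a b (Sum.inl k) (z k) (z k) =
      decoherence ω t a b := by
    unfold decoherence Matrix.trace
    rw [Finset.prod_univ_sum, Fintype.piFinset_univ]
    rfl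
  rw [← h, Finset.mul_sum, Finset.sum_mul]
  refine Finset.sum_congr rfl fun z _ => ?_
  simp only [tensorPower, Fintype.prod_sum_type, Sum.elim_inl, Sum.elim_inr]
  ring

end Dynamics

/-! ### Pointwise bound on the distance to spectrum broadcast structures. -/

section Bound

variable {d dS Nuno M Nmac : ℕ}

lemma frobSq_ket (U : Matrix.unitaryGroup (Fin dS) ℂ) (a : Fin dS) :
    frobSq (Matrix.of fun (i : Fin dS) (_ : Unit) => (U : Matrix (Fin dS) (Fin dS) ℂ) i a) = 1 := by
  have h := congrFun (congrFun (unitary_conjTranspose_mul U) a) a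
  rw [Matrix.mul_apply, Matrix.one_apply_eq] at h
  have h2 : ((frobSq (Matrix.of fun (i : Fin dS) (_ : Unit) =>
      (U : Matrix (Fin dS) (Fin dS) ℂ) i a) : ℝ) : ℂ) = 1 := by
    rw [← h]
    simp only [frobSq, Finset.univ_unique, Finset.sum_singleton, Matrix.of_apply,
      Matrix.conjTranspose_apply]
    push_cast
    refine Finset.sum_congr rfl fun i _ => ?_
    rw [RCLike.star_def, Complex.conj_mul']
  exact_mod_cast h2

lemma traceNorm_ketBra_le (A : SpectralData dS) (a b : Fin dS) : traceNorm (ketBra A a b) ≤ 1 := by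
  have h := traceNorm_mul_conjTranspose_le
    (Matrix.of fun (i : Fin dS) (_ : Unit) => (A.2 : Matrix (Fin dS) (Fin dS) ℂ) i a)
    (Matrix.of fun (i : Fin dS) (_ : Unit) => (A.2 : Matrix (Fin dS) (Fin dS) ℂ) i b)
  rw [frobSq_ket, frobSq_ket, Real.sqrt_one, one_mul] at h
  convert h using 2
  ext i j
  simp [ketBra, Matrix.mul_apply]

lemma IsState.conj_unitary {ι : Type*} [Fintype ι] [DecidableEq ι] {ρ U : Matrix ι ι ℂ}
    (h : IsState ρ) (hU : U ∈ Matrix.unitaryGroup ι ℂ) : IsState (U * ρ * Uᴴ) := by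
  have h1 : Uᴴ * U = 1 := Matrix.mem_unitaryGroup_iff'.mp hU
  refine ⟨h.1.mul_mul_conjTranspose_same U, ?_⟩
  rw [Matrix.trace_mul_comm, ← Matrix.mul_assoc, h1, Matrix.one_mul, h.2]

lemma IsState.exists_factor {ι : Type*} [Fintype ι] [DecidableEq ι] {ρ : Matrix ι ι ℂ}
    (h : IsState ρ) : ∃ Y : Matrix ι ι ℂ, ρ = Y * Yᴴ ∧ frobSq Y = 1 := by
  obtain ⟨Y, hY⟩ := h.1.exists_mul_conjTranspose
  refine ⟨Y, hY, ?_⟩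
  have h2 := trace_mul_conjTranspose_self Y
  rw [← hY, h.2] at h2
  exact_mod_cast h2.symm

lemma IsState.norm_entry_le {ι : Type*} [Fintype ι] [DecidableEq ι] {ρ : Matrix ι ι ℂ}
    (h : IsState ρ) (i j : ι) : ‖ρ i j‖ ≤ 1 := by
  obtain ⟨Y, hY, hf⟩ := h.exists_factor
  have hrow : ∀ i, √(∑ k, ‖Y i k‖ ^ 2) ≤ 1 := by
    intro i
    rw [Real.sqrt_le_one, ← hf]
    exact Finset.single_le_sum (f := fun i => ∑ k, ‖Y i k‖ ^ 2) (fun _ _ => by positivity)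
      (Finset.mem_univ i)
  rw [hY, Matrix.mul_apply]
  refine (norm_sum_le _ _).trans ?_
  simp only [norm_mul, Matrix.conjTranspose_apply, norm_star]
  refine (Real.sum_mul_le_sqrt_mul_sqrt _ _ _).trans ?_
  exact mul_le_one₀ (hrow i) (Real.sqrt_nonneg _) (hrow j)

lemma isState_pointerEntry (A : SpectralData dS) {ρ : Matrix (Fin dS) (Fin dS) ℂ}
    (h : IsState ρ) : IsState (Matrix.of (pointerEntry A ρ)) := by
  have := h.conj_unitary (Unitary.star_mem A.2.2)
  rw [Matrix.star_eq_conjTranspose, Matrix.conjTranspose_conjTranspose] at this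
  exact this

lemma norm_pointerEntry_le (A : SpectralData dS) {ρ : Matrix (Fin dS) (Fin dS) ℂ}
    (h : IsState ρ) (a b : Fin dS) : ‖pointerEntry A ρ a b‖ ≤ 1 :=
  (isState_pointerEntry A h).norm_entry_le a b

lemma pointerEntry_self_eq (A : SpectralData dS) {ρ : Matrix (Fin dS) (Fin dS) ℂ}
    (h : IsState ρ) (a : Fin dS) :
    0 ≤ pointerProb A ρ a ∧ pointerEntry A ρ a a = (pointerProb A ρ a : ℂ) := by
  have h1 : pointerEntry A ρ a a = (pointer A a * ρ).trace := by
    simp only [pointerEntry, Matrix.trace, Matrix.diag, Matrix.mul_apply, pointer,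
      Matrix.conjTranspose_apply, Finset.sum_mul]
    refine Finset.sum_congr rfl fun i _ => Finset.sum_congr rfl fun j _ => ?_
    ring
  obtain ⟨h2, h3⟩ := Complex.nonneg_iff.mp ((isState_pointerEntry A h).1.diag_nonneg (i := a))
  simp only [Matrix.of_apply] at h2 h3
  unfold pointerProb
  rw [← h1]
  exact ⟨h2, Complex.ext rfl (by simpa using h3.symm)⟩

lemma sum_pointerProb (A : SpectralData dS) {ρ : Matrix (Fin dS) (Fin dS) ℂ}
    (h : IsState ρ) : ∑ a, pointerProb A ρ a = 1 := by
  have h1 := (isState_pointerEntry A h).2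
  simp only [Matrix.trace, Matrix.diag, Matrix.of_apply] at h1
  have h2 : ((∑ a, pointerProb A ρ a : ℝ) : ℂ) = 1 := by
    push_cast
    rw [← h1]
    exact Finset.sum_congr rfl fun a _ => ((pointerEntry_self_eq A h a).2).symm
  exact_mod_cast h2

/-- The spectra that belong to density matrices. -/
def IsSpectrum (x : Fin d → ℝ) : Prop := (∀ i, 0 ≤ x i) ∧ ∑ i, x i = 1

lemma IsSpectrum.isState {s : SpectralData d} (h : IsSpectrum s.1) : IsState s.toMatrix := by
  have : IsState (Matrix.diagonal fun i => (s.1 i : ℂ)) := by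
    refine ⟨?_, ?_⟩
    · rw [Matrix.posSemidef_diagonal_iff]; intro i; exact_mod_cast h.1 i
    · rw [Matrix.trace_diagonal]; exact_mod_cast h.2
  exact this.conj_unitary s.2.2

/-- The product of operators of the macrofractions. -/
def macroTensor (X : Fin M → Matrix (Fin Nmac → Fin d) (Fin Nmac → Fin d) ℂ) :
    Matrix (ObsLabel M Nmac → Fin d) (ObsLabel M Nmac → Fin d) ℂ :=
  (tensorPower X).submatrix (Equiv.curry _ _ _) (Equiv.curry _ _ _)

lemma macroTensor_apply (X : Fin M → Matrix (Fin Nmac → Fin d) (Fin Nmac → Fin d) ℂ)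
    (x y : ObsLabel M Nmac → Fin d) :
    macroTensor X x y = ∏ m, X m (fun k => x (m, k)) (fun k => y (m, k)) := rfl

lemma tensorPower_obs (X : ObsLabel M Nmac → Matrix (Fin d) (Fin d) ℂ) :
    tensorPower X = macroTensor fun m => tensorPower fun k => X (m, k) := by
  ext x y
  rw [macroTensor_apply]
  simp only [tensorPower, Fintype.prod_prod_type]

lemma traceNorm_macroTensor_le (X : Fin M → Matrix (Fin Nmac → Fin d) (Fin Nmac → Fin d) ℂ) :
    traceNorm (macroTensor X) ≤ ∏ m, traceNorm (X m) :=
  (traceNorm_submatrix_le _ _).trans (traceNorm_tensorPower_le X)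

/-- Telescoping: the factors `X` are exchanged for `Y` one macrofraction at a time, and in each
difference the other factors have trace norm at most one. -/
lemma traceNorm_macroTensor_sub_le
    {X Y : Fin M → Matrix (Fin Nmac → Fin d) (Fin Nmac → Fin d) ℂ}
    (hX : ∀ m, traceNorm (X m) ≤ 1) (hY : ∀ m, traceNorm (Y m) ≤ 1) :
    traceNorm (macroTensor X - macroTensor Y) ≤ ∑ m, traceNorm (X m - Y m) := by
  have h : macroTensor X - macroTensor Y = ∑ m, macroTensor
      (fun j => if j < m then Y j else if j = m then X m - Y m else X j) := by
    ext x y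
    rw [Matrix.sub_apply, Matrix.sum_apply]
    simp only [macroTensor_apply]
    have := Finset.prod_sub_ordered Finset.univ
      (fun m => X m (fun k => x (m, k)) (fun k => y (m, k)))
      (fun m => (X m - Y m) (fun k => x (m, k)) (fun k => y (m, k)))
    simp only [Matrix.sub_apply, sub_sub_cancel] at this
    rw [this, sub_sub_cancel]
    refine Finset.sum_congr rfl fun m _ => ?_
    have hu : (Finset.univ : Finset (Fin M)) =
        insert m (Finset.univ.filter (· < m) ∪ Finset.univ.filter (m < ·)) := by
      ext j
      simp only [Finset.mem_univ, Finset.mem_insert, Finset.mem_union, Finset.mem_filter, true_and,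
        true_iff]
      rcases lt_trichotomy j m with h | h | h <;> simp [h]
    conv_rhs => rw [hu]
    rw [Finset.prod_insert (by simp), Finset.prod_union]
    · rw [mul_assoc]
      congr 1
      · simp
      · congr 1
        · refine Finset.prod_congr rfl fun j hj => ?_
          rw [if_pos (Finset.mem_filter.mp hj).2]
        · refine Finset.prod_congr rfl fun j hj => ?_
          have hj' := (Finset.mem_filter.mp hj).2
          rw [if_neg hj'.not_gt, if_neg hj'.ne']
    · rw [Finset.disjoint_filter]
      intro j _ h1 h2
      exact absurd h1 h2.not_gt
  rw [h]
  refine (traceNorm_sum_le _ _).trans (Finset.sum_le_sum fun m _ => ?_)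
  refine (traceNorm_macroTensor_le _).trans ?_
  rw [← Finset.mul_prod_erase _ _ (Finset.mem_univ m)]
  simp only [lt_irrefl, if_false, if_true]
  refine mul_le_of_le_one_right (traceNorm_nonneg _)
    (Finset.prod_le_one (fun _ _ => traceNorm_nonneg _) fun j hj => ?_)
  rw [if_neg (Finset.ne_of_mem_erase hj)]
  split_ifs
  · exact hY j
  · exact hX j

/-- The modulus of the decoherence factor of one apparatus. -/
def siteDecoherence (τ : ℝ) (B ρ : SpectralData d) : ℝ := ‖(siteU τ B * ρ.toMatrix).trace‖

/-- The overlap of the outcome distributions of one apparatus in the states `ρ` and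
`siteU τ B * ρ * (siteU τ B)†`, measured in the eigenbasis of `ρ`. -/
def siteOverlap (τ : ℝ) (B ρ : SpectralData d) : ℝ :=
  ∑ i, √(ρ.1 i * ∑ j, ‖((ρ.2 : Matrix (Fin d) (Fin d) ℂ)ᴴ * siteU τ B * ρ.2) i j‖ ^ 2 * ρ.1 j)

/-- The overlap of a spectrum with the uniform distribution. -/
def siteFlatness (x : Fin d → ℝ) : ℝ := ∑ i, √(x i / d)

lemma siteDecoherence_nonneg (τ : ℝ) (B ρ : SpectralData d) : 0 ≤ siteDecoherence τ B ρ :=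
  norm_nonneg _

lemma siteOverlap_nonneg (τ : ℝ) (B ρ : SpectralData d) : 0 ≤ siteOverlap τ B ρ :=
  Finset.sum_nonneg fun _ _ => Real.sqrt_nonneg _

lemma siteFlatness_nonneg (x : Fin d → ℝ) : 0 ≤ siteFlatness x :=
  Finset.sum_nonneg fun _ _ => Real.sqrt_nonneg _

/-- An upper bound for the optimal trace distance to a spectrum broadcast structure. -/
def sbsBound (t : ℝ) (ω : Sample dS d Nuno M Nmac) : ℝ :=
  1 / 2 * ∑ a, ∑ b ∈ {a}ᶜ, ∏ k : Fin Nuno,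
      siteDecoherence (t * (ω.1.1 a - ω.1.1 b)) (ω.2.1 (Sum.inl k)) (ω.2.2 (Sum.inl k)) +
    ∑ m, (√(∑ a, ∑ b ∈ {a}ᶜ, ∏ k, siteOverlap (t * (ω.1.1 b - ω.1.1 a))
        (ω.2.1 (Sum.inr (m, k))) (ω.2.2 (Sum.inr (m, k)))) +
      √dS * ∏ k, siteFlatness (ω.2.2 (Sum.inr (m, k))).1)

/-- Cyclicity of the trace merges the two conditional evolutions into one, over the difference of
the effective times. -/
lemma norm_decoherence (ω : Sample dS d Nuno M Nmac) (t : ℝ) (a b : Fin dS) :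
    ‖decoherence ω t a b‖ = ∏ k : Fin Nuno,
      siteDecoherence (t * (ω.1.1 a - ω.1.1 b)) (ω.2.1 (Sum.inl k)) (ω.2.2 (Sum.inl k)) := by
  unfold decoherence
  rw [norm_prod]
  refine Finset.prod_congr rfl fun k _ => ?_
  rw [siteDecoherence, branch, Matrix.trace_mul_comm, ← Matrix.mul_assoc, siteU_conjTranspose,
    siteU_mul]
  congr 4
  ring

lemma branch_eq (ω : Sample dS d Nuno M Nmac) (t : ℝ) (a : Fin dS) (k : EnvLabel Nuno M Nmac) :
    branch ω t a a k =
      (siteU (t * ω.1.1 a) (ω.2.1 k) * ((ω.2.2 k).2 : Matrix (Fin d) (Fin d) ℂ)) *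
      (Matrix.diagonal fun i => ((ω.2.2 k).1 i : ℂ)) *
      (siteU (t * ω.1.1 a) (ω.2.1 k) * ((ω.2.2 k).2 : Matrix (Fin d) (Fin d) ℂ))ᴴ := by
  simp only [branch, SpectralData.toMatrix, Matrix.conjTranspose_mul, Matrix.mul_assoc]

lemma isState_branch {ω : Sample dS d Nuno M Nmac} (hω : ∀ k, IsSpectrum (ω.2.2 k).1) (t : ℝ)
    (a : Fin dS) (k : EnvLabel Nuno M Nmac) : IsState (branch ω t a a k) :=
  (hω k).isState.conj_unitary (siteU_mem _ _)

lemma traceNorm_branch_le {ω : Sample dS d Nuno M Nmac} (hω : ∀ k, IsSpectrum (ω.2.2 k).1) (t : ℝ)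
    (a b : Fin dS) (k : EnvLabel Nuno M Nmac) : traceNorm (branch ω t a b k) ≤ 1 := by
  obtain ⟨Y, hY, hf⟩ := (hω k).isState.exists_factor
  have h := traceNorm_mul_conjTranspose_le (siteU (t * ω.1.1 a) (ω.2.1 k) * Y)
    (siteU (t * ω.1.1 b) (ω.2.1 k) * Y)
  rw [frobSq_unitary_mul (siteU_mem _ _), frobSq_unitary_mul (siteU_mem _ _), hf, Real.sqrt_one,
    one_mul] at h
  convert h using 2
  simp only [branch, hY, Matrix.conjTranspose_mul, Matrix.mul_assoc]

/-- The state of the `m`-th macrofraction, given that the system is in the pointer state `a`. -/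
def macroState (ω : Sample dS d Nuno M Nmac) (t : ℝ) (a : Fin dS) (m : Fin M) :
    Matrix (Fin Nmac → Fin d) (Fin Nmac → Fin d) ℂ :=
  tensorPower fun k => branch ω t a a (Sum.inr (m, k))

lemma prod_sum_eq {α β : Type*} [Fintype α] [DecidableEq α] [Fintype β] (f : α → β → ℝ) :
    ∑ s : α → β, ∏ k, f k (s k) = ∏ k, ∑ i, f k i := by
  rw [Finset.prod_univ_sum, Fintype.piFinset_univ]

/-- `exists_orthogonal_states` is applied to the product spectrum and the product bases. The matrix
elements, the overlap terms and the bound on the dropped weight are then all products over the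
members of the macrofraction; dS ≤ d^Nmac is the dimension condition required there. -/
lemma exists_macro_approx (hdS : 0 < dS) (hd : dS ≤ d ^ Nmac) {ω : Sample dS d Nuno M Nmac}
    (hω : ∀ k, IsSpectrum (ω.2.2 k).1) (t : ℝ) (m : Fin M) :
    ∃ σ : Fin dS → Matrix (Fin Nmac → Fin d) (Fin Nmac → Fin d) ℂ,
      (∀ a, IsState (σ a)) ∧ (∀ a a', a ≠ a' → σ a * σ a' = 0) ∧
      ∀ a, traceNorm (macroState ω t a m - σ a) ≤
        2 * √(∑ a, ∑ b ∈ {a}ᶜ, ∏ k, siteOverlap (t * (ω.1.1 b - ω.1.1 a))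
        (ω.2.1 (Sum.inr (m, k))) (ω.2.2 (Sum.inr (m, k)))) +
      2 * (√dS * ∏ k, siteFlatness (ω.2.2 (Sum.inr (m, k))).1) := by
  set x : (Fin Nmac → Fin d) → ℝ := fun s => ∏ k, (ω.2.2 (Sum.inr (m, k))).1 (s k) with hxdef
  set r : Fin dS → Fin Nmac → Matrix (Fin d) (Fin d) ℂ := fun a k =>
    siteU (t * ω.1.1 a) (ω.2.1 (Sum.inr (m, k))) * (ω.2.2 (Sum.inr (m, k))).2 with hr
  set R : Fin dS → Matrix (Fin Nmac → Fin d) (Fin Nmac → Fin d) ℂ := fun a =>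
    tensorPower (r a) with hRdef
  have hx : ∀ s, 0 ≤ x s := fun s => Finset.prod_nonneg fun k _ => (hω _).1 _
  have hx1 : ∑ s, x s = 1 := by
    rw [hxdef, prod_sum_eq (fun k i => (ω.2.2 (Sum.inr (m, k))).1 i)]
    exact Finset.prod_eq_one fun k _ => (hω _).2
  have hR : ∀ a, R a ∈ Matrix.unitaryGroup (Fin Nmac → Fin d) ℂ := fun a =>
    tensorPower_mem_unitary fun k => mul_mem (siteU_mem _ _) (ω.2.2 (Sum.inr (m, k))).2.2
  obtain ⟨σ, h1, h2, h3⟩ := exists_orthogonal_states (n := dS) hdS (by simpa using hd) hx hx1 hR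
  refine ⟨σ, h1, h2, fun a => ?_⟩
  have e1 : macroState ω t a m = R a * (Matrix.diagonal fun s => (x s : ℂ)) * (R a)ᴴ := by
    have : (Matrix.diagonal fun s => (x s : ℂ)) = tensorPower fun k =>
        Matrix.diagonal fun i => ((ω.2.2 (Sum.inr (m, k))).1 i : ℂ) := by
      rw [tensorPower_diagonal]; simp [hxdef]
    rw [this, hRdef, tensorPower_conjTranspose, tensorPower_mul, tensorPower_mul, macroState]
    exact congrArg tensorPower (funext fun k => branch_eq ω t a _)
  have hent : ∀ a b s s', ((R a)ᴴ * R b) s s' = ∏ k,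
      (((ω.2.2 (Sum.inr (m, k))).2 : Matrix (Fin d) (Fin d) ℂ)ᴴ *
        siteU (t * (ω.1.1 b - ω.1.1 a)) (ω.2.1 (Sum.inr (m, k))) *
        (ω.2.2 (Sum.inr (m, k))).2) (s k) (s' k) := by
    intro a b s s'
    have h5 : (R a)ᴴ * R b = tensorPower fun k => (r a k)ᴴ * r b k := by
      rw [hRdef, tensorPower_conjTranspose, tensorPower_mul]
    rw [h5, tensorPower]
    refine Finset.prod_congr rfl fun k _ => ?_
    have h6 : (r a k)ᴴ * r b k = ((ω.2.2 (Sum.inr (m, k))).2 : Matrix (Fin d) (Fin d) ℂ)ᴴ *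
        ((siteU (t * ω.1.1 a) (ω.2.1 (Sum.inr (m, k))))ᴴ *
          siteU (t * ω.1.1 b) (ω.2.1 (Sum.inr (m, k)))) * (ω.2.2 (Sum.inr (m, k))).2 := by
      simp only [hr, Matrix.conjTranspose_mul, Matrix.mul_assoc]
    rw [h6, siteU_conjTranspose, siteU_mul, mul_sub, neg_add_eq_sub]
  have e2 : overlapSum x R = ∑ a, ∑ b ∈ {a}ᶜ, ∏ k, siteOverlap (t * (ω.1.1 b - ω.1.1 a))
        (ω.2.1 (Sum.inr (m, k))) (ω.2.2 (Sum.inr (m, k))) := by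
    unfold overlapSum
    refine Finset.sum_congr rfl fun a _ => Finset.sum_congr rfl fun b _ => ?_
    simp only [siteOverlap]
    rw [← prod_sum_eq]
    refine Finset.sum_congr rfl fun s _ => ?_
    rw [← Real.sqrt_prod _ fun k _ => mul_nonneg ((hω _).1 _) (Finset.sum_nonneg fun j _ =>
      mul_nonneg (by positivity) ((hω _).1 _))]
    congr 1
    rw [Finset.prod_mul_distrib]
    congr 1
    rw [← prod_sum_eq]
    refine Finset.sum_congr rfl fun s' _ => ?_
    rw [Finset.prod_mul_distrib]
    congr 1
    rw [hent a b s s', norm_prod, Finset.prod_pow]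
  have e3 : ∑ s, √(x s / Fintype.card (Fin Nmac → Fin d)) =
      ∏ k, siteFlatness (ω.2.2 (Sum.inr (m, k))).1 := by
    simp only [siteFlatness]
    rw [← prod_sum_eq]
    refine Finset.sum_congr rfl fun s _ => ?_
    rw [← Real.sqrt_prod _ fun k _ => div_nonneg ((hω _).1 _) (Nat.cast_nonneg _)]
    congr 1
    simp [hxdef, Finset.prod_div_distrib]
  rw [e1, ← e2, ← e3]
  exact h3 a

lemma epsSBS_le_of_isSBS {ρS : Matrix (Fin dS) (Fin dS) ℂ} {t : ℝ} {ω : Sample dS d Nuno M Nmac}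
    {σ : Matrix (Fin dS × (ObsLabel M Nmac → Fin d)) (Fin dS × (ObsLabel M Nmac → Fin d)) ℂ}
    (hσ : IsSBS ω.1 (pointerProb ω.1 ρS) σ) :
    epsSBS ρS t ω ≤ 1 / 2 * traceNorm (reducedState ρS ω t - σ) := by
  refine csInf_le ⟨0, ?_⟩ ⟨σ, hσ, rfl⟩
  rintro r ⟨σ', -, rfl⟩
  have := traceNorm_nonneg (reducedState ρS ω t - σ')
  positivity

lemma epsSBS_nonneg (ρS : Matrix (Fin dS) (Fin dS) ℂ) (t : ℝ) (ω : Sample dS d Nuno M Nmac) :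
    0 ≤ epsSBS ρS t ω := by
  refine Real.sInf_nonneg ?_
  rintro r ⟨σ', -, rfl⟩
  have := traceNorm_nonneg (reducedState ρS ω t - σ')
  positivity

/-- The spectrum broadcast structure made of given states of the macrofractions. -/
def sbsState (A : SpectralData dS) (p : Fin dS → ℝ)
    (σ : Fin dS → Fin M → Matrix (Fin Nmac → Fin d) (Fin Nmac → Fin d) ℂ) :
    Matrix (Fin dS × (ObsLabel M Nmac → Fin d)) (Fin dS × (ObsLabel M Nmac → Fin d)) ℂ :=
  ∑ a, (p a : ℂ) • Matrix.kronecker (pointer A a) (macroTensor (σ a))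

lemma sbsState_apply (A : SpectralData dS) (p : Fin dS → ℝ)
    (σ : Fin dS → Fin M → Matrix (Fin Nmac → Fin d) (Fin Nmac → Fin d) ℂ) (i x j y) :
    sbsState A p σ (i, x) (j, y) = ∑ a, (p a : ℂ) * pointer A a i j *
        ∏ m, σ a m (fun k => x (m, k)) (fun k => y (m, k)) := by
  simp only [sbsState, Matrix.sum_apply, Matrix.smul_apply, Matrix.kronecker,
    Matrix.kroneckerMap_apply, macroTensor_apply, smul_eq_mul, mul_assoc]

/-- The competitor keeps the probabilities p_a and replaces each macrofraction state by its
orthogonalised version. The coherences are discarded, at the cost of the decoherence factors; the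
diagonal errors form a convex combination with weights p_a, so they add no further power of the
system dimension. The factor 1/2 of the trace distance cancels the factors 2 from the
orthogonalisation. -/
theorem epsSBS_le_sbsBound (hdS : 0 < dS) (hd : dS ≤ d ^ Nmac) {ω : Sample dS d Nuno M Nmac}
    (hω : ∀ k, IsSpectrum (ω.2.2 k).1) {ρS : Matrix (Fin dS) (Fin dS) ℂ} (hρ : IsState ρS)
    (t : ℝ) : epsSBS ρS t ω ≤ sbsBound t ω := by
  choose σ h1 h2 h3 using exists_macro_approx (M := M) hdS hd hω t
  have hsbs : IsSBS ω.1 (pointerProb ω.1 ρS)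
      (sbsState ω.1 (pointerProb ω.1 ρS) fun a m => σ m a) :=
    ⟨fun a m => σ m a, fun a m => h1 m a, fun a a' haa m => h2 m a a' haa,
      fun i x j y => sbsState_apply _ _ _ _ _ _ _⟩
  refine (epsSBS_le_of_isSBS hsbs).trans ?_
  set p := pointerProb ω.1 ρS
  have hp : ∀ a, 0 ≤ p a := fun a => (pointerEntry_self_eq ω.1 hρ a).1
  have hp1 : ∑ a, p a = 1 := sum_pointerProb ω.1 hρ
  have hdec1 : ∀ a, decoherence ω t a a = 1 := fun a =>
    Finset.prod_eq_one fun k _ => (isState_branch hω t a _).2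
  have e1 : reducedState ρS ω t - sbsState ω.1 p (fun a m => σ m a) =
      ∑ a, ∑ b ∈ {a}ᶜ, (pointerEntry ω.1 ρS a b * decoherence ω t a b) •
      Matrix.kronecker (ketBra ω.1 a b)
        (tensorPower fun k : ObsLabel M Nmac => branch ω t a b (Sum.inr k)) +
      ∑ a, (p a : ℂ) • Matrix.kronecker (pointer ω.1 a)
        (macroTensor (macroState ω t a) - macroTensor fun m => σ m a) := by
    rw [reducedState_eq, sbsState, ← Finset.sum_sub_distrib, ← Finset.sum_add_distrib]
    refine Finset.sum_congr rfl fun a _ => ?_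
    rw [← Finset.sum_add_sum_compl {a}, Finset.sum_singleton, hdec1, mul_one,
      (pointerEntry_self_eq ω.1 hρ a).2, tensorPower_obs, add_comm, add_sub_assoc, ← smul_sub]
    congr 2
    ext p q
    simp only [Matrix.sub_apply, Matrix.kronecker, Matrix.kroneckerMap_apply, mul_sub]
    rfl
  have hnorm : ∀ a m, traceNorm (macroState ω t a m) ≤ 1 := fun a m =>
    (traceNorm_tensorPower_le _).trans
      (Finset.prod_le_one (fun _ _ => traceNorm_nonneg _) fun k _ => traceNorm_branch_le hω t a a _)
  have b1 : traceNorm (∑ a, ∑ b ∈ {a}ᶜ, (pointerEntry ω.1 ρS a b * decoherence ω t a b) •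
      Matrix.kronecker (ketBra ω.1 a b)
        (tensorPower fun k : ObsLabel M Nmac => branch ω t a b (Sum.inr k))) ≤
      ∑ a, ∑ b ∈ {a}ᶜ, ∏ k : Fin Nuno,
      siteDecoherence (t * (ω.1.1 a - ω.1.1 b)) (ω.2.1 (Sum.inl k)) (ω.2.2 (Sum.inl k)) := by
    refine (traceNorm_sum_le _ _).trans (Finset.sum_le_sum fun a _ => ?_)
    refine (traceNorm_sum_le _ _).trans (Finset.sum_le_sum fun b _ => ?_)
    refine (traceNorm_smul_le _ _).trans ?_
    rw [norm_mul, norm_decoherence]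
    have hP := Finset.prod_nonneg fun (k : Fin Nuno) (_ : k ∈ Finset.univ) =>
      siteDecoherence_nonneg (t * (ω.1.1 a - ω.1.1 b)) (ω.2.1 (Sum.inl k)) (ω.2.2 (Sum.inl k))
    have hk : traceNorm (Matrix.kronecker (ketBra ω.1 a b)
        (tensorPower fun k : ObsLabel M Nmac => branch ω t a b (Sum.inr k))) ≤ 1 := by
      refine (traceNorm_kronecker_le _ _).trans
        (mul_le_one₀ (traceNorm_ketBra_le _ _ _) (traceNorm_nonneg _) ?_)
      exact (traceNorm_tensorPower_le _).trans
        (Finset.prod_le_one (fun _ _ => traceNorm_nonneg _)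
          fun k _ => traceNorm_branch_le hω t a b _)
    refine (mul_le_of_le_one_right (mul_nonneg (norm_nonneg _) hP) hk).trans ?_
    exact mul_le_of_le_one_left hP (norm_pointerEntry_le ω.1 hρ a b)
  set Q : ℝ := ∑ m, (2 * √(∑ a, ∑ b ∈ {a}ᶜ, ∏ k, siteOverlap (t * (ω.1.1 b - ω.1.1 a))
        (ω.2.1 (Sum.inr (m, k))) (ω.2.2 (Sum.inr (m, k)))) +
      2 * (√dS * ∏ k, siteFlatness (ω.2.2 (Sum.inr (m, k))).1)) with hQ
  have b2 : traceNorm (∑ a, (p a : ℂ) • Matrix.kronecker (pointer ω.1 a)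
        (macroTensor (macroState ω t a) - macroTensor fun m => σ m a)) ≤ Q := by
    refine (traceNorm_sum_le _ _).trans ?_
    calc _ ≤ ∑ a, p a * Q := by
          refine Finset.sum_le_sum fun a _ => ?_
          refine (traceNorm_smul_le _ _).trans ?_
          rw [Complex.norm_real, Real.norm_eq_abs, abs_of_nonneg (hp a)]
          refine mul_le_mul_of_nonneg_left ?_ (hp a)
          refine (traceNorm_kronecker_le _ _).trans ?_
          refine (mul_le_of_le_one_left (traceNorm_nonneg _) (traceNorm_ketBra_le ω.1 a a)).trans ?_
          refine (traceNorm_macroTensor_sub_le (hnorm a)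
            fun m => (h1 m a).traceNorm_le_one).trans ?_
          exact Finset.sum_le_sum fun m _ => h3 m a
      _ = Q := by rw [← Finset.sum_mul, hp1, one_mul]
  rw [e1]
  have b3 := traceNorm_add_le (∑ a, ∑ b ∈ {a}ᶜ, (pointerEntry ω.1 ρS a b * decoherence ω t a b) •
      Matrix.kronecker (ketBra ω.1 a b)
        (tensorPower fun k : ObsLabel M Nmac => branch ω t a b (Sum.inr k)))
      (∑ a, (p a : ℂ) • Matrix.kronecker (pointer ω.1 a)
        (macroTensor (macroState ω t a) - macroTensor fun m => σ m a))
  have hQ2 : Q = 2 * ∑ m, (√(∑ a, ∑ b ∈ {a}ᶜ, ∏ k, siteOverlap (t * (ω.1.1 b - ω.1.1 a))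
        (ω.2.1 (Sum.inr (m, k))) (ω.2.2 (Sum.inr (m, k)))) +
      √dS * ∏ k, siteFlatness (ω.2.2 (Sum.inr (m, k))).1) := by
    rw [hQ, Finset.mul_sum]
    exact Finset.sum_congr rfl fun m _ => by ring
  unfold sbsBound
  linarith

end Bound

open scoped ENNReal

/-! ### Polar coordinates on the positive orthant: trace and normalised spectrum. -/

section Polar

variable {n : ℕ}

/-- The closed positive orthant. -/
def orthant (d : ℕ) : Set (Fin d → ℝ) := {x | ∀ i, 0 ≤ x i}

lemma measurableSet_orthant (d : ℕ) : MeasurableSet (orthant d) := by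
  unfold orthant
  rw [Set.ofPred_forall]
  exact MeasurableSet.iInter fun i => measurableSet_le measurable_const (measurable_pi_apply i)

lemma measurableSet_subsimplex :
    MeasurableSet {y : Fin n → ℝ | (∀ i, 0 ≤ y i) ∧ ∑ i, y i ≤ 1} := by
  refine (measurableSet_orthant n).inter ?_
  exact measurableSet_le (f := fun y : Fin n → ℝ => ∑ i, y i) (by fun_prop) measurable_const

lemma measurable_simplexChart :
    Measurable (fun y : Fin n → ℝ => (Fin.cons (1 - ∑ i, y i) y : Fin (n + 1) → ℝ)) := by
  rw [measurable_pi_iff]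
  intro i
  refine Fin.cases ?_ (fun j => ?_) i
  · simp only [Fin.cons_zero]; fun_prop
  · simp only [Fin.cons_succ]; fun_prop

lemma lintegral_simplexMeasure {F : (Fin (n + 1) → ℝ) → ℝ≥0∞} (hF : Measurable F) :
    ∫⁻ x, F x ∂(simplexMeasure (n + 1)) =
      ∫⁻ y in {y : Fin n → ℝ | (∀ i, 0 ≤ y i) ∧ ∑ i, y i ≤ 1},
        F (Fin.cons (1 - ∑ i, y i) y : Fin (n + 1) → ℝ) := by
  rw [simplexMeasure, lintegral_map hF measurable_simplexChart]

lemma ae_simplexMeasure_isSpectrum : ∀ᵐ x ∂(simplexMeasure (n + 1)), IsSpectrum x := by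
  have hms : MeasurableSet {x : Fin (n + 1) → ℝ | IsSpectrum x} := by
    refine (measurableSet_orthant (n + 1)).inter ?_
    exact measurableSet_eq_fun (by fun_prop) measurable_const
  rw [simplexMeasure, ae_map_iff measurable_simplexChart.aemeasurable hms]
  filter_upwards [ae_restrict_mem measurableSet_subsimplex] with y hy
  refine ⟨fun i => ?_, ?_⟩
  · refine Fin.cases ?_ (fun j => ?_) i
    · simp only [Fin.cons_zero]; linarith [hy.2]
    · simp only [Fin.cons_succ]; exact hy.1 j
  · rw [Fin.sum_univ_succ]; simp

lemma lintegral_comp_smul_pi {g : (Fin n → ℝ) → ℝ≥0∞} {s : ℝ} (hs : 0 < s) :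
    ∫⁻ y, g y = ENNReal.ofReal (s ^ n) * ∫⁻ z, g (s • z) := by
  have h := Measure.map_addHaar_smul (volume : Measure (Fin n → ℝ)) hs.ne'
  have h2 : ∫⁻ z, g (s • z) = ∫⁻ y, g y ∂(Measure.map (s • ·) (volume : Measure (Fin n → ℝ))) :=
    (lintegral_map_equiv g (MeasurableEquiv.smul₀ s hs.ne')).symm
  rw [h2, h, lintegral_smul_measure, smul_eq_mul, ← mul_assoc, ← ENNReal.ofReal_mul (by positivity)]
  simp only [Module.finrank_fintype_fun_eq_card, Fintype.card_fin]
  rw [abs_of_pos (by positivity), mul_inv_cancel₀ (by positivity), ENNReal.ofReal_one, one_mul]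

/-- Integration over the positive orthant in terms of the sum of the coordinates and the normalised
coordinates. -/
theorem lintegral_orthant_eq {F : (Fin (n + 1) → ℝ) → ℝ≥0∞} (hF : Measurable F) :
    ∫⁻ x in orthant (n + 1), F x =
      ∫⁻ s in Set.Ioi (0 : ℝ), ENNReal.ofReal (s ^ n) *
        ∫⁻ x, F (s • x) ∂(simplexMeasure (n + 1)) := by
  set G : (Fin (n + 1) → ℝ) → ℝ≥0∞ := (orthant (n + 1)).indicator F with hG
  have hGm : Measurable G := hF.indicator (measurableSet_orthant _)
  have e1 : ∫⁻ x in orthant (n + 1), F x = ∫⁻ x, G x :=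
    (lintegral_indicator (measurableSet_orthant _) _).symm
  have hmp := (volume_preserving_piFinSuccAbove (fun _ : Fin (n + 1) => ℝ) 0).symm
  have e2 : ∫⁻ x, G x = ∫⁻ p : ℝ × (Fin n → ℝ), G (Fin.cons p.1 p.2 : Fin (n + 1) → ℝ) := by
    rw [← hmp.lintegral_comp hGm]
    refine lintegral_congr fun p => ?_
    congr 1
    simp [MeasurableEquiv.piFinSuccAbove, Fin.insertNthEquiv]
  have hcons : Measurable fun p : ℝ × (Fin n → ℝ) =>
      (Fin.cons p.1 p.2 : Fin (n + 1) → ℝ) := by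
    rw [measurable_pi_iff]
    intro i
    refine Fin.cases ?_ (fun j => ?_) i
    · simp only [Fin.cons_zero]; fun_prop
    · simp only [Fin.cons_succ]; fun_prop
  -- For fixed remaining coordinates, a translation makes the total sum s the integration variable
  -- in place of the first coordinate.
  have e3 : ∫⁻ p : ℝ × (Fin n → ℝ), G (Fin.cons p.1 p.2 : Fin (n + 1) → ℝ) =
      ∫⁻ y : Fin n → ℝ, ∫⁻ s : ℝ, G (Fin.cons (s - ∑ i, y i) y : Fin (n + 1) → ℝ) := by
    rw [Measure.volume_eq_prod, lintegral_prod_symm (fun p : ℝ × (Fin n → ℝ) =>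
      G (Fin.cons p.1 p.2 : Fin (n + 1) → ℝ)) (hGm.comp hcons).aemeasurable]
    refine lintegral_congr fun y => ?_
    exact (lintegral_sub_right_eq_self (fun s => G (Fin.cons s y : Fin (n + 1) → ℝ))
      (∑ i, y i)).symm
  have hcons2 : Measurable fun p : (Fin n → ℝ) × ℝ =>
      (Fin.cons (p.2 - ∑ i, p.1 i) p.1 : Fin (n + 1) → ℝ) :=
    hcons.comp (by fun_prop : Measurable fun p : (Fin n → ℝ) × ℝ => (p.2 - ∑ i, p.1 i, p.1))
  rw [e1, e2, e3, lintegral_lintegral_swap (f := fun (y : Fin n → ℝ) (s : ℝ) =>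
    G (Fin.cons (s - ∑ i, y i) y : Fin (n + 1) → ℝ)) (hGm.comp hcons2).aemeasurable]
  rw [← lintegral_indicator measurableSet_Ioi]
  have hae : ∀ᵐ s : ℝ, s ≠ 0 := by simp [ae_iff]
  refine lintegral_congr_ae ?_
  filter_upwards [hae] with s hs0
  rcases lt_or_gt_of_ne hs0 with hs | hs
  · rw [Set.indicator_of_notMem (by simpa using hs.le)]
    have : ∀ y : Fin n → ℝ, G (Fin.cons (s - ∑ i, y i) y : Fin (n + 1) → ℝ) = 0 := by
      intro y
      refine Set.indicator_of_notMem (fun hy => ?_) _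
      have h0 := hy 0
      have h1 : 0 ≤ ∑ i, y i := Finset.sum_nonneg fun i _ => by simpa using hy i.succ
      simp only [Fin.cons_zero] at h0
      linarith
    simp [this]
  -- The dilation y = s z supplies the Jacobian s^n and turns the orthant constraint into the domain
  -- of the simplex chart.
  · rw [Set.indicator_of_mem (by simpa using hs), lintegral_simplexMeasure (F := fun x => F (s • x)) (by fun_prop),
      lintegral_comp_smul_pi hs, ← lintegral_indicator measurableSet_subsimplex]
    congr 1
    refine lintegral_congr fun z => ?_
    have hsm : (Fin.cons (s - ∑ i, (s • z) i) (s • z) : Fin (n + 1) → ℝ) =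
        s • (Fin.cons (1 - ∑ i, z i) z : Fin (n + 1) → ℝ) := by
      ext i
      refine Fin.cases ?_ (fun j => ?_) i
      · simp [← Finset.mul_sum]; ring
      · simp
    rw [hsm]
    by_cases hz : z ∈ {y : Fin n → ℝ | (∀ i, 0 ≤ y i) ∧ ∑ i, y i ≤ 1}
    · rw [Set.indicator_of_mem hz]
      refine Set.indicator_of_mem (fun i => ?_) _
      refine mul_nonneg hs.le ?_
      refine Fin.cases ?_ (fun j => ?_) i
      · simp only [Fin.cons_zero]; linarith [hz.2]
      · simp only [Fin.cons_succ]; exact hz.1 j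
    · rw [Set.indicator_of_notMem hz]
      refine Set.indicator_of_notMem (fun h => hz ⟨fun i => ?_, ?_⟩) _
      · have := h i.succ
        simp only [Pi.smul_apply, Fin.cons_succ, smul_eq_mul] at this
        exact nonneg_of_mul_nonneg_right this hs
      · have := h 0
        simp only [Pi.smul_apply, Fin.cons_zero, smul_eq_mul] at this
        linarith [nonneg_of_mul_nonneg_right this hs]

/-- Integration of a homogeneous function times a function of the sum of the coordinates. -/
theorem lintegral_orthant_homogeneous {F : (Fin (n + 1) → ℝ) → ℝ≥0∞} (hF : Measurable F) {h : ℝ}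
    (hom : ∀ s : ℝ, 0 < s → ∀ x, F (s • x) = ENNReal.ofReal (s ^ h) * F x)
    {χ : ℝ → ℝ≥0∞} (hχ : Measurable χ) :
    ∫⁻ x in orthant (n + 1), F x * χ (∑ i, x i) =
      (∫⁻ x, F x ∂(simplexMeasure (n + 1))) *
        ∫⁻ s in Set.Ioi (0 : ℝ), ENNReal.ofReal (s ^ (h + n)) * χ s := by
  rw [lintegral_orthant_eq (by fun_prop), ← lintegral_const_mul _ (by fun_prop)]
  refine setLIntegral_congr_fun measurableSet_Ioi fun s hs => ?_
  have hs' : 0 < s := hs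
  have e1 : ∫⁻ x, F (s • x) * χ (∑ i, (s • x) i) ∂(simplexMeasure (n + 1)) =
      ∫⁻ x, (ENNReal.ofReal (s ^ h) * χ s) * F x ∂(simplexMeasure (n + 1)) := by
    refine lintegral_congr_ae ?_
    filter_upwards [ae_simplexMeasure_isSpectrum] with x hx
    have : ∑ i, (s • x) i = s := by
      simp only [Pi.smul_apply, smul_eq_mul, ← Finset.mul_sum, hx.2, mul_one]
    rw [this, hom s hs' x]
    ring
  rw [e1, lintegral_const_mul _ hF, Real.rpow_add hs', Real.rpow_natCast,
    ENNReal.ofReal_mul (by positivity)]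
  ring

end Polar

/-! ### The two eigenvalue densities in a common form. -/

section Weights

/-- The exponent of the additional factors of the Bures density. -/
def StateEnsemble.expo : StateEnsemble → ℕ
  | .hilbertSchmidt => 0
  | .bures => 1

lemma StateEnsemble.expo_le_one (e : StateEnsemble) : e.expo ≤ 1 := by cases e <;> simp [expo]

/-- The ordered pairs of distinct indices. -/
def pairs (d : ℕ) : Finset (Fin d × Fin d) := Finset.univ.filter fun p => p.1 < p.2

lemma mem_pairs {d : ℕ} {p : Fin d × Fin d} : p ∈ pairs d ↔ p.1 < p.2 := by simp [pairs]

lemma prod_prod_Ioi {d : ℕ} {R : Type*} [CommMonoid R] (f : Fin d → Fin d → R) :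
    ∏ i, ∏ j ∈ Finset.Ioi i, f i j = ∏ p ∈ pairs d, f p.1 p.2 := by
  rw [pairs, Finset.prod_filter, Fintype.prod_prod_type]
  refine Finset.prod_congr rfl fun i _ => ?_
  rw [← Finset.prod_filter]
  refine Finset.prod_congr ?_ fun _ _ => rfl
  ext j; simp

lemma card_pairs (d : ℕ) : ((pairs d).card : ℝ) = d * (d - 1) / 2 := by
  have h1 : (pairs d).card = ∑ i : Fin d, i.1 := by
    have : (pairs d).card = ∑ p : Fin d × Fin d, if p.1 < p.2 then 1 else 0 := by
      rw [pairs, Finset.card_filter]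
    rw [this, Fintype.sum_prod_type, Finset.sum_comm]
    refine Finset.sum_congr rfl fun i _ => ?_
    rw [← Finset.card_filter]
    have : (Finset.univ.filter fun j : Fin d => j < i) = Finset.Iio i := by ext; simp
    rw [this, Fin.card_Iio]
  rw [h1, Fin.sum_univ_eq_sum_range (fun i => i), Finset.sum_range_id]
  have := Nat.div_mul_cancel (Nat.even_mul_pred_self d).two_dvd
  have h2 : ((d * (d - 1) / 2 : ℕ) : ℝ) * 2 = d * (d - 1 : ℕ) := by exact_mod_cast this
  rcases Nat.eq_zero_or_pos d with rfl | hd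
  · simp
  · rw [Nat.cast_sub hd] at h2
    push_cast at h2 ⊢
    linarith

/-- The single-eigenvalue factor of the density. -/
def wgt1 (σ : ℕ) (s : ℝ) : ℝ := (√s)⁻¹ ^ σ

/-- The pair factor of the density. -/
def wgt2 (σ : ℕ) (s t : ℝ) : ℝ := (s - t) ^ 2 / (s + t) ^ σ

/-- One formula with an exponent σ equal to 0 (Hilbert-Schmidt) or 1 (Bures) covers both ensembles,
so the loop equations are derived only once, for σ ≤ 1. -/
lemma StateEnsemble.density_eq {d : ℕ} (e : StateEnsemble) (x : Fin d → ℝ) :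
    e.density x = (∏ i, wgt1 e.expo (x i)) * ∏ p ∈ pairs d, wgt2 e.expo (x p.1) (x p.2) := by
  cases e
  · simp [density, expo, wgt1, wgt2, prod_prod_Ioi]
  · simp [density, expo, wgt1, wgt2, prod_prod_Ioi]

lemma wgt1_nonneg (σ : ℕ) (s : ℝ) : 0 ≤ wgt1 σ s := by unfold wgt1; positivity

lemma wgt2_nonneg {σ : ℕ} {s t : ℝ} (hs : 0 ≤ s) (ht : 0 ≤ t) : 0 ≤ wgt2 σ s t := by
  unfold wgt2; positivity

/-- For non-negative arguments (s - t)² ≤ (s + t)², and s + t ≤ 1 absorbs the surplus power. Hence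
inside the unit simplex only the factors x_i^{-1/2} can be large, and these are integrable. -/
lemma wgt2_le_one {σ : ℕ} (hσ : σ ≤ 1) {s t : ℝ} (hs : 0 ≤ s) (ht : 0 ≤ t) (hst : s + t ≤ 1) :
    wgt2 σ s t ≤ 1 := by
  unfold wgt2
  have h0 : (s - t) ^ 2 ≤ (s + t) ^ 2 := by nlinarith
  interval_cases σ
  · rw [pow_zero, div_one]; nlinarith
  · rw [pow_one]
    refine div_le_one_of_le₀ ?_ (by positivity)
    nlinarith

lemma StateEnsemble.measurable_density {d : ℕ} (e : StateEnsemble) :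
    Measurable (e.density : (Fin d → ℝ) → ℝ) := by
  have : (e.density : (Fin d → ℝ) → ℝ) = fun x =>
      (∏ i, wgt1 e.expo (x i)) * ∏ p ∈ pairs d, wgt2 e.expo (x p.1) (x p.2) :=
    funext e.density_eq
  rw [this]
  unfold wgt1 wgt2
  fun_prop

lemma StateEnsemble.density_nonneg {d : ℕ} (e : StateEnsemble) {x : Fin d → ℝ}
    (hx : x ∈ orthant d) : 0 ≤ e.density x := by
  rw [density_eq]
  exact mul_nonneg (Finset.prod_nonneg fun _ _ => wgt1_nonneg _ _)
    (Finset.prod_nonneg fun p _ => wgt2_nonneg (hx _) (hx _))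

/-- The degree of homogeneity of the density. -/
def StateEnsemble.deg (e : StateEnsemble) (d : ℕ) : ℝ :=
  -(e.expo * d / 2) + (2 - e.expo) * (d * (d - 1) / 2)

lemma StateEnsemble.density_smul {d : ℕ} (e : StateEnsemble) {s : ℝ} (hs : 0 < s)
    (x : Fin d → ℝ) : e.density (s • x) = s ^ e.deg d * e.density x := by
  have h1 : ∀ u : ℝ, wgt1 e.expo (s * u) = s ^ (-(e.expo / 2) : ℝ) * wgt1 e.expo u := by
    intro u
    unfold wgt1
    rw [Real.sqrt_mul hs.le, mul_inv, mul_pow]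
    congr 1
    rw [Real.sqrt_eq_rpow, ← Real.rpow_neg hs.le, ← Real.rpow_natCast, ← Real.rpow_mul hs.le]
    congr 1; ring
  have h2 : ∀ u v : ℝ, wgt2 e.expo (s * u) (s * v) = s ^ (2 - e.expo : ℝ) * wgt2 e.expo u v := by
    intro u v
    unfold wgt2
    rw [← mul_sub, ← mul_add, mul_pow, mul_pow, mul_div_mul_comm]
    congr 1
    rw [Real.rpow_sub hs, Real.rpow_natCast]
    norm_cast
  simp only [density_eq, Pi.smul_apply, smul_eq_mul, h1, h2, Finset.prod_mul_distrib,
    Finset.prod_const, Finset.card_univ, Fintype.card_fin]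
  rw [deg, Real.rpow_add hs, ← Real.rpow_natCast, ← Real.rpow_natCast, ← Real.rpow_mul hs.le,
    ← Real.rpow_mul hs.le, card_pairs]
  have : -((e.expo : ℝ) / 2) * d = -(e.expo * d / 2) := by ring
  rw [this]
  ring

lemma StateEnsemble.deg_add (e : StateEnsemble) (d : ℕ) :
    e.deg d + d = d ^ 2 * (2 - e.expo) / 2 := by unfold deg; ring

/-- A dominating integrable function for everything of interest. -/
def dominator {d : ℕ} (x : Fin d → ℝ) : ℝ :=
  ∏ i, (Set.Ioc (0 : ℝ) 1).indicator (fun s => s ^ (-(1 / 2) : ℝ)) (x i)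

lemma integrable_dominator (d : ℕ) : Integrable (dominator : (Fin d → ℝ) → ℝ) := by
  refine Integrable.fintype_prod (f := fun _ : Fin d =>
    (Set.Ioc (0 : ℝ) 1).indicator fun s => s ^ (-(1 / 2) : ℝ)) fun i => ?_
  rw [integrable_indicator_iff measurableSet_Ioc, ← intervalIntegrable_iff_integrableOn_Ioc_of_le
    zero_le_one]
  exact intervalIntegral.intervalIntegrable_rpow' (by norm_num)

lemma prod_wgt1_le_dominator {σ : ℕ} (hσ : σ ≤ 1) {d : ℕ} {x : Fin d → ℝ} (hx : ∀ i, 0 < x i)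
    (hx1 : ∑ i, x i ≤ 1) : ∏ i, wgt1 σ (x i) ≤ dominator x := by
  refine Finset.prod_le_prod (fun i _ => wgt1_nonneg _ _) fun i _ => ?_
  have h1 : x i ≤ 1 := le_trans
    (Finset.single_le_sum (f := x) (fun j _ => (hx j).le) (Finset.mem_univ i)) hx1
  have hmem : x i ∈ Set.Ioc (0 : ℝ) 1 := ⟨hx i, h1⟩
  rw [Set.indicator_of_mem hmem, Real.rpow_neg (hx i).le,
    ← Real.sqrt_eq_rpow]
  unfold wgt1
  interval_cases σ
  · rw [pow_zero]
    exact (one_le_inv₀ (Real.sqrt_pos.mpr (hx i))).mpr (Real.sqrt_le_one.mpr h1)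
  · rw [pow_one]

lemma dominator_nonneg {d : ℕ} (x : Fin d → ℝ) : 0 ≤ dominator x :=
  Finset.prod_nonneg fun _ _ => Set.indicator_nonneg (fun _ hs => Real.rpow_nonneg hs.1.le _) _

lemma add_le_sum_of_ne {d : ℕ} {x : Fin d → ℝ} (hx : ∀ i, 0 ≤ x i) {i j : Fin d} (hij : i ≠ j) :
    x i + x j ≤ ∑ k, x k := by
  rw [← Finset.sum_pair hij]
  exact Finset.sum_le_univ_sum_of_nonneg hx

lemma StateEnsemble.density_le_dominator {d : ℕ} (e : StateEnsemble) {x : Fin d → ℝ}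
    (hx : ∀ i, 0 < x i) (hx1 : ∑ i, x i ≤ 1) : e.density x ≤ dominator x := by
  rw [density_eq]
  refine (mul_le_of_le_one_right (Finset.prod_nonneg fun _ _ => wgt1_nonneg _ _) ?_).trans
    (prod_wgt1_le_dominator e.expo_le_one hx hx1)
  refine Finset.prod_le_one (fun p _ => wgt2_nonneg (hx _).le (hx _).le) fun p hp => ?_
  exact wgt2_le_one e.expo_le_one (hx _).le (hx _).le
    ((add_le_sum_of_ne (fun i => (hx i).le) (mem_pairs.mp hp).ne).trans hx1)

lemma ae_ne_zero (d : ℕ) : ∀ᵐ x : Fin d → ℝ, ∀ i, x i ≠ 0 := by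
  rw [ae_all_iff]
  intro i
  have : {x : Fin d → ℝ | ¬ x i ≠ 0} = (LinearMap.ker (LinearMap.proj (R := ℝ) i)
      : Submodule ℝ (Fin d → ℝ)) := by
    ext x; simp
  rw [ae_iff, this]
  refine Measure.addHaar_submodule _ _ fun h => ?_
  have : Pi.single i (1 : ℝ) ∈ LinearMap.ker (LinearMap.proj (R := ℝ) (φ := fun _ : Fin d => ℝ) i) :=
    by rw [h]; trivial
  simp at this

lemma ae_ne {d : ℕ} {i j : Fin d} (hij : i ≠ j) : ∀ᵐ x : Fin d → ℝ, x i ≠ x j := by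
  have : {x : Fin d → ℝ | ¬ x i ≠ x j} = (LinearMap.ker
      (LinearMap.proj (R := ℝ) (φ := fun _ : Fin d => ℝ) i - LinearMap.proj j)
      : Submodule ℝ (Fin d → ℝ)) := by
    ext x; simp [sub_eq_zero]
  rw [ae_iff, this]
  refine Measure.addHaar_submodule _ _ fun h => ?_
  have : Pi.single i (1 : ℝ) ∈ LinearMap.ker
      (LinearMap.proj (R := ℝ) (φ := fun _ : Fin d => ℝ) i - LinearMap.proj j) := by rw [h]; trivial
  simp [hij.symm] at this

end Weights

/-! ### Directional derivatives of the weights and of the cutoff. -/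

section LogDerivative

/-- Each derivative is presented as value times logarithmic derivative, without asking the value to
be non-zero; the product rule then remains valid where a factor vanishes, as at coinciding
eigenvalues. -/
lemma hasDerivAt_prod_of_logDeriv {α : Type*} (u : Finset α) {f : α → ℝ → ℝ} {L : α → ℝ} {x : ℝ}
    (h : ∀ i ∈ u, HasDerivAt (f i) (f i x * L i) x) :
    HasDerivAt (fun y => ∏ i ∈ u, f i y) ((∏ i ∈ u, f i x) * ∑ i ∈ u, L i) x := by
  classical
  induction u using Finset.induction_on with
  | empty => simpa using hasDerivAt_const x (1 : ℝ)
  | insert a s ha ih =>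
    have h1 := h a (Finset.mem_insert_self a s)
    have h2 := ih fun i hi => h i (Finset.mem_insert_of_mem hi)
    simp only [Finset.prod_insert ha, Finset.sum_insert ha]
    refine (h1.mul h2).congr_deriv ?_
    ring

lemma hasDerivAt_wgt1 {σ : ℕ} (hσ : σ ≤ 1) {x : ℝ} (hx : 0 < x) (c : ℝ) :
    HasDerivAt (fun s => wgt1 σ (x + s * c)) (wgt1 σ (x + 0 * c) * (-(σ * c / (2 * x)))) 0 := by
  have hl : HasDerivAt (fun s : ℝ => x + s * c) c 0 := by
    simpa using ((hasDerivAt_id (0 : ℝ)).mul_const c).const_add x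
  unfold wgt1
  interval_cases σ
  · simpa using hasDerivAt_const (0 : ℝ) (1 : ℝ)
  · have hx' : x + 0 * c ≠ 0 := by simpa using hx.ne'
    have h1 := (hl.sqrt hx').inv (by simpa [Real.sqrt_eq_zero hx.le] using hx.ne')
    simp only [pow_one]
    refine h1.congr_deriv ?_
    have hsq : √x ≠ 0 := (Real.sqrt_pos.mpr hx).ne'
    simp only [zero_mul, add_zero, Nat.cast_one, one_mul]
    rw [Real.sq_sqrt hx.le]
    field_simp

lemma hasDerivAt_wgt2 {σ : ℕ} (hσ : σ ≤ 1) {x y : ℝ} (hxy : 0 < x + y) (c c' : ℝ) :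
    HasDerivAt (fun s => wgt2 σ (x + s * c) (y + s * c')) (wgt2 σ (x + 0 * c) (y + 0 * c') *
      ((c - c') * (2 / (x - y)) - σ * ((c + c') / (x + y)))) 0 := by
  have hl : ∀ x c : ℝ, HasDerivAt (fun s : ℝ => x + s * c) c 0 := fun x c => by
    simpa using ((hasDerivAt_id (0 : ℝ)).mul_const c).const_add x
  have h1 := ((hl x c).sub (hl y c')).pow 2
  have h2 := (hl x c).add (hl y c')
  unfold wgt2
  have hne := hxy.ne'
  -- At coinciding arguments 2 / (x - y) is 0 by the convention for division by zero. Both sides of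
  -- the formula vanish there, since the pair factor has a double zero.
  by_cases hd : x - y = 0
  · have hxy' : x = y := sub_eq_zero.mp hd
    subst hxy'
    interval_cases σ
    · simp only [pow_zero, div_one]
      exact h1.congr_deriv (by simp)
    · simp only [pow_one]
      exact (h1.div h2 (by simpa using hne)).congr_deriv (by simp)
  · interval_cases σ
    · simp only [pow_zero, div_one]
      refine h1.congr_deriv ?_
      simp only [zero_mul, add_zero, Pi.sub_apply, Nat.cast_zero, sub_zero]
      field_simp
      norm_num
      ring
    · simp only [pow_one]
      refine (h1.div h2 (by simpa using hne)).congr_deriv ?_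
      simp only [zero_mul, add_zero, Pi.sub_apply, Pi.add_apply, Pi.pow_apply, Nat.cast_one,
        one_mul]
      field_simp
      norm_num
      ring

/-- A continuously differentiable cutoff. -/
def cutoff (s : ℝ) : ℝ := max (1 - s) 0 ^ 2

lemma cutoff_nonneg (s : ℝ) : 0 ≤ cutoff s := by unfold cutoff; positivity

lemma cutoff_of_one_le {s : ℝ} (hs : 1 ≤ s) : cutoff s = 0 := by
  simp [cutoff, max_eq_right (by linarith : 1 - s ≤ 0)]

lemma cutoff_le_one {s : ℝ} (hs : 0 ≤ s) : cutoff s ≤ 1 := by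
  unfold cutoff
  have h1 : max (1 - s) 0 ≤ 1 := max_le (by linarith) zero_le_one
  have h2 : 0 ≤ max (1 - s) 0 := le_max_right _ _
  nlinarith

lemma hasDerivAt_cutoff (s : ℝ) : HasDerivAt cutoff (-(2 * max (1 - s) 0)) s := by
  rcases lt_trichotomy s 1 with h | h | h
  · have h1 : HasDerivAt (fun u : ℝ => (1 - u) ^ 2) (-(2 * (1 - s))) s := by
      refine (((hasDerivAt_id s).const_sub 1).pow 2).congr_deriv ?_
      simp
    rw [max_eq_left (by linarith)]
    refine h1.congr_of_eventuallyEq ?_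
    filter_upwards [eventually_lt_nhds h] with u hu
    rw [cutoff, max_eq_left (by linarith)]
  · subst h
    simp only [sub_self, max_self, mul_zero, neg_zero]
    rw [hasDerivAt_iff_isLittleO]
    have : ∀ u : ℝ, ‖cutoff u - cutoff 1 - (u - 1) • (0 : ℝ)‖ ≤ ‖(u - 1) ^ 2‖ := by
      intro u
      rw [cutoff_of_one_le le_rfl, smul_zero, sub_zero, sub_zero, Real.norm_eq_abs,
        Real.norm_eq_abs, abs_of_nonneg (cutoff_nonneg u), abs_of_nonneg (by positivity)]
      unfold cutoff
      rcases le_total (1 - u) 0 with h | h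
      · rw [max_eq_right h]; nlinarith [sq_nonneg (u - 1)]
      · rw [max_eq_left h]; nlinarith
    refine (Asymptotics.IsBigO.of_bound' (Filter.Eventually.of_forall this)).trans_isLittleO ?_
    have := Asymptotics.isLittleO_pow_sub_sub (1 : ℝ) one_lt_two
    simpa using this
  · rw [max_eq_right (by linarith), mul_zero, neg_zero]
    refine (hasDerivAt_const s (0 : ℝ)).congr_of_eventuallyEq ?_
    filter_upwards [eventually_gt_nhds h] with u hu
    exact cutoff_of_one_le hu.le

end LogDerivative

/-! ### Loop equations: integration by parts against the joint eigenvalue density. -/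

section LoopEquation

variable {d : ℕ}

/-- The open positive orthant. -/
def openOrthant (d : ℕ) : Set (Fin d → ℝ) := {x | ∀ i, 0 < x i}

lemma measurableSet_openOrthant (d : ℕ) : MeasurableSet (openOrthant d) := by
  unfold openOrthant
  rw [Set.ofPred_forall]
  exact MeasurableSet.iInter fun i => measurableSet_lt measurable_const (measurable_pi_apply i)

/-- The Kronecker delta. -/
def delta (i j : Fin d) : ℝ := if i = j then 1 else 0

/-- The logarithmic derivative of the pair factor `p` in the direction of the coordinate `i`. -/
def pairLog (σ : ℕ) (i : Fin d) (p : Fin d × Fin d) (x : Fin d → ℝ) : ℝ :=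
  (delta i p.1 - delta i p.2) * (2 / (x p.1 - x p.2)) -
    σ * ((delta i p.1 + delta i p.2) / (x p.1 + x p.2))

/-- The joint density of the eigenvalues. -/
def wgt (σ : ℕ) (x : Fin d → ℝ) : ℝ :=
  (∏ i, wgt1 σ (x i)) * ∏ p ∈ pairs d, wgt2 σ (x p.1) (x p.2)

lemma measurable_wgt (σ : ℕ) : Measurable (wgt σ : (Fin d → ℝ) → ℝ) := by
  unfold wgt wgt1 wgt2; fun_prop

lemma wgt_nonneg (σ : ℕ) {x : Fin d → ℝ} (hx : x ∈ openOrthant d) : 0 ≤ wgt σ x :=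
  mul_nonneg (Finset.prod_nonneg fun _ _ => wgt1_nonneg _ _)
    (Finset.prod_nonneg fun _ _ => wgt2_nonneg (hx _).le (hx _).le)

lemma wgt_le_prod {σ : ℕ} (hσ : σ ≤ 1) {x : Fin d → ℝ} (hx : x ∈ openOrthant d)
    (hx1 : ∑ i, x i ≤ 1) : wgt σ x ≤ ∏ i, wgt1 σ (x i) := by
  refine mul_le_of_le_one_right (Finset.prod_nonneg fun _ _ => wgt1_nonneg _ _) ?_
  refine Finset.prod_le_one (fun p _ => wgt2_nonneg (hx _).le (hx _).le) fun p hp => ?_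
  exact wgt2_le_one hσ (hx _).le (hx _).le
    ((add_le_sum_of_ne (fun i => (hx i).le) (mem_pairs.mp hp).ne).trans hx1)

/-- The components of the vector field of the loop equation. -/
def loopField (σ k : ℕ) (i : Fin d) : (Fin d → ℝ) → ℝ :=
  (openOrthant d).indicator fun x => x i ^ (k + 1) * wgt σ x * cutoff (∑ j, x j)

/-- The derivative of `loopField` in the direction of the coordinate `i`. -/
def loopDeriv (σ k : ℕ) (i : Fin d) : (Fin d → ℝ) → ℝ :=
  (openOrthant d).indicator fun x =>
    (((k + 1 - σ / 2) * x i ^ k + x i ^ (k + 1) * ∑ p ∈ pairs d, pairLog σ i p x) * wgt σ x) *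
      cutoff (∑ j, x j) - x i ^ (k + 1) * wgt σ x * (2 * max (1 - ∑ j, x j) 0)

lemma line_apply (x : Fin d → ℝ) (s : ℝ) (i j : Fin d) :
    (x + s • (Pi.single i 1 : Fin d → ℝ)) j = x j + s * delta i j := by
  simp [Pi.single_apply, delta, eq_comm]

lemma sum_line (x : Fin d → ℝ) (s : ℝ) (i : Fin d) :
    ∑ j, (x + s • (Pi.single i 1 : Fin d → ℝ)) j = ∑ j, x j + s := by
  simp only [line_apply, Finset.sum_add_distrib, ← Finset.mul_sum]
  simp [delta]

lemma hasDerivAt_wgt_line {σ : ℕ} (hσ : σ ≤ 1) {x : Fin d → ℝ} (hx : x ∈ openOrthant d)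
    (i : Fin d) :
    HasDerivAt (fun s : ℝ => wgt σ (x + s • (Pi.single i 1 : Fin d → ℝ)))
      (wgt σ x * (-(σ / (2 * x i)) + ∑ p ∈ pairs d, pairLog σ i p x)) 0 := by
  unfold wgt
  simp only [line_apply]
  have h1 := hasDerivAt_prod_of_logDeriv Finset.univ
    (f := fun (j : Fin d) (s : ℝ) => wgt1 σ (x j + s * delta i j)) (x := 0)
    fun j _ => hasDerivAt_wgt1 hσ (hx j) (delta i j)
  have h2 := hasDerivAt_prod_of_logDeriv (pairs d)
    (f := fun p (s : ℝ) => wgt2 σ (x p.1 + s * delta i p.1) (x p.2 + s * delta i p.2)) (x := 0)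
    fun p _ => hasDerivAt_wgt2 hσ (add_pos (hx p.1) (hx p.2)) (delta i p.1) (delta i p.2)
  refine (h1.mul h2).congr_deriv ?_
  simp only [zero_mul, add_zero]
  have h3 : ∑ j, -(σ * delta i j / (2 * x j)) = -(σ / (2 * x i)) := by
    rw [Finset.sum_eq_single i]
    · simp [delta]
    · intro j _ hj; simp [delta, hj.symm]
    · simp
  rw [h3]
  simp only [pairLog]
  ring

/-- The integration by parts used below requires the derivative at every point, the boundary of the
orthant included. On the face x_i = 0 the factor x_i^{k+1} beats the Bures singularity x_i^{-1/2},
since k ≥ 1; elsewhere outside the orthant the field vanishes near the point along the line. -/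
theorem hasLineDerivAt_loopField {σ : ℕ} (hσ : σ ≤ 1) {k : ℕ} (hk : 1 ≤ k) (i : Fin d)
    (x : Fin d → ℝ) :
    HasLineDerivAt ℝ (loopField σ k i) (loopDeriv σ k i x) x (Pi.single i 1) := by
  unfold HasLineDerivAt
  -- If another coordinate is not positive, the whole line in direction i misses the open orthant.
  by_cases hA : ∃ j, j ≠ i ∧ x j ≤ 0
  · obtain ⟨j, hji, hj⟩ := hA
    have h0 : ∀ s : ℝ, loopField σ k i (x + s • (Pi.single i 1 : Fin d → ℝ)) = 0 := by
      intro s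
      refine Set.indicator_of_notMem (fun h => ?_) _
      have := h j
      rw [line_apply, delta, if_neg hji.symm, mul_zero, add_zero] at this
      linarith
    have h1 : loopDeriv σ k i x = 0 :=
      Set.indicator_of_notMem (fun h : x ∈ openOrthant d => absurd (h j) (not_lt.mpr hj)) _
    rw [h1]
    exact (hasDerivAt_const (0 : ℝ) (0 : ℝ)).congr_of_eventuallyEq
      (Filter.Eventually.of_forall h0)
  push Not at hA
  rcases lt_trichotomy (x i) 0 with hi | hi | hi
  · have h1 : loopDeriv σ k i x = 0 :=
      Set.indicator_of_notMem (fun h : x ∈ openOrthant d => absurd (h i) (not_lt.mpr hi.le)) _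
    rw [h1]
    refine (hasDerivAt_const (0 : ℝ) (0 : ℝ)).congr_of_eventuallyEq ?_
    filter_upwards [eventually_lt_nhds (neg_pos.mpr hi)] with s hs
    refine Set.indicator_of_notMem (fun h => ?_) _
    have := h i
    rw [line_apply, delta, if_pos rfl] at this
    linarith
  · have h1 : loopDeriv σ k i x = 0 :=
      Set.indicator_of_notMem (fun h : x ∈ openOrthant d => absurd (h i) (not_lt.mpr hi.le)) _
    rw [h1, hasDerivAt_iff_isLittleO]
    have h0 : loopField σ k i (x + (0 : ℝ) • (Pi.single i 1 : Fin d → ℝ)) = 0 := by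
      refine Set.indicator_of_notMem (fun h => ?_) _
      have := h i
      simp [hi] at this
    rw [h0]
    set K : ℝ := ∏ j ∈ Finset.univ.erase i, wgt1 σ (x j) with hK
    have hK0 : 0 ≤ K := Finset.prod_nonneg fun j _ => wgt1_nonneg _ _
    -- On the face the field is at most K s^{3/2}: one factor s comes from x_i^k and a factor √s
    -- from x_i times its weight. This is o(s), so the derivative is zero. `K` collects the weights
    -- of the other coordinates, which are fixed on the line.
    have hb : ∀ s : ℝ, ‖loopField σ k i (x + s • (Pi.single i 1 : Fin d → ℝ)) - 0 -
        (s - 0) • (0 : ℝ)‖ ≤ ‖(K * √|s|) * (s - 0)‖ := by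
      intro s
      rw [sub_zero, smul_zero, sub_zero, sub_zero]
      by_cases hP : x + s • (Pi.single i 1 : Fin d → ℝ) ∈ openOrthant d
      · have hs : 0 < s := by
          have := hP i
          rw [line_apply, delta, if_pos rfl, hi] at this
          linarith
        rw [loopField, Set.indicator_of_mem hP, sum_line]
        rcases le_or_gt 1 (∑ j, x j + s) with hle | hlt
        · rw [cutoff_of_one_le hle, mul_zero, norm_zero]; positivity
        · have hsum : ∑ j, (x + s • (Pi.single i 1 : Fin d → ℝ)) j ≤ 1 := by
            rw [sum_line]; exact hlt.le
          have hw := wgt_le_prod hσ hP hsum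
          have hw0 := wgt_nonneg σ hP
          have hxi : (x + s • (Pi.single i 1 : Fin d → ℝ)) i = s := by
            rw [line_apply, delta, if_pos rfl, hi]; ring
          have hs1 : s ≤ 1 := by
            have := Finset.single_le_sum (f := x + s • (Pi.single i 1 : Fin d → ℝ))
              (fun j _ => (hP j).le) (Finset.mem_univ i)
            rw [hxi] at this
            linarith
          have hprod : ∏ j, wgt1 σ ((x + s • (Pi.single i 1 : Fin d → ℝ)) j) = wgt1 σ s * K := by
            rw [← Finset.mul_prod_erase _ _ (Finset.mem_univ i), hxi]
            congr 1
            refine Finset.prod_congr rfl fun j hj => ?_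
            rw [line_apply, delta, if_neg (Finset.ne_of_mem_erase hj).symm, mul_zero, add_zero]
          have hsum0 : 0 ≤ ∑ j, x j + s := by
            rw [← sum_line x s i]
            exact Finset.sum_nonneg fun j _ => (hP j).le
          have hsq : s * wgt1 σ s ≤ √s := by
            have h5 : √s * √s = s := Real.mul_self_sqrt hs.le
            have h6 : 0 < √s := Real.sqrt_pos.mpr hs
            have h7 : √s ≤ 1 := Real.sqrt_le_one.mpr hs1
            unfold wgt1
            interval_cases σ
            · rw [pow_zero, mul_one]; nlinarith
            · rw [pow_one, ← div_eq_mul_inv, Real.div_sqrt]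
          rw [hxi, Real.norm_eq_abs, Real.norm_eq_abs, abs_of_nonneg (mul_nonneg (mul_nonneg
            (by positivity) hw0) (cutoff_nonneg _)), abs_of_pos hs, abs_of_nonneg (by positivity)]
          calc s ^ (k + 1) * wgt σ (x + s • (Pi.single i 1 : Fin d → ℝ)) * cutoff (∑ j, x j + s)
              ≤ s ^ (k + 1) * wgt σ (x + s • (Pi.single i 1 : Fin d → ℝ)) * 1 :=
                mul_le_mul_of_nonneg_left (cutoff_le_one hsum0) (mul_nonneg (by positivity) hw0)
            _ ≤ s ^ (k + 1) * (wgt1 σ s * K) := by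
                rw [mul_one, ← hprod]
                exact mul_le_mul_of_nonneg_left hw (by positivity)
            _ = s ^ k * (K * (s * wgt1 σ s)) := by ring
            _ ≤ s * (K * √s) := by
                refine mul_le_mul ?_ (mul_le_mul_of_nonneg_left hsq hK0)
                  (mul_nonneg hK0 (mul_nonneg hs.le (wgt1_nonneg _ _))) hs.le
                exact pow_le_of_le_one hs.le hs1 (by omega)
            _ = K * √s * s := by ring
      · rw [loopField, Set.indicator_of_notMem hP, norm_zero]; positivity
    refine (Asymptotics.IsBigO.of_bound' (Filter.Eventually.of_forall hb)).trans_isLittleO ?_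
    have ht : Filter.Tendsto (fun s : ℝ => K * √|s|) (nhds 0) (nhds 0) := by
      have : Continuous fun s : ℝ => K * √|s| := by fun_prop
      simpa using this.tendsto 0
    have := ((Asymptotics.isLittleO_one_iff ℝ).mpr ht).mul_isBigO
      (Asymptotics.isBigO_refl (fun s : ℝ => s - 0) (nhds 0))
    simpa using this
  · have hx : x ∈ openOrthant d := by
      intro j
      by_cases hj : j = i
      · rw [hj]; exact hi
      · exact hA j hj
    have h1 : loopDeriv σ k i x = _ := Set.indicator_of_mem hx _
    rw [h1]
    have hpow : HasDerivAt (fun s : ℝ => (x i + s) ^ (k + 1)) ((k + 1) * x i ^ k) 0 := by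
      refine (((hasDerivAt_id (0 : ℝ)).const_add (x i)).pow (k + 1)).congr_deriv ?_
      simp
    have hcut : HasDerivAt (fun s : ℝ => cutoff (∑ j, x j + s))
        (-(2 * max (1 - ∑ j, x j) 0)) 0 := by
      have h5 := hasDerivAt_cutoff (∑ j, x j + 0)
      have h6 := (hasDerivAt_id (0 : ℝ)).const_add (∑ j, x j)
      refine (HasDerivAt.comp (0 : ℝ) h5 h6).congr_deriv ?_
      simp
    have hall := (hpow.mul (hasDerivAt_wgt_line hσ hx i)).mul hcut
    refine (hall.congr_of_eventuallyEq ?_).congr_deriv ?_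
    · filter_upwards [eventually_gt_nhds (neg_neg_of_pos hi)] with s hs
      have hP : x + s • (Pi.single i 1 : Fin d → ℝ) ∈ openOrthant d := by
        intro j
        rw [line_apply]
        by_cases hj : i = j
        · subst hj; rw [delta, if_pos rfl]; linarith
        · rw [delta, if_neg hj, mul_zero, add_zero]; exact hx j
      rw [loopField, Set.indicator_of_mem hP, sum_line]
      have hxi : (x + s • (Pi.single i 1 : Fin d → ℝ)) i = x i + s := by
        rw [line_apply, delta, if_pos rfl, mul_one]
      rw [hxi]
      rfl
    · simp only [zero_smul, add_zero, Pi.mul_apply]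
      field_simp
      ring

/-- The pole 1/(x - y) of the logarithmic derivative is cancelled by the double zero of the pair
factor. The pole 1/(x + y) is compensated by the power of x_i, because it occurs only when i belongs
to the pair, and then x_i ≤ x + y. -/
lemma sub_mul_pairLog_bound {σ : ℕ} (hσ : σ ≤ 1) {x : Fin d → ℝ} (hx : x ∈ openOrthant d)
    (hx1 : ∑ i, x i ≤ 1) {k : ℕ} (i : Fin d) {p : Fin d × Fin d} (hp : p ∈ pairs d) :
    |x i ^ (k + 1) * pairLog σ i p x * wgt2 σ (x p.1) (x p.2)| ≤ 4 := by
  have hne : p.1 ≠ p.2 := (mem_pairs.mp hp).ne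
  have ha := hx p.1
  have hb := hx p.2
  have hab : x p.1 + x p.2 ≤ 1 := (add_le_sum_of_ne (fun i => (hx i).le) hne).trans hx1
  have hi0 := hx i
  have hi1 : x i ≤ 1 := le_trans
    (Finset.single_le_sum (f := x) (fun j _ => (hx j).le) (Finset.mem_univ i)) hx1
  have hpow : x i ^ (k + 1) ≤ x i := by
    rw [pow_succ]; exact mul_le_of_le_one_left hi0.le (pow_le_one₀ hi0.le hi1)
  have hpow0 : 0 ≤ x i ^ (k + 1) := by positivity
  have hw0 := wgt2_nonneg (σ := σ) ha.le hb.le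
  have hw1 := wgt2_le_one hσ ha.le hb.le hab
  have hdel : |delta i p.1 - delta i p.2| ≤ 1 := by
    unfold delta
    split_ifs <;> norm_num
  have hq : |2 / (x p.1 - x p.2) * wgt2 σ (x p.1) (x p.2)| ≤ 2 := by
    unfold wgt2
    by_cases h0 : x p.1 - x p.2 = 0
    · simp [h0]
    · have hs : 0 < x p.1 + x p.2 := add_pos ha hb
      interval_cases σ
      · have : 2 / (x p.1 - x p.2) * ((x p.1 - x p.2) ^ 2 / (x p.1 + x p.2) ^ 0) =
            2 * (x p.1 - x p.2) := by field_simp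
        rw [this, abs_le]; constructor <;> linarith
      · have : 2 / (x p.1 - x p.2) * ((x p.1 - x p.2) ^ 2 / (x p.1 + x p.2) ^ 1) =
            2 * (x p.1 - x p.2) / (x p.1 + x p.2) := by field_simp
        rw [this, abs_le, le_div_iff₀ hs, div_le_iff₀ hs]; constructor <;> linarith
  have hr : |x i ^ (k + 1) * (σ * ((delta i p.1 + delta i p.2) / (x p.1 + x p.2)))| ≤ 1 := by
    have hs : 0 < x p.1 + x p.2 := add_pos ha hb
    have hσ' : (σ : ℝ) ≤ 1 := by exact_mod_cast hσ
    have h1 : x i * ((delta i p.1 + delta i p.2) / (x p.1 + x p.2)) ≤ 1 := by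
      rw [← mul_div_assoc, div_le_one hs]
      unfold delta
      split_ifs with h2 h3 h3
      · exact absurd (h2.symm.trans h3) hne
      · rw [h2]; linarith
      · rw [h3]; linarith
      · linarith
    have hdd : 0 ≤ (delta i p.1 + delta i p.2) / (x p.1 + x p.2) := by
      unfold delta
      split_ifs <;> positivity
    rw [abs_of_nonneg (by positivity)]
    calc x i ^ (k + 1) * (σ * ((delta i p.1 + delta i p.2) / (x p.1 + x p.2)))
        ≤ x i * (1 * ((delta i p.1 + delta i p.2) / (x p.1 + x p.2))) := by gcongr
      _ ≤ 1 := by rw [one_mul]; exact h1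
  have e : x i ^ (k + 1) * pairLog σ i p x * wgt2 σ (x p.1) (x p.2) =
      x i ^ (k + 1) * ((delta i p.1 - delta i p.2) *
        (2 / (x p.1 - x p.2) * wgt2 σ (x p.1) (x p.2))) -
      x i ^ (k + 1) * (σ * ((delta i p.1 + delta i p.2) / (x p.1 + x p.2))) *
        wgt2 σ (x p.1) (x p.2) := by unfold pairLog; ring
  rw [e]
  refine (abs_sub _ _).trans ?_
  have t1 : |x i ^ (k + 1) * ((delta i p.1 - delta i p.2) *
        (2 / (x p.1 - x p.2) * wgt2 σ (x p.1) (x p.2)))| ≤ 1 * (1 * 2) := by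
    rw [abs_mul, abs_mul, abs_of_nonneg hpow0]
    gcongr
    linarith
  have t2 : |x i ^ (k + 1) * (σ * ((delta i p.1 + delta i p.2) / (x p.1 + x p.2))) *
        wgt2 σ (x p.1) (x p.2)| ≤ 1 * 1 := by
    rw [abs_mul, abs_of_nonneg hw0]
    gcongr
  linarith

lemma abs_loopDeriv_le {σ : ℕ} (hσ : σ ≤ 1) {k : ℕ} (hk : 1 ≤ k) (i : Fin d) (x : Fin d → ℝ) :
    |loopDeriv σ k i x| ≤ (k + 1 + 4 * (pairs d).card + 2) * dominator x := by
  by_cases hx : x ∈ openOrthant d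
  swap
  · rw [loopDeriv, Set.indicator_of_notMem hx, abs_zero]
    exact mul_nonneg (by positivity) (dominator_nonneg x)
  rw [loopDeriv, Set.indicator_of_mem hx]
  rcases le_or_gt 1 (∑ j, x j) with hle | hlt
  · rw [cutoff_of_one_le hle, max_eq_right (by linarith)]
    simp only [mul_zero, sub_zero, abs_zero]
    exact mul_nonneg (by positivity) (dominator_nonneg x)
  set P1 : ℝ := ∏ i, wgt1 σ (x i) with hP1
  have hP10 : 0 ≤ P1 := Finset.prod_nonneg fun _ _ => wgt1_nonneg _ _
  have hdom : P1 ≤ dominator x := prod_wgt1_le_dominator hσ hx hlt.le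
  have hw := wgt_le_prod hσ hx hlt.le
  have hw0 := wgt_nonneg σ hx
  have hi0 := hx i
  have hi1 : x i ≤ 1 := le_trans
    (Finset.single_le_sum (f := x) (fun j _ => (hx j).le) (Finset.mem_univ i)) hlt.le
  have hS0 : 0 ≤ ∑ j, x j := Finset.sum_nonneg fun j _ => (hx j).le
  have hc0 := cutoff_nonneg (∑ j, x j)
  have hc1 := cutoff_le_one hS0
  have hσ' : (σ : ℝ) ≤ 1 := by exact_mod_cast hσ
  have t1 : |(k + 1 - σ / 2) * x i ^ k * wgt σ x| ≤ (k + 1) * P1 := by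
    rw [abs_mul, abs_mul, abs_of_nonneg hw0]
    have h1 : |((k : ℝ) + 1 - σ / 2)| ≤ k + 1 := by
      have : (0 : ℝ) ≤ σ := Nat.cast_nonneg _
      have : (0 : ℝ) ≤ k := Nat.cast_nonneg _
      rw [abs_le]; constructor <;> linarith
    have h2 : |x i ^ k| ≤ 1 := by rw [abs_of_nonneg (by positivity)]; exact pow_le_one₀ hi0.le hi1
    calc _ ≤ ((k : ℝ) + 1) * 1 * P1 := by gcongr
      _ = _ := by ring
  have t2 : |(x i ^ (k + 1) * ∑ p ∈ pairs d, pairLog σ i p x) * wgt σ x| ≤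
      4 * (pairs d).card * P1 := by
    -- Each logarithmic derivative is grouped with the pair factor of its own pair, which cancels
    -- its poles; the remaining pair factors are at most one.
    have e : (x i ^ (k + 1) * ∑ p ∈ pairs d, pairLog σ i p x) * wgt σ x = ∑ p ∈ pairs d,
        (x i ^ (k + 1) * pairLog σ i p x * wgt2 σ (x p.1) (x p.2)) *
        (P1 * ∏ q ∈ (pairs d).erase p, wgt2 σ (x q.1) (x q.2)) := by
      rw [Finset.mul_sum, Finset.sum_mul]
      refine Finset.sum_congr rfl fun p hp => ?_
      rw [wgt, ← Finset.mul_prod_erase _ _ hp]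
      ring
    rw [e]
    refine (Finset.abs_sum_le_sum_abs _ _).trans ?_
    calc _ ≤ ∑ p ∈ pairs d, 4 * (P1 * 1) := by
          refine Finset.sum_le_sum fun p hp => ?_
          rw [abs_mul]
          have h3 : 0 ≤ ∏ q ∈ (pairs d).erase p, wgt2 σ (x q.1) (x q.2) :=
            Finset.prod_nonneg fun q _ => wgt2_nonneg (hx _).le (hx _).le
          rw [abs_of_nonneg (mul_nonneg hP10 h3)]
          refine mul_le_mul (sub_mul_pairLog_bound hσ hx hlt.le i hp) ?_
            (mul_nonneg hP10 h3) (by norm_num)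
          refine mul_le_mul_of_nonneg_left ?_ hP10
          refine Finset.prod_le_one (fun q _ => wgt2_nonneg (hx _).le (hx _).le) fun q hq => ?_
          exact wgt2_le_one hσ (hx _).le (hx _).le ((add_le_sum_of_ne (fun i => (hx i).le)
            (mem_pairs.mp (Finset.mem_of_mem_erase hq)).ne).trans hlt.le)
      _ = _ := by rw [Finset.sum_const, nsmul_eq_mul]; ring
  have t3 : |x i ^ (k + 1) * wgt σ x * (2 * max (1 - ∑ j, x j) 0)| ≤ 2 * P1 := by
    have hm0 : 0 ≤ max (1 - ∑ j, x j) 0 := le_max_right _ _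
    have hm1 : max (1 - ∑ j, x j) 0 ≤ 1 := max_le (by linarith) zero_le_one
    rw [abs_of_nonneg (by positivity)]
    calc _ ≤ 1 * P1 * (2 * 1) := by
          gcongr
          exact pow_le_one₀ hi0.le hi1
      _ = _ := by ring
  have e2 : (((k + 1 - σ / 2) * x i ^ k + x i ^ (k + 1) * ∑ p ∈ pairs d, pairLog σ i p x) *
      wgt σ x) * cutoff (∑ j, x j) - x i ^ (k + 1) * wgt σ x * (2 * max (1 - ∑ j, x j) 0) =
      ((k + 1 - σ / 2) * x i ^ k * wgt σ x +
        (x i ^ (k + 1) * ∑ p ∈ pairs d, pairLog σ i p x) * wgt σ x) * cutoff (∑ j, x j) -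
      x i ^ (k + 1) * wgt σ x * (2 * max (1 - ∑ j, x j) 0) := by ring
  rw [e2]
  refine (abs_sub _ _).trans ?_
  have t4 : |((k + 1 - σ / 2) * x i ^ k * wgt σ x +
        (x i ^ (k + 1) * ∑ p ∈ pairs d, pairLog σ i p x) * wgt σ x) * cutoff (∑ j, x j)| ≤
      (k + 1) * P1 + 4 * (pairs d).card * P1 := by
    rw [abs_mul, abs_of_nonneg hc0]
    refine (mul_le_of_le_one_right (abs_nonneg _) hc1).trans ((abs_add_le _ _).trans ?_)
    linarith
  have hfin : ((k : ℝ) + 1 + 4 * (pairs d).card + 2) * P1 ≤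
      (k + 1 + 4 * (pairs d).card + 2) * dominator x :=
    mul_le_mul_of_nonneg_left hdom (by positivity)
  linarith

lemma measurable_cutoff : Measurable cutoff := by unfold cutoff; fun_prop

lemma abs_loopField_le {σ : ℕ} (hσ : σ ≤ 1) {k : ℕ} (i : Fin d) (x : Fin d → ℝ) :
    |loopField σ k i x| ≤ dominator x := by
  by_cases hx : x ∈ openOrthant d
  swap
  · rw [loopField, Set.indicator_of_notMem hx, abs_zero]
    exact dominator_nonneg x
  rw [loopField, Set.indicator_of_mem hx]
  rcases le_or_gt 1 (∑ j, x j) with hle | hlt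
  · rw [cutoff_of_one_le hle, mul_zero, abs_zero]
    exact dominator_nonneg x
  have hw0 := wgt_nonneg σ hx
  have hi0 := hx i
  have hi1 : x i ≤ 1 := le_trans
    (Finset.single_le_sum (f := x) (fun j _ => (hx j).le) (Finset.mem_univ i)) hlt.le
  have hc0 := cutoff_nonneg (∑ j, x j)
  have hc1 := cutoff_le_one (Finset.sum_nonneg fun j _ => (hx j).le : 0 ≤ ∑ j, x j)
  rw [abs_of_nonneg (by positivity)]
  calc _ ≤ 1 * dominator x * 1 := by
        gcongr
        · exact mul_nonneg zero_le_one (dominator_nonneg x)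
        · exact pow_le_one₀ hi0.le hi1
        · exact (wgt_le_prod hσ hx hlt.le).trans (prod_wgt1_le_dominator hσ hx hlt.le)
    _ = _ := by ring

lemma integrable_loopField {σ : ℕ} (hσ : σ ≤ 1) (k : ℕ) (i : Fin d) :
    Integrable (loopField σ k i) := by
  refine (integrable_dominator d).mono' ?_ (Filter.Eventually.of_forall fun x => abs_loopField_le hσ i x)
  have := measurable_wgt (d := d) σ
  have := measurable_cutoff
  exact (Measurable.indicator (by fun_prop) (measurableSet_openOrthant d)).aestronglyMeasurable

lemma integrable_loopDeriv {σ : ℕ} (hσ : σ ≤ 1) {k : ℕ} (hk : 1 ≤ k) (i : Fin d) :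
    Integrable (loopDeriv σ k i) := by
  refine ((integrable_dominator d).const_mul _).mono' ?_
    (Filter.Eventually.of_forall fun x => abs_loopDeriv_le hσ hk i x)
  have := measurable_wgt (d := d) σ
  have := measurable_cutoff
  unfold loopDeriv pairLog
  exact (Measurable.indicator (by fun_prop) (measurableSet_openOrthant d)).aestronglyMeasurable

/-- Integration by parts against the constant function 1: the field and its line derivative are both
integrable, so no boundary term survives. -/
lemma integral_loopDeriv {σ : ℕ} (hσ : σ ≤ 1) {k : ℕ} (hk : 1 ≤ k) (i : Fin d) :
    ∫ x, loopDeriv σ k i x = 0 := by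
  have h := integral_bilinear_hasLineDerivAt_right_eq_neg_left_of_integrable
    (μ := (volume : Measure (Fin d → ℝ))) (f := loopField σ k i) (f' := loopDeriv σ k i)
    (g := fun _ => (1 : ℝ)) (g' := fun _ => 0) (v := Pi.single i 1)
    (B := ContinuousLinearMap.mul ℝ ℝ)
    (by simpa using integrable_loopDeriv hσ hk i) (by simp)
    (by simpa using integrable_loopField hσ k i)
    (fun x _ => hasLineDerivAt_loopField hσ hk i x)
    (fun x _ => hasDerivAt_const (0 : ℝ) (1 : ℝ))
  simpa using h.symm

/-- The polynomial of the loop equation of order `k`. -/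
def loopPoly (σ k : ℕ) (x : Fin d → ℝ) : ℝ :=
  (k + 1 - σ / 2) * ∑ i, x i ^ k + ∑ p ∈ pairs d,
    ((x p.1 ^ (k + 1) - x p.2 ^ (k + 1)) * (2 / (x p.1 - x p.2)) -
      σ * ((x p.1 ^ (k + 1) + x p.2 ^ (k + 1)) / (x p.1 + x p.2)))

/-- The loop equation of order `k`. -/
theorem loop_equation {σ : ℕ} (hσ : σ ≤ 1) {k : ℕ} (hk : 1 ≤ k) :
    ∫ x in openOrthant d, (loopPoly σ k x * wgt σ x * cutoff (∑ j, x j) -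
      (∑ i, x i ^ (k + 1)) * wgt σ x * (2 * max (1 - ∑ j, x j) 0)) = 0 ∧
    IntegrableOn (fun x => loopPoly σ k x * wgt σ x * cutoff (∑ j, x j) -
      (∑ i, x i ^ (k + 1)) * wgt σ x * (2 * max (1 - ∑ j, x j) 0)) (openOrthant d) := by
  have hsum : (openOrthant d).indicator (fun x => loopPoly σ k x * wgt σ x * cutoff (∑ j, x j) -
      (∑ i, x i ^ (k + 1)) * wgt σ x * (2 * max (1 - ∑ j, x j) 0)) =
      fun x => ∑ i, loopDeriv σ k i x := by
    ext x
    by_cases hx : x ∈ openOrthant d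
    · simp only [loopDeriv, Set.indicator_of_mem hx]
      -- The sum over i sees only the two members of each pair, so the poles combine into the
      -- divided difference of x^{k+1}, which is a polynomial at distinct eigenvalues.
      have hp : ∑ i, x i ^ (k + 1) * ∑ p ∈ pairs d, pairLog σ i p x = ∑ p ∈ pairs d,
          ((x p.1 ^ (k + 1) - x p.2 ^ (k + 1)) * (2 / (x p.1 - x p.2)) -
          σ * ((x p.1 ^ (k + 1) + x p.2 ^ (k + 1)) / (x p.1 + x p.2))) := by
        simp only [Finset.mul_sum]
        rw [Finset.sum_comm]
        refine Finset.sum_congr rfl fun p _ => ?_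
        have h1 : ∀ j, ∑ i, x i ^ (k + 1) * delta i j = x j ^ (k + 1) := by
          intro j; simp [delta]
        rw [← h1 p.1, ← h1 p.2, ← Finset.sum_sub_distrib, ← Finset.sum_add_distrib, Finset.sum_mul,
          Finset.sum_div, Finset.mul_sum, ← Finset.sum_sub_distrib]
        refine Finset.sum_congr rfl fun i _ => ?_
        unfold pairLog
        ring
      rw [Finset.sum_sub_distrib, loopPoly, ← hp, ← Finset.sum_mul, ← Finset.sum_mul,
        ← Finset.sum_mul, ← Finset.sum_mul, Finset.sum_add_distrib, Finset.mul_sum]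
    · simp only [loopDeriv, Set.indicator_of_notMem hx, Finset.sum_const_zero]
  have hi : Integrable fun x => ∑ i, loopDeriv (d := d) σ k i x :=
    integrable_finsetSum _ fun i _ => integrable_loopDeriv hσ hk i
  constructor
  · rw [← integral_indicator (measurableSet_openOrthant d), hsum, integral_finsetSum _
      fun i _ => integrable_loopDeriv hσ hk i]
    exact Finset.sum_eq_zero fun i _ => integral_loopDeriv hσ hk i
  · rw [← integrable_indicator_iff (measurableSet_openOrthant d), hsum]
    exact hi

end LoopEquation

/-! ### The laws of spectra and matrices are probability measures. -/

section ProbabilityMeasures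

instance instSecondCountableTopologyUnitaryGroup (d : ℕ) :
    SecondCountableTopology (Matrix.unitaryGroup (Fin d) ℂ) := by
  have : SecondCountableTopology (Matrix (Fin d) (Fin d) ℂ) :=
    inferInstanceAs (SecondCountableTopology (Fin d → Fin d → ℂ))
  exact TopologicalSpace.Subtype.secondCountableTopology _

instance instIsProbabilityMeasureHaarUnitary (d : ℕ) : IsProbabilityMeasure (haarUnitary d) :=
  ⟨Measure.haarMeasure_self (K₀ := (⊤ : TopologicalSpace.PositiveCompacts
    (Matrix.unitaryGroup (Fin d) ℂ)))⟩

instance instIsMulLeftInvariantHaarUnitary (d : ℕ) :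
    Measure.IsMulLeftInvariant (haarUnitary d) := by
  unfold haarUnitary; infer_instance

lemma isProbabilityMeasure_normalise {α : Type*} [MeasurableSpace α] {ν : Measure α}
    (h0 : ν Set.univ ≠ 0) (h1 : ν Set.univ ≠ ∞) : IsProbabilityMeasure (normalise ν) :=
  ⟨by rw [normalise, Measure.smul_apply, smul_eq_mul, ENNReal.inv_mul_cancel h0 h1]⟩

lemma StateEnsemble.deg_add_eq (e : StateEnsemble) (n : ℕ) :
    e.deg (n + 1) + n = ((n + 1 : ℕ) : ℝ) ^ 2 * (2 - e.expo) / 2 - 1 := by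
  rw [← e.deg_add]; push_cast; ring

lemma StateEnsemble.half_sq_le (e : StateEnsemble) (d : ℕ) :
    (d : ℝ) ^ 2 / 2 ≤ (d : ℝ) ^ 2 * (2 - e.expo) / 2 := by
  have h : (e.expo : ℝ) ≤ 1 := by exact_mod_cast e.expo_le_one
  have := sq_nonneg (d : ℝ)
  nlinarith

/-- The unnormalised eigenvalue distribution of a random state. -/
def StateEnsemble.spec (e : StateEnsemble) (d : ℕ) : Measure (Fin d → ℝ) :=
  (simplexMeasure d).withDensity fun x => ENNReal.ofReal (e.density x)

/-- The normalised eigenvalue distribution of a random state. -/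
def StateEnsemble.specLaw (e : StateEnsemble) (d : ℕ) : Measure (Fin d → ℝ) :=
  normalise (e.spec d)

lemma StateEnsemble.spec_univ (e : StateEnsemble) (d : ℕ) :
    e.spec d Set.univ = ∫⁻ x, ENNReal.ofReal (e.density x) ∂(simplexMeasure d) := by
  rw [spec, withDensity_apply _ MeasurableSet.univ, setLIntegral_univ]

/-- Relates the mass of the simplex density to a Lebesgue integral over the orthant. Positivity can
then be tested on an open set, and finiteness by comparison with `dominator`. -/
lemma StateEnsemble.lintegral_orthant_density (e : StateEnsemble) (n : ℕ) :
    ∫⁻ x in orthant (n + 1), ENNReal.ofReal (e.density x) *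
        (Set.Ioo (0 : ℝ) 1).indicator 1 (∑ i, x i) =
      e.spec (n + 1) Set.univ * ∫⁻ s in Set.Ioi (0 : ℝ), ENNReal.ofReal
        (s ^ (e.deg (n + 1) + n)) * (Set.Ioo (0 : ℝ) 1).indicator 1 s := by
  rw [spec_univ]
  refine lintegral_orthant_homogeneous (h := e.deg (n + 1)) e.measurable_density.ennreal_ofReal ?_
    (measurable_one.indicator measurableSet_Ioo)
  intro s hs x
  rw [density_smul e hs, ENNReal.ofReal_mul (by positivity)]

lemma StateEnsemble.density_pos (e : StateEnsemble) {d : ℕ} {x : Fin d → ℝ}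
    (hx : x ∈ openOrthant d) (hne : ∀ p ∈ pairs d, x p.1 ≠ x p.2) : 0 < e.density x := by
  rw [density_eq]
  refine mul_pos (Finset.prod_pos fun i _ => ?_) (Finset.prod_pos fun p hp => ?_)
  · have := Real.sqrt_pos.mpr (hx i)
    unfold wgt1; positivity
  · have h1 := sq_pos_of_ne_zero (sub_ne_zero.mpr (hne p hp))
    have h2 := add_pos (hx p.1) (hx p.2)
    unfold wgt2; positivity

lemma ae_forall_pairs_ne (d : ℕ) : ∀ᵐ x : Fin d → ℝ, ∀ p ∈ pairs d, x p.1 ≠ x p.2 := by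
  have h : ∀ᵐ x : Fin d → ℝ, ∀ p : Fin d × Fin d, p ∈ pairs d → x p.1 ≠ x p.2 := by
    rw [ae_all_iff]
    intro p
    by_cases hp : p ∈ pairs d
    · filter_upwards [ae_ne (mem_pairs.mp hp).ne] with x hx _ using hx
    · exact Filter.Eventually.of_forall fun x h => absurd h hp
  exact h

lemma isOpen_openOrthant (d : ℕ) : IsOpen (openOrthant d) := by
  have : openOrthant d = ⋂ i, {x : Fin d → ℝ | 0 < x i} := by
    ext x; simp [openOrthant]
  rw [this]
  exact isOpen_iInter_of_finite fun i => isOpen_lt continuous_const (continuous_apply i)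

lemma StateEnsemble.spec_univ_ne_zero (e : StateEnsemble) (n : ℕ) :
    e.spec (n + 1) Set.univ ≠ 0 := by
  intro h0
  have h1 := e.lintegral_orthant_density n
  rw [h0, zero_mul, lintegral_eq_zero_iff (by
    have := e.measurable_density (d := n + 1)
    exact this.ennreal_ofReal.mul ((measurable_one.indicator measurableSet_Ioo).comp
      (by fun_prop : Measurable fun x : Fin (n + 1) → ℝ => ∑ i, x i)))] at h1
  have h2 := (ae_restrict_iff' (measurableSet_orthant (n + 1))).mp h1
  set O : Set (Fin (n + 1) → ℝ) := openOrthant (n + 1) ∩ {x | ∑ i, x i < 1} with hO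
  have hOo : IsOpen O := (isOpen_openOrthant _).inter
    (isOpen_lt (by fun_prop) continuous_const)
  have hOne : O.Nonempty := by
    refine ⟨fun _ => 1 / (2 * (n + 1)), fun i => by positivity, ?_⟩
    show ∑ _i : Fin (n + 1), (1 / (2 * ((n : ℝ) + 1))) < 1
    rw [Finset.sum_const, Finset.card_univ, Fintype.card_fin, nsmul_eq_mul]
    push_cast
    have : (0 : ℝ) < n + 1 := by positivity
    rw [mul_one_div, div_lt_one (by positivity)]
    linarith
  refine (hOo.measure_pos volume hOne).ne' ?_
  have h3 : ∀ᵐ x : Fin (n + 1) → ℝ, x ∉ O := by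
    filter_upwards [h2, ae_forall_pairs_ne (n + 1)] with x hx hne hxO
    have hpos := e.density_pos hxO.1 hne
    have := hx fun i => (hxO.1 i).le
    have hmem : ∑ i, x i ∈ Set.Ioo (0 : ℝ) 1 :=
      ⟨Finset.sum_pos (fun i _ => hxO.1 i) Finset.univ_nonempty, hxO.2⟩
    simp only [Set.indicator_of_mem hmem, Pi.one_apply, mul_one, Pi.zero_apply,
      ENNReal.ofReal_eq_zero] at this
    linarith
  rw [measure_eq_zero_iff_ae_notMem]
  exact h3

lemma StateEnsemble.spec_univ_ne_top (e : StateEnsemble) (n : ℕ) :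
    e.spec (n + 1) Set.univ ≠ ∞ := by
  intro htop
  have h1 := e.lintegral_orthant_density n
  have h2 : ∫⁻ s in Set.Ioi (0 : ℝ), ENNReal.ofReal
        (s ^ (e.deg (n + 1) + n)) * (Set.Ioo (0 : ℝ) 1).indicator 1 s ≠ 0 := by
    rw [Ne, lintegral_eq_zero_iff (by
      refine Measurable.mul ?_ (measurable_one.indicator measurableSet_Ioo)
      fun_prop)]
    intro h
    have h3 := (ae_restrict_iff' measurableSet_Ioi).mp h
    have h4 : ∀ᵐ s : ℝ, s ∉ Set.Ioo (0 : ℝ) 1 := by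
      filter_upwards [h3] with s hs hmem
      have := hs hmem.1
      simp only [Set.indicator_of_mem hmem, Pi.one_apply, mul_one, Pi.zero_apply,
        ENNReal.ofReal_eq_zero] at this
      have := Real.rpow_pos_of_pos hmem.1 (e.deg (n + 1) + n)
      linarith
    rw [← measure_eq_zero_iff_ae_notMem] at h4
    simp at h4
  rw [htop, ENNReal.top_mul h2] at h1
  have h5 : ∫⁻ x in orthant (n + 1), ENNReal.ofReal (e.density x) *
        (Set.Ioo (0 : ℝ) 1).indicator 1 (∑ i, x i) ≤
      ∫⁻ x : Fin (n + 1) → ℝ, ENNReal.ofReal (dominator x) := by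
    refine le_trans ?_ (setLIntegral_le_lintegral (orthant (n + 1)) _)
    refine lintegral_mono_ae ?_
    filter_upwards [ae_restrict_mem (measurableSet_orthant (n + 1)),
      ae_restrict_of_ae (ae_ne_zero (n + 1))] with x hx hx0
    by_cases hmem : ∑ i, x i ∈ Set.Ioo (0 : ℝ) 1
    · rw [Set.indicator_of_mem hmem, Pi.one_apply, mul_one]
      exact ENNReal.ofReal_le_ofReal (e.density_le_dominator
        (fun i => lt_of_le_of_ne (hx i) (hx0 i).symm) hmem.2.le)
    · rw [Set.indicator_of_notMem hmem, mul_zero]; exact zero_le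
  rw [h1] at h5
  exact absurd h5 (not_le.mpr (integrable_dominator (n + 1)).lintegral_lt_top)

lemma StateEnsemble.isProbabilityMeasure_specLaw (e : StateEnsemble) {d : ℕ} (hd : 1 ≤ d) :
    IsProbabilityMeasure (e.specLaw d) := by
  obtain ⟨n, rfl⟩ := Nat.exists_eq_add_of_le' hd
  exact isProbabilityMeasure_normalise (e.spec_univ_ne_zero n) (e.spec_univ_ne_top n)

lemma StateEnsemble.law_eq (e : StateEnsemble) (d : ℕ) :
    e.law d = (e.specLaw d).prod (haarUnitary d) := rfl

lemma StateEnsemble.isProbabilityMeasure_law (e : StateEnsemble) {d : ℕ} (hd : 1 ≤ d) :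
    IsProbabilityMeasure (e.law d) := by
  have := e.isProbabilityMeasure_specLaw hd
  rw [law_eq]
  infer_instance

lemma ae_simplexMeasure (d : ℕ) : ∀ᵐ x ∂(simplexMeasure d), IsSpectrum x := by
  cases d with
  | zero => exact ae_zero.le trivial
  | succ n => exact ae_simplexMeasure_isSpectrum

lemma StateEnsemble.ae_specLaw (e : StateEnsemble) (d : ℕ) : ∀ᵐ x ∂(e.specLaw d), IsSpectrum x := by
  have h : ∀ᵐ x ∂(e.spec d), IsSpectrum x :=
    (withDensity_absolutelyContinuous _ _).ae_le (ae_simplexMeasure d)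
  exact Measure.ae_smul_measure h _

/-- The unnormalised eigenvalue density of the Gaussian Unitary Ensemble. -/
def gueDensity (η : ℝ) {d : ℕ} (x : Fin d → ℝ) : ℝ :=
  Real.exp (-(η / 2) * ∑ i, x i ^ 2) * ∏ i, ∏ j ∈ Finset.Ioi i, (x i - x j) ^ 2

lemma gueDensity_nonneg (η : ℝ) {d : ℕ} (x : Fin d → ℝ) : 0 ≤ gueDensity η x := by
  unfold gueDensity; positivity

lemma continuous_gueDensity (η : ℝ) {d : ℕ} : Continuous (gueDensity η : (Fin d → ℝ) → ℝ) := by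
  unfold gueDensity; fun_prop

/-- Half of the Gaussian exponent absorbs the squared Vandermonde factor, through (η r / 4)^m ≤ m!
e^{η r / 4} with r = Σ x_i² and m the number of pairs. -/
lemma integrable_gueDensity {η : ℝ} (hη : 0 < η) (d : ℕ) :
    Integrable (gueDensity η : (Fin d → ℝ) → ℝ) := by
  have hG : Integrable (fun x : Fin d → ℝ => ∏ i, Real.exp (-(η / 4) * x i ^ 2)) :=
    Integrable.fintype_prod (f := fun _ s => Real.exp (-(η / 4) * s ^ 2)) fun _ =>
      integrable_exp_neg_mul_sq (by positivity)
  set m := (pairs d).card with hm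
  refine (hG.const_mul ((16 / η) ^ m * m.factorial)).mono'
    (continuous_gueDensity η).aestronglyMeasurable (Filter.Eventually.of_forall fun x => ?_)
  rw [Real.norm_eq_abs, abs_of_nonneg (gueDensity_nonneg η x), gueDensity, prod_prod_Ioi,
    ← Real.exp_sum, ← Finset.mul_sum]
  set r := ∑ i, x i ^ 2 with hr
  have hr0 : 0 ≤ r := Finset.sum_nonneg fun i _ => sq_nonneg _
  have h1 : ∏ p ∈ pairs d, (x p.1 - x p.2) ^ 2 ≤ (4 * r) ^ m := by
    rw [hm, ← Finset.prod_const]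
    refine Finset.prod_le_prod (fun p _ => sq_nonneg _) fun p _ => ?_
    have ha : x p.1 ^ 2 ≤ r := Finset.single_le_sum (f := fun i => x i ^ 2)
      (fun i _ => sq_nonneg _) (Finset.mem_univ _)
    have hb : x p.2 ^ 2 ≤ r := Finset.single_le_sum (f := fun i => x i ^ 2)
      (fun i _ => sq_nonneg _) (Finset.mem_univ _)
    nlinarith [sq_nonneg (x p.1 + x p.2)]
  have h2 : (η / 4 * r) ^ m ≤ m.factorial * Real.exp (η / 4 * r) := by
    have := Real.pow_div_factorial_le_exp (η / 4 * r) (by positivity) m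
    rw [div_le_iff₀ (by positivity)] at this
    linarith
  have h3 : (4 * r) ^ m = (16 / η) ^ m * (η / 4 * r) ^ m := by
    rw [← mul_pow]; congr 1; field_simp; ring
  calc Real.exp (-(η / 2) * r) * ∏ p ∈ pairs d, (x p.1 - x p.2) ^ 2
      ≤ Real.exp (-(η / 2) * r) * ((16 / η) ^ m * (m.factorial * Real.exp (η / 4 * r))) := by
        rw [h3] at h1
        gcongr
        exact h1.trans (by gcongr)
    _ = (16 / η) ^ m * m.factorial * (Real.exp (-(η / 2) * r) * Real.exp (η / 4 * r)) := by ring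
    _ = _ := by rw [← Real.exp_add]; congr 2; ring

/-- The eigenvalue distribution of the Gaussian Unitary Ensemble. -/
def gueSpec (η : ℝ) (d : ℕ) : Measure (Fin d → ℝ) :=
  normalise (volume.withDensity fun x => ENNReal.ofReal (gueDensity η x))

lemma gue_eq (η : ℝ) (d : ℕ) : gue η d = (gueSpec η d).prod (haarUnitary d) := rfl

lemma isProbabilityMeasure_gueSpec {η : ℝ} (hη : 0 < η) (d : ℕ) :
    IsProbabilityMeasure (gueSpec η d) := by
  refine isProbabilityMeasure_normalise ?_ ?_
  · rw [withDensity_apply _ MeasurableSet.univ, setLIntegral_univ, Ne,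
      lintegral_eq_zero_iff (continuous_gueDensity η).measurable.ennreal_ofReal]
    intro h
    have : ∀ᵐ _x : Fin d → ℝ, False := by
      filter_upwards [h, ae_forall_pairs_ne d] with x hx hne
      simp only [Pi.zero_apply, ENNReal.ofReal_eq_zero] at hx
      refine absurd hx (not_le.mpr ?_)
      rw [gueDensity, prod_prod_Ioi]
      exact mul_pos (Real.exp_pos _) (Finset.prod_pos fun p hp =>
        sq_pos_of_ne_zero (sub_ne_zero.mpr (hne p hp)))
    rw [Filter.eventually_false_iff_eq_bot, ae_eq_bot] at this
    exact (NeZero.ne (volume : Measure (Fin d → ℝ))) this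
  · rw [withDensity_apply _ MeasurableSet.univ, setLIntegral_univ]
    exact (integrable_gueDensity hη d).lintegral_lt_top.ne

lemma isProbabilityMeasure_gue {η : ℝ} (hη : 0 < η) (d : ℕ) : IsProbabilityMeasure (gue η d) := by
  have := isProbabilityMeasure_gueSpec hη d
  rw [gue_eq]
  infer_instance

lemma isProbabilityMeasure_sampleLaw (e : StateEnsemble) {ηS ηE : ℝ} (hS : 0 < ηS) (hE : 0 < ηE)
    {dS d Nuno M Nmac : ℕ} (hd : 1 ≤ d) :
    IsProbabilityMeasure (sampleLaw e ηS ηE dS d Nuno M Nmac) := by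
  have := isProbabilityMeasure_gue hS dS
  have := isProbabilityMeasure_gue hE d
  have := e.isProbabilityMeasure_law hd
  unfold sampleLaw
  infer_instance

lemma StateEnsemble.integral_specLaw (e : StateEnsemble) (d : ℕ) (f : (Fin d → ℝ) → ℝ) :
    ∫ x, f x ∂(e.specLaw d) = ((e.spec d Set.univ)⁻¹).toReal *
      ∫ x, f x * e.density x ∂(simplexMeasure d) := by
  rw [specLaw, normalise, integral_smul_measure, smul_eq_mul]
  congr 1
  rw [spec, integral_withDensity_eq_integral_toReal_smul e.measurable_density.ennreal_ofReal
    (Filter.Eventually.of_forall fun x => ENNReal.ofReal_lt_top)]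
  refine integral_congr_ae ?_
  filter_upwards [ae_simplexMeasure d] with x hx
  rw [ENNReal.toReal_ofReal (e.density_nonneg hx.1), smul_eq_mul, mul_comm]

lemma exists_integral_gueSpec (η : ℝ) (d : ℕ) :
    ∃ c : ℝ, ∀ f : (Fin d → ℝ) → ℂ, ∫ x, f x ∂(gueSpec η d) =
      c • ∫ x, gueDensity η x • f x := by
  refine ⟨((volume.withDensity (fun x : Fin d → ℝ => ENNReal.ofReal (gueDensity η x))
    Set.univ)⁻¹).toReal, fun f => ?_⟩
  rw [gueSpec, normalise, integral_smul_measure]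
  congr 1
  rw [integral_withDensity_eq_integral_toReal_smul
    (continuous_gueDensity η).measurable.ennreal_ofReal
    (Filter.Eventually.of_forall fun x => ENNReal.ofReal_lt_top)]
  congr 1; ext x
  rw [ENNReal.toReal_ofReal (gueDensity_nonneg η x)]

end ProbabilityMeasures

/-! ### Purity, third moment and flatness of random spectra. -/

section SpectralMoments

variable {n : ℕ}

theorem integral_orthant_homogeneous {G : (Fin (n + 1) → ℝ) → ℝ} (hG : Measurable G) {h : ℝ}
    (hom : ∀ s : ℝ, 0 < s → ∀ x, G (s • x) = s ^ h * G x)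
    (hint : Integrable G (simplexMeasure (n + 1))) {χ : ℝ → ℝ} (hχ : Measurable χ)
    (hχ0 : ∀ s, 0 ≤ χ s)
    (hχi : IntegrableOn (fun s => s ^ (h + n) * χ s) (Set.Ioi 0)) :
    ∫ x in orthant (n + 1), G x * χ (∑ i, x i) =
      (∫ x, G x ∂(simplexMeasure (n + 1))) * ∫ s in Set.Ioi (0 : ℝ), s ^ (h + n) * χ s ∧
    IntegrableOn (fun x => G x * χ (∑ i, x i)) (orthant (n + 1)) := by
  have hpol : ∀ H : (Fin (n + 1) → ℝ) → ℝ, Measurable H →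
      (∀ s : ℝ, 0 < s → ∀ x, H (s • x) = s ^ h * H x) →
      ∫⁻ x in orthant (n + 1), ENNReal.ofReal (H x * χ (∑ i, x i)) =
        (∫⁻ x, ENNReal.ofReal (H x) ∂(simplexMeasure (n + 1))) *
          ENNReal.ofReal (∫ s in Set.Ioi (0 : ℝ), s ^ (h + n) * χ s) := by
    intro H hH hhom
    have := lintegral_orthant_homogeneous (n := n) (F := fun x => ENNReal.ofReal (H x)) (h := h)
      hH.ennreal_ofReal (fun s hs x => by
        rw [hhom s hs, ENNReal.ofReal_mul (by positivity)])
      (χ := fun s => ENNReal.ofReal (χ s)) hχ.ennreal_ofReal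
    rw [ofReal_integral_eq_lintegral_ofReal hχi ((ae_restrict_mem measurableSet_Ioi).mono
      fun s hs => mul_nonneg (Real.rpow_nonneg (le_of_lt hs) _) (hχ0 s))]
    simp only [ENNReal.ofReal_mul' (hχ0 _)] at this ⊢
    exact this
  have hsumm : Measurable fun x : Fin (n + 1) → ℝ => ∑ i, x i := by fun_prop
  have hI : IntegrableOn (fun x => G x * χ (∑ i, x i)) (orthant (n + 1)) := by
    refine ⟨(hG.mul (hχ.comp hsumm)).aestronglyMeasurable, ?_⟩
    rw [hasFiniteIntegral_iff_norm]
    have h1 := hpol (fun x => |G x|) (by fun_prop) (fun s hs x => by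
      rw [hom s hs, abs_mul, abs_of_nonneg (Real.rpow_nonneg hs.le _)])
    have h2 : ∀ x : Fin (n + 1) → ℝ, ‖G x * χ (∑ i, x i)‖ = |G x| * χ (∑ i, x i) := fun x => by
      rw [Real.norm_eq_abs, abs_mul, abs_of_nonneg (hχ0 _)]
    simp only [h2]
    rw [h1]
    refine ENNReal.mul_lt_top ?_ ENNReal.ofReal_lt_top
    have := hint.hasFiniteIntegral
    rw [hasFiniteIntegral_iff_norm] at this
    simpa using this
  refine ⟨?_, hI⟩
  have hJ : 0 ≤ ∫ s in Set.Ioi (0 : ℝ), s ^ (h + n) * χ s :=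
    setIntegral_nonneg measurableSet_Ioi fun s hs =>
      mul_nonneg (Real.rpow_nonneg (le_of_lt hs) _) (hχ0 s)
  rw [integral_eq_lintegral_pos_part_sub_lintegral_neg_part hI,
    integral_eq_lintegral_pos_part_sub_lintegral_neg_part hint, hpol G hG hom]
  have h3 := hpol (fun x => -G x) hG.neg (fun s hs x => by rw [hom s hs]; ring)
  simp only [neg_mul] at h3
  rw [h3, ENNReal.toReal_mul, ENNReal.toReal_mul, ENNReal.toReal_ofReal hJ]
  ring

/-- The identity is integration by parts for the cutoff (1 - s)², and is read off from explicit
power integrals. It says that the radial integrals of the two terms of the loop equation differ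
exactly by the factor a. -/
lemma integral_rpow_mul_one_sub {a : ℝ} (ha : 0 < a) :
    IntegrableOn (fun s : ℝ => s ^ (a - 1) * cutoff s) (Set.Ioi 0) ∧
    IntegrableOn (fun s : ℝ => s ^ a * (2 * max (1 - s) 0)) (Set.Ioi 0) ∧
    ∫ s in Set.Ioi (0 : ℝ), s ^ a * (2 * max (1 - s) 0) =
      a * ∫ s in Set.Ioi (0 : ℝ), s ^ (a - 1) * cutoff s ∧
    0 < ∫ s in Set.Ioi (0 : ℝ), s ^ (a - 1) * cutoff s := by
  have hi : ∀ b : ℝ, 0 < b → IntegrableOn (fun s : ℝ => s ^ (b - 1)) (Set.Ioc 0 1) := fun b hb => by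
    rw [← intervalIntegrable_iff_integrableOn_Ioc_of_le zero_le_one]
    exact intervalIntegral.intervalIntegrable_rpow' (by linarith)
  have hv : ∀ b : ℝ, 0 < b → ∫ s in Set.Ioc (0 : ℝ) 1, s ^ (b - 1) = 1 / b := fun b hb => by
    rw [← intervalIntegral.integral_of_le zero_le_one, integral_rpow (Or.inl (by linarith))]
    rw [Real.one_rpow, sub_add_cancel, Real.zero_rpow hb.ne', sub_zero]
  have e1 : ∀ s : ℝ, s ∈ Set.Ioc (0 : ℝ) 1 → s ^ (a - 1) * cutoff s =
      s ^ (a - 1) - 2 * s ^ (a + 1 - 1) + s ^ (a + 2 - 1) := by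
    intro s hs
    have h1 : s ^ (a + 1 - 1) = s ^ (a - 1) * s := by
      rw [← Real.rpow_add_one hs.1.ne']; congr 1; ring
    have h2 : s ^ (a + 2 - 1) = s ^ (a - 1) * s ^ 2 := by
      rw [← Real.rpow_natCast s 2, ← Real.rpow_add hs.1]; congr 1; push_cast; ring
    rw [h1, h2, cutoff, max_eq_left (by linarith [hs.2])]; ring
  have e2 : ∀ s : ℝ, s ∈ Set.Ioc (0 : ℝ) 1 → s ^ a * (2 * max (1 - s) 0) =
      2 * s ^ (a + 1 - 1) - 2 * s ^ (a + 2 - 1) := by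
    intro s hs
    have h1 : s ^ (a + 1 - 1) = s ^ a := by congr 1; ring
    have h2 : s ^ (a + 2 - 1) = s ^ a * s := by
      rw [← Real.rpow_add_one hs.1.ne']; congr 1; ring
    rw [h1, h2, max_eq_left (by linarith [hs.2])]; ring
  have hU : Set.Ioi (0 : ℝ) = Set.Ioc 0 1 ∪ Set.Ioi 1 :=
    (Set.Ioc_union_Ioi_eq_Ioi zero_le_one).symm
  have z1 : ∀ s ∈ Set.Ioi (0 : ℝ) \ Set.Ioc 0 1, s ^ (a - 1) * cutoff s = 0 := by
    intro s hs
    have : 1 < s := by by_contra h; exact hs.2 ⟨hs.1, not_lt.mp h⟩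
    rw [cutoff_of_one_le this.le, mul_zero]
  have z2 : ∀ s ∈ Set.Ioi (0 : ℝ) \ Set.Ioc 0 1, s ^ a * (2 * max (1 - s) 0) = 0 := by
    intro s hs
    have : 1 < s := by by_contra h; exact hs.2 ⟨hs.1, not_lt.mp h⟩
    rw [max_eq_right (by linarith), mul_zero, mul_zero]
  have i1 : IntegrableOn (fun s : ℝ => s ^ (a - 1) * cutoff s) (Set.Ioc 0 1) :=
    IntegrableOn.congr_fun (((hi a ha).sub ((hi (a + 1) (by linarith)).const_mul 2)).add
      (hi (a + 2) (by linarith))) (fun s hs => (e1 s hs).symm) measurableSet_Ioc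
  have i2 : IntegrableOn (fun s : ℝ => s ^ a * (2 * max (1 - s) 0)) (Set.Ioc 0 1) :=
    IntegrableOn.congr_fun (((hi (a + 1) (by linarith)).const_mul 2).sub
      ((hi (a + 2) (by linarith)).const_mul 2)) (fun s hs => (e2 s hs).symm) measurableSet_Ioc
  have v1 : ∫ s in Set.Ioi (0 : ℝ), s ^ (a - 1) * cutoff s = 1 / a - 2 * (1 / (a + 1)) +
      1 / (a + 2) := by
    rw [setIntegral_eq_of_subset_of_forall_sdiff_eq_zero measurableSet_Ioi
      Set.Ioc_subset_Ioi_self z1, setIntegral_congr_fun measurableSet_Ioc e1]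
    have := integral_add ((hi a ha).sub ((hi (a + 1) (by linarith)).const_mul 2)) (hi (a + 2) (by linarith))
    simp only [Pi.sub_apply] at this
    rw [this, integral_sub (hi a ha) ((hi (a + 1) (by linarith)).const_mul 2), integral_const_mul,
      hv a ha, hv (a + 1) (by linarith), hv (a + 2) (by linarith)]
  have v2 : ∫ s in Set.Ioi (0 : ℝ), s ^ a * (2 * max (1 - s) 0) = 2 * (1 / (a + 1)) -
      2 * (1 / (a + 2)) := by
    rw [setIntegral_eq_of_subset_of_forall_sdiff_eq_zero measurableSet_Ioi
      Set.Ioc_subset_Ioi_self z2, setIntegral_congr_fun measurableSet_Ioc e2, integral_sub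
      ((hi (a + 1) (by linarith)).const_mul 2) ((hi (a + 2) (by linarith)).const_mul 2),
      integral_const_mul, integral_const_mul, hv (a + 1) (by linarith), hv (a + 2) (by linarith)]
  refine ⟨?_, ?_, ?_, ?_⟩
  · exact i1.of_forall_sdiff_eq_zero measurableSet_Ioi z1
  · exact i2.of_forall_sdiff_eq_zero measurableSet_Ioi z2
  · rw [v1, v2]; field_simp; ring
  · rw [v1]
    have : 1 / a - 2 * (1 / (a + 1)) + 1 / (a + 2) = 2 / (a * (a + 1) * (a + 2)) := by
      field_simp; ring
    rw [this]; positivity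

lemma StateEnsemble.integrable_density (e : StateEnsemble) :
    Integrable (e.density : (Fin (n + 1) → ℝ) → ℝ) (simplexMeasure (n + 1)) := by
  refine ⟨e.measurable_density.aestronglyMeasurable, ?_⟩
  have h := e.spec_univ_ne_top n
  rw [spec_univ] at h
  rw [hasFiniteIntegral_iff_ofReal]
  · exact lt_top_iff_ne_top.mpr h
  · filter_upwards [ae_simplexMeasure_isSpectrum (n := n)] with x hx using e.density_nonneg hx.1

lemma StateEnsemble.integrable_mul_density (e : StateEnsemble) {G : (Fin (n + 1) → ℝ) → ℝ}
    (hG : Measurable G) {c : ℝ} (hc : ∀ x, IsSpectrum x → |G x| ≤ c) :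
    Integrable (fun x => G x * e.density x) (simplexMeasure (n + 1)) := by
  refine e.integrable_density.bdd_mul (c := c) hG.aestronglyMeasurable ?_
  filter_upwards [ae_simplexMeasure_isSpectrum (n := n)] with x hx using hc x hx

lemma StateEnsemble.wgt_expo (e : StateEnsemble) {d : ℕ} (x : Fin d → ℝ) :
    wgt e.expo x = e.density x := (e.density_eq x).symm

lemma IsSpectrum.le_one {d : ℕ} {x : Fin d → ℝ} (hx : IsSpectrum x) (i : Fin d) : x i ≤ 1 :=
  (Finset.single_le_sum (fun j _ => hx.1 j) (Finset.mem_univ i)).trans hx.2.le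

lemma abs_loopPoly_le {d : ℕ} {σ : ℕ} (hσ : σ ≤ 1) (k : ℕ) {x : Fin d → ℝ} (hx : IsSpectrum x) :
    |loopPoly σ k x| ≤ (k + 1) * d + ∑ _p ∈ pairs d, (2 * ((k : ℝ) + 1) + 1) := by
  have h01 : ∀ i, |x i| ≤ 1 := fun i => by rw [abs_of_nonneg (hx.1 i)]; exact hx.le_one i
  have hσ' : (σ : ℝ) ≤ 1 := by exact_mod_cast hσ
  have hσ0 : (0 : ℝ) ≤ σ := Nat.cast_nonneg _
  have hk0 : (0 : ℝ) ≤ k := Nat.cast_nonneg _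
  unfold loopPoly
  refine (abs_add_le _ _).trans (add_le_add ?_ ((Finset.abs_sum_le_sum_abs _ _).trans
    (Finset.sum_le_sum fun p _ => (abs_sub _ _).trans (add_le_add ?_ ?_))))
  · rw [abs_mul]
    have h1 : |((k : ℝ) + 1 - σ / 2)| ≤ k + 1 := by rw [abs_le]; constructor <;> linarith
    have h2 : |∑ i, x i ^ k| ≤ d := by
      refine (Finset.abs_sum_le_sum_abs _ _).trans ?_
      calc _ ≤ ∑ _i : Fin d, (1 : ℝ) := Finset.sum_le_sum fun i _ => by
            rw [abs_pow]; exact pow_le_one₀ (abs_nonneg _) (h01 i)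
        _ = d := by simp
    gcongr
  · by_cases h0 : x p.1 - x p.2 = 0
    · rw [h0, div_zero, mul_zero, abs_zero]; positivity
    · rw [abs_mul, abs_div, mul_div_assoc', div_le_iff₀ (abs_pos.mpr h0), abs_two]
      have h1 := abs_pow_sub_pow_le (x p.1) (x p.2) (k + 1)
      have h2 : max |x p.1| |x p.2| ^ (k + 1 - 1) ≤ 1 :=
        pow_le_one₀ (le_max_of_le_left (abs_nonneg _)) (max_le (h01 _) (h01 _))
      have h3 : |x p.1 ^ (k + 1) - x p.2 ^ (k + 1)| ≤ |x p.1 - x p.2| * (k + 1 : ℕ) :=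
        h1.trans (mul_le_of_le_one_right (by positivity) h2)
      push_cast at h3
      linarith
  · have h1 := hx.1 p.1
    have h2 := hx.1 p.2
    have h3 : (x p.1 ^ (k + 1) + x p.2 ^ (k + 1)) / (x p.1 + x p.2) ≤ 1 :=
      div_le_one_of_le₀ (add_le_add (pow_le_of_le_one h1 (hx.le_one _) (by omega))
        (pow_le_of_le_one h2 (hx.le_one _) (by omega))) (by positivity)
    rw [abs_of_nonneg (by positivity)]
    exact mul_le_one₀ hσ' (by positivity) h3

lemma measurable_loopPoly {d : ℕ} (σ k : ℕ) : Measurable (loopPoly σ k : (Fin d → ℝ) → ℝ) := by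
  unfold loopPoly; fun_prop

lemma loopPoly_smul {d : ℕ} (σ k : ℕ) {s : ℝ} (hs : 0 < s) (x : Fin d → ℝ) :
    loopPoly σ k (s • x) = s ^ k * loopPoly σ k x := by
  unfold loopPoly
  simp only [Pi.smul_apply, smul_eq_mul]
  rw [mul_add, Finset.mul_sum, Finset.mul_sum, Finset.mul_sum, Finset.mul_sum]
  congr 1
  · refine Finset.sum_congr rfl fun i _ => by rw [mul_pow]; ring
  · refine Finset.sum_congr rfl fun p _ => ?_
    rw [← mul_sub, ← mul_add, mul_pow, mul_pow, ← mul_sub, ← mul_add, ← div_div,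
      mul_div_mul_comm, pow_succ]
    have h2 : s ^ k * s / s = s ^ k := by field_simp
    rw [h2, div_div, mul_comm s (x p.1 - x p.2), ← div_div]
    field_simp

/-- The loop equation on the orthant is pushed to the simplex. Both its terms are homogeneous
functions times a function of the trace, so the polar formula separates off the radial integrals,
whose ratio is D + k with D = d²(2 - σ)/2. The number D is the degree of the density plus the
dimension d. -/
theorem StateEnsemble.loop_moment (e : StateEnsemble) {k : ℕ} (hk : 1 ≤ k) :
    (((n + 1 : ℕ) : ℝ) ^ 2 * (2 - e.expo) / 2 + k) *
      ∫ x, (∑ i, x i ^ (k + 1)) ∂(e.specLaw (n + 1)) =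
    ∫ x, loopPoly e.expo k x ∂(e.specLaw (n + 1)) := by
  set D : ℝ := ((n + 1 : ℕ) : ℝ) ^ 2 * (2 - e.expo) / 2 with hD
  have hD0 : 0 ≤ D := le_trans (by positivity) (e.half_sq_le (n + 1))
  have hk0 : (1 : ℝ) ≤ k := by exact_mod_cast hk
  have hdeg := e.deg_add_eq n
  rw [← hD] at hdeg
  obtain ⟨i1, i2, hJ, hJ0⟩ := integral_rpow_mul_one_sub (a := D + k) (by linarith)
  set J := ∫ s in Set.Ioi (0 : ℝ), s ^ (D + k - 1) * cutoff s with hJdef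
  have hmd := e.measurable_density (d := n + 1)
  have hml := measurable_loopPoly (d := n + 1) e.expo k
  have E1 : (k : ℝ) + e.deg (n + 1) + n = D + k - 1 := by linarith
  have E2 : ((k + 1 : ℕ) : ℝ) + e.deg (n + 1) + n = D + k := by push_cast; linarith
  have h1 := integral_orthant_homogeneous (n := n) (G := fun x => loopPoly e.expo k x * e.density x)
    (h := k + e.deg (n + 1)) (hml.mul hmd) (fun s hs x => by
      rw [loopPoly_smul _ _ hs, e.density_smul hs, Real.rpow_add hs, Real.rpow_natCast]; ring)
    (e.integrable_mul_density hml fun x hx => abs_loopPoly_le e.expo_le_one k hx)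
    (χ := cutoff) measurable_cutoff cutoff_nonneg (by rw [E1]; exact i1)
  have h2 := integral_orthant_homogeneous (n := n)
    (G := fun x => (∑ i, x i ^ (k + 1)) * e.density x)
    (h := (k + 1 : ℕ) + e.deg (n + 1)) (by fun_prop) (fun s hs x => by
      rw [e.density_smul hs, Real.rpow_add hs, Real.rpow_natCast]
      simp only [Pi.smul_apply, smul_eq_mul, mul_pow, ← Finset.mul_sum]; ring)
    (e.integrable_mul_density (c := 1) (by fun_prop) fun x hx => by
      rw [abs_of_nonneg (Finset.sum_nonneg fun i _ => pow_nonneg (hx.1 i) _), ← hx.2]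
      exact Finset.sum_le_sum fun i _ => pow_le_of_le_one (hx.1 i) (hx.le_one i) (by omega))
    (χ := fun s => 2 * max (1 - s) 0) (by fun_prop) (fun s => by positivity)
    (by rw [E2]; exact i2)
  rw [E1, ← hJdef] at h1
  rw [E2, hJ] at h2
  obtain ⟨h3, -⟩ := loop_equation (d := n + 1) e.expo_le_one hk
  have hae : (openOrthant (n + 1) : Set (Fin (n + 1) → ℝ)) =ᵐ[volume] orthant (n + 1) := by
    filter_upwards [ae_ne_zero (n + 1)] with x hx
    refine propext ⟨fun h i => (h i).le, fun h i => lt_of_le_of_ne (h i) (hx i).symm⟩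
  rw [setIntegral_congr_set hae] at h3
  simp only [e.wgt_expo] at h3
  rw [integral_sub h1.2 h2.2, h1.1, h2.1] at h3
  have h4 : ∫ x, loopPoly e.expo k x * e.density x ∂(simplexMeasure (n + 1)) =
      (D + k) * ∫ x, (∑ i, x i ^ (k + 1)) * e.density x ∂(simplexMeasure (n + 1)) := by
    have := hJ0.ne'
    apply mul_right_cancel₀ this
    linarith
  rw [e.integral_specLaw, e.integral_specLaw, h4]
  ring

lemma sum_pairs {d : ℕ} (f : Fin d → Fin d → ℝ) :
    ∑ p ∈ pairs d, (f p.1 p.2 + f p.2 p.1) = ∑ i, ∑ j, f i j - ∑ i, f i i := by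
  have h1 : ∀ g : Fin d → Fin d → ℝ, ∑ p ∈ pairs d, g p.1 p.2 =
      ∑ i, ∑ j, if i < j then g i j else 0 := by
    intro g
    rw [pairs, Finset.sum_filter, Fintype.sum_prod_type]
  rw [Finset.sum_add_distrib, h1 f, h1 fun i j => f j i, Finset.sum_comm (f := fun i j : Fin d =>
    if i < j then f j i else 0), ← Finset.sum_add_distrib, ← Finset.sum_sub_distrib]
  refine Finset.sum_congr rfl fun i _ => ?_
  have h2 : f i i = ∑ j, if i = j then f i j else 0 := by simp
  rw [h2, ← Finset.sum_add_distrib, ← Finset.sum_sub_distrib]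
  refine Finset.sum_congr rfl fun j _ => ?_
  rcases lt_trichotomy i j with h | h | h
  · simp [h, h.not_gt, h.ne]
  · simp [h]
  · simp [h, h.not_gt, h.ne']

/-- The density itself vanishes at coincidences. This permits `loopPoly`, whose quotients carry a
default value at coinciding eigenvalues, to be simplified almost surely. -/
lemma StateEnsemble.ae_specLaw_ne (e : StateEnsemble) (d : ℕ) :
    ∀ᵐ x ∂(e.specLaw d), ∀ p ∈ pairs d, x p.1 ≠ x p.2 := by
  have h : ∀ᵐ x ∂(e.spec d), ∀ p ∈ pairs d, x p.1 ≠ x p.2 := by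
    unfold spec
    rw [ae_withDensity_iff e.measurable_density.ennreal_ofReal]
    refine Filter.Eventually.of_forall fun x hx p hp heq => hx ?_
    rw [density_eq, Finset.prod_eq_zero hp, mul_zero, ENNReal.ofReal_zero]
    rw [wgt2, heq, sub_self]; simp
  exact Measure.ae_smul_measure h _

lemma sum_pairs_add_pow {d : ℕ} (x : Fin d → ℝ) (k : ℕ) :
    ∑ p ∈ pairs d, (x p.1 ^ k + x p.2 ^ k) = (d - 1) * ∑ i, x i ^ k := by
  rw [sum_pairs fun i _ => x i ^ k]
  simp only [Finset.sum_const, Finset.card_univ, Fintype.card_fin, nsmul_eq_mul]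
  rw [← Finset.mul_sum]; ring

lemma sum_pairs_mul {d : ℕ} (x : Fin d → ℝ) :
    ∑ p ∈ pairs d, (x p.1 * x p.2) = ((∑ i, x i) ^ 2 - ∑ i, x i ^ 2) / 2 := by
  have h := sum_pairs fun i j => x i * x j
  have h1 : ∑ p ∈ pairs d, (x p.1 * x p.2 + x p.2 * x p.1) = 2 * ∑ p ∈ pairs d, x p.1 * x p.2 := by
    rw [Finset.mul_sum]; exact Finset.sum_congr rfl fun p _ => by ring
  rw [h1] at h
  have h2 : ∑ i, ∑ j, x i * x j = (∑ i, x i) ^ 2 := by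
    rw [sq, Finset.sum_mul_sum]
  rw [h2] at h
  simp only [← sq] at h
  linarith

/-- For k = 1 the divided difference is 2(x + y), but the Bures term (x² + y²)/(x + y) is not a
polynomial; it is only known to lie between 0 and x + y. Hence two bounds instead of a formula. -/
lemma loopPoly_one_bounds {d : ℕ} {σ : ℕ} (hσ : σ ≤ 1) {x : Fin d → ℝ} (hx : IsSpectrum x)
    (hne : ∀ p ∈ pairs d, x p.1 ≠ x p.2) :
    (2 - σ / 2) + (2 - σ) * (d - 1) ≤ loopPoly σ 1 x ∧ loopPoly σ 1 x ≤ 2 * d := by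
  have hσ' : (σ : ℝ) ≤ 1 := by exact_mod_cast hσ
  have hσ0 : (0 : ℝ) ≤ σ := Nat.cast_nonneg _
  have h1 : ∀ p ∈ pairs d, (2 - σ) * (x p.1 ^ 1 + x p.2 ^ 1) ≤
      (x p.1 ^ (1 + 1) - x p.2 ^ (1 + 1)) * (2 / (x p.1 - x p.2)) -
      σ * ((x p.1 ^ (1 + 1) + x p.2 ^ (1 + 1)) / (x p.1 + x p.2)) ∧
      (x p.1 ^ (1 + 1) - x p.2 ^ (1 + 1)) * (2 / (x p.1 - x p.2)) -
      σ * ((x p.1 ^ (1 + 1) + x p.2 ^ (1 + 1)) / (x p.1 + x p.2)) ≤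
      2 * (x p.1 ^ 1 + x p.2 ^ 1) := by
    intro p hp
    have ha := hx.1 p.1
    have hb := hx.1 p.2
    have hn := sub_ne_zero.mpr (hne p hp)
    have e1 : (x p.1 ^ (1 + 1) - x p.2 ^ (1 + 1)) * (2 / (x p.1 - x p.2)) =
        2 * (x p.1 + x p.2) := by field_simp; ring
    have e2 : (x p.1 ^ (1 + 1) + x p.2 ^ (1 + 1)) / (x p.1 + x p.2) ≤ x p.1 + x p.2 :=
      div_le_of_le_mul₀ (by positivity) (by positivity) (by rw [one_add_one_eq_two]; nlinarith [mul_nonneg ha hb])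
    have e3 : 0 ≤ (x p.1 ^ (1 + 1) + x p.2 ^ (1 + 1)) / (x p.1 + x p.2) := by positivity
    rw [e1, pow_one, pow_one]
    constructor <;> nlinarith
  have h2 := Finset.sum_le_sum fun p hp => (h1 p hp).1
  have h3 := Finset.sum_le_sum fun p hp => (h1 p hp).2
  rw [← Finset.mul_sum, sum_pairs_add_pow] at h2 h3
  simp only [pow_one, hx.2] at h2 h3
  unfold loopPoly
  simp only [pow_one, hx.2, Nat.cast_one]
  constructor
  · linarith
  · linarith

/-- For k = 2 the Bures quotient (x³ + y³)/(x + y) = x² - xy + y² is a polynomial, so the right-hand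
side closes on the purity. -/
lemma loopPoly_two {d : ℕ} (σ : ℕ) {x : Fin d → ℝ} (hx : IsSpectrum x)
    (hne : ∀ p ∈ pairs d, x p.1 ≠ x p.2) :
    loopPoly σ 2 x = (2 - σ) * d * ∑ i, x i ^ 2 + (1 + σ / 2) := by
  have h1 : ∀ p ∈ pairs d, (x p.1 ^ (2 + 1) - x p.2 ^ (2 + 1)) * (2 / (x p.1 - x p.2)) -
      σ * ((x p.1 ^ (2 + 1) + x p.2 ^ (2 + 1)) / (x p.1 + x p.2)) =
      (2 - σ) * (x p.1 ^ 2 + x p.2 ^ 2) + (2 + σ) * (x p.1 * x p.2) := by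
    intro p hp
    have ha := hx.1 p.1
    have hb := hx.1 p.2
    have hn := sub_ne_zero.mpr (hne p hp)
    have hs : x p.1 + x p.2 ≠ 0 := by
      intro h
      have h1 : x p.1 = 0 := by linarith
      have h2 : x p.2 = 0 := by linarith
      exact hne p hp (h1.trans h2.symm)
    field_simp
    ring
  unfold loopPoly
  rw [Finset.sum_congr rfl h1, Finset.sum_add_distrib, ← Finset.mul_sum, ← Finset.mul_sum,
    sum_pairs_add_pow, sum_pairs_mul, hx.2]
  push_cast
  ring

lemma IsSpectrum.sum_pow_le_one {d : ℕ} {x : Fin d → ℝ} (hx : IsSpectrum x) {k : ℕ} (hk : k ≠ 0) :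
    ∑ i, x i ^ k ≤ 1 := by
  rw [← hx.2]
  exact Finset.sum_le_sum fun i _ => pow_le_of_le_one (hx.1 i) (hx.le_one i) hk

lemma StateEnsemble.integrable_specLaw (e : StateEnsemble) {d : ℕ} (hd : 1 ≤ d)
    {f : (Fin d → ℝ) → ℝ} (hf : Measurable f) {c : ℝ} (hc : ∀ x, IsSpectrum x → |f x| ≤ c) :
    Integrable f (e.specLaw d) := by
  have := e.isProbabilityMeasure_specLaw hd
  refine Integrable.of_bound hf.aestronglyMeasurable c ?_
  filter_upwards [e.ae_specLaw d] with x hx using hc x hx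

lemma StateEnsemble.integrable_sum_pow (e : StateEnsemble) {d : ℕ} (hd : 1 ≤ d) {k : ℕ}
    (hk : k ≠ 0) : Integrable (fun x : Fin d → ℝ => ∑ i, x i ^ k) (e.specLaw d) := by
  refine e.integrable_specLaw hd (by fun_prop) (c := 1) fun x hx => ?_
  rw [abs_of_nonneg (Finset.sum_nonneg fun i _ => pow_nonneg (hx.1 i) _)]
  exact hx.sum_pow_le_one hk

/-- The loop equation with k = 1, solved for the mean of Σ x_i². The first bound enters the mean
flatness with a negative coefficient, so its leading value 2 matters; of the second only the order
1/d is needed. -/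
theorem StateEnsemble.purity_bounds (e : StateEnsemble) {d : ℕ} (hd : 1 ≤ d) :
    2 - 3 / d ≤ d * ∫ x, (∑ i, x i ^ 2) ∂(e.specLaw d) ∧
      ∫ x, (∑ i, x i ^ 2) ∂(e.specLaw d) ≤ 4 / d := by
  have := e.isProbabilityMeasure_specLaw hd
  obtain ⟨n, rfl⟩ := Nat.exists_eq_add_of_le' hd
  have hloop := e.loop_moment (n := n) (k := 1) le_rfl
  set P := ∫ x, (∑ i, x i ^ 2) ∂(e.specLaw (n + 1)) with hP
  have hli : Integrable (loopPoly e.expo 1) (e.specLaw (n + 1)) :=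
    e.integrable_specLaw hd (measurable_loopPoly _ _) fun x hx =>
      abs_loopPoly_le e.expo_le_one 1 hx
  have hb : ∀ᵐ x ∂(e.specLaw (n + 1)), (2 - e.expo / 2 : ℝ) + (2 - e.expo) * ((n + 1 : ℕ) - 1) ≤
      loopPoly e.expo 1 x ∧ loopPoly e.expo 1 x ≤ 2 * (n + 1 : ℕ) := by
    filter_upwards [e.ae_specLaw _, e.ae_specLaw_ne _] with x hx hne using
      loopPoly_one_bounds e.expo_le_one hx hne
  have hlow := integral_mono_ae (integrable_const _) hli (hb.mono fun x hx => hx.1)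
  have hupp := integral_mono_ae hli (integrable_const _) (hb.mono fun x hx => hx.2)
  rw [integral_const, probReal_univ, one_smul] at hlow hupp
  rw [← hloop] at hlow hupp
  have hσ1 : (e.expo : ℝ) ≤ 1 := by exact_mod_cast e.expo_le_one
  have hσ0 : (0 : ℝ) ≤ e.expo := Nat.cast_nonneg _
  have hP0 : 0 ≤ P := integral_nonneg fun x => Finset.sum_nonneg fun i _ => sq_nonneg _
  set d : ℝ := ((n + 1 : ℕ) : ℝ) with hdd
  have hd1 : (1 : ℝ) ≤ d := by rw [hdd]; exact_mod_cast hd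
  rw [Nat.cast_one] at hlow hupp
  constructor
  -- Since 2 - σ ≥ 1, it can be factored out of d²(2 - σ)/2 + 1 at the price of an upper bound;
  -- cancelling it makes the estimate the same for both ensembles.
  · have h1 : (2 - e.expo : ℝ) * (d - 1) ≤ (2 - e.expo) * (d ^ 2 / 2 + 1) * P := by
      have : (d ^ 2 * (2 - e.expo) / 2 + 1) * P ≤ (2 - e.expo) * (d ^ 2 / 2 + 1) * P := by
        refine mul_le_mul_of_nonneg_right ?_ hP0
        nlinarith
      have h2 : (0 : ℝ) ≤ 2 - e.expo / 2 := by linarith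
      linarith
    have h2 : d - 1 ≤ (d ^ 2 / 2 + 1) * P := by
      rw [mul_assoc] at h1
      exact le_of_mul_le_mul_left h1 (by linarith)
    have h3 : 2 - 3 / d ≤ d * ((d - 1) / (d ^ 2 / 2 + 1)) := by
      have hd0 : 0 < d := by linarith
      rw [mul_div_assoc', le_div_iff₀ (by positivity)]
      have e : (2 - 3 / d) * (d ^ 2 / 2 + 1) = d ^ 2 + 2 - 3 * d / 2 - 3 / d := by
        field_simp
        ring
      rw [e]
      have : 2 - d / 2 ≤ 3 / d := by
        rw [le_div_iff₀ hd0]; nlinarith [sq_nonneg (d - 2)]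
      nlinarith
    refine h3.trans (mul_le_mul_of_nonneg_left ?_ (by linarith))
    rw [div_le_iff₀ (by positivity)]
    linarith
  · rw [le_div_iff₀ (by linarith)]
    have h1 := e.half_sq_le (n + 1)
    rw [← hdd] at h1
    have h2 : d ^ 2 / 2 * P ≤ 2 * d := by nlinarith
    have h3 : d * (P * d) ≤ d * 4 := by nlinarith
    exact le_of_mul_le_mul_left h3 (by linarith)

/-- The loop equation with k = 2 is a linear recursion from the mean of Σ x_i³ to the mean purity.
-/
theorem StateEnsemble.third_moment_le (e : StateEnsemble) {d : ℕ} (hd : 1 ≤ d) :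
    (d : ℝ) ^ 2 * ∫ x, (∑ i, x i ^ 3) ∂(e.specLaw d) ≤
      2 * (d * ∫ x, (∑ i, x i ^ 2) ∂(e.specLaw d)) + 3 := by
  have := e.isProbabilityMeasure_specLaw hd
  obtain ⟨n, rfl⟩ := Nat.exists_eq_add_of_le' hd
  have hloop := e.loop_moment (n := n) (k := 2) (by norm_num)
  have h1 : ∫ x, loopPoly e.expo 2 x ∂(e.specLaw (n + 1)) =
      (2 - e.expo) * (n + 1 : ℕ) * ∫ x, (∑ i, x i ^ 2) ∂(e.specLaw (n + 1)) + (1 + e.expo / 2) := by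
    rw [← integral_const_mul]
    have : (1 + e.expo / 2 : ℝ) = ∫ _x, (1 + e.expo / 2 : ℝ) ∂(e.specLaw (n + 1)) := by simp
    rw [this, ← integral_add ((e.integrable_sum_pow hd (by norm_num)).const_mul _)
      (integrable_const _)]
    refine integral_congr_ae ?_
    filter_upwards [e.ae_specLaw _, e.ae_specLaw_ne _] with x hx hne using loopPoly_two _ hx hne
  rw [h1] at hloop
  set P := ∫ x, (∑ i, x i ^ 2) ∂(e.specLaw (n + 1)) with hP
  have hQe : ∫ x, (∑ i, x i ^ (2 + 1)) ∂(e.specLaw (n + 1)) =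
    ∫ x, (∑ i, x i ^ 3) ∂(e.specLaw (n + 1)) := rfl
  rw [hQe] at hloop
  set Q := ∫ x, (∑ i, x i ^ 3) ∂(e.specLaw (n + 1)) with hQ
  have hQ0 : 0 ≤ Q := integral_nonneg_of_ae (by
    filter_upwards [e.ae_specLaw _] with x hx using
      Finset.sum_nonneg fun i _ => pow_nonneg (hx.1 i) _)
  have hσ1 : (e.expo : ℝ) ≤ 1 := by exact_mod_cast e.expo_le_one
  have hσ0 : (0 : ℝ) ≤ e.expo := Nat.cast_nonneg _
  set d : ℝ := ((n + 1 : ℕ) : ℝ) with hdd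
  push_cast at hloop
  -- The constant 3 is the smallest with 2 + σ ≤ 3(2 - σ) for σ = 1; for σ = 0 there is room to
  -- spare.
  have h2 : (2 - e.expo : ℝ) * (d ^ 2 * Q) ≤ (2 - e.expo) * (2 * (d * P) + 3) := by
    nlinarith
  exact le_of_mul_le_mul_left h2 (by linarith)

/-- With u = 2v² the difference of the two sides is a multiple of (v - 1)⁴ (v² + 4v + 5), a contact
of fourth order at u = 2. The quadratic coefficient is negative, so a lower bound on the second
moment together with upper bounds on the first and third bounds the mean of a square root below its
Jensen bound. The same cubic serves for the spectra and for the phase sums. -/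
lemma sqrt_le_cubic {u : ℝ} (hu : 0 ≤ u) :
    √u ≤ √2 / 16 * (5 + 15 / 2 * u - 5 / 4 * u ^ 2 + u ^ 3 / 8) := by
  set v := √(u / 2) with hv
  have hu2 : u = 2 * v ^ 2 := by rw [hv, Real.sq_sqrt (by positivity)]; ring
  have hsu : √u = √2 * v := by rw [hv, ← Real.sqrt_mul zero_le_two]; congr 1; ring
  have hv0 : 0 ≤ v := Real.sqrt_nonneg _
  have key : 0 ≤ √2 / 16 * ((v - 1) ^ 4 * (v ^ 2 + 4 * v + 5)) := by positivity
  rw [hsu, hu2]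
  have e : √2 / 16 * (5 + 15 / 2 * (2 * v ^ 2) - 5 / 4 * (2 * v ^ 2) ^ 2 + (2 * v ^ 2) ^ 3 / 8) -
      √2 * v = √2 / 16 * ((v - 1) ^ 4 * (v ^ 2 + 4 * v + 5)) := by ring
  linarith

lemma siteFlatness_le {d : ℕ} (hd : 1 ≤ d) {x : Fin d → ℝ} (hx : IsSpectrum x) :
    siteFlatness x ≤ √2 / 16 * (25 / 2 - 5 / 4 * (d * ∑ i, x i ^ 2) +
      d ^ 2 * (∑ i, x i ^ 3) / 8) := by
  have hd0 : (0 : ℝ) < d := by exact_mod_cast hd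
  have h1 : ∀ i, √(x i / d) = √(d * x i) / d := by
    intro i
    have : x i / d = d * x i / d ^ 2 := by field_simp
    rw [this, Real.sqrt_div' _ (by positivity), Real.sqrt_sq hd0.le]
  unfold siteFlatness
  calc ∑ i, √(x i / d) = ∑ i, √(d * x i) / d := Finset.sum_congr rfl fun i _ => h1 i
    _ ≤ ∑ i, √2 / 16 * (5 + 15 / 2 * (d * x i) - 5 / 4 * (d * x i) ^ 2 + (d * x i) ^ 3 / 8) / d :=
        Finset.sum_le_sum fun i _ => div_le_div_of_nonneg_right
          (sqrt_le_cubic (mul_nonneg hd0.le (hx.1 i))) hd0.le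
    _ = ∑ i, √2 / 16 * (5 / d + 15 / 2 * x i - 5 / 4 * (d * x i ^ 2) + d ^ 2 * x i ^ 3 / 8) :=
        Finset.sum_congr rfl fun i _ => by field_simp
    _ = _ := by
        rw [← Finset.mul_sum, Finset.sum_add_distrib, Finset.sum_sub_distrib,
          Finset.sum_add_distrib]
        simp only [← Finset.sum_div, ← Finset.mul_sum]
        rw [hx.2, Finset.sum_const, Finset.card_univ, Fintype.card_fin, nsmul_eq_mul]
        field_simp
        ring

lemma siteFlatness_le_one {d : ℕ} {x : Fin d → ℝ} (hx : IsSpectrum x) : siteFlatness x ≤ 1 := by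
  unfold siteFlatness
  have h := Real.sum_sqrt_mul_sqrt_le Finset.univ (f := x) (g := fun _ => 1 / (d : ℝ)) hx.1
    (fun _ => by positivity)
  have h1 : ∑ _i : Fin d, 1 / (d : ℝ) ≤ 1 := by
    rw [Finset.sum_const, Finset.card_univ, Fintype.card_fin, nsmul_eq_mul, mul_one_div]
    exact div_self_le_one _
  calc ∑ i, √(x i / d) = ∑ i, √(x i) * √(1 / (d : ℝ)) :=
        Finset.sum_congr rfl fun i _ => by rw [← Real.sqrt_mul (hx.1 i), mul_one_div]
    _ ≤ _ := h
    _ ≤ 1 * 1 := by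
        rw [hx.2, Real.sqrt_one]
        gcongr
        exact Real.sqrt_le_one.mpr h1
    _ = 1 := one_mul 1

/-- With m₂ the mean of d Σ x_i² and m₃ ≤ 2m₂ + 3, the cubic gives 25/2 - 5m₂/4 + m₃/8 ≤ 103/8 - m₂,
and m₂ ≥ 2 - 3/d leaves 87/8 + 3/d. For large d the bound is about 0.961; only its being below one
matters. -/
theorem StateEnsemble.integral_siteFlatness_le (e : StateEnsemble) {d : ℕ} (hd : 1 ≤ d) :
    ∫ x, siteFlatness x ∂(e.specLaw d) ≤ √2 / 16 * (87 / 8 + 3 / d) := by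
  have := e.isProbabilityMeasure_specLaw hd
  have i2 := (e.integrable_sum_pow hd (two_ne_zero)).const_mul (d : ℝ) |>.const_mul (5 / 4)
  have i3 := ((e.integrable_sum_pow hd (three_ne_zero)).const_mul ((d : ℝ) ^ 2)).div_const 8
  have h0 : Integrable (siteFlatness : (Fin d → ℝ) → ℝ) (e.specLaw d) :=
    e.integrable_specLaw hd (by unfold siteFlatness; fun_prop) (c := 1) fun x hx => by
      rw [abs_of_nonneg (siteFlatness_nonneg x)]; exact siteFlatness_le_one hx
  have h1 := integral_mono_ae h0 ((((integrable_const (25 / 2 : ℝ)).sub i2).add i3).const_mul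
    (√2 / 16)) ((e.ae_specLaw d).mono fun x hx => siteFlatness_le hd hx)
  refine h1.trans ?_
  rw [integral_const_mul]
  have h2 := integral_add ((integrable_const (25 / 2 : ℝ)).sub i2) i3
  have h3 := integral_sub (integrable_const (25 / 2 : ℝ)) i2
  simp only [Pi.add_apply, Pi.sub_apply] at h2 h3 ⊢
  rw [h2, h3, integral_const, probReal_univ, one_smul, integral_const_mul, integral_const_mul,
    integral_div, integral_const_mul]
  have h4 := e.third_moment_le hd
  have h5 := (e.purity_bounds hd).1
  have h6 : (0 : ℝ) ≤ √2 / 16 := by positivity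
  refine mul_le_mul_of_nonneg_left ?_ h6
  linarith

end SpectralMoments

/-! ### Measurability of ε_SBS, its range [0, 1], and the tail bound. -/

section Concentration

variable {dS d Nuno M Nmac : ℕ}

lemma posSemidef_tensorPower {α ι : Type*} [Fintype α] [DecidableEq α] [Fintype ι] [DecidableEq ι]
    {ρ : α → Matrix ι ι ℂ}
    (h : ∀ k, (ρ k).PosSemidef) : (tensorPower ρ).PosSemidef := by
  choose Y hY using fun k => (h k).exists_mul_conjTranspose
  have : tensorPower ρ = tensorPower Y * (tensorPower Y)ᴴ := by
    rw [tensorPower_conjTranspose, tensorPower_mul]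
    congr 1; ext1 k; exact hY k
  rw [this]
  exact Matrix.posSemidef_self_mul_conjTranspose _

lemma trace_tensorPower {α ι : Type*} [Fintype α] [DecidableEq α] [Fintype ι]
    (ρ : α → Matrix ι ι ℂ) : (tensorPower ρ).trace = ∏ k, (ρ k).trace := by
  classical
  unfold Matrix.trace
  rw [Finset.prod_univ_sum, Fintype.piFinset_univ]
  rfl

lemma trace_ketBra (A : SpectralData dS) (a b : Fin dS) :
    (ketBra A a b).trace = if a = b then 1 else 0 := by
  have h := congrFun (congrFun (unitary_conjTranspose_mul A.2) b) a
  rw [Matrix.mul_apply, Matrix.one_apply] at h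
  have h2 : (ketBra A a b).trace = ∑ i, (A.2 : Matrix (Fin dS) (Fin dS) ℂ)ᴴ b i * A.2.1 i a :=
    Finset.sum_congr rfl fun i _ => mul_comm _ _
  rw [h2, h]
  simp [eq_comm]

lemma isState_reducedState {ω : Sample dS d Nuno M Nmac} (hω : ∀ k, IsSpectrum (ω.2.2 k).1)
    {ρS : Matrix (Fin dS) (Fin dS) ℂ} (hρ : IsState ρS) (t : ℝ) :
    IsState (reducedState ρS ω t) := by
  constructor
  · have h1 : (totalState ρS ω t).PosSemidef :=
      (hρ.1.kronecker (posSemidef_tensorPower fun k => (hω k).isState.1)).mul_mul_conjTranspose_same _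
    have h2 : reducedState ρS ω t = ∑ z : Fin Nuno → Fin d, (totalState ρS ω t).submatrix
        (fun ix : Fin dS × (ObsLabel M Nmac → Fin d) => (ix.1, Sum.elim z ix.2))
        (fun ix => (ix.1, Sum.elim z ix.2)) := by
      ext ix jy
      rw [Matrix.sum_apply]
      rfl
    rw [h2]
    exact Matrix.posSemidef_sum _ fun z _ => h1.submatrix _
  · rw [reducedState_eq, Matrix.trace_sum]
    have h3 : ∀ a, (∑ b, (pointerEntry ω.1 ρS a b * decoherence ω t a b) •
      Matrix.kronecker (ketBra ω.1 a b)
        (tensorPower fun k : ObsLabel M Nmac => branch ω t a b (Sum.inr k))).trace =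
        ((pointerProb ω.1 ρS a : ℝ) : ℂ) := by
      intro a
      rw [Matrix.trace_sum, Finset.sum_eq_single a]
      · rw [Matrix.trace_smul, Matrix.kronecker, Matrix.trace_kronecker, trace_ketBra, if_pos rfl,
          trace_tensorPower, Finset.prod_eq_one fun k _ => (isState_branch hω t a _).2,
          (pointerEntry_self_eq ω.1 hρ a).2, decoherence,
          Finset.prod_eq_one fun k _ => (isState_branch hω t a _).2]
        simp
      · intro b _ hb
        rw [Matrix.trace_smul, Matrix.kronecker, Matrix.trace_kronecker, trace_ketBra,
          if_neg hb.symm, zero_mul, smul_zero]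
      · simp
    rw [Finset.sum_congr rfl fun a _ => h3 a, ← Complex.ofReal_sum, sum_pointerProb ω.1 hρ,
      Complex.ofReal_one]

/-- The families of macrofraction states that define a spectrum broadcast structure. -/
def SBSFamily (dS d M Nmac : ℕ) : Type :=
  {ρ : Fin dS → Fin M → Matrix (Fin Nmac → Fin d) (Fin Nmac → Fin d) ℂ //
    (∀ a m, IsState (ρ a m)) ∧ ∀ a a', a ≠ a' → ∀ m, ρ a m * ρ a' m = 0}

/-- Only existence is wanted here, and `exists_orthogonal_states` supplies it when applied to the
uniform spectrum. -/
lemma nonempty_SBSFamily (hdS : 1 ≤ dS) (hd : dS ≤ d ^ Nmac) :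
    Nonempty (SBSFamily dS d M Nmac) := by
  have hc : Fintype.card (Fin Nmac → Fin d) = d ^ Nmac := by simp
  have hpos : (0 : ℝ) < Fintype.card (Fin Nmac → Fin d) := by
    rw [hc]; exact_mod_cast lt_of_lt_of_le hdS hd
  obtain ⟨σ, h1, h2, -⟩ := exists_orthogonal_states (ι := Fin Nmac → Fin d) (n := dS)
    (x := fun _ => 1 / (Fintype.card (Fin Nmac → Fin d) : ℝ)) (R := fun _ => 1) hdS
    (by rw [hc]; exact hd) (fun _ => by positivity)
    (by rw [Finset.sum_const, Finset.card_univ, nsmul_eq_mul, mul_one_div, div_self hpos.ne'])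
    (fun _ => one_mem _)
  exact ⟨⟨fun a _ => σ a, fun a _ => h1 a, fun a a' haa _ => h2 a a' haa⟩⟩

/-- The trace distance to a given spectrum broadcast structure. -/
def sbsDist (ρS : Matrix (Fin dS) (Fin dS) ℂ) (t : ℝ) (f : SBSFamily dS d M Nmac)
    (ω : Sample dS d Nuno M Nmac) : ℝ :=
  1 / 2 * traceNorm (reducedState ρS ω t - sbsState ω.1 (pointerProb ω.1 ρS) f.1)

/-- Structures are parametrised by their macrofraction states alone, with the eigenbasis of A and
the p_a inserted afterwards. The index set of the infimum then no longer depends on the sample, as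
measurability requires. -/
lemma epsSBS_eq_iInf (ρS : Matrix (Fin dS) (Fin dS) ℂ) (t : ℝ) (ω : Sample dS d Nuno M Nmac) :
    epsSBS ρS t ω = ⨅ f : SBSFamily dS d M Nmac, sbsDist ρS t f ω := by
  unfold epsSBS iInf
  congr 1
  ext r
  constructor
  · rintro ⟨σ, ⟨ρ, h1, h2, h3⟩, rfl⟩
    refine ⟨⟨ρ, h1, h2⟩, ?_⟩
    have : σ = sbsState ω.1 (pointerProb ω.1 ρS) ρ := by
      ext ⟨i, x⟩ ⟨j, y⟩
      rw [h3, sbsState_apply]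
    rw [this]; rfl
  · rintro ⟨f, rfl⟩
    exact ⟨_, ⟨f.1, f.2.1, f.2.2, fun i x j y => sbsState_apply _ _ _ _ _ _ _⟩, rfl⟩

lemma sbsDist_nonneg (ρS : Matrix (Fin dS) (Fin dS) ℂ) (t : ℝ) (f : SBSFamily dS d M Nmac)
    (ω : Sample dS d Nuno M Nmac) : 0 ≤ sbsDist ρS t f ω :=
  mul_nonneg (by norm_num) (traceNorm_nonneg _)

lemma sbsDist_le_one {ω : Sample dS d Nuno M Nmac} (hω : ∀ k, IsSpectrum (ω.2.2 k).1)
    {ρS : Matrix (Fin dS) (Fin dS) ℂ} (hρ : IsState ρS) (t : ℝ) (f : SBSFamily dS d M Nmac) :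
    sbsDist ρS t f ω ≤ 1 := by
  have h1 := (isState_reducedState hω hρ t).traceNorm_le_one
  have hp : ∀ a, 0 ≤ pointerProb ω.1 ρS a := fun a => (pointerEntry_self_eq ω.1 hρ a).1
  have h2 : traceNorm (sbsState ω.1 (pointerProb ω.1 ρS) f.1) ≤ 1 := by
    refine (traceNorm_sum_le _ _).trans ?_
    rw [← sum_pointerProb ω.1 hρ]
    refine Finset.sum_le_sum fun a _ => (traceNorm_smul_le _ _).trans ?_
    rw [Complex.norm_real, Real.norm_eq_abs, abs_of_nonneg (hp a)]
    refine mul_le_of_le_one_right (hp a) ((traceNorm_kronecker_le _ _).trans ?_)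
    refine mul_le_one₀ (traceNorm_ketBra_le ω.1 a a) (traceNorm_nonneg _) ?_
    exact (traceNorm_macroTensor_le _).trans
      (Finset.prod_le_one (fun _ _ => traceNorm_nonneg _) fun m _ => (f.2.1 a m).traceNorm_le_one)
  have h3 := traceNorm_sub_le (reducedState ρS ω t) (sbsState ω.1 (pointerProb ω.1 ρS) f.1)
  unfold sbsDist
  linarith

lemma continuous_unitary_coe : Continuous fun U : Matrix.unitaryGroup (Fin d) ℂ =>
    (U : Matrix (Fin d) (Fin d) ℂ) := continuous_subtype_val

lemma continuous_toMatrix : Continuous (SpectralData.toMatrix : SpectralData d → _) := by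
  have := continuous_unitary_coe (d := d)
  unfold SpectralData.toMatrix
  fun_prop

lemma continuous_siteU : Continuous fun q : ℝ × SpectralData d => siteU q.1 q.2 := by
  have := continuous_unitary_coe (d := d)
  unfold siteU
  fun_prop

lemma continuous_branch (t : ℝ) (a b : Fin dS) (k : EnvLabel Nuno M Nmac) :
    Continuous fun ω : Sample dS d Nuno M Nmac => branch ω t a b k := by
  have h1 := continuous_toMatrix (d := d)
  have h2 : ∀ a : Fin dS, Continuous fun ω : Sample dS d Nuno M Nmac =>
      siteU (t * ω.1.1 a) (ω.2.1 k) := fun a =>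
    continuous_siteU.comp (f := fun ω : Sample dS d Nuno M Nmac => (t * ω.1.1 a, ω.2.1 k))
      (by fun_prop)
  have h3 := h2 a
  have h4 := h2 b
  have h5 : Continuous fun ω : Sample dS d Nuno M Nmac => (ω.2.2 k).toMatrix :=
    h1.comp (by fun_prop)
  unfold branch
  fun_prop

lemma continuous_sbsDist (ρS : Matrix (Fin dS) (Fin dS) ℂ) (t : ℝ) (f : SBSFamily dS d M Nmac) :
    Continuous (sbsDist ρS t f : Sample dS d Nuno M Nmac → ℝ) := by
  have hU : Continuous fun ω : Sample dS d Nuno M Nmac => (ω.1.2 : Matrix (Fin dS) (Fin dS) ℂ) :=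
    continuous_unitary_coe.comp (by fun_prop)
  have hUe : ∀ i j, Continuous fun ω : Sample dS d Nuno M Nmac =>
      (ω.1.2 : Matrix (Fin dS) (Fin dS) ℂ) i j := fun i j => hU.matrix_elem i j
  have hb : ∀ a b k i j, Continuous fun ω : Sample dS d Nuno M Nmac => branch ω t a b k i j :=
    fun a b k i j => (continuous_branch t a b k).matrix_elem i j
  have hp : ∀ a, Continuous fun ω : Sample dS d Nuno M Nmac => pointerProb ω.1 ρS a := fun a => by
    have h1 : Continuous fun ω : Sample dS d Nuno M Nmac => pointer ω.1 a :=
      continuous_matrix fun i j => (hUe i a).mul (continuous_star.comp (hUe j a))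
    exact Complex.continuous_re.comp (h1.matrix_mul continuous_const).matrix_trace
  have he : ∀ a b, Continuous fun ω : Sample dS d Nuno M Nmac => pointerEntry ω.1 ρS a b :=
    fun a b => by unfold pointerEntry; exact Continuous.matrix_elem (by fun_prop) a b
  have hd : ∀ a b, Continuous fun ω : Sample dS d Nuno M Nmac => decoherence ω t a b :=
    fun a b => 
    continuous_finsetProd _ fun k _ => (continuous_branch t a b _).matrix_trace
  have hX : Continuous fun ω : Sample dS d Nuno M Nmac =>
      reducedState ρS ω t - sbsState ω.1 (pointerProb ω.1 ρS) f.1 := by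
    refine continuous_matrix fun ix jy => ?_
    obtain ⟨i, x⟩ := ix
    obtain ⟨j, y⟩ := jy
    simp only [Matrix.sub_apply, reducedState_eq, Matrix.sum_apply, Matrix.smul_apply,
      Matrix.kronecker, Matrix.kroneckerMap_apply, smul_eq_mul, sbsState_apply, tensorPower]
    refine Continuous.sub (continuous_finsetSum _ fun a _ => continuous_finsetSum _ fun b _ => ?_)
      (continuous_finsetSum _ fun a _ => ?_)
    · exact ((he a b).mul (hd a b)).mul (((hUe i a).mul (continuous_star.comp (hUe j b))).mul
        (continuous_finsetProd _ fun k _ => hb a b _ _ _))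
    · exact ((Complex.continuous_ofReal.comp (hp a)).mul
        ((hUe i a).mul (continuous_star.comp (hUe j a)))).mul continuous_const
  unfold sbsDist
  exact continuous_const.mul (continuous_traceNorm.comp hX)

/-- An infimum of continuous functions is upper semicontinuous: its strict sublevel sets are unions
of open sets, even though the family is uncountable. -/
lemma measurable_epsSBS (hdS : 1 ≤ dS) (hd : dS ≤ d ^ Nmac) (ρS : Matrix (Fin dS) (Fin dS) ℂ)
    (t : ℝ) : Measurable (epsSBS ρS t : Sample dS d Nuno M Nmac → ℝ) := by
  have := nonempty_SBSFamily (M := M) hdS hd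
  refine measurable_of_Iio fun c => ?_
  have : (epsSBS ρS t : Sample dS d Nuno M Nmac → ℝ) ⁻¹' Set.Iio c =
      ⋃ f : SBSFamily dS d M Nmac, sbsDist ρS t f ⁻¹' Set.Iio c := by
    ext ω
    simp only [Set.mem_preimage, Set.mem_Iio, Set.mem_iUnion, epsSBS_eq_iInf]
    exact ciInf_lt_iff ⟨0, by rintro _ ⟨f, rfl⟩; exact sbsDist_nonneg _ _ _ _⟩
  rw [this]
  exact (isOpen_iUnion fun f => isOpen_Iio.preimage (continuous_sbsDist ρS t f)).measurableSet

lemma epsSBS_le_one (hdS : 1 ≤ dS) (hd : dS ≤ d ^ Nmac) {ω : Sample dS d Nuno M Nmac}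
    (hω : ∀ k, IsSpectrum (ω.2.2 k).1) {ρS : Matrix (Fin dS) (Fin dS) ℂ} (hρ : IsState ρS)
    (t : ℝ) : epsSBS ρS t ω ≤ 1 := by
  obtain ⟨f⟩ := nonempty_SBSFamily (M := M) hdS hd
  rw [epsSBS_eq_iInf]
  exact (ciInf_le ⟨0, by rintro _ ⟨f, rfl⟩; exact sbsDist_nonneg _ _ _ _⟩ f).trans
    (sbsDist_le_one hω hρ t f)

lemma StateEnsemble.ae_law (e : StateEnsemble) (hd : 1 ≤ d) :
    ∀ᵐ s ∂(e.law d), IsSpectrum s.1 := by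
  have := e.isProbabilityMeasure_specLaw hd
  rw [law_eq]
  exact (Measure.quasiMeasurePreserving_fst (μ := e.specLaw d) (ν := haarUnitary d)).ae
    (e.ae_specLaw d)

lemma ae_sampleLaw (e : StateEnsemble) {ηS ηE : ℝ} (hS : 0 < ηS) (hE : 0 < ηE) (hd : 1 ≤ d) :
    ∀ᵐ ω ∂(sampleLaw e ηS ηE dS d Nuno M Nmac), ∀ k, IsSpectrum (ω.2.2 k).1 := by
  have := isProbabilityMeasure_gue hS dS
  have := isProbabilityMeasure_gue hE d
  have := e.isProbabilityMeasure_law hd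
  rw [ae_all_iff]
  intro k
  have h1 : ∀ᵐ r ∂(Measure.pi fun _ : EnvLabel Nuno M Nmac => e.law d), IsSpectrum (r k).1 :=
    (Measure.quasiMeasurePreserving_eval (fun _ : EnvLabel Nuno M Nmac => e.law d) k).ae
      (e.ae_law hd)
  have h2 := (Measure.quasiMeasurePreserving_snd
    (μ := Measure.pi fun _ : EnvLabel Nuno M Nmac => gue ηE d)
    (ν := Measure.pi fun _ : EnvLabel Nuno M Nmac => e.law d)).ae h1
  exact (Measure.quasiMeasurePreserving_snd (μ := gue ηS dS)
    (ν := (Measure.pi fun _ : EnvLabel Nuno M Nmac => gue ηE d).prod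
      (Measure.pi fun _ : EnvLabel Nuno M Nmac => e.law d))).ae h2

lemma integrable_epsSBS (e : StateEnsemble) {ηS ηE : ℝ} (hS : 0 < ηS) (hE : 0 < ηE) (hd1 : 1 ≤ d)
    (hdS : 1 ≤ dS) (hd : dS ≤ d ^ Nmac) {ρS : Matrix (Fin dS) (Fin dS) ℂ} (hρ : IsState ρS)
    (t : ℝ) : Integrable (epsSBS ρS t) (sampleLaw e ηS ηE dS d Nuno M Nmac) := by
  have := isProbabilityMeasure_sampleLaw e hS hE (dS := dS) (Nuno := Nuno) (M := M) (Nmac := Nmac)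
    hd1
  refine Integrable.of_bound (measurable_epsSBS hdS hd ρS t).aestronglyMeasurable 1 ?_
  filter_upwards [ae_sampleLaw e hS hE hd1] with ω hω
  rw [Real.norm_eq_abs, abs_of_nonneg (epsSBS_nonneg ρS t ω)]
  exact epsSBS_le_one hdS hd hω hρ t

/-- Hoeffding's lemma for a random variable with values in [0, 1], applied to both tails. No
independence structure is used. -/
theorem epsSBS_concentration (e : StateEnsemble) {ηS ηE : ℝ} (hS : 0 < ηS) (hE : 0 < ηE)
    (hd1 : 1 ≤ d) (hdS : 1 ≤ dS) (hd : dS ≤ d ^ Nmac) {ρS : Matrix (Fin dS) (Fin dS) ℂ}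
    (hρ : IsState ρS) (t : ℝ) {δ : ℝ} (hδ : 0 ≤ δ) :
    (sampleLaw e ηS ηE dS d Nuno M Nmac).real {ω | δ ≤ |epsSBS ρS t ω -
      ∫ ω', epsSBS ρS t ω' ∂(sampleLaw e ηS ηE dS d Nuno M Nmac)|} ≤ 2 * Real.exp (-2 * δ ^ 2) := by
  set μ := sampleLaw e ηS ηE dS d Nuno M Nmac with hμ
  have : IsProbabilityMeasure μ := isProbabilityMeasure_sampleLaw e hS hE hd1
  have hsub := ProbabilityTheory.hasSubgaussianMGF_of_mem_Icc (μ := μ) (X := epsSBS ρS t)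
    (a := 0) (b := 1) (measurable_epsSBS hdS hd ρS t).aemeasurable (by
      filter_upwards [ae_sampleLaw e hS hE hd1] with ω hω using
        ⟨epsSBS_nonneg ρS t ω, epsSBS_le_one hdS hd hω hρ t⟩)
  have h1 := hsub.measure_ge_le hδ
  have h2 := hsub.neg.measure_ge_le hδ
  -- The variance proxy of an interval of length 1 is (1/2)², which turns -δ²/(2 · 1/4) into -2δ².
  have hc : -δ ^ 2 / (2 * (((‖(1 : ℝ) - 0‖₊ / 2) ^ 2 : NNReal) : ℝ)) = -2 * δ ^ 2 := by
    simp; ring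
  rw [hc] at h1 h2
  refine (measureReal_mono (s₂ := {ω | δ ≤ epsSBS ρS t ω - ∫ ω', epsSBS ρS t ω' ∂μ} ∪
    {ω | δ ≤ (-fun ω => epsSBS ρS t ω - ∫ ω', epsSBS ρS t ω' ∂μ) ω}) ?_).trans
    ((measureReal_union_le _ _).trans ?_)
  · intro ω hω
    rcases le_abs.mp (Set.mem_ofPred_eq ▸ hω) with h | h
    · exact Or.inl h
    · exact Or.inr h
  · linarith

end Concentration

/-! ### Fourth and sixth moments of the entries of a Haar unitary. -/

section HaarMoments

variable {d : ℕ}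

/-- The rotation that mixes two rows with relative phase `w`. -/
def planeRotation (i k : Fin d) (w : ℂ) : Matrix (Fin d) (Fin d) ℂ := fun a b =>
  if a = i then (if b = i then ((√2 : ℝ) : ℂ)⁻¹ else if b = k then w * ((√2 : ℝ) : ℂ)⁻¹ else 0)
  else if a = k then
    (if b = i then ((√2 : ℝ) : ℂ)⁻¹ else if b = k then -(w * ((√2 : ℝ) : ℂ)⁻¹) else 0)
  else if b = a then 1 else 0

lemma sum_two {i k : Fin d} (hik : i ≠ k) (p q : ℂ) (f : Fin d → ℂ) :
    ∑ b, (if b = i then p else if b = k then q else 0) * f b = p * f i + q * f k := by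
  have : ∀ b, (if b = i then p else if b = k then q else 0) * f b =
      (if b = i then p * f b else 0) + (if b = k then q * f b else 0) := by
    intro b
    by_cases h1 : b = i
    · subst h1; simp [hik]
    · simp [h1]
  rw [Finset.sum_congr rfl fun b _ => this b, Finset.sum_add_distrib]
  simp

lemma planeRotation_mem {i k : Fin d} (hik : i ≠ k) {w : ℂ} (hw : w * star w = 1) :
    planeRotation i k w ∈ Matrix.unitaryGroup (Fin d) ℂ := by
  have hc : ((√2 : ℝ) : ℂ)⁻¹ * ((√2 : ℝ) : ℂ)⁻¹ = 1 / 2 := by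
    rw [← mul_inv, ← Complex.ofReal_mul, Real.mul_self_sqrt (by norm_num)]; norm_num
  have hsc : star (((√2 : ℝ) : ℂ)⁻¹) = ((√2 : ℝ) : ℂ)⁻¹ := by
    rw [star_inv₀]; simp
  rw [Matrix.mem_unitaryGroup_iff]
  ext a b
  rw [Matrix.mul_apply, Matrix.star_eq_conjTranspose]
  simp only [Matrix.conjTranspose_apply]
  have key : ∀ f : Fin d → ℂ, ∑ c, planeRotation i k w a c * f c =
      if a = i then ((√2 : ℝ) : ℂ)⁻¹ * f i + w * ((√2 : ℝ) : ℂ)⁻¹ * f k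
      else if a = k then ((√2 : ℝ) : ℂ)⁻¹ * f i + -(w * ((√2 : ℝ) : ℂ)⁻¹) * f k
      else f a := by
    intro f
    unfold planeRotation
    split_ifs with h1 h2
    · rw [sum_two hik]
    · rw [sum_two hik]
    · simp
  rw [key fun c => star (planeRotation i k w b c)]
  have hki := hik.symm
  by_cases ha : a = i
  · subst ha
    by_cases hb : b = a
    · subst hb
      simp only [planeRotation, if_true, if_neg hki, star_mul', hsc, Matrix.one_apply_eq]
      linear_combination (1 + w * star w) * hc + (1 / 2) * hw
    · by_cases hbk : b = k
      · subst hbk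
        simp only [planeRotation, if_true, if_neg hki, star_mul', star_neg, hsc,
          Matrix.one_apply_ne hik]
        linear_combination (1 - w * star w) * hc - (1 / 2) * hw
      · simp [planeRotation, hb, hbk, Ne.symm hb, Ne.symm hbk]
  · by_cases hak : a = k
    · subst hak
      by_cases hb : b = i
      · subst hb
        simp only [planeRotation, if_true, if_neg ha, star_mul', hsc,
          Matrix.one_apply_ne hki]
        linear_combination (1 - w * star w) * hc - (1 / 2) * hw
      · by_cases hbk : b = a
        · subst hbk
          simp only [planeRotation, if_true, if_neg ha, star_mul', star_neg, hsc,
            Matrix.one_apply_eq]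
          linear_combination (1 + w * star w) * hc + (1 / 2) * hw
        · simp [planeRotation, hb, hbk, Ne.symm hb, Ne.symm hbk]
    · by_cases hb : b = i
      · subst hb
        simp [planeRotation, ha, hak]
      · by_cases hbk : b = k
        · subst hbk
          simp [planeRotation, hb, ha, hak]
        · simp only [planeRotation, if_neg ha, if_neg hak, if_neg hb, if_neg hbk, Matrix.one_apply]
          split_ifs <;> simp

/-- The squared modulus of an entry. -/
def entrySq (i j : Fin d) (Z : Matrix.unitaryGroup (Fin d) ℂ) : ℝ :=
  ‖(Z : Matrix (Fin d) (Fin d) ℂ) i j‖ ^ 2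

lemma entrySq_nonneg (i j : Fin d) (Z : Matrix.unitaryGroup (Fin d) ℂ) : 0 ≤ entrySq i j Z :=
  sq_nonneg _

lemma continuous_entrySq (i j : Fin d) : Continuous (entrySq i j) :=
  ((continuous_unitary_coe (d := d)).matrix_elem i j).norm.pow 2

lemma sum_entrySq (j : Fin d) (Z : Matrix.unitaryGroup (Fin d) ℂ) : ∑ i, entrySq i j Z = 1 := by
  have h := congrFun (congrFun (unitary_conjTranspose_mul Z) j) j
  rw [Matrix.mul_apply, Matrix.one_apply_eq] at h
  have h2 : ((∑ i, entrySq i j Z : ℝ) : ℂ) = 1 := by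
    rw [← h, Complex.ofReal_sum]
    refine Finset.sum_congr rfl fun i _ => ?_
    rw [Matrix.conjTranspose_apply, entrySq, ← Complex.normSq_eq_norm_sq,
      Complex.normSq_eq_conj_mul_self]
    rfl
  exact_mod_cast h2

lemma sum_entrySq_row (i : Fin d) (Z : Matrix.unitaryGroup (Fin d) ℂ) : ∑ j, entrySq i j Z = 1 := by
  have h := congrFun (congrFun (unitary_mul_conjTranspose Z) i) i
  rw [Matrix.mul_apply, Matrix.one_apply_eq] at h
  have h2 : ((∑ j, entrySq i j Z : ℝ) : ℂ) = 1 := by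
    rw [← h, Complex.ofReal_sum]
    refine Finset.sum_congr rfl fun j _ => ?_
    rw [Matrix.conjTranspose_apply, entrySq, ← Complex.normSq_eq_norm_sq, mul_comm,
      Complex.normSq_eq_conj_mul_self]
    rfl
  exact_mod_cast h2

lemma integrable_of_continuous_unitary {f : Matrix.unitaryGroup (Fin d) ℂ → ℝ}
    (hf : Continuous f) : Integrable f (haarUnitary d) := by
  obtain ⟨c, hc⟩ := (isCompact_univ (X := Matrix.unitaryGroup (Fin d) ℂ)).exists_bound_of_continuousOn
    hf.continuousOn
  exact Integrable.of_bound hf.aestronglyMeasurable c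
    (Filter.Eventually.of_forall fun Z => hc Z (Set.mem_univ Z))

/-- Left invariance of the Haar measure under a plane rotation: the pair (z, u) of entries in one
column may be replaced by (z ± w u)/√2. -/
lemma integral_entries_rotate {i k : Fin d} (hik : i ≠ k) {w : ℂ} (hw : w * star w = 1) (j : Fin d)
    (g : ℂ → ℂ → ℝ) :
    ∫ Z, g ((Z : Matrix (Fin d) (Fin d) ℂ) i j) ((Z : Matrix (Fin d) (Fin d) ℂ) k j)
      ∂(haarUnitary d) =
    ∫ Z, g (((√2 : ℝ) : ℂ)⁻¹ * ((Z : Matrix (Fin d) (Fin d) ℂ) i j +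
        w * (Z : Matrix (Fin d) (Fin d) ℂ) k j))
      (((√2 : ℝ) : ℂ)⁻¹ * ((Z : Matrix (Fin d) (Fin d) ℂ) i j -
        w * (Z : Matrix (Fin d) (Fin d) ℂ) k j)) ∂(haarUnitary d) := by
  rw [← integral_mul_left_eq_self _ (⟨planeRotation i k w, planeRotation_mem hik hw⟩ :
    Matrix.unitaryGroup (Fin d) ℂ)]
  refine integral_congr_ae (Filter.Eventually.of_forall fun Z => ?_)
  simp only [Submonoid.coe_mul]
  congr 1
  · rw [Matrix.mul_apply]
    simp only [planeRotation, if_true]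
    rw [sum_two hik]; ring
  · rw [Matrix.mul_apply]
    simp only [planeRotation, if_true, if_neg hik.symm]
    rw [sum_two hik]; ring

lemma norm_sq_rotate (z u w : ℂ) (hw : w * star w = 1) :
    ‖((√2 : ℝ) : ℂ)⁻¹ * (z + w * u)‖ ^ 2 = (‖z‖ ^ 2 + ‖u‖ ^ 2) / 2 + (star z * (w * u)).re := by
  have hw1 : ‖w‖ ^ 2 = 1 := by
    have : (w * star w).re = 1 := by rw [hw]; simp
    rw [← Complex.normSq_eq_norm_sq, Complex.normSq_apply]
    simpa using this
  rw [norm_mul, mul_pow, norm_inv, Complex.norm_real, Real.norm_eq_abs, inv_pow, sq_abs,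
    Real.sq_sqrt (by norm_num)]
  have h2 : ‖u‖ ^ 2 = ‖w * u‖ ^ 2 := by rw [norm_mul, mul_pow, hw1, one_mul]
  rw [h2]
  simp only [← Complex.normSq_eq_norm_sq, Complex.normSq_apply, Complex.add_re, Complex.add_im,
    Complex.mul_re, Complex.star_def, Complex.conj_re, Complex.conj_im]
  ring

/-- Averaging invariance over the four phases w = ±1, ±i. Here C = Re(z̄u) and S = Re(i z̄u), so C²
+ S² = |z|²|u|²; for φ a square or a cube the odd powers of C and S cancel and the integrand becomes
a polynomial in |z|² and |u|². -/
lemma integral_entrySq_symm {i k : Fin d} (hik : i ≠ k) (j : Fin d) (φ : ℝ → ℝ) (hφ : Continuous φ) :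
    ∫ Z, φ (entrySq i j Z) ∂(haarUnitary d) = ∫ Z, φ (entrySq k j Z) ∂(haarUnitary d) ∧
    ∃ C S : Matrix.unitaryGroup (Fin d) ℂ → ℝ,
      (∀ Z, C Z ^ 2 + S Z ^ 2 = entrySq i j Z * entrySq k j Z) ∧
      4 * ∫ Z, φ (entrySq i j Z) ∂(haarUnitary d) = ∫ Z,
        (φ ((entrySq i j Z + entrySq k j Z) / 2 + C Z) +
        φ ((entrySq i j Z + entrySq k j Z) / 2 - C Z) +
        φ ((entrySq i j Z + entrySq k j Z) / 2 + S Z) +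
        φ ((entrySq i j Z + entrySq k j Z) / 2 - S Z)) ∂(haarUnitary d) := by
  have hm1 : ((-1 : ℂ)) * star (-1) = 1 := by simp
  have hp1 : (1 : ℂ) * star 1 = 1 := by simp
  have hI : Complex.I * star Complex.I = 1 := by simp
  have hmI : (-Complex.I) * star (-Complex.I) = 1 := by simp
  set C : Matrix.unitaryGroup (Fin d) ℂ → ℝ := fun Z =>
    (star ((Z : Matrix (Fin d) (Fin d) ℂ) i j) * (1 * (Z : Matrix (Fin d) (Fin d) ℂ) k j)).re with hC
  set S : Matrix.unitaryGroup (Fin d) ℂ → ℝ := fun Z =>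
    (star ((Z : Matrix (Fin d) (Fin d) ℂ) i j) *
      (Complex.I * (Z : Matrix (Fin d) (Fin d) ℂ) k j)).re with hS
  have hent : ∀ k, Continuous fun Z : Matrix.unitaryGroup (Fin d) ℂ =>
    (Z : Matrix (Fin d) (Fin d) ℂ) k j := fun k => (continuous_unitary_coe (d := d)).matrix_elem k j
  have hCc : Continuous C := Complex.continuous_re.comp
    ((continuous_star.comp (hent i)).mul (continuous_const.mul (hent k)))
  have hSc : Continuous S := Complex.continuous_re.comp
    ((continuous_star.comp (hent i)).mul (continuous_const.mul (hent k)))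
  have hei := continuous_entrySq i j
  have hek := continuous_entrySq k j
  have f1 : ∀ w : ℂ, w * star w = 1 → ∫ Z, φ (entrySq i j Z) ∂(haarUnitary d) =
      ∫ Z, φ ((entrySq i j Z + entrySq k j Z) / 2 +
        (star ((Z : Matrix (Fin d) (Fin d) ℂ) i j) *
          (w * (Z : Matrix (Fin d) (Fin d) ℂ) k j)).re) ∂(haarUnitary d) := by
    intro w hw
    have := integral_entries_rotate hik hw j fun z _ => φ (‖z‖ ^ 2)
    simp only [norm_sq_rotate _ _ _ hw] at this
    exact this
  have f2 : ∫ Z, φ (entrySq k j Z) ∂(haarUnitary d) = ∫ Z, φ (entrySq i j Z) ∂(haarUnitary d) := by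
    have h1 := integral_entries_rotate hik hp1 j fun _ u => φ (‖u‖ ^ 2)
    have h2 : ∀ z u : ℂ, ‖((√2 : ℝ) : ℂ)⁻¹ * (z - 1 * u)‖ ^ 2 = (‖z‖ ^ 2 + ‖u‖ ^ 2) / 2 +
        (star z * (-1 * u)).re := by
      intro z u
      rw [← norm_sq_rotate z u (-1) hm1]
      congr 3; ring
    simp only [h2] at h1
    rw [f1 (-1) hm1]
    exact h1
  refine ⟨f2.symm, C, S, fun Z => ?_, ?_⟩
  · simp only [hC, hS, entrySq, ← Complex.normSq_eq_norm_sq, Complex.normSq_apply, Complex.mul_re,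
      Complex.star_def, Complex.conj_re, Complex.conj_im, Complex.mul_im, Complex.I_re,
      Complex.I_im, Complex.one_re, Complex.one_im]
    ring
  · have g1 := f1 1 hp1
    have g2 := f1 (-1) hm1
    have g3 := f1 Complex.I hI
    have g4 := f1 (-Complex.I) hmI
    have n2 : ∀ Z : Matrix.unitaryGroup (Fin d) ℂ, (star ((Z : Matrix (Fin d) (Fin d) ℂ) i j) *
        (-1 * (Z : Matrix (Fin d) (Fin d) ℂ) k j)).re = -C Z := fun Z => by
      simp only [hC, ← Complex.neg_re]; congr 1; ring
    have n4 : ∀ Z : Matrix.unitaryGroup (Fin d) ℂ, (star ((Z : Matrix (Fin d) (Fin d) ℂ) i j) *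
        (-Complex.I * (Z : Matrix (Fin d) (Fin d) ℂ) k j)).re = -S Z := fun Z => by
      simp only [hS, ← Complex.neg_re]; congr 1; ring
    simp only [n2, ← sub_eq_add_neg] at g2
    simp only [n4, ← sub_eq_add_neg] at g4
    have hi : ∀ {f : Matrix.unitaryGroup (Fin d) ℂ → ℝ}, Continuous f →
      Integrable (fun Z => φ (f Z)) (haarUnitary d) := fun hf =>
        integrable_of_continuous_unitary (hφ.comp hf)
    have i1 := hi (f := fun Z => (entrySq i j Z + entrySq k j Z) / 2 + C Z) (by fun_prop)
    have i2 := hi (f := fun Z => (entrySq i j Z + entrySq k j Z) / 2 - C Z) (by fun_prop)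
    have i3 := hi (f := fun Z => (entrySq i j Z + entrySq k j Z) / 2 + S Z) (by fun_prop)
    have i4 := hi (f := fun Z => (entrySq i j Z + entrySq k j Z) / 2 - S Z) (by fun_prop)
    have e1 : ∫ Z, φ (entrySq i j Z) ∂(haarUnitary d) =
        ∫ Z, φ ((entrySq i j Z + entrySq k j Z) / 2 + C Z) ∂(haarUnitary d) := g1
    have e3 : ∫ Z, φ (entrySq i j Z) ∂(haarUnitary d) =
        ∫ Z, φ ((entrySq i j Z + entrySq k j Z) / 2 + S Z) ∂(haarUnitary d) := g3
    refine Eq.trans ?_ ((integral_add ((i1.add i2).add i3) i4).trans (congrArg (· + _)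
      ((integral_add (i1.add i2) i3).trans (congrArg (· + _) (integral_add i1 i2))))).symm
    rw [← g2, ← g4, ← e1, ← e3]
    ring

/-- The four-phase identity with φ(s) = s². -/
lemma integral_entrySq_mul {i k : Fin d} (hik : i ≠ k) (j : Fin d) :
    ∫ Z, entrySq i j Z * entrySq k j Z ∂(haarUnitary d) =
      (∫ Z, entrySq i j Z ^ 2 ∂(haarUnitary d)) / 2 := by
  obtain ⟨h1, C, S, hCS, h2⟩ := integral_entrySq_symm hik j (fun s => s ^ 2) (by fun_prop)
  have hei := continuous_entrySq i j
  have hek := continuous_entrySq k j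
  have h3 : ∀ Z, ((entrySq i j Z + entrySq k j Z) / 2 + C Z) ^ 2 +
        ((entrySq i j Z + entrySq k j Z) / 2 - C Z) ^ 2 +
        ((entrySq i j Z + entrySq k j Z) / 2 + S Z) ^ 2 +
        ((entrySq i j Z + entrySq k j Z) / 2 - S Z) ^ 2 =
      entrySq i j Z ^ 2 + entrySq k j Z ^ 2 + 4 * (entrySq i j Z * entrySq k j Z) := fun Z => by
    linear_combination 2 * hCS Z
  simp only [h3] at h2
  rw [integral_add (integrable_of_continuous_unitary (by fun_prop))
    (integrable_of_continuous_unitary (by fun_prop)), integral_add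
    (integrable_of_continuous_unitary (by fun_prop))
    (integrable_of_continuous_unitary (by fun_prop)), integral_const_mul, ← h1] at h2
  linarith

/-- The four-phase identity with φ(s) = s³. -/
lemma integral_entrySq_cube {i k : Fin d} (hik : i ≠ k) (j : Fin d) :
    ∫ Z, (entrySq i j Z ^ 2 * entrySq k j Z + entrySq k j Z ^ 2 * entrySq i j Z) ∂(haarUnitary d) =
      2 / 3 * ∫ Z, entrySq i j Z ^ 3 ∂(haarUnitary d) := by
  obtain ⟨h1, C, S, hCS, h2⟩ := integral_entrySq_symm hik j (fun s => s ^ 3) (by fun_prop)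
  have hei := continuous_entrySq i j
  have hek := continuous_entrySq k j
  have h3 : ∀ Z, ((entrySq i j Z + entrySq k j Z) / 2 + C Z) ^ 3 +
        ((entrySq i j Z + entrySq k j Z) / 2 - C Z) ^ 3 +
        ((entrySq i j Z + entrySq k j Z) / 2 + S Z) ^ 3 +
        ((entrySq i j Z + entrySq k j Z) / 2 - S Z) ^ 3 =
      (1 / 2) * entrySq i j Z ^ 3 + (1 / 2) * entrySq k j Z ^ 3 + 9 / 2 *
        (entrySq i j Z ^ 2 * entrySq k j Z + entrySq k j Z ^ 2 * entrySq i j Z) := fun Z => by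
    linear_combination 3 * (entrySq i j Z + entrySq k j Z) * hCS Z
  simp only [h3] at h2
  rw [integral_add (integrable_of_continuous_unitary (by fun_prop))
    (integrable_of_continuous_unitary (by fun_prop)), integral_add
    (integrable_of_continuous_unitary (by fun_prop))
    (integrable_of_continuous_unitary (by fun_prop)), integral_const_mul, integral_const_mul,
    integral_const_mul, ← h1] at h2
  linarith

lemma integral_entrySq_pow_congr (i k j : Fin d) (n : ℕ) :
    ∫ Z, entrySq i j Z ^ n ∂(haarUnitary d) = ∫ Z, entrySq k j Z ^ n ∂(haarUnitary d) := by
  by_cases hik : i = k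
  · rw [hik]
  · exact (integral_entrySq_symm hik j (fun s => s ^ n) (by fun_prop)).1

lemma sum_sum_integral {f : Fin d → Fin d → Matrix.unitaryGroup (Fin d) ℂ → ℝ}
    (hf : ∀ a b, Continuous (f a b)) : ∑ a, ∑ b, ∫ Z, f a b Z ∂(haarUnitary d) =
      ∫ Z, ∑ a, ∑ b, f a b Z ∂(haarUnitary d) := by
  rw [integral_finsetSum _ fun a _ => integrable_of_continuous_unitary
    (continuous_finsetSum _ fun b _ => hf a b)]
  exact Finset.sum_congr rfl fun a _ => (integral_finsetSum _ fun b _ =>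
    integrable_of_continuous_unitary (hf a b)).symm

lemma sum_ite_const (i : Fin d) (p q : ℝ) :
    ∑ k, (if k = i then p else q) = p + (d - 1) * q := by
  have : ∀ k, (if k = i then p else q) = q + if k = i then p - q else 0 := by
    intro k; split_ifs <;> ring
  rw [Finset.sum_congr rfl fun k _ => this k, Finset.sum_add_distrib]
  simp
  ring

/-- Squaring the column normalisation Σ_a |Z_aj|² = 1 and integrating gives d f + d(d - 1) f/2 = 1.
-/
theorem integral_entrySq_sq (hd : 1 ≤ d) (i j : Fin d) :
    ∫ Z, entrySq i j Z ^ 2 ∂(haarUnitary d) = 2 / (d * (d + 1)) := by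
  set f := ∫ Z, entrySq i j Z ^ 2 ∂(haarUnitary d) with hf
  have hc := fun k => continuous_entrySq (d := d) k j
  have h1 : ∑ a, ∑ b, ∫ Z, entrySq a j Z * entrySq b j Z ∂(haarUnitary d) = 1 := by
    have : ∀ Z : Matrix.unitaryGroup (Fin d) ℂ, ∑ a, ∑ b, entrySq a j Z * entrySq b j Z = 1 := by
      intro Z
      rw [← Finset.sum_mul_sum, sum_entrySq, one_mul]
    rw [sum_sum_integral (f := fun a b Z => entrySq a j Z * entrySq b j Z) fun a b => (hc a).mul (hc b)]
    simp [this]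
  have h2 : ∀ a, ∑ b, ∫ Z, entrySq a j Z * entrySq b j Z ∂(haarUnitary d) = f + (d - 1) * (f / 2) := by
    intro a
    rw [← sum_ite_const a]
    refine Finset.sum_congr rfl fun b _ => ?_
    split_ifs with h
    · rw [h, hf, integral_entrySq_pow_congr i a j 2]
      congr 1; ext Z; ring
    · rw [integral_entrySq_mul (Ne.symm h), hf, integral_entrySq_pow_congr i a j 2]
  simp only [h2, Finset.sum_const, Finset.card_univ, Fintype.card_fin, nsmul_eq_mul] at h1
  have hd0 : (0 : ℝ) < d := by exact_mod_cast hd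
  rw [eq_div_iff (by positivity)]
  linarith

/-- Multiplying Σ_a |Z_aj|⁴ by the column normalisation, in symmetrised form, determines the sixth
moment as 6/(d(d + 1)(d + 2)). -/
theorem integral_entrySq_cube_le (hd : 1 ≤ d) (i j : Fin d) :
    ∫ Z, entrySq i j Z ^ 3 ∂(haarUnitary d) ≤ 6 / d ^ 3 := by
  set f := ∫ Z, entrySq i j Z ^ 3 ∂(haarUnitary d) with hf
  have hc := fun k => continuous_entrySq (d := d) k j
  have h1 : ∑ a, ∑ b, ∫ Z, (entrySq a j Z ^ 2 * entrySq b j Z + entrySq b j Z ^ 2 * entrySq a j Z)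
      ∂(haarUnitary d) = 2 * ∑ a, ∫ Z, entrySq a j Z ^ 2 ∂(haarUnitary d) := by
    have : ∀ Z : Matrix.unitaryGroup (Fin d) ℂ, ∑ a, ∑ b, (entrySq a j Z ^ 2 * entrySq b j Z +
        entrySq b j Z ^ 2 * entrySq a j Z) = 2 * ∑ a, entrySq a j Z ^ 2 := by
      intro Z
      simp only [Finset.sum_add_distrib]
      rw [Finset.sum_comm (f := fun a b => entrySq b j Z ^ 2 * entrySq a j Z),
        ← Finset.sum_mul_sum, sum_entrySq]
      ring
    rw [sum_sum_integral (f := fun a b Z => entrySq a j Z ^ 2 * entrySq b j Z +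
      entrySq b j Z ^ 2 * entrySq a j Z) fun a b => (((hc a).pow 2).mul (hc b)).add
        (((hc b).pow 2).mul (hc a)), ← integral_finsetSum (f := fun a Z => entrySq a j Z ^ 2) Finset.univ
      fun a _ => integrable_of_continuous_unitary ((hc a).pow 2), ← integral_const_mul]
    exact integral_congr_ae (Filter.Eventually.of_forall this)
  have h2 : ∀ a, ∑ b, ∫ Z, (entrySq a j Z ^ 2 * entrySq b j Z + entrySq b j Z ^ 2 * entrySq a j Z)
      ∂(haarUnitary d) = 2 * f + (d - 1) * (2 / 3 * f) := by
    intro a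
    rw [← sum_ite_const a]
    refine Finset.sum_congr rfl fun b _ => ?_
    split_ifs with h
    · rw [h, hf, integral_entrySq_pow_congr i a j 3, ← integral_const_mul]
      congr 1; ext Z; ring
    · rw [integral_entrySq_cube (Ne.symm h), hf, integral_entrySq_pow_congr i a j 3]
  simp only [h2, integral_entrySq_sq hd, Finset.sum_const, Finset.card_univ, Fintype.card_fin,
    nsmul_eq_mul] at h1
  have hd0 : (0 : ℝ) < d := by exact_mod_cast hd
  have h3 : f = 6 / (d * (d + 1) * (d + 2)) := by
    rw [eq_div_iff (by positivity)]
    field_simp at h1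
    linarith
  rw [h3]
  refine div_le_div_of_nonneg_left (by norm_num) (by positivity) ?_
  nlinarith [mul_pos hd0 hd0]

end HaarMoments

/-! ### Late-time moments of phase sums over GUE eigenvalues. -/

section TrigonometricMoments

variable {d : ℕ}

/-- The phase `exp (-i s)`. -/
def phase (s : ℝ) : ℂ := Complex.exp (-(Complex.I * (s : ℂ)))

lemma continuous_phase : Continuous phase := by unfold phase; fun_prop

lemma norm_phase (s : ℝ) : ‖phase s‖ = 1 := by
  unfold phase
  rw [← mul_neg, ← Complex.ofReal_neg, Complex.norm_exp_I_mul_ofReal]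

lemma phase_add (s t : ℝ) : phase (s + t) = phase s * phase t := by
  unfold phase
  rw [← Complex.exp_add]; congr 1; push_cast; ring

lemma star_phase (s : ℝ) : star (phase s) = phase (-s) := by
  unfold phase
  rw [RCLike.star_def, ← Complex.exp_conj]
  congr 1
  simp

lemma phase_zero : phase 0 = 1 := by simp [phase]

lemma phase_sum {α : Type*} (s : Finset α) (f : α → ℝ) :
    phase (∑ i ∈ s, f i) = ∏ i ∈ s, phase (f i) := by
  unfold phase
  rw [← Complex.exp_sum]; congr 1; push_cast; rw [Finset.mul_sum, Finset.sum_neg_distrib]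

/-- The characteristic functions of the eigenvalue distribution of the Gaussian Unitary Ensemble
decay uniformly over the non-zero integer frequencies. -/
theorem exists_norm_integral_phase_le (d : ℕ) {ε : ℝ} (hε : 0 < ε) :
    ∃ T : ℝ, 0 < T ∧ ∀ τ : ℝ, T ≤ |τ| → ∀ n : Fin d → ℤ, n ≠ 0 →
      ‖∫ b, phase (τ * ∑ j, n j * b j) ∂(gueSpec 1 d)‖ ≤ ε := by
  obtain ⟨c, hc⟩ := exists_integral_gueSpec 1 d
  have hRL := (tendsto_integral_exp_smul_cocompact (V := Fin d → ℝ)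
    (fun x => ((gueDensity 1 x : ℝ) : ℂ)) volume).const_smul c
  rw [smul_zero, ← Metric.cobounded_eq_cocompact] at hRL
  have h1 := hRL (Metric.closedBall_mem_nhds (0 : ℂ) hε)
  obtain ⟨R, -, hR⟩ := (Filter.hasBasis_cobounded_norm.mem_iff.mp (Filter.mem_map.mp h1))
  -- A non-zero integer vector has an entry of modulus at least 1, so its frequency, rescaled by
  -- τ/2π, has dual norm at least |τ|/2π. Hence one threshold serves all n.
  refine ⟨max 1 (2 * Real.pi * R), by positivity, fun τ hτ n hn => ?_⟩
  obtain ⟨j, hj⟩ := Function.ne_iff.mp hn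
  set w : StrongDual ℝ (Fin d → ℝ) := (τ / (2 * Real.pi)) •
    ∑ j, (n j : ℝ) • ContinuousLinearMap.proj (R := ℝ) (φ := fun _ : Fin d => ℝ) j with hw
  have hwv : ∀ v, w v = τ / (2 * Real.pi) * ∑ j, n j * v j := by
    intro v
    rw [hw]
    simp
  have hwn : R ≤ ‖w‖ := by
    have h2 := w.le_opNorm (Pi.single j 1)
    rw [hwv, Pi.norm_single, norm_one, mul_one] at h2
    have h3 : ∑ i, (n i : ℝ) * (Pi.single j (1 : ℝ) : Fin d → ℝ) i = n j := by
      simp [Pi.single_apply]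
    rw [h3, norm_mul, norm_div, Real.norm_eq_abs, Real.norm_eq_abs, Real.norm_eq_abs,
      abs_of_pos (by positivity : 0 < 2 * Real.pi)] at h2
    have h4 : (1 : ℝ) ≤ |(n j : ℝ)| := by
      have := Int.one_le_abs hj
      exact_mod_cast this
    have h5 : R ≤ |τ| / (2 * Real.pi) := by
      rw [le_div_iff₀ (by positivity)]
      linarith [le_max_right 1 (2 * Real.pi * R)]
    have h6 : |τ| / (2 * Real.pi) ≤ |τ| / (2 * Real.pi) * |(n j : ℝ)| :=
      le_mul_of_one_le_right (by positivity) h4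
    linarith
  have h7 := hR (show w ∈ {x | R ≤ ‖x‖} from hwn)
  rw [Set.mem_preimage, mem_closedBall_zero_iff] at h7
  refine le_of_eq_of_le ?_ h7
  rw [hc]
  congr 3
  ext x
  rw [hwv, Real.fourierChar_apply', Circle.smul_def, smul_eq_mul, Complex.real_smul, mul_comm]
  congr 1
  rw [Circle.coe_exp, phase]
  congr 1
  have := Real.pi_pos.ne'
  push_cast
  field_simp

/-- The frequency vector of a product of phases. -/
def freq {k : ℕ} (p q : Fin k → Fin d) (j : Fin d) : ℤ :=
  ∑ i, (if p i = j then 1 else 0) - ∑ i, (if q i = j then 1 else 0)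

lemma sum_freq_mul {k : ℕ} (p q : Fin k → Fin d) (b : Fin d → ℝ) :
    ∑ j, (freq p q j : ℝ) * b j = ∑ i, b (p i) - ∑ i, b (q i) := by
  unfold freq
  push_cast
  simp only [sub_mul, Finset.sum_mul, Finset.sum_sub_distrib]
  rw [Finset.sum_comm, Finset.sum_comm (f := fun j i => (if q i = j then (1 : ℝ) else 0) * b j)]
  simp

/-- The sum of the resonant terms. -/
def resonance (k : ℕ) (c : Fin d → ℂ) : ℂ :=
  ∑ p : Fin k → Fin d, ∑ q : Fin k → Fin d,
    if freq p q = 0 then (∏ i, c (p i)) * ∏ i, star (c (q i)) else 0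

lemma continuous_sum_phase (c : Fin d → ℂ) (τ : ℝ) :
    Continuous fun b : Fin d → ℝ => ∑ j, c j * phase (τ * b j) := by
  have := continuous_phase
  fun_prop

lemma sum_prod_pow {R : Type*} [CommSemiring R] (k : ℕ) (f : Fin d → R) :
    ∑ p : Fin k → Fin d, ∏ i, f (p i) = (∑ j, f j) ^ k := by
  rw [Fintype.sum_pow]

/-- Expand |Σ c_j e^{-iτb_j}|^{2k} into phases. Terms of zero frequency are constants and make up
`resonance`, the value for independent uniform phases; all others integrate to at most ε in modulus,
and their coefficients sum to at most (Σ|c_j|)^{2k} ≤ 1. -/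
lemma norm_integral_sub_resonance_le {ε τ : ℝ}
    (hτ : ∀ n : Fin d → ℤ, n ≠ 0 → ‖∫ b, phase (τ * ∑ j, n j * b j) ∂(gueSpec 1 d)‖ ≤ ε)
    (hε : 0 ≤ ε) (k : ℕ) {c : Fin d → ℂ} (hc : ∑ j, ‖c j‖ ≤ 1) :
    ‖((∫ b, (‖∑ j, c j * phase (τ * b j)‖ ^ 2) ^ k ∂(gueSpec 1 d) : ℝ) : ℂ) - resonance k c‖ ≤ ε := by
  have := isProbabilityMeasure_gueSpec one_pos d
  have h1 : ∀ b : Fin d → ℝ, (((‖∑ j, c j * phase (τ * b j)‖ ^ 2) ^ k : ℝ) : ℂ) =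
      ∑ p : Fin k → Fin d, ∑ q : Fin k → Fin d, ((∏ i, c (p i)) * ∏ i, star (c (q i))) *
        phase (τ * ∑ j, freq p q j * b j) := by
    intro b
    have e1 : ((‖∑ j, c j * phase (τ * b j)‖ ^ 2 : ℝ) : ℂ) =
        (∑ j, c j * phase (τ * b j)) * ∑ j, star (c j * phase (τ * b j)) := by
      rw [← star_sum, ← Complex.normSq_eq_norm_sq, ← Complex.mul_conj]; rfl
    rw [Complex.ofReal_pow, e1, mul_pow, ← sum_prod_pow, ← sum_prod_pow, Finset.sum_mul_sum]
    refine Finset.sum_congr rfl fun p _ => Finset.sum_congr rfl fun q _ => ?_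
    simp only [star_mul', star_phase, Finset.prod_mul_distrib]
    rw [sum_freq_mul, ← phase_sum, ← phase_sum, ← Finset.mul_sum, mul_sub, sub_eq_add_neg,
      phase_add, Finset.sum_neg_distrib, ← Finset.mul_sum]
    ring
  have hint : ∀ n : Fin d → ℤ, Integrable (fun b : Fin d → ℝ => phase (τ * ∑ j, n j * b j))
      (gueSpec 1 d) := fun n => by
    have := continuous_phase
    exact Integrable.of_bound (by fun_prop : Continuous fun b : Fin d → ℝ =>
      phase (τ * ∑ j, n j * b j)).aestronglyMeasurable 1
      (Filter.Eventually.of_forall fun b => (norm_phase _).le)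
  have h2 : ((∫ b, (‖∑ j, c j * phase (τ * b j)‖ ^ 2) ^ k ∂(gueSpec 1 d) : ℝ) : ℂ) =
      ∑ p : Fin k → Fin d, ∑ q : Fin k → Fin d, ((∏ i, c (p i)) * ∏ i, star (c (q i))) *
        ∫ b, phase (τ * ∑ j, freq p q j * b j) ∂(gueSpec 1 d) := by
    rw [← integral_complex_ofReal]
    rw [integral_congr_ae (Filter.Eventually.of_forall h1), integral_finsetSum _ fun p _ =>
      integrable_finsetSum _ fun q _ => (hint _).const_mul _]
    refine Finset.sum_congr rfl fun p _ => ?_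
    rw [integral_finsetSum _ fun q _ => (hint _).const_mul _]
    exact Finset.sum_congr rfl fun q _ => integral_const_mul _ _
  rw [h2, resonance, ← Finset.sum_sub_distrib]
  have h3 : ∀ p q : Fin k → Fin d, ‖((∏ i, c (p i)) * ∏ i, star (c (q i))) *
        ∫ b, phase (τ * ∑ j, freq p q j * b j) ∂(gueSpec 1 d) -
        (if freq p q = 0 then (∏ i, c (p i)) * ∏ i, star (c (q i)) else 0)‖ ≤
        ((∏ i, ‖c (p i)‖) * ∏ i, ‖c (q i)‖) * ε := by
    intro p q
    split_ifs with h
    · have : ∀ b : Fin d → ℝ, phase (τ * ∑ j, freq p q j * b j) = 1 := by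
        intro b; simp [h, phase_zero]
      simp only [this]
      simp only [integral_const, probReal_univ, one_smul, mul_one, sub_self, norm_zero]
      exact mul_nonneg (mul_nonneg (Finset.prod_nonneg fun _ _ => norm_nonneg _)
        (Finset.prod_nonneg fun _ _ => norm_nonneg _)) hε
    · rw [sub_zero, norm_mul, norm_mul, norm_prod, norm_prod]
      simp only [norm_star]
      refine mul_le_mul_of_nonneg_left (hτ _ h) ?_
      exact mul_nonneg (Finset.prod_nonneg fun _ _ => norm_nonneg _)
        (Finset.prod_nonneg fun _ _ => norm_nonneg _)
  refine (norm_sum_le _ _).trans ?_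
  calc _ ≤ ∑ p : Fin k → Fin d, ∑ q : Fin k → Fin d,
        ((∏ i, ‖c (p i)‖) * ∏ i, ‖c (q i)‖) * ε := by
        refine Finset.sum_le_sum fun p _ => ?_
        rw [← Finset.sum_sub_distrib]
        exact (norm_sum_le _ _).trans (Finset.sum_le_sum fun q _ => h3 p q)
    _ = (∑ j, ‖c j‖) ^ k * (∑ j, ‖c j‖) ^ k * ε := by
        rw [← sum_prod_pow, Finset.sum_mul_sum, Finset.sum_mul]
        exact Finset.sum_congr rfl fun p _ => (Finset.sum_mul _ _ _).symm
    _ ≤ 1 * 1 * ε := by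
        have h0 : 0 ≤ ∑ j, ‖c j‖ := Finset.sum_nonneg fun _ _ => norm_nonneg _
        gcongr <;> exact pow_le_one₀ h0 hc
    _ = ε := by ring

/-- Zero frequency means that `p` and `q` take each value equally often, and matching their fibres
gives the permutation. -/
lemma exists_perm_of_freq_eq_zero {k : ℕ} {p q : Fin k → Fin d} (h : freq p q = 0) :
    ∃ σ : Equiv.Perm (Fin k), ∀ i, q i = p (σ i) := by
  have hcard : ∀ j, Fintype.card {i // q i = j} = Fintype.card {i // p i = j} := by
    intro j
    have := congrFun h j
    simp only [freq, Pi.zero_apply, Finset.sum_boole] at this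
    rw [Fintype.card_subtype, Fintype.card_subtype]
    omega
  let e := fun j => Fintype.equivOfCardEq (hcard j)
  refine ⟨(Equiv.sigmaFiberEquiv q).symm.trans ((Equiv.sigmaCongrRight e).trans
    (Equiv.sigmaFiberEquiv p)), fun i => ?_⟩
  exact ((e (q i)) ⟨i, rfl⟩).2.symm

lemma freq_comp_perm {k : ℕ} (p : Fin k → Fin d) (σ : Equiv.Perm (Fin k)) :
    freq p (fun i => p (σ i)) = 0 := by
  ext j
  simp only [freq, Pi.zero_apply]
  rw [Equiv.sum_comp σ (fun i => if p i = j then (1 : ℤ) else 0), sub_self]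

lemma resonance_one (c : Fin d → ℂ) : resonance 1 c = ((∑ j, ‖c j‖ ^ 2 : ℝ) : ℂ) := by
  have h1 : ∀ p q : Fin 1 → Fin d, freq p q = 0 ↔ q = p := by
    intro p q
    constructor
    · intro h
      obtain ⟨σ, hσ⟩ := exists_perm_of_freq_eq_zero h
      ext i
      rw [hσ i, Subsingleton.elim (σ i) i]
    · rintro rfl
      exact freq_comp_perm q (Equiv.refl _)
  unfold resonance
  simp only [h1, Finset.sum_ite_eq', Finset.mem_univ, if_true, Fin.prod_univ_one, Fin.isValue]
  rw [← (Equiv.funUnique (Fin 1) (Fin d)).symm.sum_comp]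
  push_cast
  refine Finset.sum_congr rfl fun j _ => ?_
  rw [← Complex.ofReal_pow, ← Complex.normSq_eq_norm_sq, ← Complex.mul_conj]
  rfl

/-- The sum of the resonant terms, for real amplitudes. -/
def realResonance (k : ℕ) (r : Fin d → ℝ) : ℝ :=
  ∑ p : Fin k → Fin d, ∑ q : Fin k → Fin d,
    if freq p q = 0 then (∏ i, r (p i)) * ∏ i, r (q i) else 0

lemma resonance_ofReal (k : ℕ) (r : Fin d → ℝ) :
    resonance k (fun j => (r j : ℂ)) = (realResonance k r : ℂ) := by
  unfold resonance realResonance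
  push_cast
  refine Finset.sum_congr rfl fun p _ => Finset.sum_congr rfl fun q _ => ?_
  split_ifs <;> simp

/-- Every resonant q is a permutation of p; summing over all k! permutations overcounts at most,
since the amplitudes are non-negative. -/
lemma realResonance_le {r : Fin d → ℝ} (hr : ∀ j, 0 ≤ r j) (k : ℕ) :
    realResonance k r ≤ k.factorial * (∑ j, r j ^ 2) ^ k := by
  have h0 : ∀ p : Fin k → Fin d, 0 ≤ ∏ i, r (p i) := fun p => Finset.prod_nonneg fun i _ => hr _
  have h1 : ∀ p : Fin k → Fin d, (∑ q : Fin k → Fin d,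
      if freq p q = 0 then (∏ i, r (p i)) * ∏ i, r (q i) else 0) ≤
      ∑ _σ : Equiv.Perm (Fin k), ∏ i, r (p i) ^ 2 := by
    intro p
    have h2 : ∀ q : Fin k → Fin d, (if freq p q = 0 then (∏ i, r (p i)) * ∏ i, r (q i) else 0) ≤
        ∑ σ : Equiv.Perm (Fin k), if q = (fun i => p (σ i)) then
          (∏ i, r (p i)) * ∏ i, r (q i) else 0 := by
      intro q
      have h3 : ∀ σ ∈ (Finset.univ : Finset (Equiv.Perm (Fin k))),
          0 ≤ if q = (fun i => p (σ i)) then (∏ i, r (p i)) * ∏ i, r (q i) else 0 := by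
        intro σ _; split_ifs
        · exact mul_nonneg (h0 p) (h0 q)
        · exact le_rfl
      split_ifs with h
      · obtain ⟨σ, hσ⟩ := exists_perm_of_freq_eq_zero h
        refine le_trans ?_ (Finset.single_le_sum h3 (Finset.mem_univ σ))
        rw [if_pos (funext hσ)]
      · exact Finset.sum_nonneg h3
    refine (Finset.sum_le_sum fun q _ => h2 q).trans (le_of_eq ?_)
    rw [Finset.sum_comm]
    refine Finset.sum_congr rfl fun σ _ => ?_
    rw [Finset.sum_ite_eq' Finset.univ, if_pos (Finset.mem_univ _),
      Equiv.prod_comp σ fun i => r (p i), ← Finset.prod_mul_distrib]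
    exact Finset.prod_congr rfl fun i _ => (sq _).symm
  calc _ ≤ ∑ p : Fin k → Fin d, ∑ _σ : Equiv.Perm (Fin k), ∏ i, r (p i) ^ 2 :=
        Finset.sum_le_sum fun p _ => h1 p
    _ = _ := by
        simp only [Finset.sum_const, Finset.card_univ, Fintype.card_perm, Fintype.card_fin,
          nsmul_eq_mul]
        rw [← Finset.mul_sum, ← sum_prod_pow k fun j => r j ^ 2]

/-- For k = 2 the identity and the transposition give two different resonant terms, unless p is
constant. The constant p account for the subtracted Σ r_j⁴. -/
lemma le_realResonance_two {r : Fin d → ℝ} (hr : ∀ j, 0 ≤ r j) :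
    2 * (∑ j, r j ^ 2) ^ 2 - ∑ j, r j ^ 4 ≤ realResonance 2 r := by
  have h0 : ∀ p : Fin 2 → Fin d, 0 ≤ ∏ i, r (p i) := fun p => Finset.prod_nonneg fun i _ => hr _
  set s : Equiv.Perm (Fin 2) := Equiv.swap 0 1 with hs
  have h1 : ∀ p : Fin 2 → Fin d, 2 * ∏ i, r (p i) ^ 2 - (if p 0 = p 1 then ∏ i, r (p i) ^ 2 else 0) ≤
      ∑ q : Fin 2 → Fin d, if freq p q = 0 then (∏ i, r (p i)) * ∏ i, r (q i) else 0 := by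
    intro p
    have hnn : ∀ q ∈ (Finset.univ : Finset (Fin 2 → Fin d)),
        0 ≤ if freq p q = 0 then (∏ i, r (p i)) * ∏ i, r (q i) else 0 := by
      intro q _; split_ifs
      · exact mul_nonneg (h0 p) (h0 q)
      · exact le_rfl
    have hpp : ∀ σ : Equiv.Perm (Fin 2), (if freq p (fun i => p (σ i)) = 0 then
        (∏ i, r (p i)) * ∏ i, r (p (σ i)) else 0) = ∏ i, r (p i) ^ 2 := by
      intro σ
      rw [if_pos (freq_comp_perm p σ), Equiv.prod_comp σ fun i => r (p i),
        ← Finset.prod_mul_distrib]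
      exact Finset.prod_congr rfl fun i _ => (sq _).symm
    by_cases hp : p 0 = p 1
    · rw [if_pos hp]
      have := Finset.single_le_sum hnn (Finset.mem_univ fun i => p ((Equiv.refl _) i))
      rw [hpp] at this
      linarith
    · rw [if_neg hp, sub_zero]
      have hne : (fun i => p ((Equiv.refl (Fin 2)) i)) ≠ fun i => p (s i) := by
        intro h
        have := congrFun h 0
        rw [hs, Equiv.swap_apply_left] at this
        exact hp this
      have := Finset.sum_le_sum_of_subset_of_nonneg (Finset.subset_univ
        {(fun i => p ((Equiv.refl (Fin 2)) i)), fun i => p (s i)}) fun q hq _ => hnn q hq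
      rw [Finset.sum_pair hne, hpp, hpp] at this
      linarith
  refine le_trans (le_of_eq ?_) (Finset.sum_le_sum fun p _ => h1 p)
  rw [Finset.sum_sub_distrib, ← Finset.mul_sum, sum_prod_pow 2 fun j => r j ^ 2]
  congr 1
  rw [← (finTwoArrowEquiv (Fin d)).symm.sum_comp, Fintype.sum_prod_type]
  refine Finset.sum_congr rfl fun j _ => ?_
  simp [Fin.prod_univ_two]
  ring

end TrigonometricMoments

/-! ### Reduction of one-site averages to Haar and spectral moments. -/

section SiteBounds

variable {d : ℕ}

/-- With m = Σ r_j², the moments of |Σ r_j e^{-iτb_j}|²/m are close to or bounded by 1, 2, 6, as for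
an exponential variable. The cubic majorant turns them into 5 + 15/2 - 5/2 + 3/4 = 43/4, and
(√2/16)(43/4) ≈ 0.95 improves on the factor 1 of Cauchy-Schwarz. The Σ r_j³ term pays for coinciding
indices in the fourth moment, the ε term for the finite time. -/
lemma integral_norm_sum_phase_le {ε τ : ℝ} (hd : 1 ≤ d)
    (hτ : ∀ n : Fin d → ℤ, n ≠ 0 → ‖∫ b, phase (τ * ∑ j, n j * b j) ∂(gueSpec 1 d)‖ ≤ ε)
    (hε : 0 ≤ ε) {r : Fin d → ℝ} (hr : IsSpectrum r) :
    ∫ b, ‖∑ j, (r j : ℂ) * phase (τ * b j)‖ ∂(gueSpec 1 d) ≤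
      √2 / 16 * ((43 / 4 + 9 * ε * d ^ 3) * √(∑ j, r j ^ 2) + 5 / 4 * d * ∑ j, r j ^ 3) := by
  have := isProbabilityMeasure_gueSpec one_pos d
  set m : ℝ := ∑ j, r j ^ 2 with hm
  have hd0 : (0 : ℝ) < d := by exact_mod_cast hd
  -- Cauchy-Schwarz for a probability vector. It controls the negative powers of m multiplying ε by
  -- powers of d.
  have hmd : 1 ≤ d * m := by
    have h2 := sq_sum_le_card_mul_sum_sq (s := (Finset.univ : Finset (Fin d))) (f := r)
    rw [hr.2, Finset.card_univ, Fintype.card_fin] at h2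
    simpa using h2
  have hm0 : 0 < m := by
    by_contra h
    have : d * m ≤ 0 := mul_nonpos_of_nonneg_of_nonpos hd0.le (not_lt.mp h)
    linarith
  set u : (Fin d → ℝ) → ℝ := fun b => ‖∑ j, (r j : ℂ) * phase (τ * b j)‖ ^ 2 with hu
  have hrn : ∑ j, ‖(r j : ℂ)‖ ≤ 1 := by
    rw [← hr.2]
    refine Finset.sum_le_sum fun j _ => ?_
    rw [Complex.norm_real, Real.norm_eq_abs, abs_of_nonneg (hr.1 j)]
  have huc : Continuous u := (continuous_sum_phase _ τ).norm.pow 2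
  have hn1 : ∀ b : Fin d → ℝ, ‖∑ j, (r j : ℂ) * phase (τ * b j)‖ ≤ 1 := fun b => by
    refine (norm_sum_le _ _).trans (le_trans (le_of_eq ?_) hrn)
    exact Finset.sum_congr rfl fun j _ => by rw [norm_mul, norm_phase, mul_one]
  have hu0 : ∀ b, 0 ≤ u b := fun b => sq_nonneg _
  have hu1 : ∀ b, u b ≤ 1 := fun b => pow_le_one₀ (norm_nonneg _) (hn1 b)
  have hui : ∀ k : ℕ, Integrable (fun b => u b ^ k) (gueSpec 1 d) := fun k =>
    Integrable.of_bound (huc.pow k).aestronglyMeasurable 1 (Filter.Eventually.of_forall fun b => by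
      rw [Real.norm_eq_abs, abs_of_nonneg (pow_nonneg (hu0 b) k)]
      exact pow_le_one₀ (hu0 b) (hu1 b))
  have hmom : ∀ k : ℕ, |∫ b, u b ^ k ∂(gueSpec 1 d) - realResonance k r| ≤ ε := fun k => by
    have := norm_integral_sub_resonance_le hτ hε k hrn
    rwa [resonance_ofReal, ← Complex.ofReal_sub, Complex.norm_real, Real.norm_eq_abs] at this
  have M1 : ∫ b, u b ∂(gueSpec 1 d) ≤ m + ε := by
    have h1 := (abs_le.mp (hmom 1)).2
    have h2 := realResonance_le hr.1 1
    simp only [pow_one, Nat.factorial_one, Nat.cast_one, one_mul] at h1 h2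
    linarith
  have M2 : 2 * m ^ 2 - ∑ j, r j ^ 4 - ε ≤ ∫ b, u b ^ 2 ∂(gueSpec 1 d) := by
    have h1 := (abs_le.mp (hmom 2)).1
    have h2 := le_realResonance_two hr.1
    linarith
  have M3 : ∫ b, u b ^ 3 ∂(gueSpec 1 d) ≤ 6 * m ^ 3 + ε := by
    have h1 := (abs_le.mp (hmom 3)).2
    have h2 := realResonance_le hr.1 3
    have h3 : ((Nat.factorial 3 : ℕ) : ℝ) = 6 := by norm_num [Nat.factorial]
    rw [h3] at h2
    linarith
  set A : ℝ := √m * (√2 / 16) with hA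
  have hA0 : 0 ≤ A := by positivity
  have hpt : ∀ b, ‖∑ j, (r j : ℂ) * phase (τ * b j)‖ ≤
      A * (5 + 15 / (2 * m) * u b - 5 / (4 * m ^ 2) * u b ^ 2 + 1 / (8 * m ^ 3) * u b ^ 3) := by
    intro b
    have h1 : ‖∑ j, (r j : ℂ) * phase (τ * b j)‖ = √m * √(u b / m) := by
      rw [← Real.sqrt_mul hm0.le, mul_div_cancel₀ _ hm0.ne', hu, Real.sqrt_sq (norm_nonneg _)]
    rw [h1, hA, mul_assoc]
    refine mul_le_mul_of_nonneg_left ((sqrt_le_cubic (div_nonneg (hu0 b) hm0.le)).trans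
      (le_of_eq ?_)) (Real.sqrt_nonneg _)
    field_simp
  have hi1 : Integrable u (gueSpec 1 d) := by simpa using hui 1
  have hI : ∫ b, A * (5 + 15 / (2 * m) * u b - 5 / (4 * m ^ 2) * u b ^ 2 +
      1 / (8 * m ^ 3) * u b ^ 3) ∂(gueSpec 1 d) = A * (5 + 15 / (2 * m) * ∫ b, u b ∂(gueSpec 1 d) -
      5 / (4 * m ^ 2) * ∫ b, u b ^ 2 ∂(gueSpec 1 d) +
      1 / (8 * m ^ 3) * ∫ b, u b ^ 3 ∂(gueSpec 1 d)) := by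
    rw [integral_const_mul]
    congr 1
    have j1 := (integrable_const (5 : ℝ) (μ := gueSpec 1 d)).add (hi1.const_mul (15 / (2 * m)))
    have j2 := j1.sub ((hui 2).const_mul (5 / (4 * m ^ 2)))
    refine (integral_add j2 ((hui 3).const_mul (1 / (8 * m ^ 3)))).trans ?_
    rw [integral_const_mul]
    congr 1
    refine (integral_sub j1 ((hui 2).const_mul (5 / (4 * m ^ 2)))).trans ?_
    rw [integral_const_mul]
    congr 1
    refine (integral_add (integrable_const _) (hi1.const_mul (15 / (2 * m)))).trans ?_
    rw [integral_const_mul]; simp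
  have hint : Integrable (fun b : Fin d → ℝ => A * (5 + 15 / (2 * m) * u b -
      5 / (4 * m ^ 2) * u b ^ 2 + 1 / (8 * m ^ 3) * u b ^ 3)) (gueSpec 1 d) :=
    ((((integrable_const (5 : ℝ)).add (hi1.const_mul _)).sub ((hui 2).const_mul _)).add
      ((hui 3).const_mul _)).const_mul A
  have hint0 : Integrable (fun b : Fin d → ℝ => ‖∑ j, (r j : ℂ) * phase (τ * b j)‖)
      (gueSpec 1 d) := Integrable.of_bound (continuous_sum_phase _ τ).norm.aestronglyMeasurable 1
    (Filter.Eventually.of_forall fun b => by rw [norm_norm]; exact hn1 b)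
  refine (integral_mono hint0 hint hpt).trans ?_
  rw [hI]
  have hinv : 1 / m ≤ d := by rw [div_le_iff₀ hm0]; exact hmd
  have hinv0 : 0 < 1 / m := by positivity
  set v := 1 / m with hv
  have hd1 : (1 : ℝ) ≤ d := by exact_mod_cast hd
  have hR3 : 0 ≤ ∑ j, r j ^ 3 := Finset.sum_nonneg fun j _ => pow_nonneg (hr.1 j) 3
  -- Using r_j ≤ √m once lowers the power, so that only the third moment of the populations is
  -- needed afterwards.
  have hr4 : ∑ j, r j ^ 4 ≤ √m * ∑ j, r j ^ 3 := by
    rw [Finset.mul_sum]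
    refine Finset.sum_le_sum fun j _ => ?_
    have h1 : r j ≤ √m := Real.le_sqrt_of_sq_le
      (Finset.single_le_sum (f := fun j => r j ^ 2) (fun i _ => sq_nonneg _) (Finset.mem_univ j))
    calc r j ^ 4 = r j * r j ^ 3 := by ring
      _ ≤ _ := mul_le_mul_of_nonneg_right h1 (pow_nonneg (hr.1 j) 3)
  have hb : 5 + 15 / (2 * m) * ∫ b, u b ∂(gueSpec 1 d) -
      5 / (4 * m ^ 2) * ∫ b, u b ^ 2 ∂(gueSpec 1 d) +
      1 / (8 * m ^ 3) * ∫ b, u b ^ 3 ∂(gueSpec 1 d) ≤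
      43 / 4 + 9 * ε * d ^ 3 + 5 / 4 * (∑ j, r j ^ 4) * v ^ 2 := by
    have c1 : 15 / (2 * m) * ∫ b, u b ∂(gueSpec 1 d) ≤ 15 / (2 * m) * (m + ε) := by gcongr
    have c2 : 5 / (4 * m ^ 2) * (2 * m ^ 2 - ∑ j, r j ^ 4 - ε) ≤
      5 / (4 * m ^ 2) * ∫ b, u b ^ 2 ∂(gueSpec 1 d) := by gcongr
    have c3 : 1 / (8 * m ^ 3) * ∫ b, u b ^ 3 ∂(gueSpec 1 d) ≤ 1 / (8 * m ^ 3) * (6 * m ^ 3 + ε) := by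
      gcongr
    have e1 : 15 / (2 * m) * (m + ε) = 15 / 2 + 15 / 2 * ε * v := by rw [hv]; field_simp
    have e2 : 5 / (4 * m ^ 2) * (2 * m ^ 2 - ∑ j, r j ^ 4 - ε) =
        5 / 2 - 5 / 4 * (∑ j, r j ^ 4) * v ^ 2 - 5 / 4 * ε * v ^ 2 := by
      rw [hv]; field_simp; ring
    have e3 : 1 / (8 * m ^ 3) * (6 * m ^ 3 + ε) = 3 / 4 + 1 / 8 * ε * v ^ 3 := by
      rw [hv]; field_simp; ring
    have p1 : ε * v ≤ ε * d ^ 3 := mul_le_mul_of_nonneg_left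
      (hinv.trans (le_self_pow₀ hd1 (by norm_num))) hε
    have p2 : ε * v ^ 2 ≤ ε * d ^ 3 := mul_le_mul_of_nonneg_left
      ((pow_le_pow_left₀ hinv0.le hinv 2).trans (pow_le_pow_right₀ hd1 (by norm_num))) hε
    have p3 : ε * v ^ 3 ≤ ε * d ^ 3 := mul_le_mul_of_nonneg_left
      (pow_le_pow_left₀ hinv0.le hinv 3) hε
    have p0 : 0 ≤ ε * d ^ 3 := by positivity
    linarith
  refine (mul_le_mul_of_nonneg_left hb hA0).trans ?_
  have hfin : √m * ((∑ j, r j ^ 4) * v ^ 2) ≤ d * ∑ j, r j ^ 3 := by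
    calc √m * ((∑ j, r j ^ 4) * v ^ 2) ≤ √m * ((√m * ∑ j, r j ^ 3) * v ^ 2) := by gcongr
      _ = (√m * √m) * v ^ 2 * ∑ j, r j ^ 3 := by ring
      _ = v * ∑ j, r j ^ 3 := by
          rw [Real.mul_self_sqrt hm0.le, hv]; congr 1; field_simp
      _ ≤ _ := mul_le_mul_of_nonneg_right hinv hR3
  have h16 : 0 ≤ √2 / 16 := by positivity
  rw [hA]
  have := mul_le_mul_of_nonneg_left hfin h16
  nlinarith

/-- The populations of the basis `V` in the state with eigenvalues `x` and eigenbasis `W`, with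
`Z = W† V`. -/
def population (x : Fin d → ℝ) (Z : Matrix.unitaryGroup (Fin d) ℂ) (j : Fin d) : ℝ :=
  ∑ i, x i * entrySq i j Z

lemma IsSpectrum.population {x : Fin d → ℝ} (hx : IsSpectrum x)
    (Z : Matrix.unitaryGroup (Fin d) ℂ) : IsSpectrum (population x Z) := by
  refine ⟨fun j => Finset.sum_nonneg fun i _ => mul_nonneg (hx.1 i) (entrySq_nonneg _ _ _), ?_⟩
  unfold VonNeumann.population
  rw [Finset.sum_comm]
  simp only [← Finset.mul_sum, sum_entrySq_row, mul_one, hx.2]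

lemma coe_inv_mul (W V : Matrix.unitaryGroup (Fin d) ℂ) :
    ((W⁻¹ * V : Matrix.unitaryGroup (Fin d) ℂ) : Matrix (Fin d) (Fin d) ℂ) =
      (W : Matrix (Fin d) (Fin d) ℂ)ᴴ * V := rfl

/-- The trace evaluated in the eigenbasis of `B` is a phase sum whose amplitudes are the populations
of that basis in the state. -/
lemma siteDecoherence_eq (τ : ℝ) (B ρ : SpectralData d) :
    siteDecoherence τ B ρ =
      ‖∑ j, (population ρ.1 (ρ.2⁻¹ * B.2) j : ℂ) * phase (τ * B.1 j)‖ := by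
  unfold siteDecoherence
  congr 1
  set Z : Matrix.unitaryGroup (Fin d) ℂ := ρ.2⁻¹ * B.2 with hZ
  have hZc : (Z : Matrix (Fin d) (Fin d) ℂ) = (ρ.2 : Matrix (Fin d) (Fin d) ℂ)ᴴ * B.2 :=
    coe_inv_mul _ _
  have hZh : (Z : Matrix (Fin d) (Fin d) ℂ)ᴴ = (B.2 : Matrix (Fin d) (Fin d) ℂ)ᴴ * ρ.2 := by
    rw [hZc, Matrix.conjTranspose_mul, Matrix.conjTranspose_conjTranspose]
  have h1 : (siteU τ B * ρ.toMatrix).trace =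
      (Matrix.diagonal (fun j => phase (τ * B.1 j)) * ((Z : Matrix (Fin d) (Fin d) ℂ)ᴴ *
        Matrix.diagonal (fun i => (ρ.1 i : ℂ)) * Z)).trace := by
    rw [hZh, hZc]
    unfold siteU SpectralData.toMatrix
    rw [Matrix.mul_assoc, Matrix.mul_assoc, Matrix.trace_mul_comm]
    simp only [Matrix.mul_assoc]
    rfl
  rw [h1, Matrix.trace]
  refine Finset.sum_congr rfl fun j _ => ?_
  rw [Matrix.diag_apply, Matrix.diagonal_mul, mul_comm]
  congr 1
  rw [Matrix.mul_apply, population]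
  push_cast
  refine Finset.sum_congr rfl fun i _ => ?_
  rw [Matrix.mul_diagonal, Matrix.conjTranspose_apply, entrySq, ← Complex.normSq_eq_norm_sq,
    Complex.normSq_eq_conj_mul_self, Complex.star_def]
  ring

lemma conj_siteU_apply (τ : ℝ) (B ρ : SpectralData d) (i j : Fin d) :
    ((ρ.2 : Matrix (Fin d) (Fin d) ℂ)ᴴ * siteU τ B * ρ.2) i j =
      ∑ l, ((ρ.2⁻¹ * B.2 : Matrix.unitaryGroup (Fin d) ℂ) : Matrix (Fin d) (Fin d) ℂ) i l *
        star (((ρ.2⁻¹ * B.2 : Matrix.unitaryGroup (Fin d) ℂ) : Matrix (Fin d) (Fin d) ℂ) j l) *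
        phase (τ * B.1 l) := by
  set Z : Matrix.unitaryGroup (Fin d) ℂ := ρ.2⁻¹ * B.2 with hZ
  have hZc : (Z : Matrix (Fin d) (Fin d) ℂ) = (ρ.2 : Matrix (Fin d) (Fin d) ℂ)ᴴ * B.2 :=
    coe_inv_mul _ _
  have hZh : (Z : Matrix (Fin d) (Fin d) ℂ)ᴴ = (B.2 : Matrix (Fin d) (Fin d) ℂ)ᴴ * ρ.2 := by
    rw [hZc, Matrix.conjTranspose_mul, Matrix.conjTranspose_conjTranspose]
  have h1 : (ρ.2 : Matrix (Fin d) (Fin d) ℂ)ᴴ * siteU τ B * ρ.2 =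
      (Z : Matrix (Fin d) (Fin d) ℂ) * Matrix.diagonal (fun j => phase (τ * B.1 j)) *
        (Z : Matrix (Fin d) (Fin d) ℂ)ᴴ := by
    rw [hZh, hZc]
    unfold siteU
    simp only [Matrix.mul_assoc]
    rfl
  rw [h1, Matrix.mul_apply]
  refine Finset.sum_congr rfl fun l _ => ?_
  rw [Matrix.mul_diagonal, Matrix.conjTranspose_apply]
  ring

/-- The order of integration: first the eigenvalues of `B` with both eigenbases fixed, giving `H` as
a function of the relative basis W⁻¹V; then V, giving `K` as a function of the spectrum; finally the
state. -/
lemma integral_site_le (e : StateEnsemble) (hd : 1 ≤ d) {F : SpectralData d → SpectralData d → ℝ}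
    (hF : Continuous fun q : SpectralData d × SpectralData d => F q.1 q.2)
    (hF0 : ∀ B ρ, 0 ≤ F B ρ) (hF1 : ∀ B ρ, IsSpectrum ρ.1 → F B ρ ≤ 1)
    {H : Matrix.unitaryGroup (Fin d) ℂ → (Fin d → ℝ) → ℝ} {K : (Fin d → ℝ) → ℝ}
    (hH : ∀ x, Continuous fun Z => H Z x)
    (hFH : ∀ x V W, IsSpectrum x → ∫ b, F (b, V) (x, W) ∂(gueSpec 1 d) ≤ H (W⁻¹ * V) x)
    (hHK : ∀ x, IsSpectrum x → ∫ Z, H Z x ∂(haarUnitary d) ≤ K x)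
    (hK : Integrable K (e.specLaw d)) :
    ∫ q, F q.1 q.2 ∂((gue 1 d).prod (e.law d)) ≤ ∫ x, K x ∂(e.specLaw d) := by
  have := isProbabilityMeasure_gueSpec one_pos d
  have := isProbabilityMeasure_gue one_pos d
  have := e.isProbabilityMeasure_specLaw hd
  have := e.isProbabilityMeasure_law hd
  have hae : ∀ᵐ q ∂((gue 1 d).prod (e.law d)), IsSpectrum q.2.1 :=
    (Measure.quasiMeasurePreserving_snd (μ := gue 1 d) (ν := e.law d)).ae (e.ae_law hd)
  have hint : Integrable (fun q : SpectralData d × SpectralData d => F q.1 q.2)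
      ((gue 1 d).prod (e.law d)) := by
    refine Integrable.of_bound hF.aestronglyMeasurable 1 ?_
    filter_upwards [hae] with q hq
    rw [Real.norm_eq_abs, abs_of_nonneg (hF0 _ _)]
    exact hF1 _ _ hq
  rw [integral_prod_symm _ hint]
  have hKi : Integrable (fun ρ : SpectralData d => K ρ.1) (e.law d) := by
    rw [e.law_eq]
    exact hK.comp_fst (haarUnitary d)
  have h1 : ∫ ρ, K ρ.1 ∂(e.law d) = ∫ x, K x ∂(e.specLaw d) := by
    rw [e.law_eq, integral_fun_fst]
    simp
  rw [← h1]
  refine integral_mono_ae hint.integral_prod_right hKi ?_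
  filter_upwards [e.ae_law hd] with ρ hρ
  obtain ⟨x, W⟩ := ρ
  have hcont : Continuous fun B : SpectralData d => F B (x, W) :=
    hF.comp (by fun_prop : Continuous fun B : SpectralData d => (B, ((x, W) : SpectralData d)))
  have hint2 : Integrable (fun B : SpectralData d => F B (x, W))
      ((gueSpec 1 d).prod (haarUnitary d)) := by
    refine Integrable.of_bound hcont.aestronglyMeasurable 1 (Filter.Eventually.of_forall fun B => ?_)
    rw [Real.norm_eq_abs, abs_of_nonneg (hF0 _ _)]
    exact hF1 _ _ hρ
  show ∫ B, F B (x, W) ∂(gue 1 d) ≤ K x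
  rw [gue_eq, integral_prod_symm _ hint2]
  refine le_trans ?_ (hHK x hρ)
  -- By left invariance W⁻¹V is Haar distributed for each fixed W.
  rw [← integral_mul_left_eq_self (fun Z => H Z x) W⁻¹]
  exact integral_mono hint2.integral_prod_right (integrable_of_continuous_unitary
    ((hH x).comp (continuous_const.mul continuous_id))) fun V => hFH x V W hρ

end SiteBounds

/-! ### One-site averages of decoherence, overlap and flatness. -/

section SiteAverages

variable {d : ℕ}

lemma continuous_siteDecoherence (τ : ℝ) :
    Continuous fun q : SpectralData d × SpectralData d => siteDecoherence τ q.1 q.2 := by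
  have h1 := continuous_toMatrix (d := d)
  have h2 : Continuous fun q : SpectralData d × SpectralData d => siteU τ q.1 :=
    continuous_siteU.comp (f := fun q : SpectralData d × SpectralData d => (τ, q.1)) (by fun_prop)
  unfold siteDecoherence
  exact (h2.matrix_mul (h1.comp continuous_snd)).matrix_trace.norm

lemma continuous_siteOverlap (τ : ℝ) :
    Continuous fun q : SpectralData d × SpectralData d => siteOverlap τ q.1 q.2 := by
  have h2 : Continuous fun q : SpectralData d × SpectralData d => siteU τ q.1 :=
    continuous_siteU.comp (f := fun q : SpectralData d × SpectralData d => (τ, q.1)) (by fun_prop)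
  have h3 : Continuous fun q : SpectralData d × SpectralData d =>
      (q.2.2 : Matrix (Fin d) (Fin d) ℂ) := continuous_unitary_coe.comp (by fun_prop)
  have h4 : ∀ i j, Continuous fun q : SpectralData d × SpectralData d =>
      ((q.2.2 : Matrix (Fin d) (Fin d) ℂ)ᴴ * siteU τ q.1 * q.2.2) i j := fun i j =>
    Continuous.matrix_elem ((h3.matrix_conjTranspose.matrix_mul h2).matrix_mul h3) i j
  unfold siteOverlap
  refine continuous_finsetSum _ fun i _ => Continuous.sqrt ?_
  refine Continuous.mul (by fun_prop) (continuous_finsetSum _ fun j _ => ?_)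
  exact ((h4 i j).norm.pow 2).mul (by fun_prop)

lemma siteDecoherence_le_one (τ : ℝ) (B : SpectralData d) {ρ : SpectralData d}
    (hρ : IsSpectrum ρ.1) : siteDecoherence τ B ρ ≤ 1 := by
  rw [siteDecoherence_eq]
  have h := hρ.population (ρ.2⁻¹ * B.2)
  refine (norm_sum_le _ _).trans (le_of_eq ?_)
  rw [← h.2]
  refine Finset.sum_congr rfl fun j _ => ?_
  rw [norm_mul, norm_phase, mul_one, Complex.norm_real, Real.norm_eq_abs, abs_of_nonneg (h.1 j)]

/-- It is the fidelity of two probability distributions, the spectrum and its image under a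
bistochastic matrix. -/
lemma siteOverlap_le_one (τ : ℝ) (B : SpectralData d) {ρ : SpectralData d}
    (hρ : IsSpectrum ρ.1) : siteOverlap τ B ρ ≤ 1 := by
  set Q : Matrix.unitaryGroup (Fin d) ℂ := ρ.2⁻¹ * ⟨siteU τ B, siteU_mem τ B⟩ * ρ.2 with hQ
  have hQc : (Q : Matrix (Fin d) (Fin d) ℂ) =
      (ρ.2 : Matrix (Fin d) (Fin d) ℂ)ᴴ * siteU τ B * ρ.2 := rfl
  have hq0 : ∀ i, 0 ≤ ∑ j, entrySq i j Q * ρ.1 j := fun i =>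
    Finset.sum_nonneg fun j _ => mul_nonneg (entrySq_nonneg _ _ _) (hρ.1 j)
  have h1 : siteOverlap τ B ρ = ∑ i, √(ρ.1 i) * √(∑ j, entrySq i j Q * ρ.1 j) := by
    unfold siteOverlap
    rw [← hQc]
    exact Finset.sum_congr rfl fun i _ => Real.sqrt_mul (hρ.1 i) _
  rw [h1]
  refine (Real.sum_sqrt_mul_sqrt_le Finset.univ hρ.1 hq0).trans ?_
  rw [Finset.sum_comm]
  simp only [← Finset.sum_mul, sum_entrySq, one_mul, hρ.2, Real.sqrt_one, mul_one, le_refl]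

/-- A tangent bound: it linearises the square root, so that an average can be taken inside. Each use
chooses c as the expected size of √u. -/
lemma sqrt_le_half_add {c u : ℝ} (hc : 0 < c) (hu : 0 ≤ u) : √u ≤ (u / c + c) / 2 := by
  have h1 : √u ^ 2 = u := Real.sq_sqrt hu
  rw [le_div_iff₀ two_pos, div_add' _ _ _ hc.ne', le_div_iff₀ hc]
  nlinarith [sq_nonneg (√u - c)]

lemma integral_entrySq_mul_eq (hd : 1 ≤ d) (i k j : Fin d) :
    ∫ Z, entrySq i j Z * entrySq k j Z ∂(haarUnitary d) =
      (if i = k then 2 else 1) / (d * (d + 1)) := by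
  split_ifs with h
  · rw [← h, ← integral_entrySq_sq hd i j]
    congr 1; ext Z; ring
  · rw [integral_entrySq_mul h, integral_entrySq_sq hd]; ring

lemma integral_sum_population_sq (hd : 1 ≤ d) {x : Fin d → ℝ} (hx : IsSpectrum x) :
    ∫ Z, ∑ j, population x Z j ^ 2 ∂(haarUnitary d) = (1 + ∑ i, x i ^ 2) / (d + 1) := by
  have hc := fun i j => continuous_entrySq (d := d) i j
  have hd0 : (0 : ℝ) < d := by exact_mod_cast hd
  have h1 : ∀ j, ∫ Z, population x Z j ^ 2 ∂(haarUnitary d) =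
      (1 + ∑ i, x i ^ 2) / (d * (d + 1)) := by
    intro j
    have e1 : ∀ Z, population x Z j ^ 2 =
        ∑ i, ∑ k, x i * x k * (entrySq i j Z * entrySq k j Z) := by
      intro Z
      rw [sq, population, Finset.sum_mul_sum]
      exact Finset.sum_congr rfl fun i _ => Finset.sum_congr rfl fun k _ => by ring
    simp only [e1]
    rw [← sum_sum_integral (f := fun i k Z => x i * x k * (entrySq i j Z * entrySq k j Z))
      fun i k => continuous_const.mul ((hc i j).mul (hc k j))]
    simp only [integral_const_mul, integral_entrySq_mul_eq hd]
    have e2 : ∀ i k : Fin d, x i * x k * ((if i = k then 2 else 1) / (d * (d + 1))) =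
        (x i * x k + if i = k then x i * x k else 0) / ((d : ℝ) * (d + 1)) := by
      intro i k; split_ifs <;> ring
    simp only [e2, ← Finset.sum_div, Finset.sum_add_distrib, Finset.sum_ite_eq, Finset.mem_univ,
      if_true, ← Finset.mul_sum, hx.2, mul_one, ← sq]
  rw [integral_finsetSum _ fun j _ => integrable_of_continuous_unitary (by
    unfold population
    exact (continuous_finsetSum _ fun i _ => continuous_const.mul (hc i j)).pow 2)]
  simp only [h1, Finset.sum_const, Finset.card_univ, Fintype.card_fin, nsmul_eq_mul]
  field_simp

/-- A population is a convex combination of entries |Z_ij|², so Jensen's inequality reduces its cube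
to the sixth Haar moment. -/
lemma integral_sum_population_cube_le (hd : 1 ≤ d) {x : Fin d → ℝ} (hx : IsSpectrum x) :
    ∫ Z, ∑ j, population x Z j ^ 3 ∂(haarUnitary d) ≤ 6 / d ^ 2 := by
  have hc := fun i j => continuous_entrySq (d := d) i j
  have hd0 : (0 : ℝ) < d := by exact_mod_cast hd
  have hpc : ∀ j, Continuous fun Z => population x Z j := fun j => by
    unfold population
    exact continuous_finsetSum _ fun i _ => continuous_const.mul (hc i j)
  have h1 : ∀ j, ∫ Z, population x Z j ^ 3 ∂(haarUnitary d) ≤ 6 / d ^ 3 := by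
    intro j
    have e1 : ∀ Z, population x Z j ^ 3 ≤ ∑ i, x i * entrySq i j Z ^ 3 := fun Z =>
      
      Real.pow_arith_mean_le_arith_mean_pow _ _ _ (fun i _ => hx.1 i) hx.2
        (fun i _ => entrySq_nonneg i j Z) 3
    refine (integral_mono (integrable_of_continuous_unitary ((hpc j).pow 3))
      (integrable_of_continuous_unitary (continuous_finsetSum _ fun i _ =>
        continuous_const.mul ((hc i j).pow 3))) e1).trans ?_
    refine (integral_finsetSum (f := fun i Z => x i * entrySq i j Z ^ 3) _ fun i _ =>
      integrable_of_continuous_unitary (continuous_const.mul ((hc i j).pow 3))).le.trans ?_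
    simp only [integral_const_mul]
    calc _ ≤ ∑ i, x i * (6 / d ^ 3) := Finset.sum_le_sum fun i _ =>
          mul_le_mul_of_nonneg_left (integral_entrySq_cube_le hd i j) (hx.1 i)
      _ = _ := by rw [← Finset.sum_mul, hx.2, one_mul]
  rw [integral_finsetSum (f := fun j Z => population x Z j ^ 3) _ fun j _ =>
    integrable_of_continuous_unitary ((hpc j).pow 3)]
  refine (Finset.sum_le_sum fun j _ => h1 j).trans (le_of_eq ?_)
  simp only [Finset.sum_const, Finset.card_univ, Fintype.card_fin, nsmul_eq_mul]
  field_simp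

lemma sqrt_two_div_le : √2 / 16 ≤ 14143 / 160000 := by
  have : √2 ≤ 14143 / 10000 := by
    rw [Real.sqrt_le_left (by norm_num)]; norm_num
  linarith

/-- Cauchy-Schwarz would give √((1 + p₂)/(d + 1)), with p₂ the purity, which is slightly too large
as soon as d p₂ > 1. The factor 0.95 of `integral_norm_sum_phase_le` leaves room for this excess,
for the cubic term and for the finite-time error. -/
theorem exists_integral_siteDecoherence_le (e : StateEnsemble) (hd : 10000 ≤ d) :
    ∃ T : ℝ, 0 < T ∧ ∀ τ : ℝ, T ≤ |τ| →
      ∫ q, siteDecoherence τ q.1 q.2 ∂((gue 1 d).prod (e.law d)) ≤ 1 / √d := by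
  have hd1 : 1 ≤ d := by omega
  have := e.isProbabilityMeasure_specLaw hd1
  have hdr : (10000 : ℝ) ≤ d := by exact_mod_cast hd
  have hd0 : (0 : ℝ) < d := by linarith
  set s := √(d : ℝ) with hs
  have hss : s * s = d := Real.mul_self_sqrt hd0.le
  have hs100 : 100 ≤ s := Real.le_sqrt_of_sq_le (by norm_num; exact hd)
  have hs0 : 0 < s := by linarith
  -- The power d⁴ turns the error 9 ε d³ into 9/d.
  obtain ⟨T, hT0, hT⟩ := exists_norm_integral_phase_le d
    (ε := 1 / (d : ℝ) ^ 4) (by positivity)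
  refine ⟨T, hT0, fun τ hτ => ?_⟩
  set c1 : ℝ := 43 / 4 + 9 / d with hc1
  have hc10 : 0 < c1 := by positivity
  set H : Matrix.unitaryGroup (Fin d) ℂ → (Fin d → ℝ) → ℝ := fun Z x => √2 / 16 *
    (c1 * ((s * ∑ j, population x Z j ^ 2 + 1 / s) / 2) + 5 / 4 * d * ∑ j, population x Z j ^ 3)
    with hH
  set K : (Fin d → ℝ) → ℝ := fun x => √2 / 16 *
    (c1 * (1 / s + (1 / (2 * s)) * ∑ i, x i ^ 2) + 15 / (2 * d)) with hK
  have hpc : ∀ x j, Continuous fun Z : Matrix.unitaryGroup (Fin d) ℂ => population x Z j :=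
    fun x j => by
      unfold population
      exact continuous_finsetSum _ fun i _ => continuous_const.mul (continuous_entrySq i j)
  have hKi : Integrable K (e.specLaw d) :=
    (((integrable_const _).add ((e.integrable_sum_pow hd1 two_ne_zero).const_mul _)).const_mul _
      |>.add (integrable_const _)).const_mul _
  refine (integral_site_le e hd1 (F := fun B ρ => siteDecoherence τ B ρ) (H := H) (K := K)
    (continuous_siteDecoherence τ) (fun B ρ => siteDecoherence_nonneg τ B ρ)
    (fun B ρ hρ => siteDecoherence_le_one τ B hρ) ?_ ?_ ?_ hKi).trans ?_
  · intro x
    exact continuous_const.mul ((continuous_const.mul (((continuous_const.mul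
      (continuous_finsetSum _ fun j _ => (hpc x j).pow 2)).add continuous_const).div_const 2)).add
      (continuous_const.mul (continuous_finsetSum _ fun j _ => (hpc x j).pow 3)))
  · intro x V W hx
    simp only [siteDecoherence_eq]
    have h := integral_norm_sum_phase_le hd1 (hT τ hτ) (by positivity) (hx.population (W⁻¹ * V))
    refine h.trans (mul_le_mul_of_nonneg_left ?_ (by positivity))
    refine add_le_add_left ?_ _
    have e1 : 43 / 4 + 9 * (1 / (d : ℝ) ^ 4) * d ^ 3 = c1 := by rw [hc1]; field_simp
    rw [e1]
    refine mul_le_mul_of_nonneg_left ?_ hc10.le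
    have h2 := sqrt_le_half_add (c := 1 / s) (by positivity)
      (Finset.sum_nonneg fun j (_ : j ∈ Finset.univ) => sq_nonneg (population x (W⁻¹ * V) j))
    rwa [div_div_eq_mul_div, div_one, mul_comm _ s] at h2
  · intro x hx
    have i2 : Integrable (fun Z => ∑ j, population x Z j ^ 2) (haarUnitary d) :=
      integrable_of_continuous_unitary (continuous_finsetSum _ fun j _ => (hpc x j).pow 2)
    have i3 : Integrable (fun Z => ∑ j, population x Z j ^ 3) (haarUnitary d) :=
      integrable_of_continuous_unitary (continuous_finsetSum _ fun j _ => (hpc x j).pow 3)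
    have i2' := (((i2.const_mul s).add (integrable_const (1 / s))).div_const 2).const_mul c1
    have e1 : ∫ Z, H Z x ∂(haarUnitary d) = √2 / 16 *
        (c1 * ((s * ((1 + ∑ i, x i ^ 2) / (d + 1)) + 1 / s) / 2) +
          5 / 4 * d * ∫ Z, ∑ j, population x Z j ^ 3 ∂(haarUnitary d)) := by
      rw [integral_const_mul]
      congr 1
      refine (integral_add i2' (i3.const_mul _)).trans ?_
      rw [integral_const_mul, ← integral_sum_population_sq hd1 hx]
      congr 1
      · congr 1
        refine (integral_div _ _).trans ?_
        congr 1
        refine (integral_add (i2.const_mul s) (integrable_const (1 / s))).trans ?_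
        rw [integral_const_mul]; simp
      · exact integral_const_mul _ _
    rw [e1]
    refine mul_le_mul_of_nonneg_left (add_le_add ?_ ?_) (by positivity)
    · refine mul_le_mul_of_nonneg_left ?_ hc10.le
      have hp : 0 ≤ ∑ i, x i ^ 2 := Finset.sum_nonneg fun i _ => sq_nonneg _
      have h3 : s * ((1 + ∑ i, x i ^ 2) / (d + 1)) ≤ (1 + ∑ i, x i ^ 2) / s := by
        rw [mul_div_assoc', div_le_div_iff₀ (by positivity) hs0]
        nlinarith
      calc (s * ((1 + ∑ i, x i ^ 2) / (d + 1)) + 1 / s) / 2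
          ≤ ((1 + ∑ i, x i ^ 2) / s + 1 / s) / 2 := by gcongr
        _ = _ := by field_simp; ring
    · have h4 := integral_sum_population_cube_le hd1 hx
      calc 5 / 4 * d * ∫ Z, ∑ j, population x Z j ^ 3 ∂(haarUnitary d)
          ≤ 5 / 4 * d * (6 / d ^ 2) := by gcongr
        _ = _ := by field_simp; ring
  · have hp := (e.purity_bounds hd1).2
    have e1 : ∫ x, K x ∂(e.specLaw d) = √2 / 16 *
        (c1 * (1 / s + (1 / (2 * s)) * ∫ x, ∑ i, x i ^ 2 ∂(e.specLaw d)) + 15 / (2 * d)) := by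
      have j1 := ((e.integrable_sum_pow hd1 two_ne_zero).const_mul (1 / (2 * s)))
      have j2 := ((integrable_const (1 / s) (μ := e.specLaw d)).add j1).const_mul c1
      rw [integral_const_mul]
      congr 1
      refine (integral_add j2 (integrable_const _)).trans ?_
      congr 1
      · refine (integral_const_mul _ _).trans ?_
        congr 1
        refine (integral_add (integrable_const _) j1).trans ?_
        rw [integral_const_mul]; simp
      · simp
    rw [e1]
    have hdinv : 1 / (d : ℝ) ≤ 1 / 10000 := one_div_le_one_div_of_le (by norm_num) hdr
    have hc1' : c1 ≤ 10.7509 := by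
      have : 9 / (d : ℝ) = 9 * (1 / d) := by ring
      rw [hc1, this]; linarith
    have h5 : (1 / (2 * s)) * ∫ x, ∑ i, x i ^ 2 ∂(e.specLaw d) ≤ 1 / s * (1 / 5000) := by
      calc _ ≤ (1 / (2 * s)) * (4 / d) := by gcongr
        _ = 1 / s * (2 * (1 / d)) := by field_simp; norm_num
        _ ≤ _ := by gcongr; linarith
    have h6 : 15 / (2 * (d : ℝ)) ≤ 1 / s * (3 / 40) := by
      rw [← hss, div_mul_div_comm, div_le_div_iff₀ (by positivity) (by positivity)]
      nlinarith
    have hs' : 0 < 1 / s := by positivity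
    calc _ ≤ 14143 / 160000 * (10.7509 * (1 / s + 1 / s * (1 / 5000)) + 1 / s * (3 / 40)) := by
          refine mul_le_mul sqrt_two_div_le ?_ (by positivity) (by norm_num)
          refine add_le_add (mul_le_mul hc1' (by linarith) ?_ (by norm_num)) h6
          have : 0 ≤ ∫ x, ∑ i, x i ^ 2 ∂(e.specLaw d) :=
            integral_nonneg fun x => Finset.sum_nonneg fun i _ => sq_nonneg _
          positivity
      _ ≤ 1 / s := by linarith

lemma integral_norm_sum_phase_sq_le {ε τ : ℝ}
    (hτ : ∀ n : Fin d → ℤ, n ≠ 0 → ‖∫ b, phase (τ * ∑ j, n j * b j) ∂(gueSpec 1 d)‖ ≤ ε)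
    (hε : 0 ≤ ε) {c : Fin d → ℂ} (hc : ∑ j, ‖c j‖ ≤ 1) :
    ∫ b, ‖∑ j, c j * phase (τ * b j)‖ ^ 2 ∂(gueSpec 1 d) ≤ ∑ j, ‖c j‖ ^ 2 + ε := by
  have h := norm_integral_sub_resonance_le hτ hε 1 hc
  rw [resonance_one, ← Complex.ofReal_sub, Complex.norm_real, Real.norm_eq_abs] at h
  simp only [pow_one] at h
  linarith [(abs_le.mp h).2]

lemma sum_norm_mul_star_le (Z : Matrix.unitaryGroup (Fin d) ℂ) (i j : Fin d) :
    ∑ l, ‖(Z : Matrix (Fin d) (Fin d) ℂ) i l * star ((Z : Matrix (Fin d) (Fin d) ℂ) j l)‖ ≤ 1 := by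
  have h1 : ∀ i, ∑ l, ‖(Z : Matrix (Fin d) (Fin d) ℂ) i l‖ ^ 2 = 1 := fun i => sum_entrySq_row i Z
  simp only [norm_mul, norm_star]
  refine (Real.sum_mul_le_sqrt_mul_sqrt _ _ _).trans ?_
  rw [h1, h1, Real.sqrt_one, one_mul]

/-- At late times the rotated state, measured in the eigenbasis of the original one, has on average
almost uniform outcome weights (1 + x_i)/(d + 1). The mean overlap is therefore that of the spectrum
with the uniform distribution, up to a term of order d^{-1/2}, and the bound on the mean flatness
applies. -/
theorem exists_integral_siteOverlap_le (e : StateEnsemble) (hd : 10000 ≤ d) :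
    ∃ T : ℝ, 0 < T ∧ ∀ τ : ℝ, T ≤ |τ| →
      ∫ q, siteOverlap τ q.1 q.2 ∂((gue 1 d).prod (e.law d)) ≤ 97 / 100 := by
  have hd1 : 1 ≤ d := by omega
  have := e.isProbabilityMeasure_specLaw hd1
  have := isProbabilityMeasure_gueSpec one_pos d
  have hdr : (10000 : ℝ) ≤ d := by exact_mod_cast hd
  have hd0 : (0 : ℝ) < d := by linarith
  set s := √(d : ℝ) with hs
  have hss : s * s = d := Real.mul_self_sqrt hd0.le
  have hs100 : 100 ≤ s := Real.le_sqrt_of_sq_le (by norm_num; exact hd)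
  have hs0 : 0 < s := by linarith
  set ε : ℝ := 1 / (d : ℝ) ^ 2 with hε
  have hε0 : 0 < ε := by positivity
  obtain ⟨T, hT0, hT⟩ := exists_norm_integral_phase_le d hε0
  refine ⟨T, hT0, fun τ hτ => ?_⟩
  set H : Matrix.unitaryGroup (Fin d) ℂ → (Fin d → ℝ) → ℝ := fun Z x =>
    ∑ i, √(x i) * ((s * ∑ j, x j * (∑ l, entrySq i l Z * entrySq j l Z + ε) + 1 / s) / 2)
    with hH
  set K : (Fin d → ℝ) → ℝ := fun x => siteFlatness x + (1 / (2 * s) + 1 / (2 * d)) with hK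
  have hc := fun i j => continuous_entrySq (d := d) i j
  have hKi0 : Integrable (siteFlatness : (Fin d → ℝ) → ℝ) (e.specLaw d) :=
    e.integrable_specLaw hd1 (by unfold siteFlatness; fun_prop) (c := 1) fun x hx => by
      rw [abs_of_nonneg (siteFlatness_nonneg x)]; exact siteFlatness_le_one hx
  have hKi : Integrable K (e.specLaw d) := hKi0.add (integrable_const _)
  have hHc : ∀ (x : Fin d → ℝ) (i : Fin d), Continuous fun Z : Matrix.unitaryGroup (Fin d) ℂ =>
      ∑ j, x j * (∑ l, entrySq i l Z * entrySq j l Z + ε) := fun x i =>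
    continuous_finsetSum _ fun j _ => continuous_const.mul
      ((continuous_finsetSum _ fun l _ => (hc i l).mul (hc j l)).add continuous_const)
  refine (integral_site_le e hd1 (F := fun B ρ => siteOverlap τ B ρ) (H := H) (K := K)
    (continuous_siteOverlap τ) (fun B ρ => siteOverlap_nonneg τ B ρ)
    (fun B ρ hρ => siteOverlap_le_one τ B hρ) ?_ ?_ ?_ hKi).trans ?_
  · intro x
    exact continuous_finsetSum _ fun i _ => continuous_const.mul
      (((continuous_const.mul (hHc x i)).add continuous_const).div_const 2)
  · intro x V W hx
    set Z := W⁻¹ * V with hZ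
    set c : Fin d → Fin d → Fin d → ℂ := fun i j l => (Z : Matrix (Fin d) (Fin d) ℂ) i l *
      star ((Z : Matrix (Fin d) (Fin d) ℂ) j l) with hcdef
    have hov : ∀ b : Fin d → ℝ, siteOverlap τ (b, V) (x, W) =
        ∑ i, √(x i) * √(∑ j, x j * ‖∑ l, c i j l * phase (τ * b l)‖ ^ 2) := by
      intro b
      unfold siteOverlap
      refine Finset.sum_congr rfl fun i _ => ?_
      rw [Real.sqrt_mul (hx.1 i)]
      congr 2
      refine Finset.sum_congr rfl fun j _ => ?_
      rw [mul_comm, conj_siteU_apply τ (b, V) (x, W) i j]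
    have hcn : ∀ i j, ∑ l, ‖c i j l‖ ≤ 1 := fun i j => sum_norm_mul_star_le Z i j
    have hcont : ∀ i j, Continuous fun b : Fin d → ℝ =>
        ‖∑ l, c i j l * phase (τ * b l)‖ ^ 2 := fun i j => (continuous_sum_phase _ τ).norm.pow 2
    have hb1 : ∀ i j (b : Fin d → ℝ), ‖∑ l, c i j l * phase (τ * b l)‖ ^ 2 ≤ 1 := fun i j b => by
      refine pow_le_one₀ (norm_nonneg _) ((norm_sum_le _ _).trans (le_trans (le_of_eq ?_) (hcn i j)))
      exact Finset.sum_congr rfl fun l _ => by rw [norm_mul, norm_phase, mul_one]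
    have hint : ∀ i j, Integrable (fun b : Fin d → ℝ => ‖∑ l, c i j l * phase (τ * b l)‖ ^ 2)
        (gueSpec 1 d) := fun i j => Integrable.of_bound (hcont i j).aestronglyMeasurable 1
      (Filter.Eventually.of_forall fun b => by
        rw [Real.norm_eq_abs, abs_of_nonneg (sq_nonneg _)]; exact hb1 i j b)
    have hq : ∀ i, Integrable (fun b : Fin d → ℝ =>
        ∑ j, x j * ‖∑ l, c i j l * phase (τ * b l)‖ ^ 2) (gueSpec 1 d) := fun i =>
      integrable_finsetSum _ fun j _ => (hint i j).const_mul _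
    have hqi := fun i => ((((hq i).const_mul s).add (integrable_const (1 / s))).div_const 2).const_mul
      (√(x i))
    have hpt : ∀ b : Fin d → ℝ, siteOverlap τ (b, V) (x, W) ≤ ∑ i, √(x i) *
        ((s * (∑ j, x j * ‖∑ l, c i j l * phase (τ * b l)‖ ^ 2) + 1 / s) / 2) := by
      intro b
      rw [hov]
      refine Finset.sum_le_sum fun i _ => mul_le_mul_of_nonneg_left ?_ (Real.sqrt_nonneg _)
      have h2 := sqrt_le_half_add (c := 1 / s) (by positivity)
        (Finset.sum_nonneg fun j (_ : j ∈ Finset.univ) => mul_nonneg (hx.1 j)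
          (sq_nonneg ‖∑ l, c i j l * phase (τ * b l)‖))
      rwa [div_div_eq_mul_div, div_one, mul_comm _ s] at h2
    have hFi : Integrable (fun b : Fin d → ℝ => siteOverlap τ (b, V) (x, W)) (gueSpec 1 d) := by
      have hcF : Continuous fun b : Fin d → ℝ => siteOverlap τ (b, V) (x, W) :=
        (continuous_siteOverlap τ).comp (f := fun b : Fin d → ℝ =>
          (((b, V), (x, W)) : SpectralData d × SpectralData d)) (by fun_prop)
      refine Integrable.of_bound hcF.aestronglyMeasurable 1 (Filter.Eventually.of_forall fun b => ?_)
      rw [Real.norm_eq_abs, abs_of_nonneg (siteOverlap_nonneg _ _ _)]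
      exact siteOverlap_le_one τ _ hx
    refine (integral_mono hFi (integrable_finsetSum _ fun i _ => hqi i) hpt).trans ?_
    refine (integral_finsetSum _ fun i _ => hqi i).le.trans ?_
    refine Finset.sum_le_sum fun i _ => ?_
    refine (integral_const_mul _ _).le.trans (mul_le_mul_of_nonneg_left ?_ (Real.sqrt_nonneg _))
    refine (integral_div _ _).le.trans (div_le_div_of_nonneg_right ?_ zero_le_two)
    refine (integral_add ((hq i).const_mul s) (integrable_const (1 / s))).le.trans ?_
    refine add_le_add ?_ (by simp)
    refine (integral_const_mul _ _).le.trans (mul_le_mul_of_nonneg_left ?_ hs0.le)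
    refine (integral_finsetSum _ fun j _ => (hint i j).const_mul _).le.trans ?_
    refine Finset.sum_le_sum fun j _ => ?_
    refine (integral_const_mul _ _).le.trans (mul_le_mul_of_nonneg_left ?_ (hx.1 j))
    refine (integral_norm_sum_phase_sq_le (hT τ hτ) hε0.le (hcn i j)).trans (le_of_eq ?_)
    congr 1
    refine Finset.sum_congr rfl fun l _ => ?_
    rw [hcdef, norm_mul, norm_star, mul_pow]
    rfl
  · intro x hx
    have i1 : ∀ i, Integrable (fun Z => ∑ j, x j * (∑ l, entrySq i l Z * entrySq j l Z + ε))
        (haarUnitary d) := fun i => integrable_of_continuous_unitary (hHc x i)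
    have hE : ∀ i, ∫ Z, ∑ j, x j * (∑ l, entrySq i l Z * entrySq j l Z + ε) ∂(haarUnitary d) =
        (1 + x i) / (d + 1) + ε := by
      intro i
      have k1 : ∀ j, Integrable (fun Z => ∑ l, entrySq i l Z * entrySq j l Z) (haarUnitary d) :=
        fun j => integrable_of_continuous_unitary
          (continuous_finsetSum _ fun l _ => (hc i l).mul (hc j l))
      have k2 : ∀ j, ∫ Z, x j * (∑ l, entrySq i l Z * entrySq j l Z + ε) ∂(haarUnitary d) =
          x j * ((if i = j then 2 else 1) / (d + 1) + ε) := by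
        intro j
        refine (integral_const_mul _ _).trans ?_
        congr 1
        refine (integral_add (k1 j) (integrable_const ε)).trans ?_
        congr 1
        · refine (integral_finsetSum (f := fun l Z => entrySq i l Z * entrySq j l Z) _ fun l _ =>
            integrable_of_continuous_unitary ((hc i l).mul (hc j l))).trans ?_
          simp only [integral_entrySq_mul_eq hd1, Finset.sum_const, Finset.card_univ,
            Fintype.card_fin, nsmul_eq_mul]
          field_simp
        · simp
      refine (integral_finsetSum _ fun j _ =>
        ((k1 j).add (integrable_const ε)).const_mul (x j)).trans ?_
      refine (Finset.sum_congr rfl fun j _ => k2 j).trans ?_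
      have k3 : ∀ j, x j * ((if i = j then 2 else 1) / (d + 1) + ε) =
          x j * (1 / (d + 1) + ε) + if i = j then x j * (1 / (d + 1)) else 0 := by
        intro j; split_ifs <;> ring
      simp only [k3, Finset.sum_add_distrib, ← Finset.sum_mul, hx.2, Finset.sum_ite_eq,
        Finset.mem_univ, if_true]
      ring
    have hI := fun i => ((((i1 i).const_mul s).add (integrable_const (1 / s))).div_const 2).const_mul
      (√(x i))
    have hHI : ∫ Z, H Z x ∂(haarUnitary d) =
        ∑ i, √(x i) * ((s * ((1 + x i) / (d + 1) + ε) + 1 / s) / 2) := by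
      refine (integral_finsetSum _ fun i _ => hI i).trans ?_
      refine Finset.sum_congr rfl fun i _ => ?_
      refine (integral_const_mul _ _).trans ?_
      congr 1
      refine (integral_div _ _).trans ?_
      congr 1
      refine (integral_add ((i1 i).const_mul s) (integrable_const (1 / s))).trans ?_
      rw [integral_const_mul, hE]; simp
    rw [hHI]
    have hfl : siteFlatness x = ∑ i, √(x i) / s := by
      unfold siteFlatness
      exact Finset.sum_congr rfl fun i _ => by rw [Real.sqrt_div (hx.1 i)]
    have hsd : s / (d + 1) ≤ 1 / s := by
      rw [div_le_div_iff₀ (by positivity) hs0]; linarith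
    have hterm : ∀ i, √(x i) * ((s * ((1 + x i) / (d + 1) + ε) + 1 / s) / 2) ≤
        √(x i) / s + (x i / (2 * s) + √(x i) / s * (ε * d / 2)) := by
      intro i
      have h0 := Real.sqrt_nonneg (x i)
      have h1 : √(x i) * x i ≤ x i := mul_le_of_le_one_left (hx.1 i)
        (Real.sqrt_le_one.mpr (hx.le_one i))
      have h2 : s * ((1 + x i) / (d + 1)) ≤ (1 + x i) * (1 / s) := by
        calc s * ((1 + x i) / (d + 1)) = (1 + x i) * (s / (d + 1)) := by ring
          _ ≤ _ := mul_le_mul_of_nonneg_left hsd (by linarith [hx.1 i])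
      have h3 : s * ε = ε * d / s := by rw [← hss]; field_simp
      calc _ = √(x i) * ((s * ((1 + x i) / (d + 1)) + s * ε + 1 / s) / 2) := by ring
        _ ≤ √(x i) * (((1 + x i) * (1 / s) + ε * d / s + 1 / s) / 2) := by
            rw [h3]; gcongr
        _ = √(x i) / s + ((√(x i) * x i) / (2 * s) + √(x i) / s * (ε * d / 2)) := by
            field_simp; ring
        _ ≤ _ := by gcongr
    refine (Finset.sum_le_sum fun i _ => hterm i).trans ?_
    rw [Finset.sum_add_distrib, Finset.sum_add_distrib, ← hfl, ← Finset.sum_div, hx.2,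
      ← Finset.sum_mul, ← hfl]
    have h4 : ε * d / 2 = 1 / (2 * d) := by rw [hε]; field_simp
    rw [h4]
    have h5 : siteFlatness x * (1 / (2 * d)) ≤ 1 / (2 * d) :=
      mul_le_of_le_one_left (by positivity) (siteFlatness_le_one hx)
    simp only [hK]
    linarith
  · have h1 : ∫ x, K x ∂(e.specLaw d) = ∫ x, siteFlatness x ∂(e.specLaw d) +
        (1 / (2 * s) + 1 / (2 * d)) := by
      refine (integral_add hKi0 (integrable_const _)).trans ?_
      simp
    rw [h1]
    have h2 := e.integral_siteFlatness_le hd1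
    have hdinv : 1 / (d : ℝ) ≤ 1 / 10000 := one_div_le_one_div_of_le (by norm_num) hdr
    have hsinv : 1 / s ≤ 1 / 100 := one_div_le_one_div_of_le (by norm_num) hs100
    have h3 : √2 / 16 * (87 / 8 + 3 / (d : ℝ)) ≤ 14143 / 160000 * (87 / 8 + 3 / 10000) := by
      refine mul_le_mul sqrt_two_div_le ?_ (by positivity) (by norm_num)
      have : 3 / (d : ℝ) = 3 * (1 / d) := by ring
      rw [this]; linarith
    have h4 : 1 / (2 * s) = 1 / s / 2 := by field_simp
    have h5 : 1 / (2 * (d : ℝ)) = 1 / d / 2 := by field_simp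
    rw [h4, h5]
    linarith

lemma integral_siteFlatness_law_le (e : StateEnsemble) (hd : 10000 ≤ d) :
    ∫ ρ, siteFlatness ρ.1 ∂(e.law d) ≤ 97 / 100 := by
  have hd1 : 1 ≤ d := by omega
  have hdr : (10000 : ℝ) ≤ d := by exact_mod_cast hd
  have := e.isProbabilityMeasure_specLaw hd1
  have h1 : ∫ ρ, siteFlatness ρ.1 ∂(e.law d) = ∫ x, siteFlatness x ∂(e.specLaw d) := by
    rw [e.law_eq, integral_fun_fst]
    simp
  rw [h1]
  refine (e.integral_siteFlatness_le hd1).trans ?_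
  have hdinv : 1 / (d : ℝ) ≤ 1 / 10000 := one_div_le_one_div_of_le (by norm_num) hdr
  have h3 : √2 / 16 * (87 / 8 + 3 / (d : ℝ)) ≤ 14143 / 160000 * (87 / 8 + 3 / 10000) := by
    refine mul_le_mul sqrt_two_div_le ?_ (by positivity) (by norm_num)
    have : 3 / (d : ℝ) = 3 * (1 / d) := by ring
    rw [this]; linarith
  linarith

lemma le_exp_neg_one_div (hd : 10000 ≤ d) : (97 / 100 : ℝ) ≤ Real.exp (-(1 / (d : ℝ))) := by
  have hdr : (10000 : ℝ) ≤ d := by exact_mod_cast hd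
  have hdinv : 1 / (d : ℝ) ≤ 1 / 10000 := one_div_le_one_div_of_le (by norm_num) hdr
  have := Real.add_one_le_exp (-(1 / (d : ℝ)))
  linarith

end SiteAverages

/-! ### Scale factors of the GUE as dilations. -/

section Scaling

variable {d : ℕ}

lemma normalise_smul {α : Type*} [MeasurableSpace α] (ν : Measure α) {c : ℝ≥0∞} (h0 : c ≠ 0)
    (h1 : c ≠ ∞) : normalise (c • ν) = normalise ν := by
  unfold normalise
  rw [Measure.smul_apply, smul_eq_mul, ENNReal.mul_inv (Or.inl h0) (Or.inl h1), smul_smul,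
    mul_right_comm, ENNReal.inv_mul_cancel h0 h1, one_mul]

lemma normalise_map {α β : Type*} [MeasurableSpace α] [MeasurableSpace β] (ν : Measure α)
    {g : α → β} (hg : Measurable g) : normalise (ν.map g) = (normalise ν).map g := by
  unfold normalise
  rw [Measure.map_smul, Measure.map_apply hg MeasurableSet.univ, Set.preimage_univ]

lemma gueDensity_smul {η c : ℝ} (hc : η * c ^ 2 = 1) (x : Fin d → ℝ) :
    gueDensity 1 x * ∏ i : Fin d, ∏ _j ∈ Finset.Ioi i, c ^ 2 = gueDensity η (c • x) := by
  unfold gueDensity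
  simp only [Pi.smul_apply, smul_eq_mul, ← mul_sub, mul_pow, Finset.prod_mul_distrib,
    ← Finset.mul_sum]
  have : -(η / 2) * (c ^ 2 * ∑ i, x i ^ 2) = -(1 / 2) * ∑ i, x i ^ 2 := by
    rw [← hc]; ring
  rw [this]
  ring

/-- A change of the scale factor amounts to a dilation of the spectrum. -/
lemma gueSpec_eq_map {η c : ℝ} (hc0 : 0 < c) (hc : η * c ^ 2 = 1) (d : ℕ) :
    gueSpec η d = (gueSpec 1 d).map (fun x => c • x) := by
  have hg : Measurable fun x : Fin d → ℝ => c • x := measurable_const_smul c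
  set k : ℝ := ∏ i : Fin d, ∏ _j ∈ Finset.Ioi i, c ^ 2 with hk
  have hk0 : 0 < k := Finset.prod_pos fun i _ => Finset.prod_pos fun j _ => by positivity
  have hvol := Measure.map_addHaar_smul (volume : Measure (Fin d → ℝ)) hc0.ne'
  set r : ℝ := |(c ^ Module.finrank ℝ (Fin d → ℝ))⁻¹| with hr
  have hr0 : 0 < r := by rw [hr]; positivity
  unfold gueSpec
  rw [← normalise_map _ hg]
  have key : Measure.map (fun x => c • x)
      (volume.withDensity fun x : Fin d → ℝ => ENNReal.ofReal (gueDensity 1 x)) =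
      (ENNReal.ofReal k⁻¹ * ENNReal.ofReal r) •
        volume.withDensity fun x : Fin d → ℝ => ENNReal.ofReal (gueDensity η x) := by
    have hm : Measurable fun x : Fin d → ℝ => ENNReal.ofReal (gueDensity η x) :=
      (continuous_gueDensity η).measurable.ennreal_ofReal
    ext s hs
    rw [Measure.map_apply hg hs, withDensity_apply _ (hg hs), Measure.smul_apply,
      withDensity_apply _ hs, smul_eq_mul, mul_assoc]
    have h1 : ∀ x : Fin d → ℝ, ENNReal.ofReal (gueDensity 1 x) =
        ENNReal.ofReal k⁻¹ * ENNReal.ofReal (gueDensity η (c • x)) := by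
      intro x
      rw [← ENNReal.ofReal_mul (by positivity), ← gueDensity_smul hc x, ← hk]
      congr 1
      field_simp
    simp only [h1]
    refine (lintegral_const_mul _ (hm.comp hg)).trans ?_
    rw [← smul_eq_mul (ENNReal.ofReal r), ← lintegral_smul_measure, ← Measure.restrict_smul, ← hvol,
      setLIntegral_map hs hm hg]
    rfl
  rw [key, normalise_smul]
  · exact mul_ne_zero (by simpa using hk0) (by simpa using hr0)
  · exact ENNReal.mul_ne_top ENNReal.ofReal_ne_top ENNReal.ofReal_ne_top

/-- The dilation of the spectrum by the factor `c`. -/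
def SpectralData.dilate (c : ℝ) (B : SpectralData d) : SpectralData d := (c • B.1, B.2)

lemma SpectralData.dilate_dilate (c c' : ℝ) (B : SpectralData d) :
    (B.dilate c').dilate c = B.dilate (c * c') := by
  simp [SpectralData.dilate, smul_smul]

lemma SpectralData.continuous_dilate :
    Continuous fun q : ℝ × SpectralData d => q.2.dilate q.1 := by
  unfold SpectralData.dilate; fun_prop

lemma gue_eq_map {η c : ℝ} (hc0 : 0 < c) (hc : η * c ^ 2 = 1) (d : ℕ) :
    gue η d = (gue 1 d).map (SpectralData.dilate c) := by
  have := isProbabilityMeasure_gueSpec one_pos d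
  rw [gue_eq, gue_eq, gueSpec_eq_map hc0 hc]
  conv_lhs => rw [← Measure.map_id (μ := haarUnitary d)]
  rw [Measure.map_prod_map _ _ (measurable_const_smul c) measurable_id]
  rfl

/-- The effective time is absorbed into the spectrum of `B`, where the scale factor of the ensemble
is absorbed as well. -/
lemma siteU_dilate (τ : ℝ) (B : SpectralData d) : siteU 1 (B.dilate τ) = siteU τ B := by
  simp [siteU, SpectralData.dilate]

lemma siteDecoherence_dilate (τ : ℝ) (B ρ : SpectralData d) :
    siteDecoherence 1 (B.dilate τ) ρ = siteDecoherence τ B ρ := by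
  simp only [siteDecoherence, siteU_dilate]

lemma siteOverlap_dilate (τ : ℝ) (B ρ : SpectralData d) :
    siteOverlap 1 (B.dilate τ) ρ = siteOverlap τ B ρ := by
  simp only [siteOverlap, siteU_dilate]

end Scaling

/-! ### Independence over sites and near-degeneracies of A. -/

section Products

variable {dS d Nuno M Nmac : ℕ}

/-- After pairing observables and states site by site, the factors are independent; sites outside
the range of `i` carry the constant 1 and integrate to one. -/
lemma integral_prod_comp_injective {κ α X Y : Type*} [Fintype κ] [DecidableEq κ] [Fintype α]
    [MeasurableSpace X] [MeasurableSpace Y] (μ : Measure X) (ν : Measure Y)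
    [IsProbabilityMeasure μ] [IsProbabilityMeasure ν] {i : α → κ} (hi : Function.Injective i)
    (f : X × Y → ℝ) :
    ∫ q, ∏ k, f (q.1 (i k), q.2 (i k))
        ∂((Measure.pi fun _ : κ => μ).prod (Measure.pi fun _ : κ => ν)) =
      (∫ q, f q ∂(μ.prod ν)) ^ Fintype.card α := by
  classical
  have h1 := (measurePreserving_arrowProdEquivProdArrow X Y κ (fun _ => μ)
    (fun _ => ν)).integral_comp' (g := fun q : (κ → X) × (κ → Y) =>
      ∏ k, f (q.1 (i k), q.2 (i k)))
  rw [← h1]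
  have h2 : ∀ z : κ → X × Y, ∏ k, f (z (i k)) =
      ∏ j, (if j ∈ Finset.univ.image i then f else fun _ => 1) (z j) := by
    intro z
    rw [← Finset.prod_image (f := fun j => f (z j)) (fun a _ b _ h => hi h)]
    rw [← Finset.prod_subset (Finset.subset_univ (Finset.univ.image i))]
    · exact Finset.prod_congr rfl fun j hj => by rw [if_pos hj]
    · intro j _ hj; rw [if_neg hj]
  refine (integral_congr_ae (Filter.Eventually.of_forall h2)).trans ?_
  rw [integral_fintype_prod_eq_prod
    (f := fun j : κ => (if j ∈ Finset.univ.image i then f else fun _ => 1))]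
  rw [← Finset.prod_subset (Finset.subset_univ (Finset.univ.image i))]
  · rw [Finset.prod_congr rfl (g := fun _ => ∫ q, f q ∂(μ.prod ν))
      fun j hj => by rw [if_pos hj], Finset.prod_const, Finset.card_image_of_injective _ hi,
      Finset.card_univ]
  · intro j _ hj
    rw [if_neg hj]; simp

lemma integral_sampleLaw_env (e : StateEnsemble) {ηS ηE : ℝ} (hS : 0 < ηS) (hE : 0 < ηE)
    (hd : 1 ≤ d) {α : Type*} [Fintype α] {i : α → EnvLabel Nuno M Nmac}
    (hi : Function.Injective i) (f : SpectralData d → ℝ) :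
    ∫ ω, ∏ k, f (ω.2.2 (i k)) ∂(sampleLaw e ηS ηE dS d Nuno M Nmac) =
      (∫ ρ, f ρ ∂(e.law d)) ^ Fintype.card α := by
  have := isProbabilityMeasure_gue hS dS
  have := isProbabilityMeasure_gue hE d
  have := e.isProbabilityMeasure_law hd
  rw [sampleLaw]
  refine (integral_fun_snd (μ := gue ηS dS)
    (fun q : (EnvLabel Nuno M Nmac → SpectralData d) × (EnvLabel Nuno M Nmac → SpectralData d) =>
      ∏ k, f (q.2 (i k)))).trans ?_
  rw [probReal_univ, one_smul]
  refine (integral_prod_comp_injective (gue ηE d) (e.law d) hi fun q => f q.2).trans ?_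
  rw [integral_fun_snd, probReal_univ, one_smul]

/-- The product over apparatuses of the site quantities `f` at the time difference
`t * (α_a - α_b)`. -/
def siteProd {α : Type*} [Fintype α] (f : SpectralData d → SpectralData d → ℝ)
    (i : α → EnvLabel Nuno M Nmac) (a b : Fin dS) (t : ℝ) (ω : Sample dS d Nuno M Nmac) : ℝ :=
  ∏ k, f ((ω.2.1 (i k)).dilate (t * (ω.1.1 a - ω.1.1 b))) (ω.2.2 (i k))

variable {α : Type*} [Fintype α] {f : SpectralData d → SpectralData d → ℝ}
  {i : α → EnvLabel Nuno M Nmac} {e : StateEnsemble} {ηS ηE : ℝ}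

lemma continuous_siteProd (hf : Continuous fun q : SpectralData d × SpectralData d => f q.1 q.2)
    (i : α → EnvLabel Nuno M Nmac) (a b : Fin dS) (t : ℝ) : Continuous (siteProd f i a b t) := by
  unfold siteProd
  refine continuous_finsetProd _ fun k _ => ?_
  have h1 : Continuous fun ω : Sample dS d Nuno M Nmac =>
      (ω.2.1 (i k)).dilate (t * (ω.1.1 a - ω.1.1 b)) :=
    SpectralData.continuous_dilate.comp (f := fun ω : Sample dS d Nuno M Nmac =>
      ((t * (ω.1.1 a - ω.1.1 b) : ℝ), ω.2.1 (i k))) (by fun_prop)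
  exact hf.comp (h1.prodMk (by fun_prop :
    Continuous fun ω : Sample dS d Nuno M Nmac => ω.2.2 (i k)))

lemma siteProd_nonneg (h0 : ∀ B ρ, 0 ≤ f B ρ) (a b : Fin dS) (t : ℝ)
    (ω : Sample dS d Nuno M Nmac) : 0 ≤ siteProd f i a b t ω :=
  Finset.prod_nonneg fun _ _ => h0 _ _

lemma integrable_siteProd (hS : 0 < ηS) (hE : 0 < ηE) (hd : 1 ≤ d)
    (hf : Continuous fun q : SpectralData d × SpectralData d => f q.1 q.2)
    (h0 : ∀ B ρ, 0 ≤ f B ρ) (h1 : ∀ B ρ : SpectralData d, IsSpectrum ρ.1 → f B ρ ≤ 1)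
    (a b : Fin dS) (t : ℝ) :
    Integrable (siteProd f i a b t) (sampleLaw e ηS ηE dS d Nuno M Nmac) := by
  have := isProbabilityMeasure_sampleLaw e hS hE (dS := dS) (Nuno := Nuno) (M := M) (Nmac := Nmac)
    hd
  refine Integrable.of_bound (continuous_siteProd hf i a b t).measurable.aestronglyMeasurable 1 ?_
  filter_upwards [ae_sampleLaw e hS hE hd] with ω hω
  rw [Real.norm_eq_abs, abs_of_nonneg (siteProd_nonneg h0 a b t ω)]
  exact Finset.prod_le_one (fun _ _ => h0 _ _) fun k _ => h1 _ _ (hω _)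

lemma integral_dilate (hE : 0 < ηE) (hd : 1 ≤ d)
    (hf : Continuous fun q : SpectralData d × SpectralData d => f q.1 q.2) (τ : ℝ) :
    ∫ q, f (q.1.dilate τ) q.2 ∂((gue ηE d).prod (e.law d)) =
      ∫ q, f (q.1.dilate (τ / √ηE)) q.2 ∂((gue 1 d).prod (e.law d)) := by
  have := isProbabilityMeasure_gue one_pos d
  have := e.isProbabilityMeasure_law hd
  have hs : 0 < √ηE := Real.sqrt_pos.mpr hE
  have hc : ηE * ((√ηE)⁻¹) ^ 2 = 1 := by
    rw [inv_pow, Real.sq_sqrt hE.le, mul_inv_cancel₀ hE.ne']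
  have hm : ∀ c : ℝ, Continuous (SpectralData.dilate c : SpectralData d → SpectralData d) :=
    fun c => SpectralData.continuous_dilate.comp (by fun_prop : Continuous fun B : SpectralData d =>
      (c, B))
  rw [gue_eq_map (inv_pos.mpr hs) hc]
  conv_lhs => rw [← Measure.map_id (μ := e.law d)]
  rw [Measure.map_prod_map _ _ (hm _).measurable measurable_id, integral_map
    ((hm _).measurable.prodMap measurable_id).aemeasurable]
  · refine integral_congr_ae (Filter.Eventually.of_forall fun q => ?_)
    simp only [Prod.map_fst, Prod.map_snd, id, SpectralData.dilate_dilate, div_eq_mul_inv]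
  · exact (hf.comp (((hm τ).comp continuous_fst).prodMk
      continuous_snd)).measurable.aestronglyMeasurable

/-- Condition on A. Given A, the sites are independent and share one effective time; if it exceeds
T, each site contributes at most β. Otherwise the product is bounded by 1, which costs the
probability of a small gap. Unit scale factors are reached by dilating both ensembles. -/
lemma integral_siteProd_le (hS : 0 < ηS) (hE : 0 < ηE) (hd : 1 ≤ d)
    (hf : Continuous fun q : SpectralData d × SpectralData d => f q.1 q.2)
    (h0 : ∀ B ρ, 0 ≤ f B ρ) (h1 : ∀ B ρ : SpectralData d, IsSpectrum ρ.1 → f B ρ ≤ 1)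
    {T β : ℝ} (hβ : 0 ≤ β) (hT : ∀ τ, T ≤ |τ| →
      ∫ q, f (q.1.dilate τ) q.2 ∂((gue 1 d).prod (e.law d)) ≤ β)
    (hi : Function.Injective i) (a b : Fin dS) (t : ℝ) :
    ∫ ω, siteProd f i a b t ω ∂(sampleLaw e ηS ηE dS d Nuno M Nmac) ≤
      β ^ Fintype.card α +
        (gueSpec 1 dS).real {x | |t / (√ηS * √ηE) * (x a - x b)| < T} := by
  have := isProbabilityMeasure_gueSpec hS dS
  have := isProbabilityMeasure_gueSpec one_pos dS
  have := isProbabilityMeasure_gue hS dS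
  have := isProbabilityMeasure_gue hE d
  have := isProbabilityMeasure_gue one_pos d
  have := e.isProbabilityMeasure_law hd
  have hs : 0 < √ηS := Real.sqrt_pos.mpr hS
  have hc : ηS * ((√ηS)⁻¹) ^ 2 = 1 := by
    rw [inv_pow, Real.sq_sqrt hS.le, mul_inv_cancel₀ hS.ne']
  have hint := integrable_siteProd (i := i) (e := e) hS hE hd hf h0 h1 a b t
  have h01 : ∀ τ, ∫ q, f (q.1.dilate τ) q.2 ∂((gue 1 d).prod (e.law d)) ≤ 1 := by
    intro τ
    have hae : ∀ᵐ q ∂((gue 1 d).prod (e.law d)), f (q.1.dilate τ) q.2 ≤ 1 := by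
      filter_upwards [(Measure.quasiMeasurePreserving_snd (μ := gue 1 d) (ν := e.law d)).ae
        (e.ae_law hd)] with q hq using h1 _ _ hq
    refine (integral_mono_of_nonneg (Filter.Eventually.of_forall fun q => h0 _ _)
      (integrable_const (1 : ℝ)) hae).trans ?_
    simp
  set S : Set (Fin dS → ℝ) := {x | |t * (x a - x b) / √ηE| < T} with hSdef
  have hSm : MeasurableSet S := measurableSet_lt (by fun_prop) measurable_const
  -- The two cases are added up in one function of the spectrum of A.
  set g : (Fin dS → ℝ) → ℝ := fun x => β ^ Fintype.card α + S.indicator 1 x with hg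
  have hgi : Integrable g (gueSpec ηS dS) :=
    (integrable_const _).add ((integrable_const 1).indicator hSm)
  have hin : ∀ A : SpectralData dS, ∫ q, siteProd f i a b t (A, q)
      ∂((Measure.pi fun _ : EnvLabel Nuno M Nmac => gue ηE d).prod
        (Measure.pi fun _ : EnvLabel Nuno M Nmac => e.law d)) ≤ g A.1 := by
    intro A
    refine (integral_prod_comp_injective (gue ηE d) (e.law d) hi
      fun q => f (q.1.dilate (t * (A.1 a - A.1 b))) q.2).le.trans ?_
    rw [integral_dilate hE hd hf]
    have hnn : 0 ≤ ∫ q, f (q.1.dilate (t * (A.1 a - A.1 b) / √ηE)) q.2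
        ∂((gue 1 d).prod (e.law d)) := integral_nonneg fun q => h0 _ _
    simp only [hg]
    by_cases hA : A.1 ∈ S
    · rw [Set.indicator_of_mem hA, Pi.one_apply]
      linarith [pow_le_one₀ (n := Fintype.card α) hnn (h01 (t * (A.1 a - A.1 b) / √ηE)),
        pow_nonneg hβ (Fintype.card α)]
    · rw [Set.indicator_of_notMem hA, add_zero]
      exact pow_le_pow_left₀ hnn (hT _ (not_lt.mp hA)) _
  rw [sampleLaw] at hint ⊢
  rw [integral_prod _ hint]
  refine (integral_mono hint.integral_prod_left (hgi.comp_fst (haarUnitary dS)) hin).trans ?_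
  rw [gue_eq, integral_fun_fst, probReal_univ, one_smul]
  refine (integral_add (integrable_const _) ((integrable_const 1).indicator hSm)).le.trans ?_
  refine add_le_add (by simp) ?_
  rw [integral_indicator_one hSm, gueSpec_eq_map (inv_pos.mpr hs) hc,
    map_measureReal_apply (measurable_const_smul _) hSm]
  refine le_of_eq (congrArg _ ?_)
  ext x
  simp only [hSdef, Set.mem_preimage, Set.mem_ofPred_eq, Pi.smul_apply, smul_eq_mul]
  have : t * ((√ηS)⁻¹ * x a - (√ηS)⁻¹ * x b) / √ηE = t / (√ηS * √ηE) * (x a - x b) := by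
    have := Real.sqrt_pos.mpr hE
    field_simp
  rw [this]

/-- Near-degeneracies of the spectrum become negligible at large times. -/
lemma exists_gueSpec_near_le (dS : ℕ) (T : ℝ) {δ : ℝ} (hδ : 0 < δ) :
    ∃ S : ℝ, 0 < S ∧ ∀ s, S ≤ s → ∀ a b : Fin dS, a ≠ b →
      (gueSpec 1 dS).real {x | |s * (x a - x b)| < T} ≤ δ := by
  have := isProbabilityMeasure_gueSpec one_pos dS
  have hac : gueSpec 1 dS ≪ volume :=
    Measure.smul_absolutelyContinuous.trans (withDensity_absolutelyContinuous _ _)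
  have key : ∀ a b : Fin dS, ∀ᶠ n : ℕ in Filter.atTop, a ≠ b →
      (gueSpec 1 dS).real {x | |(n : ℝ) * (x a - x b)| < T} ≤ δ := by
    intro a b
    by_cases hab : a = b
    · exact Filter.Eventually.of_forall fun _ h => absurd hab h
    set F : ℕ → Set (Fin dS → ℝ) := fun n => {x | |(n : ℝ) * (x a - x b)| < T} with hF
    have hFm : ∀ n, MeasurableSet (F n) := fun n => measurableSet_lt (by fun_prop) measurable_const
    have hanti : Antitone F := by
      intro n m hnm x hx
      simp only [hF, Set.mem_ofPred_eq, abs_mul, Nat.abs_cast] at hx ⊢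
      exact lt_of_le_of_lt (mul_le_mul_of_nonneg_right (by exact_mod_cast hnm) (abs_nonneg _)) hx
    have hzero : gueSpec 1 dS (⋂ n, F n) = 0 := by
      refine measure_mono_null ?_ (hac (ae_iff.mp (ae_ne hab)))
      intro x hx
      rw [Set.mem_ofPred_eq, not_not]
      by_contra hne
      obtain ⟨n, hn⟩ := exists_nat_gt (T / |x a - x b|)
      rw [div_lt_iff₀ (abs_pos.mpr (sub_ne_zero.mpr hne))] at hn
      have := Set.mem_iInter.mp hx n
      simp only [hF, Set.mem_ofPred_eq, abs_mul, Nat.abs_cast] at this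
      linarith
    have hlim := tendsto_measure_iInter_atTop (μ := gueSpec 1 dS)
      (fun n => (hFm n).nullMeasurableSet) hanti ⟨0, measure_ne_top _ _⟩
    rw [hzero] at hlim
    have := (ENNReal.tendsto_toReal ENNReal.zero_ne_top).comp hlim
    filter_upwards [this.eventually (ge_mem_nhds (by simpa using hδ))] with n hn _ using hn
  have hall : ∀ᶠ n : ℕ in Filter.atTop, ∀ a b : Fin dS, a ≠ b →
      (gueSpec 1 dS).real {x | |(n : ℝ) * (x a - x b)| < T} ≤ δ :=
    Filter.eventually_all.mpr fun a => Filter.eventually_all.mpr fun b => key a b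
  obtain ⟨n, hn, hn1⟩ := (hall.and (Filter.eventually_ge_atTop 1)).exists
  have hn0 : (0 : ℝ) < n := by exact_mod_cast hn1
  refine ⟨n, hn0, fun s hs a b hab => (measureReal_mono ?_).trans (hn a b hab)⟩
  intro x hx
  simp only [Set.mem_ofPred_eq, abs_mul, Nat.abs_cast, abs_of_pos (hn0.trans_le hs)] at hx ⊢
  exact lt_of_le_of_lt (mul_le_mul_of_nonneg_right hs (abs_nonneg _)) hx

end Products

/-! ### Final estimate and choice of the time constant. -/

section Assembly

variable {dS d Nuno M Nmac : ℕ} {e : StateEnsemble} {ηS ηE : ℝ}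

lemma trace_toMatrix_sq_re (s : SpectralData d) :
    (s.toMatrix * s.toMatrix).trace.re = ∑ i, s.1 i ^ 2 := by
  have h : s.toMatrix * s.toMatrix = (s.2 : Matrix (Fin d) (Fin d) ℂ) *
      (Matrix.diagonal (fun i => (s.1 i : ℂ)) * Matrix.diagonal (fun i => (s.1 i : ℂ))) *
      (s.2 : Matrix (Fin d) (Fin d) ℂ)ᴴ := by
    unfold SpectralData.toMatrix
    calc _ = (s.2 : Matrix (Fin d) (Fin d) ℂ) * Matrix.diagonal (fun i => (s.1 i : ℂ)) *
          ((s.2 : Matrix (Fin d) (Fin d) ℂ)ᴴ * s.2) * Matrix.diagonal (fun i => (s.1 i : ℂ)) *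
          (s.2 : Matrix (Fin d) (Fin d) ℂ)ᴴ := by simp only [Matrix.mul_assoc]
      _ = _ := by rw [unitary_conjTranspose_mul, Matrix.mul_one]; simp only [Matrix.mul_assoc]
  rw [h, Matrix.trace_mul_comm, ← Matrix.mul_assoc, unitary_conjTranspose_mul, Matrix.one_mul,
    Matrix.diagonal_mul_diagonal, Matrix.trace_diagonal, Complex.re_sum]
  exact Finset.sum_congr rfl fun i _ => by rw [← Complex.ofReal_mul, Complex.ofReal_re, sq]

lemma meanPurity_nonneg (e : StateEnsemble) (d : ℕ) : 0 ≤ e.meanPurity d :=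
  integral_nonneg fun s => by
    rw [trace_toMatrix_sq_re]; exact Finset.sum_nonneg fun _ _ => sq_nonneg _

lemma meanPurity_le_one (e : StateEnsemble) (hd : 1 ≤ d) : e.meanPurity d ≤ 1 := by
  have := e.isProbabilityMeasure_law hd
  refine (integral_mono_of_nonneg (Filter.Eventually.of_forall fun s => ?_)
    (integrable_const (1 : ℝ)) ?_).trans (by simp)
  · simp only [trace_toMatrix_sq_re]; exact Finset.sum_nonneg fun _ _ => sq_nonneg _
  · filter_upwards [e.ae_law hd] with s hs
    rw [trace_toMatrix_sq_re, ← hs.2]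
    exact Finset.sum_le_sum fun i _ => by
      rw [sq]; exact mul_le_of_le_one_left (hs.1 i) (hs.le_one i)

/-- In units of the inverse coupling, the time scale is bounded below. -/
lemma le_tauSBS (e : StateEnsemble) (hS : 0 < ηS) (hE : 0 < ηE) (hd : 2 ≤ d) (hdS : 1 ≤ dS)
    (hN : 1 ≤ Nuno) (Nmac : ℕ) :
    √ηS * √ηE / √(8 * Nuno * dS * d) ≤ tauSBS e ηS ηE dS d Nuno Nmac := by
  refine le_trans ?_ (le_max_left _ _)
  have hdr : (2 : ℝ) ≤ d := by exact_mod_cast hd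
  have hdSr : (0 : ℝ) < dS := by exact_mod_cast hdS
  have hNr : (0 : ℝ) < Nuno := by exact_mod_cast hN
  have h0 := meanPurity_nonneg e d
  have h1 := meanPurity_le_one e (d := d) (by omega)
  have hc : coupling ηS ηE ^ 2 = 1 / (ηS * ηE) := by
    rw [coupling, div_pow, one_pow, Real.sq_sqrt (mul_pos hS hE).le]
  have hpos : 0 < 8 * coupling ηS ηE ^ 2 * Nuno * dS * (d - e.meanPurity d) := by
    rw [hc]; have : 0 < d - e.meanPurity d := by linarith
    positivity
  rw [tauDec, ← Real.sqrt_mul hS.le, ← one_div_div, ← Real.sqrt_div (by positivity)]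
  refine one_div_le_one_div_of_le (Real.sqrt_pos.mpr hpos) (Real.sqrt_le_sqrt ?_)
  rw [hc]
  calc 8 * (1 / (ηS * ηE)) * Nuno * dS * (d - e.meanPurity d)
      ≤ 8 * (1 / (ηS * ηE)) * Nuno * dS * d := by gcongr; linarith
    _ = _ := by ring

lemma sbsBound_eq (t : ℝ) (ω : Sample dS d Nuno M Nmac) :
    sbsBound t ω = 1 / 2 * ∑ a, ∑ b ∈ {a}ᶜ, siteProd (siteDecoherence 1) Sum.inl a b t ω +
      ∑ m, (√(∑ a, ∑ b ∈ {a}ᶜ, siteProd (siteOverlap 1) (fun k => Sum.inr (m, k)) b a t ω) +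
        √dS * ∏ k : Fin Nmac, siteFlatness (ω.2.2 (Sum.inr (m, k))).1) := by
  simp only [siteProd, siteDecoherence_dilate, siteOverlap_dilate]
  rfl

lemma sum_sum_compl_le {F : Fin dS → Fin dS → ℝ} {c : ℝ} (hc : 0 ≤ c)
    (hF : ∀ a b, a ≠ b → F a b ≤ c) : ∑ a, ∑ b ∈ {a}ᶜ, F a b ≤ (dS : ℝ) ^ 2 * c := by
  have h1 : ∀ a : Fin dS, ∑ b ∈ {a}ᶜ, F a b ≤ dS * c := by
    intro a
    calc ∑ b ∈ {a}ᶜ, F a b ≤ ∑ _b ∈ ({a}ᶜ : Finset (Fin dS)), c :=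
          Finset.sum_le_sum fun b hb => hF a b fun h => by simp [h] at hb
      _ ≤ ∑ _b : Fin dS, c :=
          Finset.sum_le_sum_of_subset_of_nonneg (Finset.subset_univ _) fun _ _ _ => hc
      _ = dS * c := by simp
  calc _ ≤ ∑ _a : Fin dS, (dS : ℝ) * c := Finset.sum_le_sum fun a _ => h1 a
    _ = _ := by simp; ring

/-- Integrates `sbsBound`. The square root of the overlaps halves their exponential rate, which is
why they are required to be of size q² in order to obtain q. -/
lemma integral_epsSBS_le (hS : 0 < ηS) (hE : 0 < ηE) (hd1 : 1 ≤ d)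
    (hdS : 1 ≤ dS) (hd : dS ≤ d ^ Nmac) {ρS : Matrix (Fin dS) (Fin dS) ℂ} (hρ : IsState ρS)
    (t : ℝ) {X q : ℝ} (hX : 0 ≤ X) (hq : 0 < q) (hq1 : q ≤ 1)
    (hdec : ∀ a b : Fin dS, a ≠ b → ∫ ω, siteProd (siteDecoherence 1) Sum.inl a b t ω
      ∂(sampleLaw e ηS ηE dS d Nuno M Nmac) ≤ 2 * X)
    (hov : ∀ a b : Fin dS, a ≠ b → ∀ m, ∫ ω, siteProd (siteOverlap 1)
      (fun k => Sum.inr (m, k)) a b t ω ∂(sampleLaw e ηS ηE dS d Nuno M Nmac) ≤ 2 * q ^ 2)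
    (hfl : (∫ ρ, siteFlatness ρ.1 ∂(e.law d)) ^ Nmac ≤ q ^ 2) :
    ∫ ω, epsSBS ρS t ω ∂(sampleLaw e ηS ηE dS d Nuno M Nmac) ≤
      5 / 2 * ((dS : ℝ) ^ 2 * (X + M * q)) := by
  set μ := sampleLaw e ηS ηE dS d Nuno M Nmac with hμ
  have : IsProbabilityMeasure μ := isProbabilityMeasure_sampleLaw e hS hE hd1
  have hdSr : (1 : ℝ) ≤ dS := by exact_mod_cast hdS
  -- The expected size of the square root: the overlap sum has mean at most 2 dS² q², so the
  -- linearised root contributes 3c/2. The flatness term adds at most dS q, whence 5/2 per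
  -- macrofraction.
  set c : ℝ := dS * q with hc
  have hc0 : 0 < c := by positivity
  set D : Fin dS → Fin dS → Sample dS d Nuno M Nmac → ℝ :=
    fun a b => siteProd (siteDecoherence 1) Sum.inl a b t with hD
  set O : Fin M → Fin dS → Fin dS → Sample dS d Nuno M Nmac → ℝ :=
    fun m a b => siteProd (siteOverlap 1) (fun k => Sum.inr (m, k)) b a t with hO
  set L : Fin M → Sample dS d Nuno M Nmac → ℝ :=
    fun m ω => ∏ k : Fin Nmac, siteFlatness (ω.2.2 (Sum.inr (m, k))).1 with hL
  have iD : ∀ a b, Integrable (D a b) μ := fun a b => integrable_siteProd hS hE hd1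
    (continuous_siteDecoherence 1) (siteDecoherence_nonneg 1)
    (fun B _ h => siteDecoherence_le_one 1 B h) a b t
  have iO : ∀ m a b, Integrable (O m a b) μ := fun m a b => integrable_siteProd hS hE hd1
    (continuous_siteOverlap 1) (siteOverlap_nonneg 1)
    (fun B _ h => siteOverlap_le_one 1 B h) b a t
  have hinj : ∀ m : Fin M, Function.Injective
      (fun k : Fin Nmac => (Sum.inr (m, k) : EnvLabel Nuno M Nmac)) :=
    fun m k l h => (Prod.mk.inj (Sum.inr.inj h)).2
  have iL : ∀ m, Integrable (L m) μ := by
    intro m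
    have hcont : Continuous (L m) := continuous_finsetProd _ fun k _ => by
      unfold siteFlatness; fun_prop
    refine Integrable.of_bound hcont.measurable.aestronglyMeasurable 1 ?_
    filter_upwards [ae_sampleLaw e hS hE hd1] with ω hω
    rw [Real.norm_eq_abs, abs_of_nonneg (Finset.prod_nonneg fun k _ => siteFlatness_nonneg _)]
    exact Finset.prod_le_one (fun k _ => siteFlatness_nonneg _) fun k _ => siteFlatness_le_one (hω _)
  have EL : ∀ m, ∫ ω, L m ω ∂μ ≤ q ^ 2 := fun m =>
    (integral_sampleLaw_env e hS hE hd1 (hinj m) fun ρ => siteFlatness ρ.1).le.trans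
      (by rwa [Fintype.card_fin])
  have iDs : Integrable (fun ω => 1 / 2 * ∑ a, ∑ b ∈ {a}ᶜ, D a b ω) μ :=
    (integrable_finsetSum _ fun a _ => integrable_finsetSum _ fun b _ => iD a b).const_mul _
  have iOs : ∀ m, Integrable (fun ω => ∑ a, ∑ b ∈ {a}ᶜ, O m a b ω) μ := fun m =>
    integrable_finsetSum _ fun a _ => integrable_finsetSum _ fun b _ => iO m a b
  have iR : ∀ m, Integrable (fun ω => ((∑ a, ∑ b ∈ {a}ᶜ, O m a b ω) / c + c) / 2) μ := fun m =>
    (((iOs m).div_const c).add (integrable_const c)).div_const 2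
  have iF : ∀ m, Integrable (fun ω => √(dS : ℝ) * L m ω) μ := fun m => (iL m).const_mul _
  have iM : Integrable (fun ω => ∑ m, (((∑ a, ∑ b ∈ {a}ᶜ, O m a b ω) / c + c) / 2 +
      √(dS : ℝ) * L m ω)) μ := integrable_finsetSum _ fun m _ => (iR m).add (iF m)
  have hpt : ∀ᵐ ω ∂μ, epsSBS ρS t ω ≤ 1 / 2 * ∑ a, ∑ b ∈ {a}ᶜ, D a b ω +
      ∑ m, (((∑ a, ∑ b ∈ {a}ᶜ, O m a b ω) / c + c) / 2 + √(dS : ℝ) * L m ω) := by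
    filter_upwards [ae_sampleLaw e hS hE hd1] with ω hω
    refine (epsSBS_le_sbsBound hdS hd hω hρ t).trans ?_
    rw [sbsBound_eq]
    refine add_le_add le_rfl (Finset.sum_le_sum fun m _ => add_le_add ?_ le_rfl)
    exact sqrt_le_half_add hc0 (Finset.sum_nonneg fun a _ => Finset.sum_nonneg fun b _ =>
      siteProd_nonneg (siteOverlap_nonneg 1) _ _ _ _)
  refine (integral_mono_ae (integrable_epsSBS e hS hE hd1 hdS hd hρ t) (iDs.add iM) hpt).trans ?_
  refine (integral_add iDs iM).le.trans ?_
  have e1 : ∫ ω, 1 / 2 * ∑ a, ∑ b ∈ {a}ᶜ, D a b ω ∂μ ≤ dS ^ 2 * X := by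
    have h : ∫ ω, ∑ a, ∑ b ∈ {a}ᶜ, D a b ω ∂μ ≤ dS ^ 2 * (2 * X) := by
      refine (integral_finsetSum _ fun a _ =>
        integrable_finsetSum _ fun b _ => iD a b).le.trans ?_
      refine (Finset.sum_congr rfl fun a _ => integral_finsetSum _ fun b _ => iD a b).le.trans ?_
      exact sum_sum_compl_le (by positivity) hdec
    refine (integral_const_mul _ _).le.trans ?_
    linarith
  have e2 : ∀ m, ∫ ω, (((∑ a, ∑ b ∈ {a}ᶜ, O m a b ω) / c + c) / 2 + √(dS : ℝ) * L m ω) ∂μ ≤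
      5 / 2 * (dS * q) := by
    intro m
    have h : ∫ ω, ∑ a, ∑ b ∈ {a}ᶜ, O m a b ω ∂μ ≤ dS ^ 2 * (2 * q ^ 2) := by
      refine (integral_finsetSum _ fun a _ =>
        integrable_finsetSum _ fun b _ => iO m a b).le.trans ?_
      refine (Finset.sum_congr rfl fun a _ => integral_finsetSum _ fun b _ => iO m a b).le.trans ?_
      exact sum_sum_compl_le (by positivity) fun a b hab => hov b a hab.symm m
    have h2 : ∫ ω, ((∑ a, ∑ b ∈ {a}ᶜ, O m a b ω) / c + c) / 2 ∂μ ≤ 3 / 2 * (dS * q) := by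
      refine (integral_div _ _).le.trans ?_
      have h3 : ∫ ω, ((∑ a, ∑ b ∈ {a}ᶜ, O m a b ω) / c + c) ∂μ ≤ 2 * c + c := by
        refine (integral_add ((iOs m).div_const c) (integrable_const c)).le.trans ?_
        refine add_le_add ?_ (by simp)
        refine (integral_div _ _).le.trans ?_
        rw [div_le_iff₀ hc0]
        calc _ ≤ _ := h
          _ = _ := by rw [hc]; ring
      rw [← hc]; linarith
    have h4 : ∫ ω, √(dS : ℝ) * L m ω ∂μ ≤ dS * q := by
      refine (integral_const_mul _ _).le.trans ?_
      have hs : √(dS : ℝ) ≤ dS := Real.sqrt_le_self_iff.mpr (Or.inr hdSr)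
      have hq2 : q ^ 2 ≤ q := by rw [sq]; exact mul_le_of_le_one_left hq.le hq1
      calc √(dS : ℝ) * ∫ ω, L m ω ∂μ ≤ √(dS : ℝ) * q :=
            mul_le_mul_of_nonneg_left ((EL m).trans hq2) (Real.sqrt_nonneg _)
        _ ≤ _ := mul_le_mul_of_nonneg_right hs hq.le
    refine (integral_add (iR m) (iF m)).le.trans ?_
    linarith
  have e3 : ∫ ω, ∑ m, (((∑ a, ∑ b ∈ {a}ᶜ, O m a b ω) / c + c) / 2 + √(dS : ℝ) * L m ω) ∂μ ≤
      M * (5 / 2 * (dS * q)) := by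
    refine (integral_finsetSum _ fun m _ => (iR m).add (iF m)).le.trans ?_
    refine (Finset.sum_le_sum fun m _ => e2 m).trans (by simp)
  refine (add_le_add e1 e3).trans ?_
  have h5 : (dS : ℝ) * q ≤ dS ^ 2 * q := by
    rw [sq, mul_assoc]; exact le_mul_of_one_le_left hc0.le hdSr
  have h6 : (M : ℝ) * (5 / 2 * (dS * q)) ≤ M * (5 / 2 * (dS ^ 2 * q)) := by gcongr
  have h7 : 0 ≤ (dS : ℝ) ^ 2 * X := by positivity
  calc _ ≤ (dS : ℝ) ^ 2 * X + M * (5 / 2 * (dS ^ 2 * q)) := add_le_add le_rfl h6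
    _ ≤ 5 / 2 * ((dS : ℝ) ^ 2 * X) + M * (5 / 2 * (dS ^ 2 * q)) := by linarith
    _ = _ := by ring

/-- The constants from Riemann-Lebesgue and from the near-degeneracies depend on the dimensions but
not on ηS, ηE, ρS or t, hence so does `K`. -/
theorem exists_integral_epsSBS_le (e : StateEnsemble) (hd0 : 10000 ≤ d) (hdS : 1 ≤ dS)
    (hN : 1 ≤ Nuno) (M : ℕ) (hd : dS ≤ d ^ Nmac) :
    ∃ K : ℝ, 0 < K ∧ ∀ ηS ηE : ℝ, 0 < ηS → 0 < ηE →
      ∀ ρS : Matrix (Fin dS) (Fin dS) ℂ, IsState ρS →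
      ∀ t : ℝ, K * tauSBS e ηS ηE dS d Nuno Nmac ≤ t →
        ∫ ω, epsSBS ρS t ω ∂(sampleLaw e ηS ηE dS d Nuno M Nmac) ≤
          5 / 2 * ((dS : ℝ) ^ 2 * (Real.exp (-((Nuno : ℝ) / 2) * Real.log (d : ℝ)) +
            (M : ℝ) * Real.exp (-((Nmac : ℝ) / (2 * (d : ℝ)))))) := by
  have hd1 : 1 ≤ d := by omega
  have hdr : (0 : ℝ) < d := by exact_mod_cast hd1
  have hdSr : (0 : ℝ) < dS := by exact_mod_cast hdS
  have hNr : (0 : ℝ) < Nuno := by exact_mod_cast hN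
  set X := Real.exp (-((Nuno : ℝ) / 2) * Real.log (d : ℝ)) with hX
  set q := Real.exp (-((Nmac : ℝ) / (2 * (d : ℝ)))) with hq
  have hX0 : 0 < X := Real.exp_pos _
  have hq0 : 0 < q := Real.exp_pos _
  have hq1 : q ≤ 1 := Real.exp_le_one_iff.mpr (neg_nonpos.mpr (by positivity))
  have hXpow : (1 / √(d : ℝ)) ^ Nuno = X := by
    have h : 1 / √(d : ℝ) = Real.exp (-(1 / 2 * Real.log d)) := by
      rw [Real.exp_neg, one_div, Real.sqrt_eq_rpow, Real.rpow_def_of_pos hdr, mul_comm]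
    rw [h, ← Real.exp_nat_mul, hX]
    congr 1; ring
  -- For d ≥ 10000 one has 97/100 ≤ e^{-1/d}, and e^{-Nmac/d} is q².
  have hqpow : (97 / 100 : ℝ) ^ Nmac ≤ q ^ 2 := by
    refine (pow_le_pow_left₀ (by norm_num) (le_exp_neg_one_div hd0) _).trans (le_of_eq ?_)
    rw [← Real.exp_nat_mul, hq, ← Real.exp_nat_mul]
    congr 1; push_cast; field_simp
  obtain ⟨T₁, -, hT₁⟩ := exists_integral_siteDecoherence_le e hd0
  obtain ⟨T₂, -, hT₂⟩ := exists_integral_siteOverlap_le e hd0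
  -- The probability of a small gap is brought below X for the decoherence terms and below q² for
  -- the overlaps, which merely doubles the respective one-site products.
  obtain ⟨S₁, hS₁, hn₁⟩ := exists_gueSpec_near_le dS T₁ hX0
  obtain ⟨S₂, -, hn₂⟩ := exists_gueSpec_near_le dS T₂ (pow_pos hq0 2)
  have hr0 : 0 < √(8 * Nuno * dS * d) := Real.sqrt_pos.mpr (by positivity)
  have hS0 : 0 < max S₁ S₂ := lt_max_of_lt_left hS₁
  -- The root compensates the denominator in the lower bound `le_tauSBS`, so that t ≥ K τ_SBS forces
  -- t/√(ηS ηE) ≥ max S₁ S₂.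
  refine ⟨max S₁ S₂ * √(8 * Nuno * dS * d), mul_pos hS0 hr0, fun ηS ηE hS hE ρS hρ t ht => ?_⟩
  have hg : 0 < √ηS * √ηE := mul_pos (Real.sqrt_pos.mpr hS) (Real.sqrt_pos.mpr hE)
  have hs : max S₁ S₂ ≤ t / (√ηS * √ηE) := by
    rw [le_div_iff₀ hg]
    refine le_trans ?_ ht
    have := mul_le_mul_of_nonneg_left (le_tauSBS e hS hE (by omega : 2 ≤ d) hdS hN Nmac)
      (mul_pos hS0 hr0).le
    refine le_trans (le_of_eq ?_) this
    field_simp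
  refine integral_epsSBS_le hS hE hd1 hdS hd hρ t hX0.le hq0 hq1 ?_ ?_ ?_
  · intro a b hab
    refine (integral_siteProd_le (β := 1 / √(d : ℝ)) (T := T₁) hS hE hd1
      (continuous_siteDecoherence 1) (siteDecoherence_nonneg 1)
      (fun B _ h => siteDecoherence_le_one 1 B h) (by positivity) (fun τ hτ => ?_)
      Sum.inl_injective a b t).trans ?_
    · simpa only [siteDecoherence_dilate] using hT₁ τ hτ
    · rw [Fintype.card_fin, hXpow]
      linarith [hn₁ _ ((le_max_left _ _).trans hs) a b hab]
  · intro a b hab m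
    refine (integral_siteProd_le (β := 97 / 100) (T := T₂) hS hE hd1
      (continuous_siteOverlap 1) (siteOverlap_nonneg 1)
      (fun B _ h => siteOverlap_le_one 1 B h) (by norm_num) (fun τ hτ => ?_)
      (fun k l h => (Prod.mk.inj (Sum.inr.inj h)).2) a b t).trans ?_
    · simpa only [siteOverlap_dilate] using hT₂ τ hτ
    · rw [Fintype.card_fin]
      linarith [hn₂ _ ((le_max_right _ _).trans hs) a b hab]
  · exact (pow_le_pow_left₀ (integral_nonneg fun ρ => siteFlatness_nonneg _)
      (integral_siteFlatness_law_le e hd0) _).trans hqpow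

end Assembly

end VonNeumann

end

theorem mainTheorem3 :
    (∃ C : ℝ, 0 < C ∧ ∃ d₀ : ℕ, 2 ≤ d₀ ∧
      ∀ (e : VonNeumann.StateEnsemble) (dS d Nuno M Nmac : ℕ),
        d₀ ≤ d → 1 ≤ dS → 1 ≤ Nuno → 1 ≤ M → 1 ≤ Nmac → dS ≤ d ^ Nmac →
        ∃ K : ℝ, 0 < K ∧
          ∀ ηS ηE : ℝ, 0 < ηS → 0 < ηE →
          ∀ ρS : Matrix (Fin dS) (Fin dS) ℂ, VonNeumann.IsState ρS →
          ∀ t : ℝ, K * VonNeumann.tauSBS e ηS ηE dS d Nuno Nmac ≤ t →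
            ∫ ω, VonNeumann.epsSBS ρS t ω ∂(VonNeumann.sampleLaw e ηS ηE dS d Nuno M Nmac) ≤
              C * ((dS : ℝ) ^ 2 * (Real.exp (-((Nuno : ℝ) / 2) * Real.log (d : ℝ)) +
                (M : ℝ) * Real.exp (-((Nmac : ℝ) / (2 * (d : ℝ))))))) ∧
    (∀ (e : VonNeumann.StateEnsemble) (dS d Nuno M Nmac : ℕ),
      1 ≤ d → 1 ≤ dS → 1 ≤ Nuno → 1 ≤ M → 1 ≤ Nmac → dS ≤ d ^ Nmac →
      ∀ ηS ηE : ℝ, 0 < ηS → 0 < ηE →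
      ∀ ρS : Matrix (Fin dS) (Fin dS) ℂ, VonNeumann.IsState ρS →
      ∀ t : ℝ,
        MeasureTheory.IsProbabilityMeasure (VonNeumann.sampleLaw e ηS ηE dS d Nuno M Nmac) ∧
        MeasureTheory.Integrable (VonNeumann.epsSBS ρS t)
          (VonNeumann.sampleLaw e ηS ηE dS d Nuno M Nmac) ∧
        ∀ δ : ℝ, 0 ≤ δ →
          (VonNeumann.sampleLaw e ηS ηE dS d Nuno M Nmac).real
              {ω | δ ≤ |VonNeumann.epsSBS ρS t ω -
                ∫ ω', VonNeumann.epsSBS ρS t ω'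
                  ∂(VonNeumann.sampleLaw e ηS ηE dS d Nuno M Nmac)|} ≤
            2 * Real.exp (-2 * δ ^ 2)) := by
  refine ⟨⟨5 / 2, by norm_num, 10000, by norm_num, ?_⟩, ?_⟩
  · intro e dS d Nuno M Nmac hd0 hdS hN _ _ hd
    exact VonNeumann.exists_integral_epsSBS_le e hd0 hdS hN M hd
  · intro e dS d Nuno M Nmac hd1 hdS _ _ _ hd ηS ηE hS hE ρS hρ t
    exact ⟨VonNeumann.isProbabilityMeasure_sampleLaw e hS hE hd1,
      VonNeumann.integrable_epsSBS e hS hE hd1 hdS hd hρ t,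
      fun δ hδ => VonNeumann.epsSBS_concentration e hS hE hd1 hdS hd hρ t hδ⟩
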